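/- **Setting.** Let $X$ be a real unnodal toric del Pezzo surface, i.e. $\mathbb{CP}^1\times\mathbb{CP}^1$ or $\mathbb{CP}^2$ blown up at $k\le 3$ distinct real points, not contained in a line, with its toric structure; let $D_\rho$ be its toric boundary divisors and $u_\rho\in\mathbb Z^2$ the primitive generators of the corresponding rays. Let $d\in H_2(X;\mathbb Z)$ and $s\in\mathbb Z_{\ge0}$. Its *tropical refined descendant invariant of genus $0$* (Göttsche–Schroeter), $G_X(d,0;s)$, is defined as follows. Suppose $d\cdot D_\rho\ge 0$ for all $\rho$ and $r:=c_1(X)\cdot d-1-2s\ge 0$ (otherwise $G_X(d,0;s):=0$). Choose a configuration $P\subset\mathbb R^2$ of $r$ simple and $s$ thick points in general position, and consider all parametrized rational plane tropical curves with exactly $d\cdot D_\rho$ unbounded ends of direction $u_\rho$ and weight $1$ for every $\rho$ (and no other non-contracted end), with $r+s$ contracted ends (markings) that are mapped to the points of $P$, and such that the marking of every thick point is adjacent to a vertex of valence at least $4$. General position means that the points are distinct and that, for every such curve through $P$, the vertices adjacent to a thick marking are $4$-valent, all other vertices are $3$-valent, and there is no other curve of the same combinatorial type through $P$; in particular these curves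 are finite in number. Then $$G_X(d,0;s)=\frac1{\prod_\rho (d\cdot D_\rho)!}\sum_C\prod_V \mu_V(q)$$ (a Laurent polynomial in $q$, regarded here as a rational function in $q^{1/2}$), where $C$ runs over the isomorphism classes of these curves with labelled ends, $V$ runs over the vertices of $C$, and $\mu_V$ is defined in terms of the Mikhalkin multiplicity $m=|\det(a,b)|$ of the vertex ($a,b$ being two of the three direction vectors, weight included, of the non-contracted edges adjacent to $V$) by $$\mu_V=\frac{q^{m/2}-q^{-m/2}}{q^{1/2}-q^{-1/2}},\qquad \mu_V=1,\qquad \mu_V=\frac{q^{m/2}+q^{-m/2}}{q^{1/2}+q^{-1/2}}$$ if $V$ is adjacent to no marking, to a simple marking, to a thick marking, respectively. **Proposition.** Let $X_{\mathbb R}$ be either the quadric hyperboloid $QH=\mathbb{CP}^1\times\mathbb{CP}^1$ or $\mathbb{CP}^2$ blown up at at most two distinct real points, with its real toric structure. Let $\widetilde X_{\mathbb R}$ be the blow-up of $X_{\mathbb R}$ at one real point (a torus-fixed point that lies on no toric boundary divisor of negative self-intersection, so that $\widetilde X_{\mathbb R}$ is again an unnodal toric del Pezzo surface), and let $E$ be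 the exceptional divisor. Let $d\in H_2(X;\mathbb Z)$ and $s\in\mathbb Z_{\ge 0}$ be such that $c_1(X)\cdot d-2s\ge 3$. Then the three invariants below are well defined, i.e. configurations in general position exist and the number obtained does not depend on the choice of such a configuration, and $$G_{X_{\mathbb R}}(d,0;s+1)=G_{X_{\mathbb R}}(d,0;s)-2\,G_{\widetilde X_{\mathbb R}}(d-2E,0;s),$$ where $d$ is identified with its pull-back to $\widetilde X$. -/

import Mathlib

open scoped Nat

/-! ## Toric surfaces with their second homology -/

/-- The numerical data of a smooth projective toric surface `X`: a basis of `H₂(X; ℤ)` with the matrix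
of the intersection form, and, for every toric boundary divisor, the primitive generator of its ray
and its class.  Only the explicit surfaces built below are used. -/
structure ToricSurface where
  Basis : Type
  [fintypeBasis : Fintype Basis]
  [decEqBasis : DecidableEq Basis]
  inter : Basis → Basis → ℤ
  Div : Type
  [fintypeDiv : Fintype Div]
  [decEqDiv : DecidableEq Div]
  ray : Div → ℤ × ℤ
  cls : Div → Basis → ℤ

attribute [instance] ToricSurface.fintypeBasis ToricSurface.decEqBasis
  ToricSurface.fintypeDiv ToricSurface.decEqDiv

namespace ToricSurface

/-- `H₂(X; ℤ)`. -/
abbrev H2 (X : ToricSurface) : Type := X.Basis → ℤ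

/-- The intersection number `d · d'`. -/
def pair (X : ToricSurface) (d d' : X.H2) : ℤ :=
  ∑ a, ∑ b, d a * X.inter a b * d' b

/-- The number `c₁(X) · d`; the toric boundary is an anticanonical divisor. -/
def c1 (X : ToricSurface) (d : X.H2) : ℤ :=
  ∑ k, X.pair d (X.cls k)

/-- The pull-back `H₂(X) → H₂(X̃)` for a blow-up at one point, where `X̃` has one more basis
element `none`, the class of the exceptional divisor. -/
def pullback (X : ToricSurface) (d : X.H2) : Option X.Basis → ℤ
  | none => 0
  | some a => d a

/-- The toric blow-up at the intersection point of the boundary divisors `i` and `j`: the lattice is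
the orthogonal sum of `H₂(X)` and `ℤ E` with `E² = -1`, the new ray is the sum of the rays of `i` and
`j`, and the proper transforms of these two divisors are their pull-backs minus `E`. -/
def blowUp (X : ToricSurface) (i j : X.Div) : ToricSurface where
  Basis := Option X.Basis
  inter
    | none, none => -1
    | some a, some b => X.inter a b
    | none, some _ => 0
    | some _, none => 0
  Div := Option X.Div
  ray
    | none => X.ray i + X.ray j
    | some k => X.ray k
  cls
    | none => Pi.single none 1
    | some k => X.pullback (X.cls k) - if k = i ∨ k = j then Pi.single none 1 else 0

/-- The pull-back to the blow-up, as a class of the blown-up surface. -/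
def pull (X : ToricSurface) (i j : X.Div) (d : X.H2) : (X.blowUp i j).H2 :=
  X.pullback d

/-- The class of the exceptional divisor. -/
def exc (X : ToricSurface) (i j : X.Div) : (X.blowUp i j).H2 :=
  fun o : Option X.Basis => if o = none then 1 else 0

/-- The boundary divisors `i` and `j` meet (in one torus-fixed real point), and neither of them has
negative self-intersection, so that the point lies on no exceptional curve and the blow-up at this
point is again unnodal. -/
def IsBlowUpPoint (X : ToricSurface) (i j : X.Div) : Prop :=
  i ≠ j ∧ X.pair (X.cls i) (X.cls j) = 1 ∧
    0 ≤ X.pair (X.cls i) (X.cls i) ∧ 0 ≤ X.pair (X.cls j) (X.cls j)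

/-- The quadric hyperboloid `ℂP¹ × ℂP¹`; the basis of `H₂` consists of the classes of the two
rulings. -/
def QH : ToricSurface where
  Basis := Fin 2
  inter a b := if a = b then 0 else 1
  Div := Fin 4
  ray := ![(1, 0), (0, 1), (-1, 0), (0, -1)]
  cls := ![![1, 0], ![0, 1], ![1, 0], ![0, 1]]

/-- The projective plane; `H₂` is generated by the class of a line. -/
def P2 : ToricSurface where
  Basis := Fin 1
  inter _ _ := 1
  Div := Fin 3
  ray := ![(-1, 0), (0, -1), (1, 1)]
  cls := ![![1], ![1], ![1]]

/-- The projective plane blown up at one real point. -/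
def P2Blow1 : ToricSurface := P2.blowUp (0 : Fin 3) (1 : Fin 3)

/-- The projective plane blown up at two distinct real points. -/
def P2Blow2 : ToricSurface :=
  P2Blow1.blowUp (some (1 : Fin 3) : Option (Fin 3)) (some (2 : Fin 3) : Option (Fin 3))

end ToricSurface

/-! ## Abstract rational tropical curves -/

set_option synthInstance.maxSize 1000 in
set_option synthInstance.maxHeartbeats 200000 in
/-- The vertices of the tree with leaves `L` whose bounded edges are given by the splits `edges`.
A vertex is encoded by its star, the set of the blocks of leaves that lie beyond the edges (bounded or
leaf edges) adjacent to it.  So a star is a partition of `L` into at least three blocks, each of them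
a leaf or one side of a bounded edge, such that every bounded edge lies in one of the branches. -/
def treeStars {L : Type} [Fintype L] [DecidableEq L] (edges : Finset (Finset L)) :
    Finset (Finset (Finset L)) :=
  Finset.univ.filter fun V =>
    (∀ B ∈ V, B ∈ edges ∨ B.card = 1) ∧
    (∀ A ∈ V, ∀ B ∈ V, A ≠ B → Disjoint A B) ∧
    (∀ x, ∃ B ∈ V, x ∈ B) ∧
    3 ≤ V.card ∧
    ∀ T ∈ edges, ∃ B ∈ V, T ⊆ B ∨ Tᶜ ⊆ B

/-- A metric tree with set of unbounded ends (leaves) `L` and without vertices of valence less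
than three, that is, a point of the moduli space of abstract rational tropical curves with ends labelled
by `L`.  By the splits equivalence theorem such a tree is the same as a pairwise compatible
family of splits of `L`, one for each bounded edge, with a positive length for each of them.
A bounded edge appears in `edges` twice, through both of its sides `S` and `Sᶜ`. -/
@[ext]
structure MetricTree (L : Type) [Fintype L] [DecidableEq L] where
  edges : Finset (Finset L)
  compl_mem : ∀ S ∈ edges, Sᶜ ∈ edges
  two_le_card : ∀ S ∈ edges, 2 ≤ S.card
  compatible : ∀ S ∈ edges, ∀ T ∈ edges, S ⊆ T ∨ S ⊆ Tᶜ ∨ Sᶜ ⊆ T ∨ Sᶜ ⊆ Tᶜ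
  length : Finset L → ℝ
  length_pos : ∀ S ∈ edges, 0 < length S
  length_compl : ∀ S, length Sᶜ = length S
  length_eq_zero : ∀ S, S ∉ edges → length S = 0

/-- The leaves of a rational curve with `r` simple markings, `s` thick markings, and
unbounded ends labelled by `E`. -/
abbrev Leaf (r s : ℕ) (E : Type) : Type := (Fin r ⊕ Fin s) ⊕ E

namespace MetricTree

/-! ## Parametrized rational tropical curves in the plane

Below `u e` is the outgoing direction of the end `e`, and the markings are contracted ends.  The
directions of all edges are determined by the balancing condition, and the map to `ℝ²` is determined
by the tree up to translation. -/

/-- The direction vector (weight times primitive vector) of the edge with the leaves in `S`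
beyond it, oriented towards `S`. -/
def dirTo {r s : ℕ} {E : Type} (u : E → ℤ × ℤ) (S : Finset (Leaf r s E)) : ℤ × ℤ :=
  ∑ x ∈ S, Sum.elim (fun _ => (0, 0)) u x

/-- The vertex `V` is adjacent to a thick marking. -/
def HasThick {r s : ℕ} {E : Type} (V : Finset (Finset (Leaf r s E))) : Prop :=
  ∃ k : Fin s, {Sum.inl (Sum.inr k)} ∈ V

/-- The vertex `V` is adjacent to a simple marking. -/
def HasSimple {r s : ℕ} {E : Type} (V : Finset (Finset (Leaf r s E))) : Prop :=
  ∃ k : Fin r, {Sum.inl (Sum.inl k)} ∈ V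

/-- The tropical curve passes through the configuration `P`: the markings can be mapped to the
prescribed points (the displacement between two markings is the sum along the path that joins them of
length times direction), and every thick marking is adjacent to a vertex of valence at
least `4` (the descendant condition). -/
def PassesThrough {r s : ℕ} {E : Type} [Fintype E] [DecidableEq E] (u : E → ℤ × ℤ)
    (P : Fin r ⊕ Fin s → ℝ × ℝ) (C : MetricTree (Leaf r s E)) : Prop :=
  (∀ i j : Fin r ⊕ Fin s,
    P j - P i = ∑ S ∈ C.edges.filter (fun S => Sum.inl i ∉ S ∧ Sum.inl j ∈ S),
      C.length S • (((dirTo u S).1 : ℝ), ((dirTo u S).2 : ℝ))) ∧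
  ∀ V ∈ treeStars C.edges, HasThick V → 4 ≤ V.card

/-- The configuration `P` is in general position: its points are distinct, every curve through `P` lies
in a cell of maximal dimension of the moduli space (the vertices adjacent to a thick marking have
valence `4`, all the others have valence `3`), and the evaluation map is injective on this cell.
This says that `P` avoids the images of all cells on which the evaluation map is not dominant. -/
def IsGeneric {r s : ℕ} {E : Type} [Fintype E] [DecidableEq E] (u : E → ℤ × ℤ)
    (P : Fin r ⊕ Fin s → ℝ × ℝ) : Prop :=
  Function.Injective P ∧
  ∀ C : MetricTree (Leaf r s E), C.PassesThrough u P →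
    (∀ V ∈ treeStars C.edges, (HasThick V → V.card = 4) ∧ (¬ HasThick V → V.card = 3)) ∧
    ∀ C' : MetricTree (Leaf r s E), C'.PassesThrough u P → C'.edges = C.edges → C' = C

/-- The Mikhalkin multiplicity `|det (a, b)|` of a vertex with three non-contracted adjacent edges of
directions `a`, `b`, `-a-b`.  It does not depend on the choice of two of the three edges; pairs that
contain a marking or a repeated edge contribute `0` to the supremum. -/
def mikhalkinMult {r s : ℕ} {E : Type} [DecidableEq E] (u : E → ℤ × ℤ)
    (V : Finset (Finset (Leaf r s E))) : ℕ :=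
  (V ×ˢ V).sup fun p =>
    ((dirTo u p.1).1 * (dirTo u p.2).2 - (dirTo u p.1).2 * (dirTo u p.2).1).natAbs

open Classical in
/-- The refined multiplicity of a vertex, in the field of rational functions in `X = q^(1/2)`. -/
noncomputable def vertexMult {r s : ℕ} {E : Type} [DecidableEq E] (u : E → ℤ × ℤ)
    (V : Finset (Finset (Leaf r s E))) : RatFunc ℚ :=
  let X : RatFunc ℚ := RatFunc.X
  let m := mikhalkinMult u V
  if HasThick V then (X ^ m + X⁻¹ ^ m) / (X + X⁻¹)
  else if HasSimple V then 1
  else (X ^ m - X⁻¹ ^ m) / (X - X⁻¹)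

/-- The refined multiplicity of a rational tropical curve. -/
noncomputable def refinedMult {r s : ℕ} {E : Type} [Fintype E] [DecidableEq E] (u : E → ℤ × ℤ)
    (C : MetricTree (Leaf r s E)) : RatFunc ℚ :=
  ∏ V ∈ treeStars C.edges, vertexMult u V

/-- The refined number of rational tropical curves with labelled ends through `P`. -/
noncomputable def labelledCount {r s : ℕ} {E : Type} [Fintype E] [DecidableEq E]
    (u : E → ℤ × ℤ) (P : Fin r ⊕ Fin s → ℝ × ℝ) : RatFunc ℚ :=
  ∑ᶠ (C : MetricTree (Leaf r s E)) (_ : C.PassesThrough u P), C.refinedMult u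

end MetricTree

/-! ## Refined descendant invariants -/

namespace ToricSurface

/-- The labelled ends of tropical curves of class `d`: as many ends in the direction of the
ray of a boundary divisor `D` as the intersection number `d · D`, each of weight one. -/
abbrev Ends (X : ToricSurface) (d : X.H2) : Type :=
  Σ k : X.Div, Fin (X.pair d (X.cls k)).toNat

/-- The direction of an end. -/
def endDir (X : ToricSurface) (d : X.H2) (e : X.Ends d) : ℤ × ℤ := X.ray e.1

/-- The number `c₁(X) · d - 1 - 2s` of simple points. -/
def numSimple (X : ToricSurface) (d : X.H2) (s : ℕ) : ℕ := (X.c1 d - 1 - 2 * s).toNat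

/-- The refined number of rational tropical curves of class `d` in `X` through the configuration
`P` of `c₁(X) · d - 1 - 2s` simple and `s` thick points.  The division removes the
labelling of the ends. -/
noncomputable def refinedCount (X : ToricSurface) (d : X.H2) (s : ℕ)
    (P : Fin (X.numSimple d s) ⊕ Fin s → ℝ × ℝ) : RatFunc ℚ :=
  MetricTree.labelledCount (X.endDir d) P / ∏ k, (((X.pair d (X.cls k)).toNat ! : ℕ) : RatFunc ℚ)

/-- `g` is the refined descendant invariant of genus `0` of the class `d` with `s` thick points:
the refined number of curves through `P` is equal to `g` for every configuration `P` in
general position, and such configurations exist.  If the class has negative intersection with a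
boundary divisor or if there are too many thick points, then there are no curves, and the
invariant is `0`. -/
def IsRefinedInvariant (X : ToricSurface) (d : X.H2) (s : ℕ) (g : RatFunc ℚ) : Prop :=
  if (∀ k, 0 ≤ X.pair d (X.cls k)) ∧ 0 ≤ X.c1 d - 1 - 2 * s then
    (∃ P : Fin (X.numSimple d s) ⊕ Fin s → ℝ × ℝ, MetricTree.IsGeneric (X.endDir d) P) ∧
    ∀ P : Fin (X.numSimple d s) ⊕ Fin s → ℝ × ℝ, MetricTree.IsGeneric (X.endDir d) P →
      X.refinedCount d s P = g
  else g = 0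

/-- The tropical refined descendant invariant `G_X(d, 0; s)`, a Laurent polynomial
in `q = X²`, regarded as a rational function in `X`. -/
noncomputable def G (X : ToricSurface) (d : X.H2) (s : ℕ) : RatFunc ℚ :=
  Classical.epsilon (X.IsRefinedInvariant d s)

end ToricSurface

/-! The labelled count of curves does not change when the points move, and it can be computed
recursively by sending one point far away. The formula results from comparing two such recursions.

Invariance. A curve is a split system with edge lengths; for a fixed type, the positions of the
markings are linear in a translation and the lengths. The images `evSpan` of these linear maps are
defined over ℚ, so points whose coordinates are linearly independent over ℚ avoid all proper ones;
hence generic configurations exist (`QIndep.isGeneric`). Two generic configurations are joined,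
through a common intermediate one, by segments that meet only walls of codimension one, and these
transversally. On a wall exactly one vertex has a valence that is too large by one, and the adjacent
top types are its resolutions. If the wall is the kernel of `f`, the side on which a resolution
lives is given by the sign of `f` on the new edge. The signed sum of the multiplicities vanishes
(`wall_sum`). This reduces to three local cancellations: at a 4-valent unmarked vertex, at a
4-valent vertex with a simple marking, and at a 5-valent vertex with a thick marking. The result is
`IsGeneric.labelledCount_eq_labelledCount`.

Far points. In a suitable lattice basis, the two rays at the point to be blown up are (1,0) and
(0,1), and all other rays are (-1,0), (0,-1) or (-1,-1). Put one marking at (L, M) with L ≫ M ≫ 0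
and keep the others fixed. Counting conditions against edges (`excess`) shows that every branch at
the far marking is a path to an unbounded end, and that the branches attached to this path begin in
a bounded region. Elementary geometry then leaves few possible corners (`corner_simple`,
`corner_thick`). A simple marking meets an end (1,0), followed by an end (0,1) or (1,1), or it meets
an end (1,1), followed by (0,-1). A thick marking meets two ends (1,0), followed by (0,1), or ends
(1,0) and (0,1), followed by (0,-1). Replacing the corner by one end of the total direction is a
bijection onto the curves through the remaining points (`labelledCount_eq_sum_far`). The factor lost
is 1, except for the corner with two ends (1,0), where it is 2/(x + x⁻¹) · (x + x⁻¹) = 2 with x =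
q^(1/2).

Comparison (`labelledCount_sub_labelledCount`). Let a, b, c be the numbers of ends (1,0), (0,1),
(0,-1), and suppose that no end is (1,1). Moving two simple points away one after the other gives N
= ab((a-1)(b-1)B + (a-1)B₁ + cB₂); moving one thick point away gives N' = a(a-1)b B₁ + abc B₂. Here
B₁ and B₂ count curves in which the three ends of the respective thick corner are replaced by one
end (2,1) or (1,0), and B counts curves in which two pairs (1,0), (0,1) are replaced by two ends
(1,1). So N - N' = a(a-1)b(b-1)B. The ends in B are those of the class d - 2E on the blow-up. After
division by the factorials, the two labelled ends belonging to E produce the coefficient 2. -/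

/-! ## Split systems and the vertices of the associated trees -/

section SplitSystems

variable {L : Type} [Fintype L] [DecidableEq L]

/-- A set of splits, closed under complements, with pairwise compatible members that are not leaf
edges. -/
structure IsSplitSystem (σ : Finset (Finset L)) : Prop where
  compl_mem : ∀ S ∈ σ, Sᶜ ∈ σ
  two_le_card : ∀ S ∈ σ, 2 ≤ S.card
  compatible : ∀ S ∈ σ, ∀ T ∈ σ, S ⊆ T ∨ S ⊆ Tᶜ ∨ Sᶜ ⊆ T ∨ Sᶜ ⊆ Tᶜ

theorem MetricTree.isSplitSystem (C : MetricTree L) : IsSplitSystem C.edges :=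
  ⟨C.compl_mem, C.two_le_card, C.compatible⟩

/-- One side of a bounded edge or a leaf edge. -/
def IsBlock (σ : Finset (Finset L)) (B : Finset L) : Prop := B ∈ σ ∨ B.card = 1

theorem mem_treeStars {σ V : Finset (Finset L)} :
    V ∈ treeStars σ ↔ (∀ B ∈ V, IsBlock σ B) ∧
      (∀ A ∈ V, ∀ B ∈ V, A ≠ B → Disjoint A B) ∧ (∀ x, ∃ B ∈ V, x ∈ B) ∧ 3 ≤ V.card ∧
      ∀ T ∈ σ, ∃ B ∈ V, T ⊆ B ∨ Tᶜ ⊆ B := by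
  simp [treeStars, IsBlock]

/-- Two blocks of a star with a common point coincide. -/
theorem star_eq_of_mem {σ V : Finset (Finset L)} (hV : V ∈ treeStars σ) {A B : Finset L}
    (hA : A ∈ V) (hB : B ∈ V) {x : L} (hxA : x ∈ A) (hxB : x ∈ B) : A = B := by
  by_contra h
  exact Finset.disjoint_left.1 ((mem_treeStars.1 hV).2.1 A hA B hB h) hxA hxB

theorem star_subset_compl {σ V : Finset (Finset L)} (hV : V ∈ treeStars σ) {A B : Finset L}
    (hA : A ∈ V) (hB : B ∈ V) (h : A ≠ B) : A ⊆ Bᶜ :=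
  Finset.subset_compl_iff_disjoint_right.2 ((mem_treeStars.1 hV).2.1 A hA B hB h)

theorem compl_subset_comm' {A B : Finset L} : Aᶜ ⊆ B ↔ Bᶜ ⊆ A := by
  constructor <;> intro h x hx <;> by_contra hc <;> exact Finset.mem_compl.1 hx (h (by simpa using hc))

namespace IsSplitSystem

variable {σ : Finset (Finset L)}

theorem block_nonempty (hσ : IsSplitSystem σ) {B : Finset L} (hB : IsBlock σ B) : B.Nonempty := by
  rcases hB with hB | hB
  · exact Finset.card_pos.1 (by have := hσ.two_le_card B hB; omega)
  · exact Finset.card_pos.1 (by omega)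

theorem ne_univ (hσ : IsSplitSystem σ) {B : Finset L} (hB : B ∈ σ) : B ≠ Finset.univ := by
  rintro rfl
  have := hσ.two_le_card _ (hσ.compl_mem _ hB)
  simp at this

theorem star_nonempty (hσ : IsSplitSystem σ) {V : Finset (Finset L)} (hV : V ∈ treeStars σ)
    {B : Finset L} (hB : B ∈ V) : B.Nonempty :=
  hσ.block_nonempty ((mem_treeStars.1 hV).1 B hB)

/-- A star does not have two blocks that cover all leaves. -/
theorem not_compl_subset (hσ : IsSplitSystem σ) {V : Finset (Finset L)} (hV : V ∈ treeStars σ)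
    {A B : Finset L} (hA : A ∈ V) (hB : B ∈ V) : ¬ Bᶜ ⊆ A := by
  intro h
  have h3 := (mem_treeStars.1 hV).2.2.2.1
  obtain ⟨C, hC, hCA, hCB⟩ : ∃ C ∈ V, C ≠ A ∧ C ≠ B := by
    by_contra hcon
    push Not at hcon
    have : V ⊆ {A, B} := by
      intro C hC
      by_cases hCA : C = A
      · simp [hCA]
      · simp [hcon C hC hCA]
    have := (Finset.card_le_card this).trans Finset.card_le_two
    omega
  obtain ⟨x, hx⟩ := hσ.star_nonempty hV hC
  exact hCA (star_eq_of_mem hV hC hA hx (h (star_subset_compl hV hC hB hCB hx)))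

theorem star_ne_univ (hσ : IsSplitSystem σ) {V : Finset (Finset L)} (hV : V ∈ treeStars σ)
    {A : Finset L} (hA : A ∈ V) : A ≠ Finset.univ := by
  rintro rfl
  exact hσ.not_compl_subset hV hA hA (by simp)

/-- Every leaf lies in a unique block of a star and every split lies on one side of a unique
block. -/
theorem exists_block (_hσ : IsSplitSystem σ) {V : Finset (Finset L)} (hV : V ∈ treeStars σ)
    {T : Finset L} (hT : T ∈ σ) : ∃ B ∈ V, T ⊆ B ∨ Tᶜ ⊆ B :=
  (mem_treeStars.1 hV).2.2.2.2 T hT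

/-- The maximal blocks properly inside `S` are the branches at the vertex beyond the edge `S`.
Compatibility makes two of them disjoint: the only other possibility for incomparable sets, that
they cover all leaves, is excluded by `S ≠ univ`. One alone cannot cover `S`, hence there are two.
-/
theorem exists_children (hσ : IsSplitSystem σ) {S : Finset L} (h2 : 2 ≤ S.card)
    (hu : S ≠ Finset.univ) :
    ∃ Ch : Finset (Finset L), (∀ B ∈ Ch, IsBlock σ B ∧ B ⊂ S) ∧
      (∀ A ∈ Ch, ∀ B ∈ Ch, A ≠ B → Disjoint A B) ∧
      (∀ B, IsBlock σ B → B ⊂ S → ∃ B' ∈ Ch, B ⊆ B') ∧ (∀ x ∈ S, ∃ B ∈ Ch, x ∈ B) ∧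
      2 ≤ Ch.card := by
  classical
  set F : Finset (Finset L) := Finset.univ.filter (fun B => IsBlock σ B ∧ B ⊂ S) with hF
  set Ch : Finset (Finset L) := F.filter (fun B => Maximal (· ∈ F) B) with hCh
  have hmem : ∀ B ∈ Ch, IsBlock σ B ∧ B ⊂ S := by
    intro B hB
    have := (Finset.mem_filter.1 hB).1
    simpa [hF] using this
  have hmax : ∀ B, IsBlock σ B → B ⊂ S → ∃ B' ∈ Ch, B ⊆ B' := by
    intro B hB hBS
    have hBF : B ∈ F := by simp [hF, hB, hBS]
    obtain ⟨b, hb, hbm⟩ := Finset.exists_le_maximal F hBF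
    exact ⟨b, by simp only [hCh, Finset.mem_filter]; exact ⟨hbm.1, hbm⟩, hb⟩
  have hcov : ∀ x ∈ S, ∃ B ∈ Ch, x ∈ B := by
    intro x hx
    have : ({x} : Finset L) ⊂ S := by
      refine Finset.ssubset_iff_subset_ne.2 ⟨by simpa using hx, ?_⟩
      rintro rfl
      simp at h2
    obtain ⟨B', hB', h⟩ := hmax {x} (Or.inr (by simp)) this
    exact ⟨B', hB', h (by simp)⟩
  have hmaxeq : ∀ A ∈ Ch, ∀ B ∈ Ch, A ⊆ B → A = B := by
    intro A hA B hB hAB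
    have h1 := (Finset.mem_filter.1 hA).2
    have h2 := (Finset.mem_filter.1 hB).1
    exact le_antisymm hAB (h1.2 h2 hAB)
  refine ⟨Ch, hmem, ?_, hmax, hcov, ?_⟩
  · intro A hA B hB hAB
    have hsing : ∀ A B : Finset L, A ∈ Ch → B ∈ Ch → A ≠ B → A.card = 1 → Disjoint A B := by
      intro A B hA hB hAB h1
      obtain ⟨x, rfl⟩ := Finset.card_eq_one.1 h1
      rw [Finset.disjoint_singleton_left]
      intro hx
      exact hAB (hmaxeq _ hA _ hB (by simpa using hx))
    rcases (hmem A hA).1 with hA1 | hA1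
    · rcases (hmem B hB).1 with hB1 | hB1
      · rcases hσ.compatible A hA1 B hB1 with h | h | h | h
        · exact absurd (hmaxeq _ hA _ hB h) hAB
        · exact Finset.subset_compl_iff_disjoint_right.1 h
        · exfalso
          apply hu
          refine Finset.eq_univ_of_forall fun x => ?_
          by_cases hx : x ∈ A
          · exact (hmem A hA).2.1 hx
          · exact (hmem B hB).2.1 (h (by simpa using hx))
        · exact absurd (hmaxeq _ hB _ hA (Finset.compl_subset_compl.1 h)).symm hAB
      · exact (hsing B A hB hA hAB.symm hB1).symm
    · exact hsing A B hA hB hAB hA1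
  · obtain ⟨x, hx⟩ : S.Nonempty := Finset.card_pos.1 (by omega)
    obtain ⟨B, hB, hxB⟩ := hcov x hx
    obtain ⟨y, hy, hyB⟩ := Finset.exists_of_ssubset (hmem B hB).2
    obtain ⟨B', hB', hyB'⟩ := hcov y hy
    refine Finset.one_lt_card.2 ⟨B, hB, B', hB', ?_⟩
    rintro rfl
    exact hyB hyB'

theorem block_trichotomy (hσ : IsSplitSystem σ) {A : Finset L} (hA : IsBlock σ A) {T : Finset L}
    (hT : T ∈ σ) : T ⊆ A ∨ T ⊆ Aᶜ ∨ Tᶜ ⊆ A ∨ Tᶜ ⊆ Aᶜ := by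
  rcases hA with hA | hA
  · exact hσ.compatible T hT A hA
  · obtain ⟨x, rfl⟩ := Finset.card_eq_one.1 hA
    by_cases hx : x ∈ T
    · right; right; right
      intro y hy
      simp only [Finset.mem_compl, Finset.mem_singleton] at hy ⊢
      rintro rfl; exact hy hx
    · right; left
      intro y hy
      simp only [Finset.mem_compl, Finset.mem_singleton]
      rintro rfl; exact hx hy

/-- Every block lies in a star. -/
theorem exists_star (hσ : IsSplitSystem σ) (hL : 3 ≤ Fintype.card L) {A : Finset L}
    (hA : IsBlock σ A) : ∃ V ∈ treeStars σ, A ∈ V := by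
  have hAne := hσ.block_nonempty hA
  have h2 : 2 ≤ Aᶜ.card := by
    rcases hA with hA | hA
    · exact hσ.two_le_card _ (hσ.compl_mem _ hA)
    · rw [Finset.card_compl]; omega
  have hu : Aᶜ ≠ Finset.univ := by
    intro h
    rw [Finset.compl_eq_univ_iff] at h
    simp [h] at hAne
  obtain ⟨Ch, h1, hdis, hmax, hcov, hcard⟩ := hσ.exists_children h2 hu
  have hAd : ∀ B ∈ Ch, Disjoint A B := fun B hB =>
    (Finset.subset_compl_iff_disjoint_left.1 (h1 B hB).2.1)
  have hAC : A ∉ Ch := by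
    intro h
    have := hAd A h
    rw [disjoint_self] at this
    simp [this] at hAne
  -- The vertex at which the branch `A` is attached has as its branches `A` and the maximal blocks
  -- of the complement of `A`.
  refine ⟨insert A Ch, mem_treeStars.2 ⟨?_, ?_, ?_, ?_, ?_⟩, by simp⟩
  · intro B hB
    rcases Finset.mem_insert.1 hB with rfl | hB
    · exact hA
    · exact (h1 B hB).1
  · intro B hB B' hB' hne
    rcases Finset.mem_insert.1 hB with h2 | h2 <;> rcases Finset.mem_insert.1 hB' with h3 | h3
    · exact absurd (h2.trans h3.symm) hne
    · exact h2 ▸ hAd _ h3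
    · exact h3 ▸ (hAd _ h2).symm
    · exact hdis _ h2 _ h3 hne
  · intro x
    by_cases hx : x ∈ A
    · exact ⟨A, by simp, hx⟩
    · obtain ⟨B, hB, hxB⟩ := hcov x (by simpa using hx)
      exact ⟨B, by simp [hB], hxB⟩
  · rw [Finset.card_insert_of_notMem hAC]; omega
  · intro T hT
    have key : ∀ T ∈ σ, T ⊆ Aᶜ → ∃ B ∈ insert A Ch, T ⊆ B ∨ Tᶜ ⊆ B := by
      intro T hT h
      by_cases hTA : T = Aᶜ
      · exact ⟨A, by simp, Or.inr (by simp [hTA])⟩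
      · obtain ⟨B, hB, hTB⟩ := hmax T (Or.inl hT) (Finset.ssubset_iff_subset_ne.2 ⟨h, hTA⟩)
        exact ⟨B, by simp [hB], Or.inl hTB⟩
    rcases hσ.block_trichotomy hA hT with h | h | h | h
    · exact ⟨A, by simp, Or.inl h⟩
    · exact key T hT h
    · exact ⟨A, by simp, Or.inr h⟩
    · obtain ⟨B, hB, hB'⟩ := key Tᶜ (hσ.compl_mem _ hT) h
      exact ⟨B, hB, by simpa [or_comm] using hB'⟩

/-- Two different stars are separated by a bounded edge. -/
theorem exists_separating (hσ : IsSplitSystem σ) {V V' : Finset (Finset L)}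
    (hV : V ∈ treeStars σ) (hV' : V' ∈ treeStars σ) (hne : V ≠ V') :
    ∃ B ∈ V, ∃ B' ∈ V', Bᶜ ⊆ B' := by
  by_contra hcon
  push Not at hcon
  -- Without a separating edge, every block of one star lies in a block of the other one. Applied in
  -- both directions, this makes the two partitions equal.
  have href : ∀ V V', V ∈ treeStars σ → V' ∈ treeStars σ →
      (∀ B ∈ V, ∀ B' ∈ V', ¬ Bᶜ ⊆ B') → ∀ B ∈ V, ∃ B' ∈ V', B ⊆ B' := by
    intro V V' hV hV' hcon B hB
    rcases (mem_treeStars.1 hV).1 B hB with hBσ | hB1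
    · obtain ⟨B', hB', h | h⟩ := hσ.exists_block hV' hBσ
      · exact ⟨B', hB', h⟩
      · exact absurd h (hcon B hB B' hB')
    · obtain ⟨x, rfl⟩ := Finset.card_eq_one.1 hB1
      obtain ⟨B', hB', hx⟩ := (mem_treeStars.1 hV').2.2.1 x
      exact ⟨B', hB', by simpa using hx⟩
  have hcon' : ∀ B ∈ V', ∀ B' ∈ V, ¬ Bᶜ ⊆ B' := by
    intro B hB B' hB' h
    exact hcon B' hB' B hB (by rwa [compl_subset_comm'])
  have hsub : ∀ V V', V ∈ treeStars σ → V' ∈ treeStars σ →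
      (∀ B ∈ V, ∀ B' ∈ V', ¬ Bᶜ ⊆ B') → (∀ B ∈ V', ∀ B' ∈ V, ¬ Bᶜ ⊆ B') → V ⊆ V' := by
    intro V V' hV hV' h1 h2 B hB
    obtain ⟨B', hB', h⟩ := href V V' hV hV' h1 B hB
    obtain ⟨B'', hB'', h'⟩ := href V' V hV' hV h2 B' hB'
    obtain ⟨x, hx⟩ := hσ.star_nonempty hV hB
    have : B = B'' := star_eq_of_mem hV hB hB'' hx (h' (h hx))
    subst this
    rw [Finset.Subset.antisymm h h']
    exact hB'
  exact hne (Finset.Subset.antisymm (hsub V V' hV hV' hcon hcon') (hsub V' V hV' hV hcon' hcon))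

/-- A block lies in only one star. -/
theorem star_unique (hσ : IsSplitSystem σ) {V V' : Finset (Finset L)}
    (hV : V ∈ treeStars σ) (hV' : V' ∈ treeStars σ) {A : Finset L} (hA : A ∈ V) (hA' : A ∈ V') :
    V = V' := by
  by_contra hne
  obtain ⟨B, hB, B', hB', h⟩ := hσ.exists_separating hV hV' hne
  by_cases hAB : A = B
  · subst hAB
    exact hσ.not_compl_subset hV' hB' hA' h
  · obtain ⟨x, hx⟩ := hσ.star_nonempty hV hA
    have hxB' := h (star_subset_compl hV hA hB hAB hx)
    have := star_eq_of_mem hV' hA' hB' hx hxB'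
    subst this
    exact hσ.not_compl_subset hV hA hB h

end IsSplitSystem

/-! ### Splitting a vertex -/

/-- The split system with one more bounded edge. -/
def addSplit (σ : Finset (Finset L)) (S : Finset L) : Finset (Finset L) := insert S (insert Sᶜ σ)

theorem mem_addSplit {σ : Finset (Finset L)} {S T : Finset L} :
    T ∈ addSplit σ S ↔ T = S ∨ T = Sᶜ ∨ T ∈ σ := by
  simp [addSplit]

theorem addSplit_compl (σ : Finset (Finset L)) (S : Finset L) : addSplit σ Sᶜ = addSplit σ S := by
  ext T
  simp only [mem_addSplit, compl_compl]
  tauto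

namespace IsSplitSystem

variable {σ : Finset (Finset L)}

section Split

variable {V I : Finset (Finset L)}

theorem sub_biUnion {B : Finset L} (hB : B ∈ I) : B ⊆ I.biUnion id :=
  Finset.subset_biUnion_of_mem id hB

theorem sub_compl_biUnion (hV : V ∈ treeStars σ) (hI : I ⊆ V) {B : Finset L} (hB : B ∈ V)
    (hBI : B ∉ I) : B ⊆ (I.biUnion id)ᶜ := by
  intro x hx
  simp only [Finset.mem_compl, Finset.mem_biUnion, id, not_exists, not_and]
  intro A hA hxA
  exact hBI (star_eq_of_mem hV hB (hI hA) hx hxA ▸ hA)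

theorem compl_biUnion (hV : V ∈ treeStars σ) (hI : I ⊆ V) :
    (I.biUnion id)ᶜ = (V \ I).biUnion id := by
  ext x
  obtain ⟨B, hB, hx⟩ := (mem_treeStars.1 hV).2.2.1 x
  by_cases hBI : B ∈ I
  · have h1 : x ∈ I.biUnion id := sub_biUnion hBI hx
    simp only [Finset.mem_compl, h1, not_true, false_iff]
    intro h
    obtain ⟨A, hA, hxA⟩ := Finset.mem_biUnion.1 h
    rw [Finset.mem_sdiff] at hA
    exact hA.2 (star_eq_of_mem hV hB hA.1 hx hxA ▸ hBI)
  · have h1 := sub_compl_biUnion hV hI hB hBI hx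
    simp only [h1, true_iff]
    exact sub_biUnion (Finset.mem_sdiff.2 ⟨hB, hBI⟩) hx

theorem not_subset_block (hσ : IsSplitSystem σ) (hV : V ∈ treeStars σ) (hI : I ⊆ V)
    (h2 : 2 ≤ I.card) {B : Finset L} (hB : B ∈ V) : ¬ I.biUnion id ⊆ B := by
  intro h
  obtain ⟨A, hA, A', hA', hne⟩ := Finset.one_lt_card.1 (show 1 < I.card by omega)
  have key : ∀ A ∈ I, A = B := by
    intro A hA
    obtain ⟨x, hx⟩ := hσ.star_nonempty hV (hI hA)
    exact star_eq_of_mem hV (hI hA) hB hx (h (sub_biUnion hA hx))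
  exact hne ((key A hA).trans (key A' hA').symm)

theorem not_compl_subset_block (hσ : IsSplitSystem σ) (hV : V ∈ treeStars σ) (hI : I ⊆ V)
    (h2 : 2 ≤ (V \ I).card) {B : Finset L} (hB : B ∈ V) : ¬ (I.biUnion id)ᶜ ⊆ B := by
  rw [compl_biUnion hV hI]
  exact hσ.not_subset_block hV Finset.sdiff_subset h2 hB

theorem biUnion_notMem (hσ : IsSplitSystem σ) (hV : V ∈ treeStars σ) (hI : I ⊆ V)
    (h2 : 2 ≤ I.card) (h2' : 2 ≤ (V \ I).card) : I.biUnion id ∉ σ := by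
  intro h
  obtain ⟨B, hB, h | h⟩ := hσ.exists_block hV h
  · exact hσ.not_subset_block hV hI h2 hB h
  · exact hσ.not_compl_subset_block hV hI h2' hB h

theorem two_le_card_biUnion (hσ : IsSplitSystem σ) (hV : V ∈ treeStars σ) (hI : I ⊆ V)
    (h2 : 2 ≤ I.card) : 2 ≤ (I.biUnion id).card := by
  obtain ⟨A, hA, A', hA', hne⟩ := Finset.one_lt_card.1 (show 1 < I.card by omega)
  obtain ⟨x, hx⟩ := hσ.star_nonempty hV (hI hA)
  obtain ⟨y, hy⟩ := hσ.star_nonempty hV (hI hA')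
  refine Finset.one_lt_card.2 ⟨x, sub_biUnion hA hx, y, sub_biUnion hA' hy, ?_⟩
  rintro rfl
  exact hne (star_eq_of_mem hV (hI hA) (hI hA') hx hy)

theorem split_trichotomy (hσ : IsSplitSystem σ) (hV : V ∈ treeStars σ) (hI : I ⊆ V)
    {T : Finset L} (hT : T ∈ σ) : T ⊆ I.biUnion id ∨ T ⊆ (I.biUnion id)ᶜ ∨ Tᶜ ⊆ I.biUnion id ∨
      Tᶜ ⊆ (I.biUnion id)ᶜ := by
  obtain ⟨B, hB, h⟩ := hσ.exists_block hV hT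
  by_cases hBI : B ∈ I
  · have := sub_biUnion hBI
    rcases h with h | h
    · exact Or.inl (h.trans this)
    · exact Or.inr (Or.inr (Or.inl (h.trans this)))
  · have := sub_compl_biUnion hV hI hB hBI
    rcases h with h | h
    · exact Or.inr (Or.inl (h.trans this))
    · exact Or.inr (Or.inr (Or.inr (h.trans this)))

theorem addSplit_of_trichotomy (hσ : IsSplitSystem σ) {S : Finset L} (h2 : 2 ≤ S.card)
    (h2' : 2 ≤ Sᶜ.card) (h : ∀ T ∈ σ, T ⊆ S ∨ T ⊆ Sᶜ ∨ Tᶜ ⊆ S ∨ Tᶜ ⊆ Sᶜ) :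
    IsSplitSystem (addSplit σ S) := by
  refine ⟨?_, ?_, ?_⟩
  · intro T hT
    rcases mem_addSplit.1 hT with rfl | rfl | hT
    · simp [mem_addSplit]
    · simp [mem_addSplit]
    · exact mem_addSplit.2 (Or.inr (Or.inr (hσ.compl_mem _ hT)))
  · intro T hT
    rcases mem_addSplit.1 hT with rfl | rfl | hT
    · exact h2
    · exact h2'
    · exact hσ.two_le_card _ hT
  · have comm : ∀ S T : Finset L, (T ⊆ S ∨ T ⊆ Sᶜ ∨ Tᶜ ⊆ S ∨ Tᶜ ⊆ Sᶜ) →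
        (S ⊆ T ∨ S ⊆ Tᶜ ∨ Sᶜ ⊆ T ∨ Sᶜ ⊆ Tᶜ) := by
      intro S T h
      have e1 : T ⊆ S ↔ Sᶜ ⊆ Tᶜ := Finset.compl_subset_compl.symm
      have e2 : T ⊆ Sᶜ ↔ S ⊆ Tᶜ := Finset.subset_compl_comm
      have e3 : Tᶜ ⊆ S ↔ Sᶜ ⊆ T := compl_subset_comm'
      have e4 : Tᶜ ⊆ Sᶜ ↔ S ⊆ T := Finset.compl_subset_compl
      rw [e1, e2, e3, e4] at h
      tauto
    intro T hT T' hT'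
    rcases mem_addSplit.1 hT with k1 | k1 | k1 <;> rcases mem_addSplit.1 hT' with k2 | k2 | k2
    · simp [k1, k2]
    · simp [k1, k2]
    · subst k1; exact comm _ _ (h _ k2)
    · simp [k1, k2]
    · simp [k1, k2]
    · have := comm _ _ (h _ k2)
      subst k1
      simp only [compl_compl]; tauto
    · subst k2; exact h _ k1
    · have := h _ k1
      subst k2
      simp only [compl_compl]; tauto
    · exact hσ.compatible _ k1 _ k2

theorem addSplit_biUnion (hσ : IsSplitSystem σ) (hV : V ∈ treeStars σ) (hI : I ⊆ V)
    (h2 : 2 ≤ I.card) (h2' : 2 ≤ (V \ I).card) : IsSplitSystem (addSplit σ (I.biUnion id)) := by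
  refine hσ.addSplit_of_trichotomy (hσ.two_le_card_biUnion hV hI h2) ?_
    fun T hT => hσ.split_trichotomy hV hI hT
  rw [compl_biUnion hV hI]
  exact hσ.two_le_card_biUnion hV Finset.sdiff_subset h2'

theorem new_star_mem (hσ : IsSplitSystem σ) (hV : V ∈ treeStars σ) (hI : I ⊆ V)
    (h2 : 2 ≤ I.card) :
    insert (I.biUnion id)ᶜ I ∈ treeStars (addSplit σ (I.biUnion id)) := by
  have hne : (I.biUnion id)ᶜ ∉ I := by
    intro h
    obtain ⟨x, hx⟩ := hσ.star_nonempty hV (hI h)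
    exact Finset.mem_compl.1 hx (sub_biUnion h hx)
  have hd : ∀ B ∈ I, Disjoint B (I.biUnion id)ᶜ := fun B hB =>
    Finset.disjoint_left.2 fun x hx h => Finset.mem_compl.1 h (sub_biUnion hB hx)
  refine mem_treeStars.2 ⟨?_, ?_, ?_, ?_, ?_⟩
  · intro B hB
    rcases Finset.mem_insert.1 hB with rfl | hB
    · exact Or.inl (by simp [mem_addSplit])
    · rcases (mem_treeStars.1 hV).1 B (hI hB) with h | h
      · exact Or.inl (by simp [mem_addSplit, h])
      · exact Or.inr h
  · intro A hA B hB hAB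
    rcases Finset.mem_insert.1 hA with rfl | hA <;> rcases Finset.mem_insert.1 hB with rfl | hB
    · exact absurd rfl hAB
    · exact (hd _ hB).symm
    · exact hd _ hA
    · exact (mem_treeStars.1 hV).2.1 A (hI hA) B (hI hB) hAB
  · intro x
    by_cases hx : x ∈ I.biUnion id
    · obtain ⟨B, hB, hxB⟩ := Finset.mem_biUnion.1 hx
      exact ⟨B, by simp [hB], hxB⟩
    · exact ⟨_, Finset.mem_insert_self _ _, by simpa using hx⟩
  · rw [Finset.card_insert_of_notMem hne]; omega
  · intro T hT
    rcases mem_addSplit.1 hT with rfl | rfl | hT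
    · exact ⟨_, Finset.mem_insert_self _ _, Or.inr subset_rfl⟩
    · exact ⟨_, Finset.mem_insert_self _ _, Or.inl subset_rfl⟩
    · obtain ⟨B, hB, h⟩ := hσ.exists_block hV hT
      by_cases hBI : B ∈ I
      · exact ⟨B, by simp [hBI], h⟩
      · have := sub_compl_biUnion hV hI hB hBI
        exact ⟨_, Finset.mem_insert_self _ _, h.imp (·.trans this) (·.trans this)⟩

theorem new_star_mem' (hσ : IsSplitSystem σ) (hV : V ∈ treeStars σ) (hI : I ⊆ V)
    (h2' : 2 ≤ (V \ I).card) :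
    insert (I.biUnion id) (V \ I) ∈ treeStars (addSplit σ (I.biUnion id)) := by
  have := hσ.new_star_mem hV Finset.sdiff_subset h2'
  rwa [← compl_biUnion hV hI, compl_compl, addSplit_compl] at this

/-- Inserting an edge replaces one vertex by two. -/
theorem treeStars_addSplit (hσ : IsSplitSystem σ) (hV : V ∈ treeStars σ) (hI : I ⊆ V)
    (h2 : 2 ≤ I.card) (h2' : 2 ≤ (V \ I).card) :
    treeStars (addSplit σ (I.biUnion id)) =
      insert (insert (I.biUnion id)ᶜ I) (insert (insert (I.biUnion id) (V \ I))
        ((treeStars σ).erase V)) := by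
  have hτ := hσ.addSplit_biUnion hV hI h2 h2'
  have hV1 := hσ.new_star_mem hV hI h2
  have hV2 := hσ.new_star_mem' hV hI h2'
  ext W
  simp only [Finset.mem_insert, Finset.mem_erase]
  constructor
  · intro hW
    by_cases h1 : (I.biUnion id)ᶜ ∈ W
    · exact Or.inl (hτ.star_unique hW hV1 h1 (by simp))
    by_cases h3 : I.biUnion id ∈ W
    · exact Or.inr (Or.inl (hτ.star_unique hW hV2 h3 (by simp)))
    right; right
    have hW' := mem_treeStars.1 hW
    refine ⟨?_, mem_treeStars.2 ⟨?_, hW'.2.1, hW'.2.2.1, hW'.2.2.2.1, ?_⟩⟩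
    · rintro rfl
      obtain ⟨B, hB, h | h⟩ := hW'.2.2.2.2 (I.biUnion id) (by simp [mem_addSplit])
      · exact hσ.not_subset_block hV hI h2 hB h
      · exact hσ.not_compl_subset_block hV hI h2' hB h
    · intro B hB
      rcases hW'.1 B hB with h | h
      · rcases mem_addSplit.1 h with rfl | rfl | h
        · exact absurd hB h3
        · exact absurd hB h1
        · exact Or.inl h
      · exact Or.inr h
    · intro T hT
      exact hW'.2.2.2.2 T (by simp [mem_addSplit, hT])
  · rintro (rfl | rfl | ⟨hne, hW⟩)
    · exact hV1
    · exact hV2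
    · have hW' := mem_treeStars.1 hW
      refine mem_treeStars.2 ⟨fun B hB => ?_, hW'.2.1, hW'.2.2.1, hW'.2.2.2.1, ?_⟩
      · exact (hW'.1 B hB).imp (fun h => by simp [mem_addSplit, h]) id
      -- The vertex `W` is separated from `V` by an edge. The block of `V` that points to `W` lies
      -- on one side of the new split, so the other side lies beyond a single branch of `W`.
      · have key : ∃ B ∈ W, I.biUnion id ⊆ B ∨ (I.biUnion id)ᶜ ⊆ B := by
          obtain ⟨B, hB, B', hB', h⟩ := hσ.exists_separating hW hV hne
          refine ⟨B, hB, ?_⟩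
          by_cases hBI : B' ∈ I
          · right
            rw [compl_subset_comm']
            exact h.trans (sub_biUnion hBI)
          · left
            have := h.trans (sub_compl_biUnion hV hI hB' hBI)
            exact Finset.compl_subset_compl.1 this
        intro T hT
        rcases mem_addSplit.1 hT with rfl | rfl | hT
        · exact key
        · obtain ⟨B, hB, h⟩ := key
          exact ⟨B, hB, by simpa [or_comm] using h⟩
        · exact hW'.2.2.2.2 T hT

end Split

/-- A compatible new split splits a unique vertex. -/
theorem exists_split_star (hσ : IsSplitSystem σ) {S : Finset L}
    (hτ : IsSplitSystem (addSplit σ S)) (hS : S ∉ σ) :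
    ∃ V ∈ treeStars σ, ∃ I ⊆ V, 2 ≤ I.card ∧ 2 ≤ (V \ I).card ∧ S = I.biUnion id := by
  have hSτ : S ∈ addSplit σ S := by simp [mem_addSplit]
  have hSτ' : Sᶜ ∈ addSplit σ S := by simp [mem_addSplit]
  have hSc : Sᶜ ∉ σ := fun h => hS (by simpa using hσ.compl_mem _ h)
  have hne := hτ.ne_univ hSτ
  have hne' := hτ.ne_univ hSτ'
  -- The vertex to be split has as its branches the maximal blocks on both sides of the new split.
  obtain ⟨C1, m1, d1, x1, c1, k1⟩ := hσ.exists_children (hτ.two_le_card _ hSτ) hne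
  obtain ⟨C2, m2, d2, x2, c2, k2⟩ := hσ.exists_children (hτ.two_le_card _ hSτ') hne'
  have d12 : ∀ A ∈ C1, ∀ B ∈ C2, Disjoint A B := fun A hA B hB =>
    Finset.disjoint_left.2 fun x hx hx' =>
      Finset.mem_compl.1 ((m2 B hB).2.1 hx') ((m1 A hA).2.1 hx)
  have D12 : Disjoint C1 C2 := by
    rw [Finset.disjoint_left]
    intro A hA hA'
    have := d12 A hA A hA'
    rw [disjoint_self] at this
    have h := hσ.block_nonempty (m1 A hA).1
    simp [this] at h
  refine ⟨C1 ∪ C2, mem_treeStars.2 ⟨?_, ?_, ?_, ?_, ?_⟩, C1, Finset.subset_union_left, k1, ?_, ?_⟩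
  · intro B hB
    rcases Finset.mem_union.1 hB with h | h
    · exact (m1 B h).1
    · exact (m2 B h).1
  · intro A hA B hB hAB
    rcases Finset.mem_union.1 hA with hA | hA <;> rcases Finset.mem_union.1 hB with hB | hB
    · exact d1 A hA B hB hAB
    · exact d12 A hA B hB
    · exact (d12 B hB A hA).symm
    · exact d2 A hA B hB hAB
  · intro x
    by_cases hx : x ∈ S
    · obtain ⟨B, hB, h⟩ := c1 x hx
      exact ⟨B, by simp [hB], h⟩
    · obtain ⟨B, hB, h⟩ := c2 x (by simpa using hx)
      exact ⟨B, by simp [hB], h⟩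
  · rw [Finset.card_union_of_disjoint D12]; omega
  · intro T hT
    have hTS : ∀ T ∈ σ, T ≠ S ∧ T ≠ Sᶜ := fun T hT =>
      ⟨fun h => hS (h ▸ hT), fun h => hSc (h ▸ hT)⟩
    have key : ∀ T ∈ σ, T ⊆ S ∨ T ⊆ Sᶜ → ∃ B ∈ C1 ∪ C2, T ⊆ B := by
      rintro T hT (h | h)
      · obtain ⟨B, hB, h'⟩ := x1 T (Or.inl hT) (Finset.ssubset_iff_subset_ne.2 ⟨h, (hTS T hT).1⟩)
        exact ⟨B, by simp [hB], h'⟩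
      · obtain ⟨B, hB, h'⟩ := x2 T (Or.inl hT) (Finset.ssubset_iff_subset_ne.2 ⟨h, (hTS T hT).2⟩)
        exact ⟨B, by simp [hB], h'⟩
    rcases hτ.compatible T (by simp [mem_addSplit, hT]) S hSτ with h | h | h | h
    · obtain ⟨B, hB, h⟩ := key T hT (Or.inl h); exact ⟨B, hB, Or.inl h⟩
    · obtain ⟨B, hB, h⟩ := key T hT (Or.inr h); exact ⟨B, hB, Or.inl h⟩
    · obtain ⟨B, hB, h⟩ := key _ (hσ.compl_mem T hT) (Or.inl h); exact ⟨B, hB, Or.inr h⟩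
    · obtain ⟨B, hB, h⟩ := key _ (hσ.compl_mem T hT) (Or.inr h); exact ⟨B, hB, Or.inr h⟩
  · rw [Finset.union_sdiff_cancel_left D12]; exact k2
  · ext x
    simp only [Finset.mem_biUnion, id]
    exact ⟨c1 x, fun ⟨B, hB, h⟩ => (m1 B hB).2.1 h⟩

/-- Removing an edge from a split system. -/
theorem removeSplit (hσ : IsSplitSystem σ) {S : Finset L} :
    IsSplitSystem ((σ.erase S).erase Sᶜ) := by
  refine ⟨?_, ?_, ?_⟩
  · intro T hT
    simp only [Finset.mem_erase] at hT ⊢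
    refine ⟨?_, ?_, hσ.compl_mem T hT.2.2⟩
    · intro h; exact hT.2.1 (compl_injective h)
    · intro h; apply hT.1; rw [← h, compl_compl]
  · intro T hT
    simp only [Finset.mem_erase] at hT
    exact hσ.two_le_card T hT.2.2
  · intro T hT T' hT'
    simp only [Finset.mem_erase] at hT hT'
    exact hσ.compatible T hT.2.2 T' hT'.2.2

theorem addSplit_removeSplit (hσ : IsSplitSystem σ) {S : Finset L} (hS : S ∈ σ) :
    addSplit ((σ.erase S).erase Sᶜ) S = σ := by
  ext T
  simp only [mem_addSplit, Finset.mem_erase]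
  have := hσ.compl_mem S hS
  constructor
  · rintro (rfl | rfl | h)
    exacts [hS, this, h.2.2]
  · intro h
    by_cases h1 : T = S
    · exact Or.inl h1
    by_cases h2 : T = Sᶜ
    · exact Or.inr (Or.inl h2)
    · exact Or.inr (Or.inr ⟨h2, h1, h⟩)

theorem ne_compl {S : Finset L} (hS : S.Nonempty) : S ≠ Sᶜ := by
  intro h
  obtain ⟨x, hx⟩ := hS
  have := hx
  rw [h] at this
  exact Finset.mem_compl.1 this hx

theorem card_removeSplit (hσ : IsSplitSystem σ) {S : Finset L} (hS : S ∈ σ) :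
    ((σ.erase S).erase Sᶜ).card + 2 = σ.card := by
  have h1 : Sᶜ ∈ σ.erase S :=
    Finset.mem_erase.2 ⟨(ne_compl (hσ.block_nonempty (Or.inl hS))).symm, hσ.compl_mem S hS⟩
  have := Finset.card_erase_add_one h1
  have := Finset.card_erase_add_one hS
  omega

/-- Each of the two new stars contains a side of the new edge, and this side is not a block of `σ`;
so neither is an old star. This permits sums and products over the vertices to be expanded after a
splitting. -/
theorem sum_treeStars_addSplit (hσ : IsSplitSystem σ) {V I : Finset (Finset L)}
    (hV : V ∈ treeStars σ) (hI : I ⊆ V) (h2 : 2 ≤ I.card) (h2' : 2 ≤ (V \ I).card) :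
    insert (I.biUnion id) (V \ I) ∉ (treeStars σ).erase V ∧
    insert (I.biUnion id)ᶜ I ∉ insert (insert (I.biUnion id) (V \ I)) ((treeStars σ).erase V) := by
  have hn := hσ.biUnion_notMem hV hI h2 h2'
  have hn' : (I.biUnion id)ᶜ ∉ σ := fun h => hn (by simpa using hσ.compl_mem _ h)
  have hc := hσ.two_le_card_biUnion hV hI h2
  have hc' : 2 ≤ (I.biUnion id)ᶜ.card := by
    rw [compl_biUnion hV hI]
    exact hσ.two_le_card_biUnion hV Finset.sdiff_subset h2'
  have key : ∀ S, S ∉ σ → 2 ≤ S.card → ∀ W ∈ treeStars σ, S ∉ W := by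
    intro S hS hS2 W hW hSW
    rcases (mem_treeStars.1 hW).1 S hSW with h | h
    · exact hS h
    · omega
  refine ⟨fun h => key _ hn hc _ (Finset.mem_of_mem_erase h) (by simp), fun h => ?_⟩
  rcases Finset.mem_insert.1 h with h | h
  · have h1 : (I.biUnion id)ᶜ ∈ insert (I.biUnion id) (V \ I) := h ▸ Finset.mem_insert_self _ _
    rcases Finset.mem_insert.1 h1 with h1 | h1
    · exact ne_compl (Finset.card_pos.1 (by omega)) h1.symm
    · exact key _ hn' hc' V hV (Finset.mem_sdiff.1 h1).1
  · exact key _ hn' hc' _ (Finset.mem_of_mem_erase h) (by simp)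

theorem treeStars_empty (hL : 3 ≤ Fintype.card L) :
    treeStars (∅ : Finset (Finset L)) = {Finset.univ.image fun x : L => ({x} : Finset L)} := by
  have hmem : Finset.univ.image (fun x : L => ({x} : Finset L)) ∈ treeStars ∅ := by
    refine mem_treeStars.2 ⟨?_, ?_, ?_, ?_, ?_⟩
    · intro B hB
      obtain ⟨x, -, rfl⟩ := Finset.mem_image.1 hB
      exact Or.inr (by simp)
    · intro A hA B hB hAB
      obtain ⟨x, -, rfl⟩ := Finset.mem_image.1 hA
      obtain ⟨y, -, rfl⟩ := Finset.mem_image.1 hB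
      simp only [Finset.disjoint_singleton]
      rintro rfl; exact hAB rfl
    · intro x
      exact ⟨{x}, Finset.mem_image_of_mem _ (Finset.mem_univ x), by simp⟩
    · rw [Finset.card_image_of_injective _ Finset.singleton_injective]; simpa using hL
    · simp
  have h0 : IsSplitSystem (∅ : Finset (Finset L)) := ⟨by simp, by simp, by simp⟩
  ext W
  rw [Finset.mem_singleton]
  refine ⟨fun hW => ?_, fun h => h ▸ hmem⟩
  have hW' := mem_treeStars.1 hW
  obtain ⟨A, hA⟩ : W.Nonempty := Finset.card_pos.1 (by omega)
  obtain hA' | hA' := hW'.1 A hA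
  · simp at hA'
  obtain ⟨x, rfl⟩ := Finset.card_eq_one.1 hA'
  exact h0.star_unique hW hmem hA (Finset.mem_image_of_mem _ (Finset.mem_univ x))

/-- The number of bounded edges in terms of the valences. -/
theorem card_add_sum (hL : 3 ≤ Fintype.card L) (hσ : IsSplitSystem σ) :
    σ.card + 2 * ∑ V ∈ treeStars σ, (V.card - 3) = 2 * (Fintype.card L - 3) := by
  -- Splitting a vertex of valence k into valences a + 1 and b + 1 with a + b = k lowers the sum of
  -- the terms valence - 3 by one, and it adds two sides to `σ`. Truncated subtraction does no harm,
  -- as a and b are at least 2.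
  induction hn : σ.card using Nat.strong_induction_on generalizing σ with
  | _ n ih =>
    rcases σ.eq_empty_or_nonempty with rfl | ⟨S, hS⟩
    · rw [treeStars_empty hL, Finset.sum_singleton,
        Finset.card_image_of_injective _ Finset.singleton_injective]
      simp at hn ⊢
      omega
    · set σ' := (σ.erase S).erase Sᶜ with hσ'
      have h1 : IsSplitSystem σ' := hσ.removeSplit
      have hadd : addSplit σ' S = σ := hσ.addSplit_removeSplit hS
      have hcard : σ'.card + 2 = σ.card := hσ.card_removeSplit hS
      have hSn : S ∉ σ' := by simp [hσ']
      obtain ⟨V, hV, I, hI, h2, h2', rfl⟩ := h1.exists_split_star (hadd ▸ hσ) hSn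
      have := ih σ'.card (by omega) h1 rfl
      obtain ⟨n1, n2⟩ := h1.sum_treeStars_addSplit hV hI h2 h2'
      rw [← hadd, h1.treeStars_addSplit hV hI h2 h2', Finset.sum_insert n2, Finset.sum_insert n1]
      have hc1 : (insert (I.biUnion id)ᶜ I).card = I.card + 1 := by
        rw [Finset.card_insert_of_notMem]
        intro h
        obtain ⟨x, hx⟩ := h1.star_nonempty hV (hI h)
        exact Finset.mem_compl.1 hx (sub_biUnion h hx)
      have hc2 : (insert (I.biUnion id) (V \ I)).card = (V \ I).card + 1 := by
        rw [Finset.card_insert_of_notMem]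
        intro h
        exact h1.not_subset_block hV hI h2 (Finset.mem_sdiff.1 h).1 subset_rfl
      have hc3 := Finset.card_sdiff_add_card_eq_card hI
      have hc4 := Finset.add_sum_erase (treeStars σ') (fun V => V.card - 3) hV
      rw [hc1, hc2]
      omega

end IsSplitSystem

end SplitSystems

/-! ## The evaluation map -/

namespace MetricTree

section Evaluation

variable {r s : ℕ} {E : Type}

/-- The direction vector of an edge as a real vector. -/
def dirR (u : E → ℤ × ℤ) (S : Finset (Leaf r s E)) : ℝ × ℝ :=
  (((dirTo u S).1 : ℝ), ((dirTo u S).2 : ℝ))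

/-- The displacement of the markings caused by an edge of length one. -/
def edgeVec [DecidableEq E] (u : E → ℤ × ℤ) (S : Finset (Leaf r s E)) : Fin r ⊕ Fin s → ℝ × ℝ :=
  fun j => if Sum.inl j ∈ S then dirR u S else 0

/-- The sides of the bounded edges that do not contain the leaf `ρ`. -/
def rooted [DecidableEq E] (σ : Finset (Finset (Leaf r s E))) (ρ : Leaf r s E) :
    Finset (Finset (Leaf r s E)) :=
  σ.filter fun S => ρ ∉ S

/-- The evaluation map on the cell `σ`, in terms of a translation and the lengths of the edges. -/
def evMap [DecidableEq E] (u : E → ℤ × ℤ) (σ : Finset (Finset (Leaf r s E))) (ρ : Leaf r s E) :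
    ((ℝ × ℝ) × (rooted σ ρ → ℝ)) →ₗ[ℝ] (Fin r ⊕ Fin s → ℝ × ℝ) where
  toFun p := fun j => p.1 + ∑ S : rooted σ ρ, p.2 S • edgeVec u S.1 j
  map_add' p q := by
    ext j <;> simp [add_smul, Finset.sum_add_distrib] <;> ring
  map_smul' c p := by
    ext j <;> simp [mul_smul, Finset.smul_sum]

/-- The image of the evaluation map on the linear span of the cell `σ`. -/
def evSpan [DecidableEq E] (u : E → ℤ × ℤ) (σ : Finset (Finset (Leaf r s E))) :
    Submodule ℝ (Fin r ⊕ Fin s → ℝ × ℝ) :=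
  Submodule.span ℝ (Set.range (fun w : ℝ × ℝ => fun _ : Fin r ⊕ Fin s => w) ∪ edgeVec u '' σ)

/-- The evaluation map is injective on the cell `σ`. -/
def IsRigid [DecidableEq E] (u : E → ℤ × ℤ) (σ : Finset (Finset (Leaf r s E))) : Prop :=
  2 * Module.finrank ℝ (evSpan u σ) = σ.card + 4

/-- All valences are as they are for the curves through a configuration in general position. -/
def IsTop [Fintype E] [DecidableEq E] (σ : Finset (Finset (Leaf r s E))) : Prop :=
  IsSplitSystem σ ∧ ∀ V ∈ treeStars σ, (HasThick V → V.card = 4) ∧ (¬ HasThick V → V.card = 3)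

/-- There is a tropical curve of the type `σ` through `P`. -/
def Realizes [Fintype E] [DecidableEq E] (u : E → ℤ × ℤ) (P : Fin r ⊕ Fin s → ℝ × ℝ)
    (σ : Finset (Finset (Leaf r s E))) : Prop :=
  ∃ C : MetricTree (Leaf r s E), C.edges = σ ∧ C.PassesThrough u P

/-- The refined multiplicity of a type. -/
noncomputable def typeMult [Fintype E] [DecidableEq E] (u : E → ℤ × ℤ)
    (σ : Finset (Finset (Leaf r s E))) : RatFunc ℚ :=
  ∏ V ∈ treeStars σ, vertexMult u V

variable [DecidableEq E] {u : E → ℤ × ℤ} {σ : Finset (Finset (Leaf r s E))}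

theorem evMap_apply (p : (ℝ × ℝ) × (rooted σ ρ → ℝ)) :
    evMap u σ ρ p = (fun _ => p.1) + ∑ S : rooted σ ρ, p.2 S • edgeVec u S.1 := by
  ext j <;> simp [evMap]

theorem evMap_apply_fun {ρ : Leaf r s E} (w : ℝ × ℝ) (x : Finset (Leaf r s E) → ℝ) :
    evMap u σ ρ (w, fun S => x S) = (fun _ => w) + ∑ S ∈ rooted σ ρ, x S • edgeVec u S := by
  rw [evMap_apply, ← Finset.sum_coe_sort (rooted σ ρ) (fun S => x S • edgeVec u S)]

theorem const_mem_evSpan (w : ℝ × ℝ) : (fun _ => w) ∈ evSpan u σ :=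
  Submodule.subset_span (Or.inl ⟨w, rfl⟩)

theorem edgeVec_mem_evSpan {S : Finset (Leaf r s E)} (hS : S ∈ σ) : edgeVec u S ∈ evSpan u σ :=
  Submodule.subset_span (Or.inr ⟨S, hS, rfl⟩)

theorem mem_rooted {ρ : Leaf r s E} {S : Finset (Leaf r s E)} : S ∈ rooted σ ρ ↔ S ∈ σ ∧ ρ ∉ S := by
  simp [rooted]

variable [Fintype E]

theorem dirTo_compl (hu : ∑ e, u e = 0) (S : Finset (Leaf r s E)) :
    dirTo u Sᶜ = - dirTo u S := by
  have h : dirTo u S + dirTo u Sᶜ = 0 := by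
    simp only [dirTo]
    rw [Finset.sum_add_sum_compl, Fintype.sum_sum_type]
    have h0 : ∑ m : Fin r ⊕ Fin s, (Sum.elim (fun _ => (0, 0)) u (Sum.inl m : Leaf r s E)) = 0 :=
      Finset.sum_eq_zero fun _ _ => rfl
    rw [h0, zero_add]
    exact hu
  exact (neg_eq_of_add_eq_zero_right h).symm

theorem dirR_compl (hu : ∑ e, u e = 0) (S : Finset (Leaf r s E)) :
    dirR u Sᶜ = - dirR u S := by
  simp [dirR, dirTo_compl hu]

theorem edgeVec_compl (hu : ∑ e, u e = 0) (S : Finset (Leaf r s E)) :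
    edgeVec u Sᶜ = edgeVec u S - fun _ => dirR u S := by
  funext j
  by_cases h : Sum.inl j ∈ S <;> simp [edgeVec, h, dirR_compl hu]

/-- By balancing, passing to the other side of an edge changes its vector by a constant
configuration. So the rooted sides span the same space as all sides, and the image does not depend
on the root. -/
theorem range_evMap (hu : ∑ e, u e = 0) (hσ : IsSplitSystem σ) (ρ : Leaf r s E) :
    LinearMap.range (evMap u σ ρ) = evSpan u σ := by
  apply le_antisymm
  · rintro _ ⟨p, rfl⟩
    rw [evMap_apply]
    refine add_mem (const_mem_evSpan _) (sum_mem fun S _ => Submodule.smul_mem _ _ ?_)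
    exact edgeVec_mem_evSpan (mem_rooted.1 S.2).1
  · have hc : ∀ w : ℝ × ℝ, (fun _ => w) ∈ LinearMap.range (evMap u σ ρ) := fun w =>
      ⟨(w, 0), by rw [evMap_apply]; simp⟩
    have hr : ∀ S ∈ rooted σ ρ, edgeVec u S ∈ LinearMap.range (evMap u σ ρ) := fun S hS =>
      ⟨(0, Pi.single ⟨S, hS⟩ 1), by
        rw [evMap_apply]
        simp only [Pi.single_apply, ite_smul, one_smul, zero_smul, Finset.sum_ite_eq',
          Finset.mem_univ, if_true]
        funext j; simp⟩
    refine Submodule.span_le.2 ?_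
    rintro _ (⟨w, rfl⟩ | ⟨S, hS, rfl⟩)
    · exact hc w
    · by_cases h : ρ ∈ S
      · have h1 := hr Sᶜ (mem_rooted.2 ⟨hσ.compl_mem S hS, by simpa using h⟩)
        rw [edgeVec_compl hu] at h1
        simpa using add_mem h1 (hc (dirR u S))
      · exact hr S (mem_rooted.2 ⟨hS, h⟩)

theorem card_rooted (hσ : IsSplitSystem σ) (ρ : Leaf r s E) :
    2 * (rooted σ ρ).card = σ.card := by
  have h1 : (σ.filter fun S => ¬ ρ ∉ S).card = (rooted σ ρ).card := by
    refine Finset.card_bij (fun S _ => Sᶜ) ?_ ?_ ?_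
    · intro S hS
      simp only [Finset.mem_filter, not_not] at hS
      exact mem_rooted.2 ⟨hσ.compl_mem S hS.1, by simpa using hS.2⟩
    · intro S _ T _ h
      exact compl_injective h
    · intro S hS
      rw [mem_rooted] at hS
      exact ⟨Sᶜ, by simpa using ⟨hσ.compl_mem S hS.1, hS.2⟩, by simp⟩
  have := Finset.card_filter_add_card_filter_not (s := σ) (fun S => ρ ∉ S)
  rw [h1] at this
  change (rooted σ ρ).card + _ = _ at this
  omega

theorem finrank_domain (ρ : Leaf r s E) :
    Module.finrank ℝ ((ℝ × ℝ) × (rooted σ ρ → ℝ)) = 2 + (rooted σ ρ).card := by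
  simp

theorem finrank_config : Module.finrank ℝ (Fin r ⊕ Fin s → ℝ × ℝ) = 2 * (r + s) := by
  rw [Module.finrank_pi_fintype]
  simp
  ring

/-- Every bounded edge occurs twice in `σ`, so the domain has dimension 2 + |σ|/2, and the claim is
rank-nullity. The definition by rank has the advantage that no root has to be chosen. -/
theorem isRigid_iff (hu : ∑ e, u e = 0) (hσ : IsSplitSystem σ) (ρ : Leaf r s E) :
    IsRigid u σ ↔ Function.Injective (evMap u σ ρ) := by
  have h1 := (evMap u σ ρ).finrank_range_add_finrank_ker
  rw [finrank_domain, range_evMap hu hσ] at h1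
  have h2 := card_rooted hσ ρ
  rw [← LinearMap.ker_eq_bot, ← Submodule.finrank_eq_zero (R := ℝ), IsRigid]
  omega

/-- The sides that contain `ρ` are reindexed by their complements; the sign that this costs is the
one in the difference of the values at `j` and `i`. -/
theorem sum_separating (hu : ∑ e, u e = 0) (hσ : IsSplitSystem σ)
    {x : Finset (Leaf r s E) → ℝ} (hx : ∀ S, x Sᶜ = x S) (ρ : Leaf r s E) (i j : Fin r ⊕ Fin s) :
    ∑ S ∈ σ.filter (fun S => Sum.inl i ∉ S ∧ Sum.inl j ∈ S), x S • dirR u S =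
      ∑ S ∈ rooted σ ρ, x S • (edgeVec u S j - edgeVec u S i) := by
  have h2 : ∑ S ∈ σ.filter (fun S => ¬ ρ ∉ S),
      (if Sum.inl i ∉ S ∧ Sum.inl j ∈ S then x S • dirR u S else 0) =
      ∑ S ∈ rooted σ ρ, (if Sum.inl i ∈ S ∧ Sum.inl j ∉ S then - (x S • dirR u S) else 0) := by
    refine Finset.sum_bij (fun S _ => Sᶜ) ?_ ?_ ?_ ?_
    · intro S hS
      simp only [Finset.mem_filter, not_not] at hS
      exact mem_rooted.2 ⟨hσ.compl_mem S hS.1, by simpa using hS.2⟩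
    · intro S _ T _ h
      exact compl_injective h
    · intro S hS
      rw [mem_rooted] at hS
      exact ⟨Sᶜ, by simpa using ⟨hσ.compl_mem S hS.1, hS.2⟩, by simp⟩
    · intro S hS
      simp [hx, dirR_compl hu]
  rw [Finset.sum_filter, ← Finset.sum_filter_add_sum_filter_not σ (fun S => ρ ∉ S), h2]
  change ∑ S ∈ rooted σ ρ, _ + _ = _
  rw [← Finset.sum_add_distrib]
  refine Finset.sum_congr rfl fun S _ => ?_
  by_cases h3 : Sum.inl i ∈ S <;> by_cases h4 : Sum.inl j ∈ S <;> simp [edgeVec, h3, h4]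

/-- This turns the pairwise displacement conditions into membership in the image of a linear map.
The translation is recovered from the position of the marking `i₀`. -/
theorem passes_iff (hu : ∑ e, u e = 0) (hσ : IsSplitSystem σ) {x : Finset (Leaf r s E) → ℝ}
    (hx : ∀ S, x Sᶜ = x S) (ρ : Leaf r s E) (i₀ : Fin r ⊕ Fin s) (P : Fin r ⊕ Fin s → ℝ × ℝ) :
    (∀ i j : Fin r ⊕ Fin s, P j - P i =
      ∑ S ∈ σ.filter (fun S => Sum.inl i ∉ S ∧ Sum.inl j ∈ S), x S • dirR u S) ↔
    ∃ w, P = evMap u σ ρ (w, fun S => x S) := by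
  simp only [sum_separating hu hσ hx ρ, evMap_apply_fun]
  constructor
  · intro h
    refine ⟨P i₀ - ∑ S ∈ rooted σ ρ, x S • edgeVec u S i₀, ?_⟩
    funext j
    have := h i₀ j
    simp only [smul_sub, Finset.sum_sub_distrib] at this
    simp only [Pi.add_apply, Finset.sum_apply, Pi.smul_apply]
    rw [sub_eq_iff_eq_add] at this
    rw [this]; abel
  · rintro ⟨w, rfl⟩ i j
    simp only [smul_sub, Finset.sum_sub_distrib, Pi.add_apply, Finset.sum_apply, Pi.smul_apply]
    abel

/-- The lengths of all edges from the lengths of the rooted ones. -/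
noncomputable def extendLength (σ : Finset (Finset (Leaf r s E))) (ρ : Leaf r s E)
    (x : rooted σ ρ → ℝ) (S : Finset (Leaf r s E)) : ℝ :=
  if h : S ∈ rooted σ ρ then x ⟨S, h⟩ else if h : Sᶜ ∈ rooted σ ρ then x ⟨Sᶜ, h⟩ else 0

theorem extendLength_rooted {ρ : Leaf r s E} (x : rooted σ ρ → ℝ) (S : rooted σ ρ) :
    extendLength σ ρ x S.1 = x S := by
  simp [extendLength]

theorem extendLength_compl {ρ : Leaf r s E} (x : rooted σ ρ → ℝ) (S : Finset (Leaf r s E)) :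
    extendLength σ ρ x Sᶜ = extendLength σ ρ x S := by
  unfold extendLength
  by_cases h1 : S ∈ rooted σ ρ <;> by_cases h2 : Sᶜ ∈ rooted σ ρ
  · have := (mem_rooted.1 h1).2
    have h3 := (mem_rooted.1 h2).2
    simp [this] at h3
  · simp [h1, h2]
  · simp [h1, h2]
  · simp [h1, h2]

theorem extendLength_eq_zero {ρ : Leaf r s E} (x : rooted σ ρ → ℝ) {S : Finset (Leaf r s E)}
    (hσ : IsSplitSystem σ) (hS : S ∉ σ) : extendLength σ ρ x S = 0 := by
  have h1 : S ∉ rooted σ ρ := fun h => hS (mem_rooted.1 h).1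
  have h2 : Sᶜ ∉ rooted σ ρ := fun h => hS (by simpa using hσ.compl_mem _ (mem_rooted.1 h).1)
  simp [extendLength, h1, h2]

theorem extendLength_pos {ρ : Leaf r s E} {x : rooted σ ρ → ℝ} (hx : ∀ S, 0 < x S)
    {S : Finset (Leaf r s E)} (hσ : IsSplitSystem σ) (hS : S ∈ σ) : 0 < extendLength σ ρ x S := by
  unfold extendLength
  by_cases h : ρ ∈ S
  · have h1 : S ∉ rooted σ ρ := fun h' => (mem_rooted.1 h').2 h
    have h2 : Sᶜ ∈ rooted σ ρ := mem_rooted.2 ⟨hσ.compl_mem S hS, by simpa using h⟩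
    simp [h1, h2, hx]
  · have h1 : S ∈ rooted σ ρ := mem_rooted.2 ⟨hS, h⟩
    simp [h1, hx]

theorem realizes_iff (hu : ∑ e, u e = 0) (hσ : IsSplitSystem σ) (ρ : Leaf r s E)
    (i₀ : Fin r ⊕ Fin s) (P : Fin r ⊕ Fin s → ℝ × ℝ) :
    Realizes u P σ ↔ (∀ V ∈ treeStars σ, HasThick V → 4 ≤ V.card) ∧
      ∃ w x, (∀ S, 0 < x S) ∧ P = evMap u σ ρ (w, x) := by
  constructor
  · rintro ⟨C, rfl, h1, h2⟩
    obtain ⟨w, hw⟩ := (passes_iff hu hσ C.length_compl ρ i₀ P).1 h1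
    exact ⟨h2, w, _, fun S => C.length_pos _ (mem_rooted.1 S.2).1, hw⟩
  · rintro ⟨h1, w, x, hx, hP⟩
    refine ⟨⟨σ, hσ.compl_mem, hσ.two_le_card, hσ.compatible, extendLength σ ρ x,
      fun S hS => extendLength_pos hx hσ hS, extendLength_compl x,
      fun S hS => extendLength_eq_zero x hσ hS⟩, rfl, ?_, h1⟩
    refine (passes_iff hu hσ (extendLength_compl x) ρ i₀ P).2 ⟨w, ?_⟩
    simpa [extendLength_rooted] using hP

theorem mem_evSpan_of_realizes (hu : ∑ e, u e = 0) (i₀ : Fin r ⊕ Fin s)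
    {P : Fin r ⊕ Fin s → ℝ × ℝ} (h : Realizes u P σ) : P ∈ evSpan u σ := by
  have hσ : IsSplitSystem σ := by
    obtain ⟨C, rfl, -⟩ := h
    exact C.isSplitSystem
  obtain ⟨-, w, x, -, rfl⟩ := (realizes_iff hu hσ (Sum.inl i₀) i₀ P).1 h
  rw [← range_evMap hu hσ (Sum.inl i₀)]
  exact ⟨_, rfl⟩

/-! ### Counting thick vertices -/

theorem star_of_leaf (hσ : IsSplitSystem σ) (hL : 3 ≤ Fintype.card (Leaf r s E))
    (x : Leaf r s E) : ∃ V ∈ treeStars σ, {x} ∈ V :=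
  hσ.exists_star hL (Or.inr (by simp))

/-- Two leaves at the same vertex are not separated by an edge. -/
theorem not_separated (hσ : IsSplitSystem σ) {V : Finset (Finset (Leaf r s E))}
    (hV : V ∈ treeStars σ) {x y : Leaf r s E} (hx : {x} ∈ V) (hy : {y} ∈ V)
    {T : Finset (Leaf r s E)} (hT : T ∈ σ) (hxT : x ∉ T) (hyT : y ∈ T) : False := by
  obtain ⟨B, hB, h | h⟩ := hσ.exists_block hV hT
  · have := star_eq_of_mem hV hy hB (by simp) (h hyT)
    subst this
    have h1 := Finset.card_le_card h
    have h2 := hσ.two_le_card T hT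
    simp at h1; omega
  · have := star_eq_of_mem hV hx hB (x := x) (by simp) (h (by simpa using hxT))
    subst this
    have h1 := Finset.card_le_card h
    have h2 := hσ.two_le_card _ (hσ.compl_mem T hT)
    rw [Finset.card_singleton] at h1; omega

theorem eq_of_same_star {P : Fin r ⊕ Fin s → ℝ × ℝ} (h : Realizes u P σ)
    {V : Finset (Finset (Leaf r s E))} (hV : V ∈ treeStars σ) {i j : Fin r ⊕ Fin s}
    (hi : {Sum.inl i} ∈ V) (hj : {Sum.inl j} ∈ V) : P i = P j := by
  obtain ⟨C, rfl, hC, -⟩ := h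
  have := hC i j
  rw [Finset.sum_eq_zero, sub_eq_zero] at this
  · exact this.symm
  · intro S hS
    rw [Finset.mem_filter] at hS
    exact (not_separated C.isSplitSystem hV hi hj hS.1 hS.2.1 hS.2.2).elim

open Classical in
theorem card_thick_le (hσ : IsSplitSystem σ) :
    ((treeStars σ).filter HasThick).card ≤ s := by
  have : ∀ V : (treeStars σ).filter HasThick, ∃ k : Fin s, {Sum.inl (Sum.inr k)} ∈ V.1 :=
    fun V => (Finset.mem_filter.1 V.2).2
  choose f hf using this
  have hinj : Function.Injective f := by
    intro V V' h
    have h1 := hf V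
    have h2 := hf V'
    rw [h] at h1
    exact Subtype.ext (hσ.star_unique (Finset.mem_filter.1 V.2).1 (Finset.mem_filter.1 V'.2).1 h1 h2)
  have := Fintype.card_le_of_injective f hinj
  rwa [Fintype.card_coe, Fintype.card_fin] at this

-- Two thick markings at one vertex would be mapped to the same point, so distinct points need `s`
-- different thick vertices.
open Classical in
theorem le_card_thick (hσ : IsSplitSystem σ) (hL : 3 ≤ Fintype.card (Leaf r s E))
    {P : Fin r ⊕ Fin s → ℝ × ℝ} (hP : Function.Injective P) (h : Realizes u P σ) :
    s ≤ ((treeStars σ).filter HasThick).card := by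
  have : ∀ k : Fin s, ∃ V ∈ treeStars σ, {Sum.inl (Sum.inr k)} ∈ V :=
    fun k => star_of_leaf hσ hL _
  choose f hf hf' using this
  have : (Finset.univ.image f) ⊆ (treeStars σ).filter HasThick := by
    intro V hV
    obtain ⟨k, -, rfl⟩ := Finset.mem_image.1 hV
    exact Finset.mem_filter.2 ⟨hf k, k, hf' k⟩
  have h2 := Finset.card_le_card this
  rw [Finset.card_image_of_injective] at h2
  · simpa using h2
  · intro k l hkl
    have h3 := hf' k
    rw [hkl] at h3
    have := hP (eq_of_same_star h (hf l) h3 (hf' l))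
    simpa using this

theorem card_leaf (hE : Fintype.card E = r + 1 + 2 * s) :
    Fintype.card (Leaf r s E) = 2 * r + 3 * s + 1 := by
  simp [hE]; ring

theorem three_le_card_leaf (hE : Fintype.card E = r + 1 + 2 * s) (i₀ : Fin r ⊕ Fin s) :
    3 ≤ Fintype.card (Leaf r s E) := by
  rw [card_leaf hE]
  rcases i₀ with i | i <;> have := i.pos <;> omega

theorem one_le_of_marking (i₀ : Fin r ⊕ Fin s) : 1 ≤ r + s := by
  rcases i₀ with i | i <;> have := i.pos <;> omega

open Classical in
theorem IsTop.sum_eq (h : IsTop σ) :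
    ∑ V ∈ treeStars σ, (V.card - 3) = ((treeStars σ).filter HasThick).card := by
  rw [Finset.card_filter]
  refine Finset.sum_congr rfl fun V hV => ?_
  by_cases ht : HasThick V
  · simp [ht, (h.2 V hV).1 ht]
  · simp [ht, (h.2 V hV).2 ht]

/-- Only thick vertices contribute to the valence formula, one unit each, and there are at most `s`
of them. Together with the rank bound `IsRigid.card_le` this fixes the number of edges of a rigid
top type. -/
theorem IsTop.le_card (h : IsTop σ) (hE : Fintype.card E = r + 1 + 2 * s)
    (i₀ : Fin r ⊕ Fin s) : 4 * (r + s) ≤ σ.card + 4 := by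
  classical
  have h1 := h.1.card_add_sum (three_le_card_leaf hE i₀)
  rw [h.sum_eq, card_leaf hE] at h1
  have h2 := card_thick_le h.1
  have := one_le_of_marking i₀
  omega

theorem IsRigid.card_le (h : IsRigid u σ) : σ.card + 4 ≤ 4 * (r + s) := by
  have h1 := Submodule.finrank_le (evSpan u σ)
  rw [finrank_config] at h1
  unfold IsRigid at h
  omega

theorem IsTop.card_eq (h : IsTop σ) (h' : IsRigid u σ) (hE : Fintype.card E = r + 1 + 2 * s)
    (i₀ : Fin r ⊕ Fin s) : σ.card + 4 = 4 * (r + s) :=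
  le_antisymm h'.card_le (h.le_card hE i₀)

theorem IsTop.evSpan_eq_top (h : IsTop σ) (h' : IsRigid u σ)
    (hE : Fintype.card E = r + 1 + 2 * s) (i₀ : Fin r ⊕ Fin s) : evSpan u σ = ⊤ := by
  apply Submodule.eq_top_of_finrank_eq
  have := h.card_eq h' hE i₀
  rw [finrank_config]
  unfold IsRigid at h'
  omega

/-- The thick vertices contribute at least `s` to the sum of valence - 3, while the lower bound on
the number of edges permits at most `s`. Hence equality holds at every vertex, and no valence is
larger than required. -/
theorem isTop_of_card (hσ : IsSplitSystem σ) (hE : Fintype.card E = r + 1 + 2 * s)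
    (i₀ : Fin r ⊕ Fin s) (h4 : 4 * (r + s) ≤ σ.card + 4) {P : Fin r ⊕ Fin s → ℝ × ℝ}
    (hP : Function.Injective P) (h : Realizes u P σ) :
    IsTop σ ∧ σ.card + 4 = 4 * (r + s) := by
  classical
  have hL := three_le_card_leaf hE i₀
  have h1 := hσ.card_add_sum hL
  have h2 : s ≤ ∑ V ∈ treeStars σ, (if HasThick V then 1 else 0) := by
    rw [← Finset.card_filter]
    exact le_card_thick hσ hL hP h
  rw [card_leaf hE] at h1
  have h3 : ∀ V ∈ treeStars σ, (if HasThick V then 1 else 0) ≤ V.card - 3 := by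
    intro V hV
    obtain ⟨C, rfl, -, hC⟩ := h
    split_ifs with ht
    · have := hC V hV ht; omega
    · omega
  have h5 := Finset.sum_le_sum h3
  have := one_le_of_marking i₀
  have h6 : ∑ V ∈ treeStars σ, (if HasThick V then 1 else 0) =
      ∑ V ∈ treeStars σ, (V.card - 3) := by
    omega
  have h7 := (Finset.sum_eq_sum_iff_of_le h3).1 h6
  refine ⟨⟨hσ, fun V hV => ?_⟩, by omega⟩
  have h8 := h7 V hV
  have h9 := (mem_treeStars.1 hV).2.2.2.1
  constructor
  · intro ht; rw [if_pos ht] at h8; omega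
  · intro ht; rw [if_neg ht] at h8; omega

/-! ### Generic configurations -/

theorem IsGeneric.isTop {P : Fin r ⊕ Fin s → ℝ × ℝ} (hP : IsGeneric u P) (h : Realizes u P σ) :
    IsTop σ := by
  obtain ⟨C, rfl, hC⟩ := h
  exact ⟨C.isSplitSystem, (hP.2 C hC).1⟩

/-- A vector in the kernel of the evaluation map, scaled so that all lengths stay positive, could be
added to the lengths of the curve. This would give a second curve of the same type through `P`. -/
theorem IsGeneric.isRigid (hu : ∑ e, u e = 0) {P : Fin r ⊕ Fin s → ℝ × ℝ} (i₀ : Fin r ⊕ Fin s)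
    (hP : IsGeneric u P) (h : Realizes u P σ) : IsRigid u σ := by
  have hσ := (hP.isTop h).1
  rw [isRigid_iff hu hσ (Sum.inl i₀), ← LinearMap.ker_eq_bot, LinearMap.ker_eq_bot']
  intro p hp
  obtain ⟨h4, w, x, hx, hPx⟩ := (realizes_iff hu hσ (Sum.inl i₀) i₀ P).1 h
  obtain ⟨ε, hε, hpos⟩ : ∃ ε : ℝ, 0 < ε ∧ ∀ S, 0 < x S + ε * p.2 S := by
    have : ∀ᶠ ε in nhdsWithin (0 : ℝ) (Set.Ioi 0), ∀ S, 0 < x S + ε * p.2 S := by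
      rw [Filter.eventually_all]
      intro S
      have hc : Filter.Tendsto (fun ε : ℝ => x S + ε * p.2 S) (nhdsWithin 0 (Set.Ioi 0))
          (nhds (x S + 0 * p.2 S)) :=
        (Continuous.tendsto (by fun_prop) 0).mono_left nhdsWithin_le_nhds
      exact hc.eventually (lt_mem_nhds (by simpa using hx S))
    obtain ⟨ε, h1, h2⟩ := (this.and self_mem_nhdsWithin).exists
    exact ⟨ε, h2, h1⟩
  obtain ⟨C, hC, hCP⟩ := h
  have key : ∀ y : rooted σ (Sum.inl i₀) → ℝ, (∀ S, 0 < y S) → ∀ w',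
      P = evMap u σ (Sum.inl i₀) (w', y) → ∀ S : rooted σ (Sum.inl i₀), C.length S.1 = y S := by
    intro y hy w' hw' S
    set C' : MetricTree (Leaf r s E) := ⟨σ, hσ.compl_mem, hσ.two_le_card, hσ.compatible,
      extendLength σ (Sum.inl i₀) y, fun S hS => extendLength_pos hy hσ hS, extendLength_compl y,
      fun S hS => extendLength_eq_zero y hσ hS⟩
    have hC' : C'.PassesThrough u P :=
      ⟨(passes_iff hu hσ (extendLength_compl y) (Sum.inl i₀) i₀ P).2
        ⟨w', by simpa [extendLength_rooted] using hw'⟩, h4⟩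
    have := (hP.2 C hCP).2 C' hC' hC.symm
    rw [← this]
    exact extendLength_rooted y S
  have h1 := key x hx w hPx
  have h2 := key (fun S => x S + ε * p.2 S) hpos (w + ε • p.1) (by
    have : ((w + ε • p.1, fun S => x S + ε * p.2 S) : (ℝ × ℝ) × (rooted σ (Sum.inl i₀) → ℝ)) =
        (w, x) + ε • p := by
      ext <;> simp
    rw [this, map_add, map_smul, hp, smul_zero, add_zero, hPx])
  have h3 : p.2 = 0 := by
    funext S
    have := (h1 S).symm.trans (h2 S)
    have : ε * p.2 S = 0 := by linarith
    simpa [hε.ne'] using this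
  have h5 : p.1 = 0 := by
    have := congrFun hp i₀
    rw [evMap_apply, h3] at this
    simpa using this
  exact Prod.ext h5 h3

-- For a generic configuration a curve is determined by its type, so the sum over curves becomes a
-- finite sum over types.
open Classical in
theorem IsGeneric.labelledCount_eq {P : Fin r ⊕ Fin s → ℝ × ℝ} (hP : IsGeneric u P) :
    labelledCount u P = ∑ σ ∈ Finset.univ.filter (Realizes u P), typeMult u σ := by
  have hinj : Set.InjOn (fun C : MetricTree (Leaf r s E) => C.edges) {C | C.PassesThrough u P} := by
    intro C hC C' hC' h
    exact (hP.2 C' hC').2 C hC h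
  have h1 := finsum_mem_image (f := typeMult u) hinj
  have h2 : (fun C : MetricTree (Leaf r s E) => C.edges) '' {C | C.PassesThrough u P} =
      ↑(Finset.univ.filter (Realizes u P)) := by
    ext σ
    simp only [Set.mem_image, Set.mem_ofPred_eq, Finset.coe_filter, Finset.mem_univ, true_and]
    exact ⟨fun ⟨C, h1, h2⟩ => ⟨C, h2, h1⟩, fun ⟨C, h1, h2⟩ => ⟨C, h2, h1⟩⟩
  rw [h2, finsum_mem_coe_finset] at h1
  rw [h1]
  rfl

end Evaluation

/-- The coordinates of the points are linearly independent over the rational numbers. -/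
def QIndep {ι : Type} [Fintype ι] (P : ι → ℝ × ℝ) : Prop :=
  ∀ f g : ι → ℚ, ∑ j, ((f j : ℝ) * (P j).1 + (g j : ℝ) * (P j).2) = 0 → f = 0 ∧ g = 0

theorem QIndep.injective {ι : Type} [Fintype ι] [DecidableEq ι] {P : ι → ℝ × ℝ} (hP : QIndep P) :
    Function.Injective P := by
  intro i j hij
  by_contra hne
  have h := hP (Pi.single i 1 - Pi.single j 1) 0 (by
    have h1 : ∀ k l : ι, ((if k = l then (1 : ℚ) else 0 : ℚ) : ℝ) = if k = l then 1 else 0 := by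
      intro k l; split_ifs <;> simp
    simp [Finset.sum_sub_distrib, sub_mul, Pi.single_apply, h1, hij])
  have := congrFun h.1 i
  simp [hne] at this

section Generic

variable {r s : ℕ} {E : Type} [Fintype E] [DecidableEq E] {u : E → ℤ × ℤ}
  {σ : Finset (Finset (Leaf r s E))}

/-- A proper `evSpan` lies in the kernel of a nonzero real functional. Since `evSpan` is spanned by
integral vectors, applying a ℚ-linear map ℝ → ℚ to the coefficients of this functional gives a
rational functional that still vanishes on `evSpan`. At `P` this is a rational relation between the
coordinates. -/
theorem QIndep.evSpan_eq_top {P : Fin r ⊕ Fin s → ℝ × ℝ} (hP : QIndep P) (h : P ∈ evSpan u σ) :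
    evSpan u σ = ⊤ := by
  by_contra hne
  obtain ⟨f, hf, hle⟩ := Submodule.exists_le_ker_of_lt_top _ (lt_top_iff_ne_top.2 hne)
  set a : Fin r ⊕ Fin s → ℝ := fun j => f (Pi.single j (1, 0)) with ha
  set b : Fin r ⊕ Fin s → ℝ := fun j => f (Pi.single j (0, 1)) with hb
  have hfv : ∀ v : Fin r ⊕ Fin s → ℝ × ℝ, f v = ∑ j, (a j * (v j).1 + b j * (v j).2) := by
    intro v
    have : v = ∑ j, ((v j).1 • Pi.single (M := fun _ => ℝ × ℝ) j ((1 : ℝ), (0 : ℝ)) +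
        (v j).2 • Pi.single (M := fun _ => ℝ × ℝ) j ((0 : ℝ), (1 : ℝ))) := by
      funext k
      simp only [Finset.sum_apply, Pi.add_apply, Pi.smul_apply]
      rw [Finset.sum_eq_single k]
      · ext <;> simp
      · intro j _ hj
        simp [hj.symm]
      · simp
    conv_lhs => rw [this]
    simp only [map_sum, map_add, map_smul, smul_eq_mul]
    refine Finset.sum_congr rfl fun j _ => ?_
    simp only [ha, hb]; ring
  have hab : ∃ c : ℝ, c ≠ 0 ∧ ((∃ j, a j = c) ∨ ∃ j, b j = c) := by
    by_contra hcon
    push Not at hcon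
    apply hf
    refine LinearMap.ext fun v => ?_
    rw [hfv]
    refine Finset.sum_eq_zero fun j _ => ?_
    have h1 : a j = 0 := by
      by_contra h; exact (hcon _ h).1 j rfl
    have h2 : b j = 0 := by
      by_contra h; exact (hcon _ h).2 j rfl
    simp [h1, h2]
  obtain ⟨c, hc, hcj⟩ := hab
  -- The map θ is chosen not to kill one nonzero coefficient, so that the rational functional does
  -- not vanish identically.
  obtain ⟨θ, hθ⟩ : ∃ θ : Module.Dual ℚ ℝ, θ c ≠ 0 := by
    by_contra hcon
    push Not at hcon
    exact hc ((Module.forall_dual_apply_eq_zero_iff ℚ c).1 hcon)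
  let F : (Fin r ⊕ Fin s → ℝ × ℝ) →ₗ[ℝ] ℝ :=
    ∑ j, (((θ (a j) : ℚ) : ℝ) • (LinearMap.fst ℝ ℝ ℝ ∘ₗ LinearMap.proj j) +
      ((θ (b j) : ℚ) : ℝ) • (LinearMap.snd ℝ ℝ ℝ ∘ₗ LinearMap.proj j))
  have hF : ∀ v, F v = ∑ j, (((θ (a j) : ℚ) : ℝ) * (v j).1 + ((θ (b j) : ℚ) : ℝ) * (v j).2) := by
    intro v
    simp [F, LinearMap.sum_apply]
  -- On integral vectors the new functional is θ applied to the old one, because θ is additive.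
  have hFint : ∀ v : Fin r ⊕ Fin s → ℤ × ℤ,
      F (fun j => (((v j).1 : ℝ), ((v j).2 : ℝ))) =
        ((θ (f (fun j => (((v j).1 : ℝ), ((v j).2 : ℝ)))) : ℚ) : ℝ) := by
    intro v
    rw [hF, hfv]
    have h1 : ∀ (x : ℝ) (n : ℤ), θ (x * n) = θ x * n := by
      intro x n
      rw [mul_comm, ← zsmul_eq_mul, map_zsmul, zsmul_eq_mul, mul_comm]
    rw [map_sum]
    push_cast
    refine Finset.sum_congr rfl fun j _ => ?_
    rw [map_add, h1, h1]
    push_cast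
    ring
  have hker : evSpan u σ ≤ LinearMap.ker F := by
    refine Submodule.span_le.2 ?_
    rintro _ (⟨w, rfl⟩ | ⟨S, hS, rfl⟩)
    · have h1 := hFint (fun _ => (1, 0))
      have h2 := hFint (fun _ => (0, 1))
      have h3 : f (fun _ => (((1, 0) : ℤ × ℤ).1, ((1, 0) : ℤ × ℤ).2)) = 0 :=
        hle (const_mem_evSpan _)
      have h4 : f (fun _ => (((0, 1) : ℤ × ℤ).1, ((0, 1) : ℤ × ℤ).2)) = 0 :=
        hle (const_mem_evSpan _)
      rw [h3] at h1
      rw [h4] at h2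
      have : (fun _ : Fin r ⊕ Fin s => w) =
          w.1 • (fun _ : Fin r ⊕ Fin s => ((((1, 0) : ℤ × ℤ).1 : ℝ), (((1, 0) : ℤ × ℤ).2 : ℝ))) +
          w.2 • (fun _ : Fin r ⊕ Fin s => ((((0, 1) : ℤ × ℤ).1 : ℝ), (((0, 1) : ℤ × ℤ).2 : ℝ))) := by
        ext j <;> simp
      rw [SetLike.mem_coe, LinearMap.mem_ker]
      beta_reduce
      rw [this, map_add, map_smul, map_smul, h1, h2]
      simp
    · have h1 := hFint (fun j => if Sum.inl j ∈ S then dirTo u S else 0)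
      have h2 : (fun j : Fin r ⊕ Fin s =>
          (((if Sum.inl j ∈ S then dirTo u S else 0 : ℤ × ℤ).1 : ℝ),
          ((if Sum.inl j ∈ S then dirTo u S else 0 : ℤ × ℤ).2 : ℝ))) = edgeVec u S := by
        funext j
        by_cases hj : Sum.inl j ∈ S <;> simp [edgeVec, dirR, hj]
      rw [h2] at h1
      have h3 : f (edgeVec u S) = 0 := hle (edgeVec_mem_evSpan hS)
      rw [SetLike.mem_coe, LinearMap.mem_ker, h1, h3]
      simp
  have h0 : F P = 0 := hker h
  rw [hF] at h0
  obtain ⟨h1, h2⟩ := hP (fun j => θ (a j)) (fun j => θ (b j)) h0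
  rcases hcj with ⟨j, rfl⟩ | ⟨j, rfl⟩
  · exact hθ (congrFun h1 j)
  · exact hθ (congrFun h2 j)

/-- The image of the cell of a curve through `P` is the whole space, which bounds the number of
edges from below. The valence formula bounds it from above. Equality gives both the valences and the
injectivity of the evaluation map. -/
theorem QIndep.isGeneric {P : Fin r ⊕ Fin s → ℝ × ℝ} (hP : QIndep P) (hu : ∑ e, u e = 0)
    (hE : Fintype.card E = r + 1 + 2 * s) (i₀ : Fin r ⊕ Fin s) : IsGeneric u P := by
  refine ⟨hP.injective, fun C hC => ?_⟩
  have hσ := C.isSplitSystem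
  have hr : Realizes u P C.edges := ⟨C, rfl, hC⟩
  have htop := hP.evSpan_eq_top (mem_evSpan_of_realizes hu i₀ hr)
  have hrank : Module.finrank ℝ (evSpan u C.edges) = 2 * (r + s) := by
    rw [htop, finrank_top, finrank_config]
  have hle : 4 * (r + s) ≤ C.edges.card + 4 := by
    have h1 := (evMap u C.edges (Sum.inl i₀)).finrank_range_le
    rw [range_evMap hu hσ, hrank, finrank_domain] at h1
    have := card_rooted hσ (Sum.inl i₀)
    omega
  obtain ⟨ht, hcard⟩ := isTop_of_card hσ hE i₀ hle hP.injective hr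
  refine ⟨ht.2, fun C' hC' hedges => ?_⟩
  have hrigid : IsRigid u C.edges := by unfold IsRigid; omega
  have hinj := (isRigid_iff hu hσ (Sum.inl i₀)).1 hrigid
  obtain ⟨w, hw⟩ := (passes_iff hu hσ C.length_compl (Sum.inl i₀) i₀ P).1 hC.1
  obtain ⟨w', hw'⟩ := (passes_iff hu hσ C'.length_compl (Sum.inl i₀) i₀ P).1 (hedges ▸ hC'.1)
  have heq := (Prod.ext_iff.1 (hinj (hw.symm.trans hw'))).2
  refine MetricTree.ext hedges (funext fun S => ?_)
  have key : ∀ S ∈ rooted C.edges (Sum.inl i₀), C'.length S = C.length S := fun S hS =>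
    (congrFun heq ⟨S, hS⟩).symm
  by_cases hS : S ∈ C.edges
  · by_cases h : Sum.inl i₀ ∈ S
    · rw [← C'.length_compl, ← C.length_compl]
      exact key _ (mem_rooted.2 ⟨C.compl_mem S hS, by simpa using h⟩)
    · exact key _ (mem_rooted.2 ⟨hS, h⟩)
  · rw [C.length_eq_zero S hS, C'.length_eq_zero S (hedges ▸ hS)]

end Generic

end MetricTree

/-! ## Local identities for refined multiplicities -/

namespace MetricTree

section Local

/-- A vector of integers as a real vector. -/
def realVec (a : ℤ × ℤ) : ℝ × ℝ := ((a.1 : ℝ), (a.2 : ℝ))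

/-- The determinant of two vectors. -/
def det₂ (a b : ℤ × ℤ) : ℤ := a.1 * b.2 - a.2 * b.1

/-- The sign of a real number as a rational function. -/
noncomputable def sgn (x : ℝ) : RatFunc ℚ := ((SignType.sign x : ℤ) : RatFunc ℚ)

theorem sgn_mul (x y : ℝ) : sgn (x * y) = sgn x * sgn y := by
  simp [sgn, sign_mul]

theorem sgn_zero : sgn 0 = 0 := by simp [sgn]

theorem sgn_pos {x : ℝ} (h : 0 < x) : sgn x = 1 := by simp [sgn, sign_pos h]

theorem sgn_neg {x : ℝ} (h : x < 0) : sgn x = -1 := by simp [sgn, sign_neg h]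

theorem sgn_neg' (x : ℝ) : sgn (-x) = - sgn x := by
  rw [neg_eq_neg_one_mul, sgn_mul, sgn_neg (by norm_num)]; ring

/-- The difference of opposite powers of the variable. -/
noncomputable def powDiff (n : ℤ) : RatFunc ℚ := RatFunc.X ^ n - RatFunc.X ^ (-n)

/-- The sum of opposite powers of the variable. -/
noncomputable def powSum (n : ℤ) : RatFunc ℚ := RatFunc.X ^ n + RatFunc.X ^ (-n)

theorem powDiff_neg (n : ℤ) : powDiff (-n) = - powDiff n := by
  simp [powDiff]

theorem powSum_neg (n : ℤ) : powSum (-n) = powSum n := by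
  simp [powSum, add_comm]

theorem powDiff_natAbs (n : ℤ) : powDiff n.natAbs = sgn n * powDiff n := by
  rcases lt_trichotomy n 0 with h | h | h
  · rw [sgn_neg (by exact_mod_cast h), Int.ofNat_natAbs_of_nonpos h.le, powDiff_neg]; ring
  · subst h; simp [powDiff]
  · rw [sgn_pos (by exact_mod_cast h), Int.natAbs_of_nonneg h.le]; ring

theorem powSum_natAbs (n : ℤ) : powSum n.natAbs = powSum n := by
  rcases le_total n 0 with h | h
  · rw [Int.ofNat_natAbs_of_nonpos h, powSum_neg]
  · rw [Int.natAbs_of_nonneg h]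

/-- The square of the sign is 1 unless `n = 0`, and there the other factor vanishes. So degenerate
determinants need no separate treatment below. -/
theorem sgn_sq_mul_powDiff (n : ℤ) : sgn n * sgn n * powDiff n = powDiff n := by
  rcases lt_trichotomy n 0 with h | h | h
  · rw [sgn_neg (by exact_mod_cast h)]; ring
  · subst h; simp [powDiff]
  · rw [sgn_pos (by exact_mod_cast h)]; ring

theorem powDiff_mul (p q : ℤ) : powDiff p * powDiff q = powSum (p + q) - powSum (p - q) := by
  have hX : (RatFunc.X : RatFunc ℚ) ≠ 0 := RatFunc.X_ne_zero
  simp only [powDiff, powSum, neg_add, neg_sub, sub_mul, mul_sub]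
  simp only [← zpow_add₀ hX, sub_eq_add_neg]
  ring_nf

theorem powDiff_mul_powSum (p q : ℤ) :
    powDiff p * powSum q = powDiff (p + q) + powDiff (p - q) := by
  have hX : (RatFunc.X : RatFunc ℚ) ≠ 0 := RatFunc.X_ne_zero
  simp only [powDiff, powSum, neg_add, neg_sub, sub_mul, mul_add]
  simp only [← zpow_add₀ hX, sub_eq_add_neg]
  ring_nf

/-- This refines the identity x(y+z) + y(z-x) + z(-x-y) = 0: each product is a difference of two
sums of powers, and the six terms cancel in pairs. -/
theorem powDiff_relation (x y z : ℤ) :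
    powDiff x * powDiff (y + z) + powDiff y * powDiff (z - x) + powDiff z * powDiff (-x - y) = 0 := by
  simp only [powDiff_mul]
  have h1 : powSum (x - (y + z)) = powSum (y + (z - x)) := by
    rw [← powSum_neg]; congr 1; ring
  have h2 : powSum (z + (-x - y)) = powSum (y - (z - x)) := by
    rw [← powSum_neg]; congr 1; ring
  have h3 : powSum (z - (-x - y)) = powSum (x + (y + z)) := by congr 1; ring
  rw [h1, h2, h3]; ring

theorem powDiff_powSum_relation (x y z : ℤ) :
    powDiff (-x - y) * powSum z + powDiff (x - z) * powSum y + powDiff (y + z) * powSum x = 0 := by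
  simp only [powDiff_mul_powSum]
  have h1 : powDiff (-x - y + z) = - powDiff (x - z + y) := by
    rw [← powDiff_neg]; congr 1; ring
  have h2 : powDiff (-x - y - z) = - powDiff (y + z + x) := by
    rw [← powDiff_neg]; congr 1; ring
  have h3 : powDiff (x - z - y) = - powDiff (y + z - x) := by
    rw [← powDiff_neg]; congr 1; ring
  rw [h1, h2, h3]; ring

/-- The functionals on the plane that vanish on a nonzero vector form a line, and the determinant
with this vector spans it. -/
theorem eq_mul_det {ψ : ℝ × ℝ →ₗ[ℝ] ℝ} {a : ℤ × ℤ} (ha : a ≠ 0) (h : ψ (realVec a) = 0) :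
    ∃ c : ℝ, ∀ b : ℤ × ℤ, ψ (realVec b) = c * det₂ a b := by
  have hψ : ∀ v : ℝ × ℝ, ψ v = v.1 * ψ (1, 0) + v.2 * ψ (0, 1) := by
    intro v
    have : v = v.1 • ((1 : ℝ), (0 : ℝ)) + v.2 • ((0 : ℝ), (1 : ℝ)) := by ext <;> simp
    conv_lhs => rw [this]
    rw [map_add, map_smul, map_smul, smul_eq_mul, smul_eq_mul]
  rw [hψ] at h
  simp only [realVec] at h
  by_cases h1 : a.1 = 0
  · have h2 : a.2 ≠ 0 := fun h2 => ha (Prod.ext h1 h2)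
    have h2' : (a.2 : ℝ) ≠ 0 := by exact_mod_cast h2
    refine ⟨- ψ (1, 0) / a.2, fun b => ?_⟩
    rw [hψ]
    simp only [realVec, det₂, h1]
    have h0 : ψ (0, 1) = 0 := by simpa [h1, h2'] using h
    push_cast
    rw [h0]; field_simp; ring
  · have h1' : (a.1 : ℝ) ≠ 0 := by exact_mod_cast h1
    refine ⟨ψ (0, 1) / a.1, fun b => ?_⟩
    rw [hψ]
    simp only [realVec, det₂]
    push_cast
    field_simp
    linear_combination (b.1 : ℝ) * h

/-- Each functional is `cᵢ det(aᵢ, ·)`. With x, y, z the determinants of `a₁`, `a₂`, `a₃`, the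
vanishing sum of the functionals makes the three arguments of `sgn` the products of x(y+z), y(z-x),
z(-x-y) with one common factor κ. These are, up to sign, the products of the Mikhalkin
multiplicities of the resolutions, so all signs combine into that of κ and `powDiff_relation`
remains. -/
theorem local_unmarked {a₀ a₁ a₂ a₃ : ℤ × ℤ} (ha : a₀ + a₁ + a₂ + a₃ = 0)
    {ψ₀ ψ₁ ψ₂ ψ₃ : ℝ × ℝ →ₗ[ℝ] ℝ} (hψ : ψ₀ + ψ₁ + ψ₂ + ψ₃ = 0) (h0 : ψ₀ (realVec a₀) = 0)
    (h1 : ψ₁ (realVec a₁) = 0) (h2 : ψ₂ (realVec a₂) = 0) (h3 : ψ₃ (realVec a₃) = 0) :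
    sgn (ψ₁ (realVec a₂) + ψ₂ (realVec a₁)) *
        (powDiff (det₂ a₁ a₂).natAbs * powDiff (det₂ a₃ a₀).natAbs) +
      sgn (ψ₁ (realVec a₃) + ψ₃ (realVec a₁)) *
        (powDiff (det₂ a₁ a₃).natAbs * powDiff (det₂ a₀ a₂).natAbs) +
      sgn (ψ₂ (realVec a₃) + ψ₃ (realVec a₂)) *
        (powDiff (det₂ a₂ a₃).natAbs * powDiff (det₂ a₁ a₀).natAbs) = 0 := by
  -- If one of the four edges is contracted, then all three products of multiplicities vanish.
  have hzero : ∀ b : ℤ × ℤ, powDiff (det₂ 0 b).natAbs = 0 ∧ powDiff (det₂ b 0).natAbs = 0 := by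
    intro b; simp [det₂, powDiff]
  by_cases e0 : a₀ = 0
  · simp only [e0, hzero, mul_zero, add_zero]
  by_cases e1 : a₁ = 0
  · simp only [e1, hzero, mul_zero, zero_mul, add_zero]
  by_cases e2 : a₂ = 0
  · simp only [e2, hzero, mul_zero, zero_mul, add_zero]
  by_cases e3 : a₃ = 0
  · simp only [e3, hzero, mul_zero, zero_mul, add_zero]
  obtain ⟨c₀, k0⟩ := eq_mul_det e0 h0
  obtain ⟨c₁, k1⟩ := eq_mul_det e1 h1
  obtain ⟨c₂, k2⟩ := eq_mul_det e2 h2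
  obtain ⟨c₃, k3⟩ := eq_mul_det e3 h3
  set x := det₂ a₁ a₂ with hx
  set y := det₂ a₁ a₃ with hy
  set z := det₂ a₂ a₃ with hz
  have ha0 : a₀ = -(a₁ + a₂ + a₃) := by
    rw [eq_neg_iff_add_eq_zero, ← ha]; abel
  have d30 : det₂ a₃ a₀ = y + z := by rw [ha0, hy, hz]; simp [det₂]; ring
  have d02 : det₂ a₀ a₂ = z - x := by rw [ha0, hx, hz]; simp [det₂]; ring
  have d10 : det₂ a₁ a₀ = -x - y := by rw [ha0, hx, hy]; simp [det₂]; ring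
  have d21 : det₂ a₂ a₁ = -x := by rw [hx]; simp [det₂]; ring
  have d31 : det₂ a₃ a₁ = -y := by rw [hy]; simp [det₂]; ring
  have d32 : det₂ a₃ a₂ = -z := by rw [hz]; simp [det₂]; ring
  have hsum : ∀ b : ℤ × ℤ, c₀ * det₂ a₀ b + c₁ * det₂ a₁ b + c₂ * det₂ a₂ b + c₃ * det₂ a₃ b = 0 := by
    intro b
    have := LinearMap.congr_fun hψ (realVec b)
    simpa [k0, k1, k2, k3] using this
  have s1 := hsum a₁
  have s2 := hsum a₂
  have s3 := hsum a₃
  have t0 : det₂ a₀ a₁ = x + y := by rw [ha0, hx, hy]; simp [det₂]; ring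
  have t3 : det₂ a₀ a₃ = -y - z := by rw [ha0, hz, hy]; simp [det₂]; ring
  have tt : ∀ a : ℤ × ℤ, det₂ a a = 0 := by intro a; simp [det₂]; ring
  rw [t0, tt, d21, d31] at s1
  rw [d02, ← hx, tt, d32] at s2
  rw [t3, ← hy, ← hz, tt] at s3
  push_cast at s1 s2 s3
  -- κ is the common value of `(c₁ - c₀)/z`, `-(c₂ - c₀)/y` and `(c₃ - c₀)/x`. It is read off from a
  -- nonzero determinant if there is one, and otherwise its value is irrelevant.
  obtain ⟨κ, hκ1, hκ2, hκ3⟩ : ∃ κ : ℝ, (c₁ - c₂) * x = κ * (x * (y + z)) ∧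
      (c₁ - c₃) * y = κ * (y * (z - x)) ∧ (c₂ - c₃) * z = κ * (z * (-x - y)) := by
    have main : ∀ κ : ℝ, c₁ - c₀ = κ * z → c₂ - c₀ = -(κ * y) → c₃ - c₀ = κ * x →
        (c₁ - c₂) * x = κ * (x * (y + z)) ∧
        (c₁ - c₃) * y = κ * (y * (z - x)) ∧ (c₂ - c₃) * z = κ * (z * (-x - y)) := by
      intro κ h1 h2 h3
      refine ⟨?_, ?_, ?_⟩
      · linear_combination (x : ℝ) * (h1 - h2)
      · linear_combination (y : ℝ) * (h1 - h3)
      · linear_combination (z : ℝ) * (h2 - h3)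
    by_cases hz0 : (z : ℝ) = 0
    · by_cases hy0 : (y : ℝ) = 0
      · by_cases hx0 : (x : ℝ) = 0
        · exact ⟨0, by simp [hx0], by simp [hy0], by simp [hz0]⟩
        · have hκ : (c₃ - c₀) / x * x = c₃ - c₀ := div_mul_cancel₀ _ hx0
          refine ⟨(c₃ - c₀) / x, main _ ?_ ?_ hκ.symm⟩
          · apply mul_right_cancel₀ hx0
            linear_combination s2 - (z : ℝ) * hκ
          · apply mul_right_cancel₀ hx0
            linear_combination -s1 + (y : ℝ) * hκ
      · have hκ : -(c₂ - c₀) / y * y = -(c₂ - c₀) := div_mul_cancel₀ _ hy0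
        refine ⟨-(c₂ - c₀) / y, main _ ?_ ?_ ?_⟩
        · apply mul_right_cancel₀ hy0
          linear_combination s3 - (z : ℝ) * hκ
        · linear_combination hκ
        · apply mul_right_cancel₀ hy0
          linear_combination -s1 - (x : ℝ) * hκ
    · have hκ : (c₁ - c₀) / z * z = c₁ - c₀ := div_mul_cancel₀ _ hz0
      refine ⟨(c₁ - c₀) / z, main _ hκ.symm ?_ ?_⟩
      · apply mul_right_cancel₀ hz0
        linear_combination s3 + (y : ℝ) * hκ
      · apply mul_right_cancel₀ hz0
        linear_combination -s2 - (x : ℝ) * hκ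
  have f12 : ψ₁ (realVec a₂) + ψ₂ (realVec a₁) = κ * (x * ((y + z : ℤ) : ℝ)) := by
    rw [k1, k2, ← hx, d21]; push_cast; linear_combination hκ1
  have f13 : ψ₁ (realVec a₃) + ψ₃ (realVec a₁) = κ * (y * ((z - x : ℤ) : ℝ)) := by
    rw [k1, k3, ← hy, d31]; push_cast; linear_combination hκ2
  have f23 : ψ₂ (realVec a₃) + ψ₃ (realVec a₂) = κ * (z * ((-x - y : ℤ) : ℝ)) := by
    rw [k2, k3, ← hz, d32]; push_cast; linear_combination hκ3
  rw [f12, f13, f23, d30, d02, d10]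
  simp only [sgn_mul, powDiff_natAbs]
  have key : ∀ p q : ℤ, sgn κ * (sgn p * sgn q) * (sgn p * powDiff p * (sgn q * powDiff q)) =
      sgn κ * (powDiff p * powDiff q) := by
    intro p q
    linear_combination sgn κ * (sgn p * sgn p * powDiff p) * sgn_sq_mul_powDiff q +
      sgn κ * powDiff q * sgn_sq_mul_powDiff p
  rw [key, key, key, ← mul_add, ← mul_add, powDiff_relation, mul_zero]

/-- The functional is a multiple of `det(a₄, ·)`, so each sign is the sign of the determinant that
occurs in the same term, up to a common factor. After cancelling signs, `powDiff_powSum_relation`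
remains. -/
theorem local_thick {a₁ a₂ a₃ a₄ : ℤ × ℤ} (ha : a₁ + a₂ + a₃ + a₄ = 0)
    {ψ : ℝ × ℝ →ₗ[ℝ] ℝ} (h : ψ (realVec a₄) = 0) :
    sgn (ψ (realVec a₁)) * (powDiff (det₂ a₁ a₄).natAbs * powSum (det₂ a₂ a₃).natAbs) +
      sgn (ψ (realVec a₂)) * (powDiff (det₂ a₂ a₄).natAbs * powSum (det₂ a₁ a₃).natAbs) +
      sgn (ψ (realVec a₃)) * (powDiff (det₂ a₃ a₄).natAbs * powSum (det₂ a₁ a₂).natAbs) = 0 := by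
  by_cases e4 : a₄ = 0
  · simp [e4, det₂, powDiff]
  obtain ⟨c, hc⟩ := eq_mul_det e4 h
  have ha4 : a₄ = -(a₁ + a₂ + a₃) := by
    rw [eq_neg_iff_add_eq_zero, ← ha]; abel
  have hsymm : ∀ b, det₂ a₄ b = - det₂ b a₄ := by intro b; simp [det₂]; ring
  simp only [hc, hsymm, Int.cast_neg, mul_neg, sgn_neg', sgn_mul, powDiff_natAbs, powSum_natAbs]
  have key : ∀ n : ℤ, ∀ q, -(sgn c * sgn n) * (sgn n * powDiff n * q) = - sgn c * (powDiff n * q) := by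
    intro n q
    linear_combination - sgn c * q * sgn_sq_mul_powDiff n
  rw [key, key, key, ← mul_add, ← mul_add]
  have d1 : det₂ a₁ a₄ = - det₂ a₁ a₂ - det₂ a₁ a₃ := by rw [ha4]; simp [det₂]; ring
  have d2 : det₂ a₂ a₄ = det₂ a₁ a₂ - det₂ a₂ a₃ := by rw [ha4]; simp [det₂]; ring
  have d3 : det₂ a₃ a₄ = det₂ a₁ a₃ + det₂ a₂ a₃ := by rw [ha4]; simp [det₂]; ring
  rw [d1, d2, d3, powDiff_powSum_relation, mul_zero]

end Local

/-! ## Multiplicities of explicit vertices -/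

section Vertices

variable {r s : ℕ} {E : Type} [DecidableEq E] {u : E → ℤ × ℤ}

/-- All directions at the vertex are among a, b, 0 and -(a+b), so every determinant in the supremum
is 0 or ± det(a, b). -/
theorem mikhalkinMult_eq {V : Finset (Finset (Leaf r s E))} (A B : Finset (Leaf r s E))
    (hA : A ∈ V) (hB : B ∈ V)
    (h : ∀ C ∈ V, C ≠ A → C ≠ B → dirTo u C = 0 ∨ dirTo u C = -(dirTo u A + dirTo u B)) :
    mikhalkinMult u V = (det₂ (dirTo u A) (dirTo u B)).natAbs := by
  unfold mikhalkinMult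
  apply le_antisymm
  · refine Finset.sup_le ?_
    rintro ⟨C, D⟩ hCD
    rw [Finset.mem_product] at hCD
    obtain ⟨hC, hD⟩ := hCD
    simp only at hC hD ⊢
    have hdir : ∀ C ∈ V, dirTo u C = dirTo u A ∨ dirTo u C = dirTo u B ∨ dirTo u C = 0 ∨
        dirTo u C = -(dirTo u A + dirTo u B) := by
      intro C hC
      by_cases hCA : C = A
      · simp [hCA]
      by_cases hCB : C = B
      · simp [hCB]
      exact Or.inr (Or.inr (h C hC hCA hCB))
    have key : ∀ n : ℤ, n = det₂ (dirTo u A) (dirTo u B) ∨ n = - det₂ (dirTo u A) (dirTo u B) ∨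
        n = 0 → n.natAbs ≤ (det₂ (dirTo u A) (dirTo u B)).natAbs := by
      rintro n (h | h | h) <;> simp [h]
    apply key
    rcases hdir C hC with h2 | h2 | h2 | h2 <;> rcases hdir D hD with h3 | h3 | h3 | h3 <;>
      rw [h2, h3] <;>
      simp only [det₂, Prod.fst_neg, Prod.snd_neg, Prod.fst_add, Prod.snd_add,
        Prod.fst_zero, Prod.snd_zero] <;>
      first
        | exact Or.inr (Or.inr (by ring1))
        | exact Or.inl (by ring1)
        | exact Or.inr (Or.inl (by ring1))
        | simp
  · exact Finset.le_sup (f := fun p : Finset (Leaf r s E) × Finset (Leaf r s E) =>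
      ((dirTo u p.1).1 * (dirTo u p.2).2 - (dirTo u p.1).2 * (dirTo u p.2).1).natAbs)
      (Finset.mk_mem_product hA hB)

theorem dirTo_marking (m : Fin r ⊕ Fin s) : dirTo (r := r) (s := s) u {Sum.inl m} = 0 := by
  simp [dirTo]

theorem mult_unmarked {V : Finset (Finset (Leaf r s E))} (h1 : ¬ HasThick V) (h2 : ¬ HasSimple V) :
    vertexMult u V = powDiff (mikhalkinMult u V : ℤ) / (RatFunc.X - RatFunc.X⁻¹) := by
  simp [vertexMult, h1, h2, powDiff]

theorem mult_simple {V : Finset (Finset (Leaf r s E))} (h1 : ¬ HasThick V) (h2 : HasSimple V) :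
    vertexMult u V = 1 := by
  simp [vertexMult, h1, h2]

theorem mult_thick {V : Finset (Finset (Leaf r s E))} (h1 : HasThick V) :
    vertexMult u V = powSum (mikhalkinMult u V : ℤ) / (RatFunc.X + RatFunc.X⁻¹) := by
  simp [vertexMult, h1, powSum]

end Vertices

end MetricTree

/-! ## Resolutions of a vertex at a wall -/

theorem sum_pairs_insert {α M : Type*} [DecidableEq α] [AddCommMonoid M] (f : Finset α → M) {a : α}
    {t : Finset α} (ha : a ∉ t) :
    ∑ I ∈ (insert a t).powersetCard 2, f I =
      ∑ I ∈ t.powersetCard 2, f I + ∑ b ∈ t, f {a, b} := by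
  rw [Finset.powersetCard_succ_insert ha, Finset.sum_union, Finset.powersetCard_one,
    Finset.sum_image]
  · simp
  · intro I hI J hJ h
    simp only [Finset.coe_map, Function.Embedding.coeFn_mk, Set.mem_image, SetLike.mem_coe] at hI hJ
    obtain ⟨x, hx, rfl⟩ := hI
    obtain ⟨y, hy, rfl⟩ := hJ
    have hxa : x ≠ a := by rintro rfl; exact ha hx
    have h1 : x ∈ ({a, y} : Finset α) := h ▸ (by simp : x ∈ ({a, x} : Finset α))
    simp only [Finset.mem_insert, hxa, Finset.mem_singleton, false_or] at h1
    rw [h1]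
  · rw [Finset.disjoint_left]
    intro I hI hI'
    obtain ⟨J, -, rfl⟩ := Finset.mem_image.1 hI'
    exact ha ((Finset.mem_powersetCard.1 hI).1 (Finset.mem_insert_self a J))

theorem sum_pairs_three {α M : Type*} [DecidableEq α] [AddCommMonoid M] (f : Finset α → M)
    {a b c : α} (hab : a ≠ b) (hac : a ≠ c) (hbc : b ≠ c) :
    ∑ I ∈ ({a, b, c} : Finset α).powersetCard 2, f I = f {b, c} + (f {a, b} + f {a, c}) := by
  rw [sum_pairs_insert f (by simp [hab, hac]), sum_pairs_insert f (by simp [hbc]),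
    Finset.sum_pair hbc, Finset.sum_singleton, Finset.powersetCard_eq_empty.2 (by simp)]
  simp

namespace MetricTree

/-! ### Functionals that vanish on a wall, and the motion of branches. -/

section Walls

variable {r s : ℕ} {E : Type} [Fintype E] [DecidableEq E] {u : E → ℤ × ℤ}
  {σ : Finset (Finset (Leaf r s E))}

/-- The map that moves the markings in `S` by a given vector. -/
def moveMap (S : Finset (Leaf r s E)) : ℝ × ℝ →ₗ[ℝ] (Fin r ⊕ Fin s → ℝ × ℝ) where
  toFun w := fun j => if Sum.inl j ∈ S then w else 0
  map_add' v w := by funext j; by_cases h : Sum.inl j ∈ S <;> simp [h]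
  map_smul' c w := by funext j; by_cases h : Sum.inl j ∈ S <;> simp [h]

theorem edgeVec_eq_moveMap (S : Finset (Leaf r s E)) :
    edgeVec u S = moveMap S (realVec (dirTo u S)) := rfl

theorem dirTo_biUnion {V I : Finset (Finset (Leaf r s E))} (hV : V ∈ treeStars σ) (hI : I ⊆ V) :
    dirTo u (I.biUnion id) = ∑ B ∈ I, dirTo u B := by
  unfold dirTo
  rw [Finset.sum_biUnion]
  · rfl
  · intro A hA B hB hAB
    exact (mem_treeStars.1 hV).2.1 A (hI hA) B (hI hB) hAB

theorem star_biUnion {V : Finset (Finset (Leaf r s E))} (hV : V ∈ treeStars σ) :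
    V.biUnion id = Finset.univ := by
  ext x
  simpa using (mem_treeStars.1 hV).2.2.1 x

theorem sum_dirTo_star (hu : ∑ e, u e = 0) {V : Finset (Finset (Leaf r s E))}
    (hV : V ∈ treeStars σ) : ∑ B ∈ V, dirTo u B = 0 := by
  rw [← dirTo_biUnion hV subset_rfl, star_biUnion hV]
  have := dirTo_compl hu (∅ : Finset (Leaf r s E))
  simpa [dirTo] using this

theorem moveMap_biUnion {V I : Finset (Finset (Leaf r s E))} (hV : V ∈ treeStars σ) (hI : I ⊆ V) :
    moveMap (I.biUnion id) = ∑ B ∈ I, moveMap B := by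
  refine LinearMap.ext fun w => funext fun j => ?_
  rw [LinearMap.sum_apply, Finset.sum_apply]
  by_cases h : Sum.inl j ∈ I.biUnion id
  · obtain ⟨B, hB, hj⟩ := Finset.mem_biUnion.1 h
    rw [Finset.sum_eq_single B]
    · simp only [id] at hj
      change (if _ then w else 0) = (if _ then w else 0)
      rw [if_pos h, if_pos hj]
    · intro A hA hAB
      have : Sum.inl j ∉ A := fun hjA => hAB (star_eq_of_mem hV (hI hA) (hI hB) hjA hj)
      exact if_neg this
    · intro h'; exact absurd hB h'
  · rw [Finset.sum_eq_zero]
    · exact if_neg h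
    · intro B hB
      refine if_neg fun hj => h (Finset.mem_biUnion.2 ⟨B, hB, hj⟩)

theorem moveMap_univ (w : ℝ × ℝ) :
    moveMap (Finset.univ : Finset (Leaf r s E)) w = fun _ => w := by
  funext j; simp [moveMap]

section Functional

variable {f : (Fin r ⊕ Fin s → ℝ × ℝ) →ₗ[ℝ] ℝ}

theorem functional_edgeVec_compl (hu : ∑ e, u e = 0) (hf : evSpan u σ ≤ LinearMap.ker f)
    (S : Finset (Leaf r s E)) : f (edgeVec u Sᶜ) = f (edgeVec u S) := by
  rw [edgeVec_compl hu, map_sub, sub_eq_self]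
  exact hf (const_mem_evSpan _)

/-- Moving a branch along its own edge stays on the wall: a bounded edge changes its length, the
edge of a marking has direction zero, and an unbounded end carries no marking. -/
theorem functional_block (hf : evSpan u σ ≤ LinearMap.ker f) {V : Finset (Finset (Leaf r s E))}
    (hV : V ∈ treeStars σ) {B : Finset (Leaf r s E)} (hB : B ∈ V) :
    f (moveMap B (realVec (dirTo u B))) = 0 := by
  rcases (mem_treeStars.1 hV).1 B hB with h | h
  · exact hf (edgeVec_mem_evSpan h)
  · obtain ⟨x, rfl⟩ := Finset.card_eq_one.1 h
    rcases x with m | e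
    · rw [dirTo_marking]
      have : realVec 0 = 0 := by ext <;> simp [realVec]
      rw [this, map_zero, map_zero]
    · have : moveMap (r := r) (s := s) ({Sum.inr e} : Finset (Leaf r s E)) = 0 := by
        refine LinearMap.ext fun w => funext fun j => ?_
        simp [moveMap]
      rw [this]; simp

theorem sum_functional_star (hf : evSpan u σ ≤ LinearMap.ker f)
    {V : Finset (Finset (Leaf r s E))} (hV : V ∈ treeStars σ) :
    ∑ B ∈ V, f ∘ₗ moveMap B = 0 := by
  refine LinearMap.ext fun w => ?_
  rw [LinearMap.sum_apply]
  simp only [LinearMap.comp_apply]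
  rw [← map_sum, ← LinearMap.sum_apply, ← moveMap_biUnion hV subset_rfl, star_biUnion hV,
    moveMap_univ]
  exact hf (const_mem_evSpan w)

/-- Expand the motion of `A ∪ B` in the direction a + b bilinearly; the two terms in which a branch
moves along its own direction vanish. -/
theorem functional_pair (hf : evSpan u σ ≤ LinearMap.ker f) {V : Finset (Finset (Leaf r s E))}
    (hV : V ∈ treeStars σ) {A B : Finset (Leaf r s E)} (hA : A ∈ V) (hB : B ∈ V) (hAB : A ≠ B) :
    f (edgeVec u (Finset.biUnion {A, B} id)) =
      f (moveMap A (realVec (dirTo u B))) + f (moveMap B (realVec (dirTo u A))) := by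
  have hI : ({A, B} : Finset (Finset (Leaf r s E))) ⊆ V := by
    intro C hC
    rcases Finset.mem_insert.1 hC with rfl | hC
    · exact hA
    · rw [Finset.mem_singleton] at hC; exact hC ▸ hB
  have hr : ∀ a b : ℤ × ℤ, realVec (a + b) = realVec a + realVec b := by
    intro a b; ext <;> simp [realVec]
  rw [edgeVec_eq_moveMap, dirTo_biUnion hV hI, moveMap_biUnion hV hI, Finset.sum_pair hAB,
    Finset.sum_pair hAB, hr, LinearMap.add_apply, map_add, map_add, map_add, map_add, map_add,
    functional_block hf hV hA, functional_block hf hV hB]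
  ring

/-- At a vertex with a marking, at most one of the branches is not movable. -/
theorem functional_branch (hu : ∑ e, u e = 0) (hσ : IsSplitSystem σ)
    (hf : evSpan u σ = LinearMap.ker f) {V : Finset (Finset (Leaf r s E))} (hV : V ∈ treeStars σ)
    {m : Fin r ⊕ Fin s} (hm : {Sum.inl m} ∈ V) {A B : Finset (Leaf r s E)} (hA : A ∈ V)
    (hB : B ∈ V) (hAB : A ≠ B) (hAm : A ≠ {Sum.inl m}) (hBm : B ≠ {Sum.inl m}) :
    f ∘ₗ moveMap A = 0 ∨ f ∘ₗ moveMap B = 0 := by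
  by_contra hcon
  push Not at hcon
  obtain ⟨h1, h2⟩ := hcon
  obtain ⟨w, hw⟩ : ∃ w, f (moveMap A w) ≠ 0 := by
    by_contra h; push Not at h; exact h1 (LinearMap.ext h)
  obtain ⟨w', hw'⟩ : ∃ w, f (moveMap B w) ≠ 0 := by
    by_contra h; push Not at h; exact h2 (LinearMap.ext h)
  set c := f (moveMap A w) / f (moveMap B w') with hc
  -- If both branches were detected by `f`, a suitable simultaneous motion of both would lie in the
  -- kernel of `f`, that is, on the wall.
  have hmem : moveMap A w - c • moveMap B w' ∈ evSpan u σ := by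
    rw [hf, LinearMap.mem_ker, map_sub, map_smul, hc, smul_eq_mul, div_mul_cancel₀ _ hw', sub_self]
  rw [← range_evMap hu hσ (Sum.inl m)] at hmem
  obtain ⟨p, hp⟩ := hmem
  rw [evMap_apply] at hp
  have hmA : Sum.inl m ∉ A := fun h => hAm (star_eq_of_mem hV hA hm h (by simp))
  have hmB : Sum.inl m ∉ B := fun h => hBm (star_eq_of_mem hV hB hm h (by simp))
  have hE0 : ∀ S : rooted σ (Sum.inl m), edgeVec u S.1 m = 0 := fun S =>
    if_neg (mem_rooted.1 S.2).2
  have hp1 : p.1 = 0 := by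
    have := congrFun hp m
    simpa [hE0, moveMap, hmA, hmB] using this
  -- The marking `m` fixes the translation, so a motion on the wall decomposes branch by branch. The
  -- part in `A` comes from edges inside `A` alone, and these are killed by `f`.
  have key : moveMap A w = ∑ S : rooted σ (Sum.inl m), (if S.1 ⊆ A then p.2 S else 0) •
      edgeVec u S.1 := by
    funext j
    have hj := congrFun hp j
    simp only [hp1, Pi.add_apply, zero_add, Finset.sum_apply, Pi.smul_apply,
      Pi.sub_apply] at hj ⊢
    by_cases hjA : Sum.inl j ∈ A
    · have hjB : Sum.inl j ∉ B := fun h => hAB (star_eq_of_mem hV hA hB hjA h)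
      have e2 : moveMap B w' j = 0 := if_neg hjB
      rw [e2, smul_zero, sub_zero] at hj
      rw [← hj]
      refine Finset.sum_congr rfl fun S _ => ?_
      by_cases hSA : S.1 ⊆ A
      · simp [hSA]
      · have : edgeVec u S.1 j = 0 := by
          refine if_neg fun hjS => hSA ?_
          obtain ⟨C, hC, h | h⟩ := hσ.exists_block hV (mem_rooted.1 S.2).1
          · rwa [star_eq_of_mem hV hA hC hjA (h hjS)]
          · exfalso
            have hmC := h (Finset.mem_compl.2 (mem_rooted.1 S.2).2)
            have := star_eq_of_mem hV hC hm hmC (by simp)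
            subst this
            have h3 := Finset.card_le_card h
            have h4 := hσ.two_le_card _ (hσ.compl_mem _ (mem_rooted.1 S.2).1)
            rw [Finset.card_singleton] at h3; omega
        simp [this]
    · have e1 : moveMap A w j = 0 := if_neg hjA
      rw [e1, Finset.sum_eq_zero]
      intro S _
      by_cases hSA : S.1 ⊆ A
      · have : edgeVec u S.1 j = 0 := if_neg fun h => hjA (hSA h)
        rw [this, smul_zero]
      · simp [hSA]
  apply hw
  rw [key, map_sum]
  refine Finset.sum_eq_zero fun S _ => ?_
  rw [map_smul]
  have : f (edgeVec u S.1) = 0 := by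
    have := edgeVec_mem_evSpan (u := u) (mem_rooted.1 S.2).1
    rwa [hf, LinearMap.mem_ker] at this
  rw [this, smul_zero]

end Functional

/-- No block in `V` is a marking. -/
def NoMarking (V : Finset (Finset (Leaf r s E))) : Prop := ∀ m, {Sum.inl m} ∉ V

theorem NoMarking.not_thick {V : Finset (Finset (Leaf r s E))} (h : NoMarking V) : ¬ HasThick V :=
  fun ⟨_, hk⟩ => h _ hk

theorem NoMarking.not_simple {V : Finset (Finset (Leaf r s E))} (h : NoMarking V) : ¬ HasSimple V :=
  fun ⟨_, hk⟩ => h _ hk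

theorem mult_trivalent {A B C : Finset (Leaf r s E)} (h : NoMarking {C, A, B})
    (hd : dirTo u C = -(dirTo u A + dirTo u B)) :
    vertexMult u {C, A, B} =
      powDiff (det₂ (dirTo u A) (dirTo u B)).natAbs / (RatFunc.X - RatFunc.X⁻¹) := by
  rw [mult_unmarked h.not_thick h.not_simple, mikhalkinMult_eq A B (by simp) (by simp)]
  intro D hD hDA hDB
  simp only [Finset.mem_insert, Finset.mem_singleton, hDA, hDB, or_false] at hD
  rw [hD]
  exact Or.inr hd

theorem mult_thick_four {A B C : Finset (Leaf r s E)} {k : Fin s}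
    (hd : dirTo u C = -(dirTo u A + dirTo u B)) :
    vertexMult u {C, {Sum.inl (Sum.inr k)}, A, B} =
      powSum (det₂ (dirTo u A) (dirTo u B)).natAbs / (RatFunc.X + RatFunc.X⁻¹) := by
  rw [mult_thick ⟨k, by simp⟩, mikhalkinMult_eq A B (by simp) (by simp)]
  intro D hD hDA hDB
  simp only [Finset.mem_insert, Finset.mem_singleton, hDA, hDB, or_false] at hD
  rcases hD with rfl | rfl
  · exact Or.inr hd
  · exact Or.inl (dirTo_marking _)

end Walls

end MetricTree

/-! ### Finite sets with few named elements. -/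

section FinsetAux

variable {α : Type*} [DecidableEq α] {a b c d e : α}

theorem distinct_of_card_four (h : ({a, b, c, d} : Finset α).card = 4) :
    a ≠ b ∧ a ≠ c ∧ a ≠ d ∧ b ≠ c ∧ b ≠ d ∧ c ≠ d := by
  refine ⟨?_, ?_, ?_, ?_, ?_, ?_⟩ <;>
  · rintro rfl
    grind [Finset.card_le_three]

theorem sdiff_pair_four (hac : a ≠ c) (had : a ≠ d) (hbc : b ≠ c) (hbd : b ≠ d) :
    ({a, b, c, d} : Finset α) \ {a, b} = {c, d} := by
  grind

theorem sdiff_pair_five (hab : a ≠ b) (hac : a ≠ c) (hbd : b ≠ d) (hbe : b ≠ e) (hcd : c ≠ d)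
    (hce : c ≠ e) : ({a, b, c, d, e} : Finset α) \ {b, c} = {a, d, e} := by
  grind

theorem four_perm₁ : ({a, b, c, d} : Finset α) = {c, d, b, a} := by grind

theorem four_perm₂ : ({a, b, c, d} : Finset α) = {b, c, d, a} := by grind

theorem four_perm₃ : ({a, b, c, d} : Finset α) = {b, d, a, c} := by grind

theorem three_perm₁ : ({a, b, c} : Finset α) = {b, a, c} := by grind

theorem three_perm₂ : ({a, b, c} : Finset α) = {c, a, b} := by grind

end FinsetAux

namespace MetricTree

/-! ### Cancellation among the resolutions of one vertex. -/

section WallSum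

variable {r s : ℕ} {E : Type} [Fintype E] [DecidableEq E] {u : E → ℤ × ℤ}
  {σ : Finset (Finset (Leaf r s E))}

theorem marking_ne_biUnion (hσ : IsSplitSystem σ) {V I : Finset (Finset (Leaf r s E))}
    (hV : V ∈ treeStars σ) (hI : I ⊆ V) (h2 : 2 ≤ I.card) (x : Leaf r s E) :
    {x} ≠ I.biUnion id := by
  intro h
  have := hσ.two_le_card_biUnion hV hI h2
  rw [← h, Finset.card_singleton] at this
  omega

theorem marking_ne_compl_biUnion (hσ : IsSplitSystem σ) {V I : Finset (Finset (Leaf r s E))}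
    (hV : V ∈ treeStars σ) (hI : I ⊆ V) (h2 : 2 ≤ (V \ I).card) (x : Leaf r s E) :
    {x} ≠ (I.biUnion id)ᶜ := by
  rw [IsSplitSystem.compl_biUnion hV hI]
  exact marking_ne_biUnion hσ hV Finset.sdiff_subset h2 x

/-- The contribution of a resolution of a vertex to the change of the count at a wall. -/
noncomputable def wallTerm (u : E → ℤ × ℤ) (f : (Fin r ⊕ Fin s → ℝ × ℝ) →ₗ[ℝ] ℝ)
    (V I : Finset (Finset (Leaf r s E))) : RatFunc ℚ :=
  sgn (f (edgeVec u (I.biUnion id))) *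
    (vertexMult u (insert (I.biUnion id)ᶜ I) * vertexMult u (insert (I.biUnion id) (V \ I)))

variable {f : (Fin r ⊕ Fin s → ℝ × ℝ) →ₗ[ℝ] ℝ} {V : Finset (Finset (Leaf r s E))}

theorem pair_subset {A B : Finset (Leaf r s E)} (hA : A ∈ V) (hB : B ∈ V) :
    ({A, B} : Finset (Finset (Leaf r s E))) ⊆ V := by
  intro C hC
  rcases Finset.mem_insert.1 hC with rfl | hC
  · exact hA
  · rw [Finset.mem_singleton] at hC; exact hC ▸ hB

theorem mult_pair_branch (hu : ∑ e, u e = 0) (hσ : IsSplitSystem σ) (hV : V ∈ treeStars σ)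
    {A B : Finset (Leaf r s E)} (hA : A ∈ V) (hB : B ∈ V) (hAB : A ≠ B) (h4 : 4 ≤ V.card)
    (hmA : ∀ m, A ≠ {Sum.inl m}) (hmB : ∀ m, B ≠ {Sum.inl m}) :
    vertexMult u (insert (Finset.biUnion {A, B} id)ᶜ {A, B}) =
      powDiff (det₂ (dirTo u A) (dirTo u B)).natAbs / (RatFunc.X - RatFunc.X⁻¹) := by
  have hI := pair_subset hA hB
  have hc : 2 ≤ (V \ {A, B}).card := by
    rw [Finset.card_sdiff_of_subset hI, Finset.card_pair hAB]; omega
  refine mult_trivalent ?_ ?_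
  · intro m hm
    rw [Finset.mem_insert, Finset.mem_insert, Finset.mem_singleton] at hm
    rcases hm with h | h | h
    · exact marking_ne_compl_biUnion hσ hV hI hc _ h
    · exact hmA m h.symm
    · exact hmB m h.symm
  · rw [dirTo_compl hu, dirTo_biUnion hV hI, Finset.sum_pair hAB]

theorem wallTerm_unmarked (hu : ∑ e, u e = 0) (hσ : IsSplitSystem σ)
    (hf : evSpan u σ ≤ LinearMap.ker f) (hV : V ∈ treeStars σ) {A B C D : Finset (Leaf r s E)}
    (hV' : V = {A, B, C, D}) (h4 : V.card = 4) (hm : NoMarking V) :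
    wallTerm u f V {A, B} =
      sgn (f (moveMap A (realVec (dirTo u B))) + f (moveMap B (realVec (dirTo u A)))) *
        (powDiff (det₂ (dirTo u A) (dirTo u B)).natAbs *
          powDiff (det₂ (dirTo u C) (dirTo u D)).natAbs) /
            ((RatFunc.X - RatFunc.X⁻¹) * (RatFunc.X - RatFunc.X⁻¹)) := by
  have hA : A ∈ V := by simp [hV']
  have hB : B ∈ V := by simp [hV']
  have hC : C ∈ V := by simp [hV']
  have hD : D ∈ V := by simp [hV']
  obtain ⟨hAB, hAC, hAD, hBC, hBD, hCD⟩ := distinct_of_card_four (hV' ▸ h4)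
  have hI := pair_subset hA hB
  have hsd : V \ {A, B} = {C, D} := hV' ▸ sdiff_pair_four hAC hAD hBC hBD
  have hmv : ∀ T ∈ V, ∀ m, T ≠ {Sum.inl m} := fun T hT m h => hm m (h ▸ hT)
  have e2 : vertexMult u (insert (Finset.biUnion {A, B} id) (V \ {A, B})) =
      powDiff (det₂ (dirTo u C) (dirTo u D)).natAbs / (RatFunc.X - RatFunc.X⁻¹) := by
    have := mult_pair_branch (u := u) hu hσ hV hC hD hCD h4.ge (hmv C hC) (hmv D hD)
    rwa [← hsd, ← IsSplitSystem.compl_biUnion hV hI, compl_compl] at this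
  rw [wallTerm, functional_pair hf hV hA hB hAB, e2,
    mult_pair_branch hu hσ hV hA hB hAB h4.ge (hmv A hA) (hmv B hB), mul_div_assoc]
  congr 1
  rw [div_mul_div_comm]

/-- The pairs that avoid the fixed branch `B` represent each of the three splittings of four
branches into two pairs exactly once. Their sum is the identity `local_unmarked`. -/
theorem wallSum_unmarked (hu : ∑ e, u e = 0) (hσ : IsSplitSystem σ)
    (hf : evSpan u σ ≤ LinearMap.ker f) (hV : V ∈ treeStars σ) (h4 : V.card = 4)
    (hm : NoMarking V) {B : Finset (Leaf r s E)} (hB : B ∈ V) :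
    ∑ I ∈ (V.erase B).powersetCard 2, wallTerm u f V I = 0 := by
  obtain ⟨B₁, B₂, B₃, h12, h13, h23, hU⟩ := Finset.card_eq_three.1
    (show (V.erase B).card = 3 by rw [Finset.card_erase_of_mem hB, h4])
  have hVi : V = {B, B₁, B₂, B₃} := by rw [← hU, Finset.insert_erase hB]
  have hd := sum_dirTo_star hu hV
  have hψ := sum_functional_star hf hV
  have hB' : B ∉ ({B₁, B₂, B₃} : Finset (Finset (Leaf r s E))) := by
    rw [← hU]; exact Finset.notMem_erase _ _
  have hz := fun T hT => functional_block (u := u) hf hV (B := T) hT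
  have key : ∀ g : Finset (Leaf r s E) → ℤ × ℤ, ∑ T ∈ V, g T = g B + g B₁ + g B₂ + g B₃ := by
    intro g
    rw [hVi, Finset.sum_insert hB', Finset.sum_insert (by simp [h12, h13]), Finset.sum_pair h23]
    simp only [add_assoc]
  have key' : ∀ g : Finset (Leaf r s E) → (ℝ × ℝ →ₗ[ℝ] ℝ),
      ∑ T ∈ V, g T = g B + g B₁ + g B₂ + g B₃ := by
    intro g
    rw [hVi, Finset.sum_insert hB', Finset.sum_insert (by simp [h12, h13]), Finset.sum_pair h23]
    simp only [add_assoc]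
  rw [key] at hd; rw [key'] at hψ
  have m0 : B ∈ V := hB
  have m1 : B₁ ∈ V := by rw [hVi]; simp
  have m2 : B₂ ∈ V := by rw [hVi]; simp
  have m3 : B₃ ∈ V := by rw [hVi]; simp
  have := local_unmarked hd hψ (hz _ m0) (hz _ m1) (hz _ m2) (hz _ m3)
  rw [hU, sum_pairs_three _ h12 h13 h23,
    wallTerm_unmarked hu hσ hf hV (A := B₂) (B := B₃) (C := B₁) (D := B)
      (hVi.trans four_perm₁) h4 hm,
    wallTerm_unmarked hu hσ hf hV (A := B₁) (B := B₂) (C := B₃) (D := B)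
      (hVi.trans four_perm₂) h4 hm,
    wallTerm_unmarked hu hσ hf hV (A := B₁) (B := B₃) (C := B) (D := B₂)
      (hVi.trans four_perm₃) h4 hm,
    ← add_div, ← add_div]
  simp only [LinearMap.comp_apply] at this
  rw [div_eq_zero_iff]
  left
  rw [← this]; ring

/-- At a marked vertex on a wall, there is one movable branch. -/
theorem exists_movable_branch (hu : ∑ e, u e = 0) (hσ : IsSplitSystem σ)
    (hf : evSpan u σ = LinearMap.ker f) (hV : V ∈ treeStars σ) {m : Fin r ⊕ Fin s}
    (hm : {Sum.inl m} ∈ V) :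
    ∃ B ∈ V.erase {Sum.inl m}, ∀ A ∈ (V.erase {Sum.inl m}).erase B, f ∘ₗ moveMap A = 0 := by
  by_cases h : ∃ B ∈ V.erase {Sum.inl m}, f ∘ₗ moveMap B ≠ 0
  · obtain ⟨B, hB, hBf⟩ := h
    refine ⟨B, hB, fun A hA => ?_⟩
    rw [Finset.mem_erase, Finset.mem_erase] at hA
    rw [Finset.mem_erase] at hB
    exact (functional_branch hu hσ hf hV hm hA.2.2 hB.2 hA.1 hA.2.1 hB.1).resolve_right hBf
  · push Not at h
    have : (V.erase {Sum.inl m}).Nonempty := by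
      rw [← Finset.card_pos, Finset.card_erase_of_mem hm]
      have := (mem_treeStars.1 hV).2.2.2.1
      omega
    obtain ⟨B, hB⟩ := this
    exact ⟨B, hB, fun A hA => h A (Finset.mem_of_mem_erase hA)⟩

/-- By `functional_pair`, a pair of branches on which `f` vanishes contributes sign 0; only the
pairs with the movable branch `B` remain. -/
theorem wallSum_movable (hf : evSpan u σ ≤ LinearMap.ker f) (hV : V ∈ treeStars σ)
    {D B : Finset (Leaf r s E)} (hB : B ∈ V.erase D)
    (h : ∀ A ∈ (V.erase D).erase B, f ∘ₗ moveMap A = 0) :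
    ∑ I ∈ (V.erase D).powersetCard 2, wallTerm u f V I =
      ∑ A ∈ (V.erase D).erase B, sgn (f (moveMap B (realVec (dirTo u A)))) *
        (vertexMult u (insert (Finset.biUnion {B, A} id)ᶜ {B, A}) *
          vertexMult u (insert (Finset.biUnion {B, A} id) (V \ {B, A}))) := by
  conv_lhs => rw [← Finset.insert_erase hB]
  rw [sum_pairs_insert _ (Finset.notMem_erase _ _), Finset.sum_eq_zero, zero_add]
  · refine Finset.sum_congr rfl fun A hA => ?_
    have hA0 := LinearMap.congr_fun (h A hA) (realVec (dirTo u B))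
    rw [LinearMap.comp_apply] at hA0
    rw [wallTerm, functional_pair hf hV (Finset.mem_of_mem_erase hB)
      (Finset.mem_of_mem_erase (Finset.mem_of_mem_erase hA)) (Finset.ne_of_mem_erase hA).symm,
      hA0, LinearMap.zero_apply, add_zero]
  · intro I hI
    rw [Finset.mem_powersetCard] at hI
    obtain ⟨A, C, hAC, rfl⟩ := Finset.card_eq_two.1 hI.2
    have hA := hI.1 (Finset.mem_insert_self A {C})
    have hC := hI.1 (Finset.mem_insert_of_mem (Finset.mem_singleton_self C))
    have hA0 := LinearMap.congr_fun (h A hA) (realVec (dirTo u C))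
    have hC0 := LinearMap.congr_fun (h C hC) (realVec (dirTo u A))
    rw [LinearMap.comp_apply] at hA0 hC0
    rw [wallTerm, functional_pair hf hV (Finset.mem_of_mem_erase (Finset.mem_of_mem_erase hA))
      (Finset.mem_of_mem_erase (Finset.mem_of_mem_erase hC)) hAC, hA0, hC0]
    simp [sgn_zero]

/-- Two resolutions remain, in which the movable branch `B` meets `A` or `C`; the vertex with the
marking counts 1. As the directions of `A`, `B`, `C` sum to zero, the two determinants agree up to
sign. The two values of `f` are opposite, since `f` vanishes on the motion of `B` along itself. -/
theorem wallSum_simple (hu : ∑ e, u e = 0) (hσ : IsSplitSystem σ)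
    (hf : evSpan u σ = LinearMap.ker f) (hV : V ∈ treeStars σ) (h4 : V.card = 4)
    {k : Fin r} (hk : {Sum.inl (Sum.inl k)} ∈ V)
    (hone : ∀ m, {Sum.inl m} ∈ V → m = Sum.inl k) :
    ∑ I ∈ (V.erase {Sum.inl (Sum.inl k)}).powersetCard 2, wallTerm u f V I = 0 := by
  obtain ⟨B, hB, h⟩ := exists_movable_branch hu hσ hf hV hk
  rw [wallSum_movable hf.le hV hB h]
  obtain ⟨A, C, hAC, hU⟩ := Finset.card_eq_two.1
    (show ((V.erase {Sum.inl (Sum.inl k)}).erase B).card = 2 by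
      rw [Finset.card_erase_of_mem hB, Finset.card_erase_of_mem hk, h4])
  have hd := sum_dirTo_star hu hV
  rw [← Finset.add_sum_erase _ _ hk, ← Finset.add_sum_erase _ _ hB, hU, Finset.sum_pair hAC,
    dirTo_marking, zero_add] at hd
  have hmv : ∀ T ∈ V.erase {Sum.inl (Sum.inl k)}, ∀ m, T ≠ {Sum.inl m} := by
    rintro T hT m rfl
    have h1 := hone m (Finset.mem_of_mem_erase hT)
    exact Finset.ne_of_mem_erase hT (by rw [h1])
  have hA : A ∈ (V.erase {Sum.inl (Sum.inl k)}).erase B := by rw [hU]; simp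
  have hC : C ∈ (V.erase {Sum.inl (Sum.inl k)}).erase B := by rw [hU]; simp
  have hterm : ∀ T ∈ (V.erase {Sum.inl (Sum.inl k)}).erase B,
      vertexMult u (insert (Finset.biUnion {B, T} id)ᶜ {B, T}) *
        vertexMult u (insert (Finset.biUnion {B, T} id) (V \ {B, T})) =
      powDiff (det₂ (dirTo u B) (dirTo u T)).natAbs / (RatFunc.X - RatFunc.X⁻¹) := by
    intro T hT
    have hT1 := Finset.mem_of_mem_erase hT
    have hBV := Finset.mem_of_mem_erase hB
    have hTV := Finset.mem_of_mem_erase hT1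
    have hBT := (Finset.ne_of_mem_erase hT).symm
    rw [mult_pair_branch hu hσ hV hBV hTV hBT h4.ge (hmv B hB) (hmv T hT1), mult_simple, mul_one]
    · rintro ⟨j, hj⟩
      rw [Finset.mem_insert] at hj
      rcases hj with hj | hj
      · exact marking_ne_biUnion hσ hV (pair_subset hBV hTV) (Finset.card_pair hBT).ge _ hj
      · have := hone _ (Finset.mem_sdiff.1 hj).1
        simp at this
    · refine ⟨k, Finset.mem_insert_of_mem (Finset.mem_sdiff.2 ⟨hk, ?_⟩)⟩
      rw [Finset.mem_insert, Finset.mem_singleton]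
      rintro (h | h)
      · exact hmv B hB _ h.symm
      · exact hmv T hT1 _ h.symm
  rw [hU, Finset.sum_pair hAC, hterm A hA, hterm C hC]
  have hz := functional_block (u := u) hf.le hV (Finset.mem_of_mem_erase hB)
  have hCe : dirTo u C = -(dirTo u B + dirTo u A) := by
    rw [eq_neg_iff_add_eq_zero, ← hd]; abel
  have hdet : (det₂ (dirTo u B) (dirTo u C)).natAbs = (det₂ (dirTo u B) (dirTo u A)).natAbs := by
    rw [hCe, ← Int.natAbs_neg]
    congr 1
    simp only [det₂, Prod.fst_neg, Prod.snd_neg, Prod.fst_add, Prod.snd_add]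
    ring
  have hfun : f (moveMap B (realVec (dirTo u C))) = - f (moveMap B (realVec (dirTo u A))) := by
    have : realVec (dirTo u C) = -(realVec (dirTo u B) + realVec (dirTo u A)) := by
      rw [hCe]; ext <;> simp [realVec]
    rw [this, map_neg, map_neg, map_add, map_add, hz, zero_add]
  rw [hdet, hfun, sgn_neg']
  ring

/-- The new trivalent vertex joins the movable branch `B` to one of three other branches, and the
remaining two stay with the marking. The three products of multiplicities are those of
`local_thick`, with `B` in the role of `a₄`. -/
theorem wallSum_thick (hu : ∑ e, u e = 0) (hσ : IsSplitSystem σ)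
    (hf : evSpan u σ = LinearMap.ker f) (hV : V ∈ treeStars σ) (h5 : V.card = 5)
    {k : Fin s} (hk : {Sum.inl (Sum.inr k)} ∈ V)
    (hone : ∀ m, {Sum.inl m} ∈ V → m = Sum.inr k) :
    ∑ I ∈ (V.erase {Sum.inl (Sum.inr k)}).powersetCard 2, wallTerm u f V I = 0 := by
  obtain ⟨B, hB, h⟩ := exists_movable_branch hu hσ hf hV hk
  rw [wallSum_movable hf.le hV hB h]
  have hmv : ∀ T ∈ V.erase {Sum.inl (Sum.inr k)}, ∀ m, T ≠ {Sum.inl m} := by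
    rintro T hT m rfl
    have h1 := hone m (Finset.mem_of_mem_erase hT)
    exact Finset.ne_of_mem_erase hT (by rw [h1])
  obtain ⟨A₁, A₂, A₃, h12, h13, h23, hU⟩ := Finset.card_eq_three.1
    (show ((V.erase {Sum.inl (Sum.inr k)}).erase B).card = 3 by
      rw [Finset.card_erase_of_mem hB, Finset.card_erase_of_mem hk, h5])
  have hd := sum_dirTo_star hu hV
  rw [← Finset.add_sum_erase _ _ hk, ← Finset.add_sum_erase _ _ hB, hU,
    Finset.sum_insert (by simp [h12, h13]), Finset.sum_pair h23, dirTo_marking, zero_add] at hd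
  have hz := functional_block (u := u) hf.le hV (Finset.mem_of_mem_erase hB)
  have hBV := Finset.mem_of_mem_erase hB
  have hterm : ∀ T S₁ S₂ : Finset (Leaf r s E), T ≠ S₁ → T ≠ S₂ → S₁ ≠ S₂ →
      (V.erase {Sum.inl (Sum.inr k)}).erase B = {T, S₁, S₂} →
      vertexMult u (insert (Finset.biUnion {B, T} id)ᶜ {B, T}) *
        vertexMult u (insert (Finset.biUnion {B, T} id) (V \ {B, T})) =
      powDiff (det₂ (dirTo u B) (dirTo u T)).natAbs * powSum (det₂ (dirTo u S₁) (dirTo u S₂)).natAbs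
        / ((RatFunc.X - RatFunc.X⁻¹) * (RatFunc.X + RatFunc.X⁻¹)) := by
    intro T S₁ S₂ hT1' hT2' hS hU'
    have hT : T ∈ (V.erase {Sum.inl (Sum.inr k)}).erase B := by rw [hU']; simp
    have hT1 := Finset.mem_of_mem_erase hT
    have hTV := Finset.mem_of_mem_erase hT1
    have hBT := (Finset.ne_of_mem_erase hT).symm
    have hVe : V = {{Sum.inl (Sum.inr k)}, B, T, S₁, S₂} := by
      rw [← hU', Finset.insert_erase hB, Finset.insert_erase hk]
    have hne1 := fun x => marking_ne_biUnion hσ hV (pair_subset hBV hTV) (Finset.card_pair hBT).ge x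
    have hsd : V \ {B, T} = {{Sum.inl (Sum.inr k)}, S₁, S₂} := by
      have hS1 : S₁ ∈ (V.erase {Sum.inl (Sum.inr k)}).erase B := by rw [hU']; simp
      have hS2 : S₂ ∈ (V.erase {Sum.inl (Sum.inr k)}).erase B := by rw [hU']; simp
      have b1 := Finset.ne_of_mem_erase hS1
      have b2 := Finset.ne_of_mem_erase hS2
      have k1 := hmv B hB (Sum.inr k)
      have k2 := hmv T hT1 (Sum.inr k)
      rw [hVe]
      exact sdiff_pair_five k1.symm k2.symm b1.symm b2.symm hT1' hT2'
    rw [mult_pair_branch hu hσ hV hBV hTV hBT (by omega) (hmv B hB) (hmv T hT1), hsd,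
      mult_thick_four, div_mul_div_comm]
    have hd' := sum_dirTo_star hu hV
    rw [← Finset.add_sum_erase _ _ hk, ← Finset.add_sum_erase _ _ hB, hU',
      Finset.sum_insert (by simp [hT1', hT2']), Finset.sum_pair hS, dirTo_marking, zero_add] at hd'
    rw [dirTo_biUnion hV (pair_subset hBV hTV), Finset.sum_pair hBT, eq_neg_iff_add_eq_zero, ← hd']
    abel
  rw [hU, Finset.sum_insert (by simp [h12, h13]), Finset.sum_pair h23,
    hterm A₁ A₂ A₃ h12 h13 h23 hU,
    hterm A₂ A₁ A₃ h12.symm h23 h13 (hU.trans three_perm₁),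
    hterm A₃ A₁ A₂ h13.symm h23.symm h12 (hU.trans three_perm₂)]
  have := local_thick (a₁ := dirTo u A₁) (a₂ := dirTo u A₂) (a₃ := dirTo u A₃) (a₄ := dirTo u B)
    (ψ := f ∘ₗ moveMap B) (by rw [← hd]; abel) hz
  simp only [LinearMap.comp_apply] at this
  have hdet : ∀ T : Finset (Leaf r s E), (det₂ (dirTo u B) (dirTo u T)).natAbs = (det₂ (dirTo u T) (dirTo u B)).natAbs := by
    intro T
    rw [← Int.natAbs_neg]
    congr 1
    simp only [det₂]; ring
  rw [hdet, hdet, hdet, ← mul_div_assoc, ← mul_div_assoc, ← mul_div_assoc, ← add_div, ← add_div,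
    ← add_assoc, this, zero_div]

end WallSum

/-! ### The wall-crossing formula. -/

section WallCrossing

variable {r s : ℕ} {E : Type} [Fintype E] [DecidableEq E] {u : E → ℤ × ℤ}
  {σ τ : Finset (Finset (Leaf r s E))}

/-- Unlike in `eq_of_same_star`, no positive lengths are needed. So a vertex on a wall through
distinct points has at most one marking. -/
theorem eq_of_mem_evSpan (hσ : IsSplitSystem σ) {P : Fin r ⊕ Fin s → ℝ × ℝ} (hP : P ∈ evSpan u σ)
    {V : Finset (Finset (Leaf r s E))} (hV : V ∈ treeStars σ) {i j : Fin r ⊕ Fin s}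
    (hi : {Sum.inl i} ∈ V) (hj : {Sum.inl j} ∈ V) : P i = P j := by
  refine Submodule.span_induction (p := fun Q _ => Q i = Q j) ?_ rfl ?_ ?_ hP
  · rintro Q (⟨w, rfl⟩ | ⟨S, hS, rfl⟩)
    · rfl
    · by_cases h1 : Sum.inl i ∈ S <;> by_cases h2 : Sum.inl j ∈ S
      · simp [edgeVec, h1, h2]
      · exact (not_separated hσ hV hj hi hS h2 h1).elim
      · exact (not_separated hσ hV hi hj hS h1 h2).elim
      · simp [edgeVec, h1, h2]
  · intro x y _ _ hx hy
    rw [Pi.add_apply, Pi.add_apply, hx, hy]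
  · intro c x _ hx
    rw [Pi.smul_apply, Pi.smul_apply, hx]

theorem biUnion_injOn {V I J : Finset (Finset (Leaf r s E))} (hσ : IsSplitSystem σ)
    (hV : V ∈ treeStars σ) (hI : I ⊆ V) (hJ : J ⊆ V) (h : I.biUnion id = J.biUnion id) : I = J := by
  have key : ∀ I J : Finset (Finset (Leaf r s E)), I ⊆ V → J ⊆ V → I.biUnion id = J.biUnion id →
      I ⊆ J := by
    intro I J hI hJ h B hB
    obtain ⟨x, hx⟩ := hσ.star_nonempty hV (hI hB)
    have : x ∈ J.biUnion id := h ▸ Finset.mem_biUnion.2 ⟨B, hB, hx⟩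
    obtain ⟨C, hC, hxC⟩ := Finset.mem_biUnion.1 this
    rwa [star_eq_of_mem hV (hI hB) (hJ hC) hx hxC]
  exact Finset.Subset.antisymm (key I J hI hJ h) (key J I hJ hI h.symm)

theorem typeMult_addSplit (hσ : IsSplitSystem σ) {V I : Finset (Finset (Leaf r s E))}
    (hV : V ∈ treeStars σ) (hI : I ⊆ V) (h2 : 2 ≤ I.card) (h2' : 2 ≤ (V \ I).card) :
    typeMult u (addSplit σ (I.biUnion id)) =
      vertexMult u (insert (I.biUnion id)ᶜ I) * vertexMult u (insert (I.biUnion id) (V \ I)) *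
        ∏ W ∈ (treeStars σ).erase V, vertexMult u W := by
  obtain ⟨h, h'⟩ := hσ.sum_treeStars_addSplit hV hI h2 h2'
  rw [typeMult, hσ.treeStars_addSplit hV hI h2 h2', Finset.prod_insert h', Finset.prod_insert h,
    mul_assoc]

/-- The valence is as it is for the curves through a configuration in general position. -/
def IsTopVertex (V : Finset (Finset (Leaf r s E))) : Prop :=
  (HasThick V → V.card = 4) ∧ (¬ HasThick V → V.card = 3)

/-- The shape of the vertex of a wall. -/
theorem wall_vertex (hσ : IsSplitSystem σ) {V I : Finset (Finset (Leaf r s E))}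
    (hV : V ∈ treeStars σ) (hI : I ⊆ V) (h2 : 2 ≤ I.card) (h2' : 2 ≤ (V \ I).card)
    (hone : ∀ m m', {Sum.inl m} ∈ V → {Sum.inl m'} ∈ V → m = m')
    (h : IsTop (addSplit σ (I.biUnion id))) :
    ¬ IsTopVertex V ∧ ((V.card = 4 ∧ ¬ HasThick V) ∨ (V.card = 5 ∧ HasThick V)) := by
  have hst := hσ.treeStars_addSplit hV hI h2 h2'
  have t1 := h.2 _ (by rw [hst]; exact Finset.mem_insert_self _ _)
  have t2 := h.2 _ (by rw [hst]; exact Finset.mem_insert_of_mem (Finset.mem_insert_self _ _))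
  have n1 := marking_ne_compl_biUnion hσ hV hI h2'
  have n2 := marking_ne_biUnion hσ hV hI h2
  have c1 : (insert (I.biUnion id)ᶜ I).card = I.card + 1 := by
    apply Finset.card_insert_of_notMem
    intro hmem
    exact hσ.not_compl_subset_block hV hI h2' (hI hmem) subset_rfl
  have c2 : (insert (I.biUnion id) (V \ I)).card = (V \ I).card + 1 := by
    apply Finset.card_insert_of_notMem
    intro hmem
    exact hσ.not_subset_block hV hI h2 (Finset.mem_sdiff.1 hmem).1 subset_rfl
  rw [c1] at t1; rw [c2] at t2
  have hc : (V \ I).card + I.card = V.card := by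
    rw [Finset.card_sdiff_of_subset hI]; have := Finset.card_le_card hI; omega
  have th1 : HasThick (insert (I.biUnion id)ᶜ I) ↔ HasThick I := by
    unfold HasThick
    refine exists_congr fun k => ?_
    rw [Finset.mem_insert]
    exact or_iff_right (n1 _)
  have th2 : HasThick (insert (I.biUnion id) (V \ I)) ↔ HasThick (V \ I) := by
    unfold HasThick
    refine exists_congr fun k => ?_
    rw [Finset.mem_insert]
    exact or_iff_right (n2 _)
  have th : HasThick V ↔ HasThick I ∨ HasThick (V \ I) := by
    constructor
    · rintro ⟨k, hk⟩
      by_cases hkI : {Sum.inl (Sum.inr k)} ∈ I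
      · exact Or.inl ⟨k, hkI⟩
      · exact Or.inr ⟨k, Finset.mem_sdiff.2 ⟨hk, hkI⟩⟩
    · rintro (⟨k, hk⟩ | ⟨k, hk⟩)
      · exact ⟨k, hI hk⟩
      · exact ⟨k, (Finset.mem_sdiff.1 hk).1⟩
  have hnot : ¬ (HasThick I ∧ HasThick (V \ I)) := by
    rintro ⟨⟨k, hk⟩, ⟨l, hl⟩⟩
    have := hone _ _ (hI hk) (Finset.mem_sdiff.1 hl).1
    rw [← this] at hl
    exact (Finset.mem_sdiff.1 hl).2 hk
  rw [th1] at t1; rw [th2] at t2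
  have hd : (V.card = 4 ∧ ¬ HasThick V) ∨ (V.card = 5 ∧ HasThick V) := by
    rw [th]
    by_cases a : HasThick I <;> by_cases b : HasThick (V \ I)
    · exact absurd ⟨a, b⟩ hnot
    · have := t1.1 a; have := t2.2 b; right; exact ⟨by omega, Or.inl a⟩
    · have := t1.2 a; have := t2.1 b; right; exact ⟨by omega, Or.inr b⟩
    · have := t1.2 a; have := t2.2 b; left; exact ⟨by omega, by tauto⟩
  refine ⟨?_, hd⟩
  rintro ⟨h3, h4⟩
  rcases hd with ⟨hd, hd'⟩ | ⟨hd, hd'⟩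
  · have := h4 hd'; omega
  · have := h3 hd'; omega

open Classical in
/-- The wall crossing formula: the signed contributions of the resolutions of a wall cancel. -/
theorem wall_sum_rooted (hu : ∑ e, u e = 0) (hσ : IsSplitSystem σ)
    {f : (Fin r ⊕ Fin s → ℝ × ℝ) →ₗ[ℝ] ℝ} (hf : evSpan u σ = LinearMap.ker f)
    {P : Fin r ⊕ Fin s → ℝ × ℝ} (hP : Function.Injective P) (hPσ : P ∈ evSpan u σ)
    {S₀ : Finset (Leaf r s E)} (hS₀ : S₀ ∉ σ) (htop : IsTop (addSplit σ S₀)) :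
    ∃ ρ : Leaf r s E, ∑ S ∈ Finset.univ.filter
      (fun S => ρ ∉ S ∧ S ∉ σ ∧ IsTop (addSplit σ S)),
        sgn (f (edgeVec u S)) * typeMult u (addSplit σ S) = 0 := by
  obtain ⟨V, hV, I₀, hI₀, h2, h2', rfl⟩ := hσ.exists_split_star htop.1 hS₀
  have hone : ∀ m m', {Sum.inl m} ∈ V → {Sum.inl m'} ∈ V → m = m' := fun m m' h h' =>
    hP (eq_of_mem_evSpan hσ hPσ hV h h')
  obtain ⟨hnt, hcard⟩ := wall_vertex hσ hV hI₀ h2 h2' hone htop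
  have hothers : ∀ W ∈ (treeStars σ).erase V, IsTopVertex W := by
    intro W hW
    refine htop.2 W ?_
    rw [hσ.treeStars_addSplit hV hI₀ h2 h2']
    exact Finset.mem_insert_of_mem (Finset.mem_insert_of_mem hW)
  obtain ⟨B, hB, hsum, hBm⟩ : ∃ B ∈ V,
      ∑ I ∈ (V.erase B).powersetCard 2, wallTerm u f V I = 0 ∧
      ((V.card = 4 ∧ ¬ HasThick V) ∨ (V.card = 5 ∧ ∃ k, B = {Sum.inl (Sum.inr k)})) := by
    rcases hcard with ⟨h4, hth⟩ | ⟨h5, hth⟩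
    · by_cases hm : NoMarking V
      · obtain ⟨B, hB⟩ := Finset.card_pos.1 (show 0 < V.card by omega)
        exact ⟨B, hB, wallSum_unmarked hu hσ hf.le hV h4 hm hB, Or.inl ⟨h4, hth⟩⟩
      · unfold NoMarking at hm
        push Not at hm
        obtain ⟨m, hm⟩ := hm
        rcases m with k | k
        · exact ⟨_, hm, wallSum_simple hu hσ hf hV h4 hm (fun m' hm' => hone _ _ hm' hm),
            Or.inl ⟨h4, hth⟩⟩
        · exact absurd ⟨k, hm⟩ hth
    · obtain ⟨k, hk⟩ := hth
      exact ⟨_, hk, wallSum_thick hu hσ hf hV h5 hk (fun m' hm' => hone _ _ hm' hk),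
        Or.inr ⟨h5, k, rfl⟩⟩
  -- A root inside `B` selects from each new edge the side that does not contain the branch `B`, so
  -- that every resolution is counted once.
  obtain ⟨ρ, hρ⟩ := hσ.star_nonempty hV hB
  refine ⟨ρ, ?_⟩
  have hsub : ∀ I ∈ (V.erase B).powersetCard 2, I ⊆ V ∧ I.card = 2 ∧ 2 ≤ (V \ I).card ∧ B ∉ I := by
    intro I hI
    obtain ⟨hI1, hI2⟩ := Finset.mem_powersetCard.1 hI
    have hIV := hI1.trans (Finset.erase_subset _ _)
    refine ⟨hIV, hI2, ?_, fun h => Finset.notMem_erase _ _ (hI1 h)⟩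
    rw [Finset.card_sdiff_of_subset hIV]
    omega
  -- A resolution of top type must split `V`, as the valence of `V` is not admissible. The part
  -- without `B` consists of two branches: for valence 4 both parts do, and for valence 5 the branch
  -- `B` is the thick marking, whose vertex must become 4-valent.
  have hindex : Finset.univ.filter (fun S => ρ ∉ S ∧ S ∉ σ ∧ IsTop (addSplit σ S)) =
      ((V.erase B).powersetCard 2).image (fun I => I.biUnion id) := by
    ext S
    simp only [Finset.mem_filter, Finset.mem_univ, true_and, Finset.mem_image]
    constructor
    · rintro ⟨hρS, hSσ, hSt⟩
      obtain ⟨V', hV', I, hI, hI2, hI2', rfl⟩ := hσ.exists_split_star hSt.1 hSσ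
      have hst := hσ.treeStars_addSplit hV' hI hI2 hI2'
      have hVV : V' = V := by
        by_contra hne
        refine hnt (hSt.2 V ?_)
        rw [hst]
        exact Finset.mem_insert_of_mem (Finset.mem_insert_of_mem
          (Finset.mem_erase.2 ⟨fun h => hne h.symm, hV⟩))
      subst hVV
      have hBI : B ∉ I := fun h => hρS (Finset.mem_biUnion.2 ⟨B, h, hρ⟩)
      refine ⟨I, Finset.mem_powersetCard.2 ⟨fun T hT => Finset.mem_erase.2
        ⟨fun h => hBI (h ▸ hT), hI hT⟩, ?_⟩, rfl⟩
      have hc : (V' \ I).card + I.card = V'.card := by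
        rw [Finset.card_sdiff_of_subset hI]; have := Finset.card_le_card hI; omega
      rcases hBm with ⟨h4, -⟩ | ⟨h5, k, rfl⟩
      · omega
      · have c2 : (insert (I.biUnion id) (V' \ I)).card = (V' \ I).card + 1 := by
          apply Finset.card_insert_of_notMem
          intro hmem
          exact hσ.not_subset_block hV hI hI2 (Finset.mem_sdiff.1 hmem).1 subset_rfl
        have := (hSt.2 (insert (I.biUnion id) (V' \ I))
          (by rw [hst]; exact Finset.mem_insert_of_mem (Finset.mem_insert_self _ _))).1
          ⟨k, Finset.mem_insert_of_mem (Finset.mem_sdiff.2 ⟨hB, hBI⟩)⟩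
        omega
    · rintro ⟨I, hI, rfl⟩
      obtain ⟨hIV, hI2, hI2', hBI⟩ := hsub I hI
      refine ⟨?_, hσ.biUnion_notMem hV hIV hI2.ge hI2', hσ.addSplit_biUnion hV hIV hI2.ge hI2', ?_⟩
      · intro h
        obtain ⟨C, hC, hρC⟩ := Finset.mem_biUnion.1 h
        rw [star_eq_of_mem hV hB (hIV hC) hρ hρC] at hBI
        exact hBI hC
      · have n1 := marking_ne_compl_biUnion hσ hV hIV hI2'
        have n2 := marking_ne_biUnion hσ hV hIV hI2.ge
        have c1 : (insert (I.biUnion id)ᶜ I).card = I.card + 1 := by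
          apply Finset.card_insert_of_notMem
          intro hmem
          exact hσ.not_compl_subset_block hV hIV hI2' (hIV hmem) subset_rfl
        have c2 : (insert (I.biUnion id) (V \ I)).card = (V \ I).card + 1 := by
          apply Finset.card_insert_of_notMem
          intro hmem
          exact hσ.not_subset_block hV hIV hI2.ge (Finset.mem_sdiff.1 hmem).1 subset_rfl
        have hc : (V \ I).card + I.card = V.card := by
          rw [Finset.card_sdiff_of_subset hIV]; have := Finset.card_le_card hIV; omega
        have nt1 : ¬ HasThick (insert (I.biUnion id)ᶜ I) := by
          rintro ⟨l, hl⟩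
          rw [Finset.mem_insert] at hl
          have hl := hl.resolve_left (n1 _)
          rcases hBm with ⟨h4, hth⟩ | ⟨h5, k, rfl⟩
          · exact hth ⟨l, hIV hl⟩
          · rw [hone _ _ (hIV hl) hB] at hl
            exact hBI hl
        intro W hW
        rw [hσ.treeStars_addSplit hV hIV hI2.ge hI2', Finset.mem_insert, Finset.mem_insert] at hW
        rcases hW with rfl | rfl | hW
        · exact ⟨fun h => absurd h nt1, fun _ => by omega⟩
        · rcases hBm with ⟨h4, hth⟩ | ⟨h5, k, rfl⟩
          · refine ⟨?_, fun _ => by omega⟩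
            rintro ⟨l, hl⟩
            rw [Finset.mem_insert] at hl
            exact absurd ⟨l, (Finset.mem_sdiff.1 (hl.resolve_left (n2 _))).1⟩ hth
          · exact ⟨fun _ => by omega, fun h => absurd
              ⟨k, Finset.mem_insert_of_mem (Finset.mem_sdiff.2 ⟨hB, hBI⟩)⟩ h⟩
        · exact hothers W hW
  rw [hindex, Finset.sum_image]
  · rw [← zero_mul (∏ W ∈ (treeStars σ).erase V, vertexMult u W), ← hsum, Finset.sum_mul]
    refine Finset.sum_congr rfl fun I hI => ?_
    obtain ⟨hIV, hI2, hI2', hBI⟩ := hsub I hI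
    rw [typeMult_addSplit hσ hV hIV hI2.ge hI2', wallTerm]
    ring
  · intro I hI J hJ h
    exact biUnion_injOn hσ hV (hsub I hI).1 (hsub J hJ).1 h

-- Complementation exchanges the sides with and without `ρ`. This makes it possible to change the
-- root.
open Classical in
theorem sum_symmetric {M : Type*} [AddCommMonoid M] {g : Finset (Leaf r s E) → M}
    (hg : ∀ S, g Sᶜ = g S) {p : Finset (Leaf r s E) → Prop} (hp : ∀ S, p Sᶜ ↔ p S)
    (ρ : Leaf r s E) :
    ∑ S ∈ Finset.univ.filter p, g S = 2 • ∑ S ∈ Finset.univ.filter (fun S => ρ ∉ S ∧ p S), g S := by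
  rw [← Finset.sum_filter_add_sum_filter_not _ (fun S => ρ ∉ S), two_nsmul, Finset.filter_filter,
    Finset.filter_filter]
  congr 1
  · refine Finset.sum_congr ?_ fun _ _ => rfl
    ext S; simp [and_comm]
  · refine Finset.sum_nbij' (fun S => Sᶜ) (fun S => Sᶜ) ?_ ?_ ?_ ?_ ?_
    · intro S; simp +contextual [hp]
    · intro S; simp +contextual [hp]
    · intro S _; simp
    · intro S _; simp
    · intro S _; exact (hg S).symm

-- The sum over all sides is twice the rooted sum for every root, so the vanishing for the special
-- root in `wall_sum_rooted` carries over, as 2 is invertible.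
open Classical in
theorem wall_sum (hu : ∑ e, u e = 0) (hσ : IsSplitSystem σ)
    {f : (Fin r ⊕ Fin s → ℝ × ℝ) →ₗ[ℝ] ℝ} (hf : evSpan u σ = LinearMap.ker f)
    {P : Fin r ⊕ Fin s → ℝ × ℝ} (hP : Function.Injective P) (hPσ : P ∈ evSpan u σ)
    (ρ : Leaf r s E) :
    ∑ S ∈ Finset.univ.filter (fun S => ρ ∉ S ∧ S ∉ σ ∧ IsTop (addSplit σ S)),
        sgn (f (edgeVec u S)) * typeMult u (addSplit σ S) = 0 := by
  by_cases h : ∃ S₀, S₀ ∉ σ ∧ IsTop (addSplit σ S₀)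
  · obtain ⟨S₀, h1, h2⟩ := h
    obtain ⟨ρ', h'⟩ := wall_sum_rooted hu hσ hf hP hPσ h1 h2
    have hg : ∀ S : Finset (Leaf r s E), sgn (f (edgeVec u Sᶜ)) * typeMult u (addSplit σ Sᶜ) =
        sgn (f (edgeVec u S)) * typeMult u (addSplit σ S) := by
      intro S
      rw [functional_edgeVec_compl hu hf.le, addSplit_compl]
    have hp : ∀ S : Finset (Leaf r s E), (Sᶜ ∉ σ ∧ IsTop (addSplit σ Sᶜ)) ↔
        (S ∉ σ ∧ IsTop (addSplit σ S)) := by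
      intro S
      rw [addSplit_compl]
      refine and_congr_left fun _ => not_congr ⟨fun h => ?_, hσ.compl_mem S⟩
      simpa using hσ.compl_mem _ h
    have e1 := sum_symmetric (g := fun S => sgn (f (edgeVec u S)) * typeMult u (addSplit σ S)) 
      (p := fun S => S ∉ σ ∧ IsTop (addSplit σ S)) hg hp ρ'
    have e2 := sum_symmetric (g := fun S => sgn (f (edgeVec u S)) * typeMult u (addSplit σ S)) 
      (p := fun S => S ∉ σ ∧ IsTop (addSplit σ S)) hg hp ρ
    have key : ∀ a b : RatFunc ℚ, 2 • a = 2 • b → a = 0 → b = 0 := by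
      intro a b h ha
      rw [ha, smul_zero] at h
      exact (smul_eq_zero_iff_right two_ne_zero).1 h.symm
    have := key _ _ (e1.symm.trans e2) (by convert h')
    convert this
  · push Not at h
    rw [Finset.filter_false_of_mem, Finset.sum_empty]
    rintro S - ⟨-, h1, h2⟩
    exact h S h1 h2

end WallCrossing

/-! ### Edge lengths as coordinates on the cells. -/

section Coordinates

variable {r s : ℕ} {E : Type} [Fintype E] [DecidableEq E] {u : E → ℤ × ℤ}
  {σ τ : Finset (Finset (Leaf r s E))}

/-- The configuration with the given translation and lengths of the edges. -/
def config (u : E → ℤ × ℤ) (σ : Finset (Finset (Leaf r s E))) (ρ : Leaf r s E) (w : ℝ × ℝ)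
    (x : Finset (Leaf r s E) → ℝ) : Fin r ⊕ Fin s → ℝ × ℝ :=
  (fun _ => w) + ∑ S ∈ rooted σ ρ, x S • edgeVec u S

theorem config_eq_evMap (ρ : Leaf r s E) (w : ℝ × ℝ) (x : Finset (Leaf r s E) → ℝ) :
    config u σ ρ w x = evMap u σ ρ (w, fun S => x S) := (evMap_apply_fun w x).symm

theorem config_add (ρ : Leaf r s E) (w w' : ℝ × ℝ) (x x' : Finset (Leaf r s E) → ℝ) (t : ℝ) :
    config u σ ρ w x + t • config u σ ρ w' x' = config u σ ρ (w + t • w') (x + t • x') := by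
  rw [config_eq_evMap, config_eq_evMap, config_eq_evMap, ← map_smul, ← map_add]
  rfl

theorem mem_evSpan_iff (hu : ∑ e, u e = 0) (hσ : IsSplitSystem σ) (ρ : Leaf r s E)
    {P : Fin r ⊕ Fin s → ℝ × ℝ} : P ∈ evSpan u σ ↔ ∃ w x, P = config u σ ρ w x := by
  rw [← range_evMap hu hσ ρ]
  constructor
  · rintro ⟨⟨w, x⟩, rfl⟩
    refine ⟨w, extendLength σ ρ x, ?_⟩
    rw [config_eq_evMap]
    congr
    funext S
    exact (extendLength_rooted x S).symm
  · rintro ⟨w, x, rfl⟩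
    exact ⟨_, (config_eq_evMap ρ w x).symm⟩

theorem config_injective (hu : ∑ e, u e = 0) (hσ : IsSplitSystem σ) (h : IsRigid u σ)
    (ρ : Leaf r s E) {w w' : ℝ × ℝ} {x x' : Finset (Leaf r s E) → ℝ}
    (heq : config u σ ρ w x = config u σ ρ w' x') : w = w' ∧ ∀ S ∈ rooted σ ρ, x S = x' S := by
  rw [config_eq_evMap, config_eq_evMap] at heq
  have := (isRigid_iff hu hσ ρ).1 h heq
  rw [Prod.mk.injEq] at this
  exact ⟨this.1, fun S hS => congrFun this.2 ⟨S, hS⟩⟩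

theorem finrank_evSpan_le (hu : ∑ e, u e = 0) (hσ : IsSplitSystem σ) (ρ : Leaf r s E) :
    2 * Module.finrank ℝ (evSpan u σ) ≤ σ.card + 4 := by
  rw [← range_evMap hu hσ ρ, ← card_rooted hσ ρ]
  have := LinearMap.finrank_range_le (evMap u σ ρ)
  rw [finrank_domain] at this
  omega

open Classical in
/-- The lengths of the edges of the curve of a given type through `P`, as long as they are allowed
to be negative. -/
noncomputable def edgeLen (u : E → ℤ × ℤ) (σ : Finset (Finset (Leaf r s E))) (ρ : Leaf r s E)
    (P : Fin r ⊕ Fin s → ℝ × ℝ) : Finset (Leaf r s E) → ℝ :=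
  if h : ∃ x w, P = config u σ ρ w x then h.choose else 0

theorem config_edgeLen (hu : ∑ e, u e = 0) (hσ : IsSplitSystem σ) (ρ : Leaf r s E)
    {P : Fin r ⊕ Fin s → ℝ × ℝ} (h : P ∈ evSpan u σ) :
    ∃ w, P = config u σ ρ w (edgeLen u σ ρ P) := by
  have h' : ∃ x w, P = config u σ ρ w x := by
    obtain ⟨w, x, h⟩ := (mem_evSpan_iff hu hσ ρ).1 h
    exact ⟨x, w, h⟩
  rw [edgeLen, dif_pos h']
  exact h'.choose_spec

theorem edgeLen_eq (hu : ∑ e, u e = 0) (hσ : IsSplitSystem σ) (hr : IsRigid u σ) (ρ : Leaf r s E)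
    {w : ℝ × ℝ} {x : Finset (Leaf r s E) → ℝ} {S : Finset (Leaf r s E)} (hS : S ∈ rooted σ ρ) :
    edgeLen u σ ρ (config u σ ρ w x) S = x S := by
  obtain ⟨w', h⟩ := config_edgeLen hu hσ ρ ((mem_evSpan_iff hu hσ ρ).2 ⟨w, x, rfl⟩)
  exact ((config_injective hu hσ hr ρ h).2 S hS).symm

/-- On a cell whose evaluation map is bijective, the lengths are linear functions of the
configuration; along a line they are affine in `t`. -/
theorem edgeLen_add (hu : ∑ e, u e = 0) (hσ : IsSplitSystem σ) (hr : IsRigid u σ)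
    (h : evSpan u σ = ⊤) (ρ : Leaf r s E) (P v : Fin r ⊕ Fin s → ℝ × ℝ) (t : ℝ)
    {S : Finset (Leaf r s E)} (hS : S ∈ rooted σ ρ) :
    edgeLen u σ ρ (P + t • v) S = edgeLen u σ ρ P S + t * edgeLen u σ ρ v S := by
  obtain ⟨w, hw⟩ := config_edgeLen hu hσ ρ (P := P) (h ▸ Submodule.mem_top)
  obtain ⟨w', hw'⟩ := config_edgeLen hu hσ ρ (P := v) (h ▸ Submodule.mem_top)
  conv_lhs => rw [hw, hw', config_add, edgeLen_eq hu hσ hr ρ hS]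
  rfl

theorem realizes_iff_edgeLen (hu : ∑ e, u e = 0) (hσ : IsTop σ) (hr : IsRigid u σ)
    (h : evSpan u σ = ⊤) (i₀ : Fin r ⊕ Fin s) (ρ : Leaf r s E) (P : Fin r ⊕ Fin s → ℝ × ℝ) :
    Realizes u P σ ↔ ∀ S ∈ rooted σ ρ, 0 < edgeLen u σ ρ P S := by
  rw [realizes_iff hu hσ.1 ρ i₀]
  constructor
  · rintro ⟨-, w, x, hx, rfl⟩ S hS
    have : evMap u σ ρ (w, x) = config u σ ρ w (extendLength σ ρ x) := by
      rw [config_eq_evMap]; congr; funext S; exact (extendLength_rooted x S).symm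
    rw [this, edgeLen_eq hu hσ.1 hr ρ hS]
    exact extendLength_pos hx hσ.1 (mem_rooted.1 hS).1
  · intro hpos
    refine ⟨fun V hV hth => ((hσ.2 V hV).1 hth).ge, ?_⟩
    obtain ⟨w, hw⟩ := config_edgeLen hu hσ.1 ρ (P := P) (h ▸ Submodule.mem_top)
    exact ⟨w, fun S => edgeLen u σ ρ P S, fun S => hpos S.1 S.2, hw.trans (config_eq_evMap ρ _ _)⟩

open Classical in
/-- The refined number of the curves through `P` whose type is rigid of maximal dimension. -/
noncomputable def topCount (u : E → ℤ × ℤ) (P : Fin r ⊕ Fin s → ℝ × ℝ) : RatFunc ℚ :=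
  ∑ τ ∈ Finset.univ.filter (fun τ : Finset (Finset (Leaf r s E)) => IsTop τ ∧ IsRigid u τ),
    if Realizes u P τ then typeMult u τ else 0

/-- The count `topCount` is a finite sum that is defined for all configurations, also on walls, and
so it can be followed along a path. -/
theorem IsGeneric.labelledCount_eq_topCount (hu : ∑ e, u e = 0) (i₀ : Fin r ⊕ Fin s)
    {P : Fin r ⊕ Fin s → ℝ × ℝ} (hP : IsGeneric u P) : labelledCount u P = topCount u P := by
  classical
  rw [hP.labelledCount_eq, topCount, ← Finset.sum_filter, Finset.filter_filter]
  refine Finset.sum_congr ?_ fun _ _ => rfl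
  ext τ
  simp only [Finset.mem_filter, Finset.mem_univ, true_and]
  exact ⟨fun h => ⟨⟨hP.isTop h, hP.isRigid hu i₀ h⟩, h⟩, fun h => h.2⟩

/-! ### Degenerations -/

theorem rooted_removeSplit {ρ : Leaf r s E} {S : Finset (Leaf r s E)} (hS : S ∈ rooted σ ρ) :
    rooted ((σ.erase S).erase Sᶜ) ρ = (rooted σ ρ).erase S := by
  ext T
  simp only [mem_rooted, Finset.mem_erase] at hS ⊢
  constructor
  · rintro ⟨⟨-, h2, h3⟩, h4⟩; exact ⟨h2, h3, h4⟩
  · rintro ⟨h2, h3, h4⟩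
    refine ⟨⟨?_, h2, h3⟩, h4⟩
    rintro rfl
    exact h4 (Finset.mem_compl.2 hS.2)

theorem rooted_addSplit (hσ : IsSplitSystem σ) {ρ : Leaf r s E} {S : Finset (Leaf r s E)}
    (hρ : ρ ∉ S) : rooted (addSplit σ S) ρ = insert S (rooted σ ρ) := by
  ext T
  simp only [mem_rooted, mem_addSplit, Finset.mem_insert]
  constructor
  · rintro ⟨rfl | rfl | h, h'⟩
    · exact Or.inl rfl
    · exact absurd (Finset.mem_compl.2 hρ) h'
    · exact Or.inr ⟨h, h'⟩
  · rintro (rfl | ⟨h, h'⟩)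
    · exact ⟨Or.inl rfl, hρ⟩
    · exact ⟨Or.inr (Or.inr h), h'⟩

theorem config_removeSplit {ρ : Leaf r s E} {S : Finset (Leaf r s E)} (hS : S ∈ rooted σ ρ)
    {w : ℝ × ℝ} {x : Finset (Leaf r s E) → ℝ} (h0 : x S = 0) :
    config u ((σ.erase S).erase Sᶜ) ρ w x = config u σ ρ w x := by
  rw [config, config, rooted_removeSplit hS, ← Finset.add_sum_erase _ _ hS, h0, zero_smul, zero_add]

/-- The valence of a vertex does not become smaller if edges are contracted. -/
theorem card_star_le (hσ : IsSplitSystem σ) (hτ : IsSplitSystem τ) (h : σ ⊆ τ)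
    {V W A : Finset _} (hV : V ∈ treeStars σ) (hW : W ∈ treeStars τ) (hAV : A ∈ V) (hAW : A ∈ W) :
    W.card ≤ V.card := by
  have key : ∀ B ∈ V, ∃ C ∈ W, B ⊆ C := by
    intro B hB
    by_cases hBA : B = A
    · exact ⟨A, hAW, hBA.subset⟩
    rcases (mem_treeStars.1 hV).1 B hB with hBσ | hB1
    · obtain ⟨C, hC, hBC | hBC⟩ := hτ.exists_block hW (h hBσ)
      · exact ⟨C, hC, hBC⟩
      · exfalso
        have hAB := star_subset_compl hV hAV hB (Ne.symm hBA)
        obtain ⟨x, hx⟩ := hτ.star_nonempty hW hAW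
        have := star_eq_of_mem hW hAW hC hx (hBC (hAB hx))
        subst this
        exact hσ.not_compl_subset hV hAV hB hBC
    · obtain ⟨x, rfl⟩ := Finset.card_eq_one.1 hB1
      obtain ⟨C, hC, hxC⟩ := (mem_treeStars.1 hW).2.2.1 x
      exact ⟨C, hC, by simpa using hxC⟩
  choose! g hg hgs using key
  refine Finset.card_le_card_of_surjOn g ?_
  intro C hC
  obtain ⟨x, hx⟩ := hτ.star_nonempty hW hC
  obtain ⟨B, hB, hxB⟩ := (mem_treeStars.1 hV).2.2.1 x
  exact ⟨B, hB, star_eq_of_mem hW (hg B hB) hC (hgs B hB hxB) hx⟩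

/-- The split system of the edges whose length is not zero. -/
theorem isSplitSystem_filter (hσ : IsSplitSystem σ) {p : Finset (Leaf r s E) → Prop}
    [DecidablePred p] (hp : ∀ S, p Sᶜ ↔ p S) : IsSplitSystem (σ.filter p) where
  compl_mem S hS := by
    rw [Finset.mem_filter] at hS ⊢
    exact ⟨hσ.compl_mem S hS.1, (hp S).2 hS.2⟩
  two_le_card S hS := hσ.two_le_card S (Finset.mem_filter.1 hS).1
  compatible S hS T hT := hσ.compatible S (Finset.mem_filter.1 hS).1 T (Finset.mem_filter.1 hT).1

/-- A configuration in general position does not lie on the boundary of the image of a cell. -/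
theorem IsGeneric.edgeLen_ne_zero (hu : ∑ e, u e = 0) (hE : Fintype.card E = r + 1 + 2 * s)
    (i₀ : Fin r ⊕ Fin s) (ρ : Leaf r s E) {P : Fin r ⊕ Fin s → ℝ × ℝ} (hP : IsGeneric u P)
    (hτ : IsTop τ) (hr : IsRigid u τ) (hpos : ∀ S ∈ rooted τ ρ, 0 ≤ edgeLen u τ ρ P S)
    {S₀ : Finset (Leaf r s E)} (hS₀ : S₀ ∈ rooted τ ρ) : edgeLen u τ ρ P S₀ ≠ 0 := by
  classical
  intro h0
  set x := edgeLen u τ ρ P with hx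
  -- The edges of nonzero length, tested on the side that does not contain `ρ`, because only there
  -- `edgeLen` is meaningful.
  set p : Finset (Leaf r s E) → Prop := fun S =>
    (ρ ∉ S → x S ≠ 0) ∧ (ρ ∈ S → x Sᶜ ≠ 0) with hp_def
  have hp : ∀ S, p Sᶜ ↔ p S := by
    intro S
    simp only [hp_def, Finset.mem_compl, not_not, compl_compl]
    tauto
  have hσ := isSplitSystem_filter hτ.1 hp
  have hroot : rooted (τ.filter p) ρ = (rooted τ ρ).filter (fun S => x S ≠ 0) := by
    ext S
    simp only [mem_rooted, Finset.mem_filter, hp_def]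
    tauto
  obtain ⟨w, hw⟩ := config_edgeLen hu hτ.1 ρ (P := P)
    ((hτ.evSpan_eq_top hr hE i₀) ▸ Submodule.mem_top)
  have hreal : Realizes u P (τ.filter p) := by
    rw [realizes_iff hu hσ ρ i₀]
    refine ⟨?_, w, fun S => x S, ?_, ?_⟩
    · rintro V hV ⟨k, hk⟩
      obtain ⟨W, hW, hkW⟩ := star_of_leaf hτ.1 (three_le_card_leaf hE i₀) (Sum.inl (Sum.inr k))
      have := card_star_le hσ hτ.1 (Finset.filter_subset _ _) hV hW hk hkW
      rwa [(hτ.2 W hW).1 ⟨k, hkW⟩] at this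
    · rintro ⟨S, hS⟩
      rw [hroot, Finset.mem_filter] at hS
      exact lt_of_le_of_ne (hpos S hS.1) (Ne.symm hS.2)
    · rw [← config_eq_evMap, hw, ← hx, config, config, hroot, Finset.sum_filter]
      congr 1
      refine Finset.sum_congr rfl fun S _ => ?_
      by_cases h : x S = 0 <;> simp [h]
  -- Contracting the edges of length zero gives a curve through the generic `P`. It is again rigid
  -- of top type, so it has as many edges as `τ`, although one was removed.
  have e1 := hτ.card_eq hr hE i₀
  have e2 := (hP.isTop hreal).card_eq (hP.isRigid hu i₀ hreal) hE i₀
  have : (τ.filter p).card < τ.card := by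
    refine Finset.card_lt_card (Finset.filter_ssubset.2 ⟨S₀, (mem_rooted.1 hS₀).1, ?_⟩)
    simp only [hp_def]
    intro h
    exact h.1 (mem_rooted.1 hS₀).2 h0
  omega

end Coordinates

/-! ### The counts on the two sides of a wall. -/

section Invariance

open Filter Topology

variable {r s : ℕ} {E : Type} [Fintype E] [DecidableEq E] {u : E → ℤ × ℤ}
  {σ τ : Finset (Finset (Leaf r s E))}

theorem eventually_pos_iff (a b : ℝ) :
    ∀ᶠ t in 𝓝[>] (0 : ℝ), (0 < a + t * b ↔ 0 < a ∨ (a = 0 ∧ 0 < b)) := by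
  have hc : Tendsto (fun t : ℝ => a + t * b) (𝓝[>] 0) (𝓝 a) := by
    have : Continuous fun t : ℝ => a + t * b := by fun_prop
    have h := this.tendsto 0
    rw [zero_mul, add_zero] at h
    exact h.mono_left nhdsWithin_le_nhds
  rcases lt_trichotomy a 0 with h | rfl | h
  · filter_upwards [hc.eventually (gt_mem_nhds h)] with t ht
    exact ⟨fun h' => absurd h' ht.not_gt, by rintro (h' | ⟨h', -⟩) <;> linarith⟩
  · filter_upwards [self_mem_nhdsWithin] with t ht
    rw [zero_add, mul_pos_iff_of_pos_left ht]
    simp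
  · filter_upwards [hc.eventually (lt_mem_nhds h)] with t ht
    exact ⟨fun _ => Or.inl h, fun _ => ht⟩

/-- The conditions on a configuration `P` on a wall and a direction `v` that crosses the wall. -/
structure Crosses (u : E → ℤ × ℤ) (P v : Fin r ⊕ Fin s → ℝ × ℝ) : Prop where
  injective : Function.Injective P
  codim : ∀ σ : Finset (Finset (Leaf r s E)), IsSplitSystem σ → P ∈ evSpan u σ →
    4 * (r + s) ≤ 2 * Module.finrank ℝ (evSpan u σ) + 2
  transversal : ∀ σ : Finset (Finset (Leaf r s E)), IsSplitSystem σ → P ∈ evSpan u σ →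
    evSpan u σ ≠ ⊤ → v ∉ evSpan u σ

open Classical in
/-- The refined number of curves through `P + t v` for small positive `t`. -/
noncomputable def sideCount (u : E → ℤ × ℤ) (ρ : Leaf r s E) (P v : Fin r ⊕ Fin s → ℝ × ℝ) :
    RatFunc ℚ :=
  ∑ τ, if (IsTop τ ∧ IsRigid u τ) ∧ ∀ S ∈ rooted τ ρ, 0 < edgeLen u τ ρ P S ∨
    (edgeLen u τ ρ P S = 0 ∧ 0 < edgeLen u τ ρ v S) then typeMult u τ else 0

/-- The lengths of each type are affine in `t`. For small positive `t` their sign is that of the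
value at 0 or, if this vanishes, that of the slope. -/
theorem eventually_topCount (hu : ∑ e, u e = 0) (hE : Fintype.card E = r + 1 + 2 * s)
    (i₀ : Fin r ⊕ Fin s) (ρ : Leaf r s E) (P v : Fin r ⊕ Fin s → ℝ × ℝ) :
    ∀ᶠ t in 𝓝[>] (0 : ℝ), topCount u (P + t • v) = sideCount u ρ P v := by
  classical
  have h : ∀ᶠ t in 𝓝[>] (0 : ℝ), ∀ τ : Finset (Finset (Leaf r s E)), ∀ S : Finset (Leaf r s E),
      (0 < edgeLen u τ ρ P S + t * edgeLen u τ ρ v S ↔ 0 < edgeLen u τ ρ P S ∨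
        (edgeLen u τ ρ P S = 0 ∧ 0 < edgeLen u τ ρ v S)) := by
    rw [eventually_all]; intro τ
    rw [eventually_all]; intro S
    exact eventually_pos_iff _ _
  filter_upwards [h] with t ht
  rw [topCount, sideCount, Finset.sum_filter]
  refine Finset.sum_congr rfl fun τ _ => ?_
  by_cases hτ : IsTop τ ∧ IsRigid u τ
  · rw [if_pos hτ]
    have htop := hτ.1.evSpan_eq_top hτ.2 hE i₀
    refine if_congr ?_ rfl rfl
    rw [realizes_iff_edgeLen hu hτ.1 hτ.2 htop i₀ ρ]
    refine ⟨fun h => ⟨hτ, fun S hS => ?_⟩, fun h S hS => ?_⟩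
    · rw [← ht τ S, ← edgeLen_add hu hτ.1.1 hτ.2 htop ρ P v t hS]
      exact h S hS
    · rw [edgeLen_add hu hτ.1.1 hτ.2 htop ρ P v t hS, ht τ S]
      exact h.2 S hS
  · rw [if_neg hτ, if_neg (fun h => hτ h.1)]

theorem edgeLen_neg (hu : ∑ e, u e = 0) (hτ : IsSplitSystem τ) (hr : IsRigid u τ)
    (htop : evSpan u τ = ⊤) (ρ : Leaf r s E) (v : Fin r ⊕ Fin s → ℝ × ℝ) {S : Finset (Leaf r s E)}
    (hS : S ∈ rooted τ ρ) : edgeLen u τ ρ (-v) S = - edgeLen u τ ρ v S := by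
  have h0 : edgeLen u τ ρ 0 S = 0 := by
    have : (0 : Fin r ⊕ Fin s → ℝ × ℝ) = config u τ ρ 0 0 := by
      rw [config_eq_evMap]
      exact (map_zero (evMap u τ ρ)).symm
    rw [this, edgeLen_eq hu hτ hr ρ hS]
    rfl
  have := edgeLen_add hu hτ hr htop ρ 0 v (-1) hS
  rw [zero_add, neg_one_smul, h0] at this
  rw [this]; ring

theorem mem_evSpan_removeSplit (hu : ∑ e, u e = 0) (hτ : IsSplitSystem τ) (htop : evSpan u τ = ⊤)
    (ρ : Leaf r s E) {P : Fin r ⊕ Fin s → ℝ × ℝ} {S : Finset (Leaf r s E)} (hS : S ∈ rooted τ ρ)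
    (h0 : edgeLen u τ ρ P S = 0) : P ∈ evSpan u ((τ.erase S).erase Sᶜ) := by
  obtain ⟨w, hw⟩ := config_edgeLen hu hτ ρ (P := P) (htop ▸ Submodule.mem_top)
  rw [mem_evSpan_iff hu hτ.removeSplit ρ]
  exact ⟨w, _, hw.trans (config_removeSplit hS h0).symm⟩

/-- Removing two edges of length zero would place `P` in a span of codimension at least two. -/
theorem Crosses.zero_unique (hu : ∑ e, u e = 0) (hE : Fintype.card E = r + 1 + 2 * s)
    (i₀ : Fin r ⊕ Fin s) (ρ : Leaf r s E) {P v : Fin r ⊕ Fin s → ℝ × ℝ} (hc : Crosses u P v)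
    (hτ : IsTop τ) (hr : IsRigid u τ) {S S' : Finset (Leaf r s E)} (hS : S ∈ rooted τ ρ)
    (hS' : S' ∈ rooted τ ρ) (h0 : edgeLen u τ ρ P S = 0) (h0' : edgeLen u τ ρ P S' = 0) :
    S = S' := by
  by_contra hne
  have htop := hτ.evSpan_eq_top hr hE i₀
  obtain ⟨w, hw⟩ := config_edgeLen hu hτ.1 ρ (P := P) (htop ▸ Submodule.mem_top)
  have hS2 : S' ∈ rooted ((τ.erase S).erase Sᶜ) ρ := by
    rw [rooted_removeSplit hS]
    exact Finset.mem_erase.2 ⟨Ne.symm hne, hS'⟩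
  have hσ := (hτ.1.removeSplit (S := S))
  have hσ2 := hσ.removeSplit (S := S')
  have hmem := (mem_evSpan_iff hu hσ2 ρ).2
    ⟨w, _, hw.trans ((config_removeSplit hS h0).symm.trans (config_removeSplit hS2 h0').symm)⟩
  have h1 := hc.codim _ hσ2 hmem
  have h2 := finrank_evSpan_le hu hσ2 ρ
  have h3 := hσ.card_removeSplit (mem_rooted.1 hS2).1
  have h4 := hτ.1.card_removeSplit (mem_rooted.1 hS).1
  have h5 := hτ.card_eq hr hE i₀
  omega

theorem evSpan_removeSplit_ne_top (hu : ∑ e, u e = 0) (hE : Fintype.card E = r + 1 + 2 * s)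
    (i₀ : Fin r ⊕ Fin s) (hτ : IsTop τ) (hr : IsRigid u τ) {S : Finset (Leaf r s E)} (hS : S ∈ τ) :
    2 * Module.finrank ℝ (evSpan u ((τ.erase S).erase Sᶜ)) + 2 ≤ 4 * (r + s) := by
  have h2 := finrank_evSpan_le hu (hτ.1.removeSplit (S := S)) (Sum.inl i₀)
  have h4 := hτ.1.card_removeSplit hS
  have h5 := hτ.card_eq hr hE i₀
  omega

theorem ne_top_of_finrank {U : Submodule ℝ (Fin r ⊕ Fin s → ℝ × ℝ)}
    (h : 2 * Module.finrank ℝ U + 2 ≤ 4 * (r + s)) : U ≠ ⊤ := by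
  rintro rfl
  rw [finrank_top, finrank_config] at h
  omega

theorem exists_functional {U : Submodule ℝ (Fin r ⊕ Fin s → ℝ × ℝ)}
    (h : 2 * Module.finrank ℝ U + 2 = 4 * (r + s)) :
    ∃ f : (Fin r ⊕ Fin s → ℝ × ℝ) →ₗ[ℝ] ℝ, U = LinearMap.ker f := by
  obtain ⟨f, hf, hU⟩ := Submodule.exists_le_ker_of_lt_top U (ne_top_of_finrank h.le).lt_top
  refine ⟨f, Submodule.eq_of_le_of_finrank_eq hU ?_⟩
  have := Module.Dual.finrank_ker_add_one_of_ne_zero (f := f) hf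
  rw [finrank_config] at this
  omega

theorem sgn_mul_self {x : ℝ} (hx : x ≠ 0) : sgn x * sgn x = 1 := by
  rcases hx.lt_or_gt with h | h
  · rw [sgn_neg h]; ring
  · rw [sgn_pos h]; ring

-- The span of `σ` is the kernel of some `f`. In a rigid resolution only the new edge is seen by
-- `f`, so the rate of change of its length under `v` has the sign `f v` times the sign of `f` on
-- the edge. Hence the sum is `wall_sum` up to a common sign.
open Classical in
theorem Crosses.sum_wall (hu : ∑ e, u e = 0) (hE : Fintype.card E = r + 1 + 2 * s)
    (i₀ : Fin r ⊕ Fin s) (ρ : Leaf r s E) {P v : Fin r ⊕ Fin s → ℝ × ℝ} (hc : Crosses u P v)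
    (hσ : IsSplitSystem σ) (hPσ : P ∈ evSpan u σ) :
    ∑ S, (if S ∉ σ ∧ ρ ∉ S ∧ IsTop (addSplit σ S) ∧ IsRigid u (addSplit σ S) then
      sgn (edgeLen u (addSplit σ S) ρ v S) * typeMult u (addSplit σ S) else 0) = 0 := by
  by_cases hex : ∃ S, S ∉ σ ∧ ρ ∉ S ∧ IsTop (addSplit σ S) ∧ IsRigid u (addSplit σ S)
  swap
  · push Not at hex
    refine Finset.sum_eq_zero fun S _ => if_neg ?_
    rintro ⟨h1, h2, h3, h4⟩
    exact hex S h1 h2 h3 h4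
  have hremove : ∀ S, S ∉ σ → ((addSplit σ S).erase S).erase Sᶜ = σ := by
    intro S hS
    have hS' : Sᶜ ∉ σ := fun h => hS (by simpa using hσ.compl_mem _ h)
    ext T
    simp only [Finset.mem_erase, mem_addSplit]
    constructor
    · tauto
    · intro h
      exact ⟨fun h' => hS' (h' ▸ h), fun h' => hS (h' ▸ h), Or.inr (Or.inr h)⟩
  have hfin : 2 * Module.finrank ℝ (evSpan u σ) + 2 = 4 * (r + s) := by
    obtain ⟨S, h1, h2, h3, h4⟩ := hex
    have := evSpan_removeSplit_ne_top hu hE i₀ h3 h4 (mem_addSplit.2 (Or.inl rfl))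
    rw [hremove S h1] at this
    exact le_antisymm this (hc.codim σ hσ hPσ)
  obtain ⟨f, hf⟩ := exists_functional hfin
  have hfv : f v ≠ 0 := by
    intro h
    refine hc.transversal σ hσ hPσ (ne_top_of_finrank hfin.le) ?_
    rw [hf]; exact h
  have hsum := wall_sum hu hσ hf hc.injective hPσ ρ
  rw [Finset.sum_filter] at hsum
  refine Eq.trans ?_ ((congrArg (sgn (f v) * ·) hsum).trans (mul_zero _))
  simp only [Finset.mul_sum]
  refine Finset.sum_congr rfl fun S _ => ?_
  by_cases hS : ρ ∉ S ∧ S ∉ σ ∧ IsTop (addSplit σ S)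
  swap
  · rw [if_neg hS, if_neg (by tauto), mul_zero]
  rw [if_pos hS]
  obtain ⟨hρ, hSσ, hStop⟩ := hS
  by_cases hr : IsRigid u (addSplit σ S)
  · rw [if_pos ⟨hSσ, hρ, hStop, hr⟩, ← mul_assoc]
    congr 1
    obtain ⟨w, hw⟩ := config_edgeLen hu hStop.1 ρ (P := v)
      ((hStop.evSpan_eq_top hr hE i₀) ▸ Submodule.mem_top)
    -- The constant configurations and all old edges lie on the wall.
    have hfveq : f v = edgeLen u (addSplit σ S) ρ v S * f (edgeVec u S) := by
      conv_lhs => rw [hw]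
      rw [config, rooted_addSplit hσ hρ, Finset.sum_insert (fun h => hSσ (mem_rooted.1 h).1),
        map_add, map_add, map_sum]
      have h0 : f (fun _ => w) = 0 := by
        have := const_mem_evSpan (u := u) (σ := σ) w
        rwa [hf] at this
      rw [h0, Finset.sum_eq_zero, zero_add, add_zero, map_smul, smul_eq_mul]
      intro T hT
      have := edgeVec_mem_evSpan (u := u) (mem_rooted.1 hT).1
      rw [hf, LinearMap.mem_ker] at this
      rw [map_smul, this, smul_zero]
    have hne : f (edgeVec u S) ≠ 0 := fun h => hfv (by rw [hfveq, h, mul_zero])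
    rw [hfveq, sgn_mul, mul_assoc, sgn_mul_self hne, mul_one]
  · rw [if_neg (by tauto)]
    -- Otherwise the new edge and the hyperplane would span everything. As all resolutions of `σ`
    -- have the same number of edges and one of them is rigid, this one would be rigid too.
    have : f (edgeVec u S) = 0 := by
      by_contra hne
      refine hr ?_
      have htop : evSpan u (addSplit σ S) = ⊤ := by
        rw [eq_top_iff]
        intro x _
        have hle : evSpan u σ ≤ evSpan u (addSplit σ S) := by
          refine Submodule.span_mono (Set.union_subset_union_right _ (Set.image_mono ?_))
          intro T hT
          exact mem_addSplit.2 (Or.inr (Or.inr hT))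
        have h1 : x - (f x / f (edgeVec u S)) • edgeVec u S ∈ evSpan u σ := by
          rw [hf, LinearMap.mem_ker, map_sub, map_smul, smul_eq_mul, div_mul_cancel₀ _ hne, sub_self]
        have h2 := Submodule.add_mem _ (hle h1) (Submodule.smul_mem _ (f x / f (edgeVec u S))
          (edgeVec_mem_evSpan (u := u) (mem_addSplit.2 (Or.inl rfl) : S ∈ addSplit σ S)))
        simpa using h2
      have h1 : IsRigid u (addSplit σ S) ↔ (addSplit σ S).card + 4 = 4 * (r + s) := by
        rw [IsRigid, htop, finrank_top, finrank_config]
        omega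
      rw [h1]
      obtain ⟨S', h1', h2', h3', h4'⟩ := hex
      have c1 := h3'.1.card_removeSplit (mem_addSplit.2 (Or.inl rfl) : S' ∈ addSplit σ S')
      have c2 := hStop.1.card_removeSplit (mem_addSplit.2 (Or.inl rfl) : S ∈ addSplit σ S)
      rw [hremove _ h1'] at c1
      rw [hremove _ hSσ] at c2
      have := h3'.card_eq h4' hE i₀
      omega
    rw [this, sgn_zero]; ring

/-- The types that count on one side only are those with exactly one edge of length zero at `P`.
Grouped by the type that remains when this edge is contracted, their signed contributions vanish by
`Crosses.sum_wall`. -/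
theorem Crosses.sideCount_neg (hu : ∑ e, u e = 0) (hE : Fintype.card E = r + 1 + 2 * s)
    (i₀ : Fin r ⊕ Fin s) (ρ : Leaf r s E) {P v : Fin r ⊕ Fin s → ℝ × ℝ} (hc : Crosses u P v) :
    sideCount u ρ P (-v) = sideCount u ρ P v := by
  classical
  symm
  rw [← sub_eq_zero, sideCount, sideCount, ← Finset.sum_sub_distrib]
  -- `C` describes the pairs of a rigid type and its only edge of length zero; `C'` describes the
  -- same pairs through the contracted type and the new edge.
  let C : Finset (Finset (Leaf r s E)) × Finset (Leaf r s E) → Prop := fun p =>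
    (IsTop p.1 ∧ IsRigid u p.1) ∧ p.2 ∈ rooted p.1 ρ ∧ edgeLen u p.1 ρ P p.2 = 0 ∧
      ∀ S' ∈ rooted p.1 ρ, S' ≠ p.2 → 0 < edgeLen u p.1 ρ P S'
  let C' : Finset (Finset (Leaf r s E)) × Finset (Leaf r s E) → Prop := fun p =>
    (IsSplitSystem p.1 ∧ ∃ w x, (∀ S ∈ rooted p.1 ρ, 0 < x S) ∧ P = config u p.1 ρ w x) ∧
      (p.2 ∉ p.1 ∧ ρ ∉ p.2 ∧ IsTop (addSplit p.1 p.2) ∧ IsRigid u (addSplit p.1 p.2))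
  -- A type with a negative length counts on neither side and one with only positive lengths on
  -- both. One zero length gives the sign of its slope, which is not zero by transversality.
  have h1 : ∀ τ : Finset (Finset (Leaf r s E)),
      (if (IsTop τ ∧ IsRigid u τ) ∧ ∀ S ∈ rooted τ ρ, 0 < edgeLen u τ ρ P S ∨
        (edgeLen u τ ρ P S = 0 ∧ 0 < edgeLen u τ ρ v S) then typeMult u τ else 0) -
      (if (IsTop τ ∧ IsRigid u τ) ∧ ∀ S ∈ rooted τ ρ, 0 < edgeLen u τ ρ P S ∨
        (edgeLen u τ ρ P S = 0 ∧ 0 < edgeLen u τ ρ (-v) S) then typeMult u τ else 0) =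
      ∑ S, if C (τ, S) then sgn (edgeLen u τ ρ v S) * typeMult u τ else 0 := by
    intro τ
    by_cases hτ : IsTop τ ∧ IsRigid u τ
    swap
    · rw [if_neg (fun h => hτ h.1), if_neg (fun h => hτ h.1), sub_zero]
      exact (Finset.sum_eq_zero fun S _ => if_neg fun h => hτ h.1).symm
    have htop := hτ.1.evSpan_eq_top hτ.2 hE i₀
    by_cases hneg : ∃ S ∈ rooted τ ρ, edgeLen u τ ρ P S < 0
    · obtain ⟨S, hS, hlt⟩ := hneg
      rw [if_neg, if_neg, sub_zero, Finset.sum_eq_zero]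
      · rintro T -
        refine if_neg ?_
        rintro ⟨-, hT, hT0, hT'⟩
        have hne : S ≠ T := by rintro rfl; simp only at hT0; linarith
        have := hT' S hS hne
        simp only at this
        linarith
      · rintro ⟨-, h⟩
        rcases h S hS with h | ⟨h, -⟩ <;> linarith
      · rintro ⟨-, h⟩
        rcases h S hS with h | ⟨h, -⟩ <;> linarith
    push Not at hneg
    by_cases hzero : ∃ S ∈ rooted τ ρ, edgeLen u τ ρ P S = 0
    swap
    · push Not at hzero
      have hpos : ∀ S ∈ rooted τ ρ, 0 < edgeLen u τ ρ P S := fun S hS =>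
        lt_of_le_of_ne (hneg S hS) (Ne.symm (hzero S hS))
      rw [if_pos ⟨hτ, fun S hS => Or.inl (hpos S hS)⟩, if_pos ⟨hτ, fun S hS => Or.inl (hpos S hS)⟩,
        sub_self, Finset.sum_eq_zero]
      rintro T -
      refine if_neg ?_
      rintro ⟨-, hT, hT0, -⟩
      exact hzero T hT hT0
    obtain ⟨S, hS, h0⟩ := hzero
    have hothers : ∀ S' ∈ rooted τ ρ, S' ≠ S → 0 < edgeLen u τ ρ P S' := by
      intro S' hS' hne
      refine lt_of_le_of_ne (hneg S' hS') fun h => hne ?_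
      exact hc.zero_unique hu hE i₀ ρ hτ.1 hτ.2 hS' hS h.symm h0
    have hb : edgeLen u τ ρ v S ≠ 0 := by
      intro hb
      have hSτ := (mem_rooted.1 hS).1
      exact hc.transversal _ hτ.1.1.removeSplit (mem_evSpan_removeSplit hu hτ.1.1 htop ρ hS h0)
        (ne_top_of_finrank (evSpan_removeSplit_ne_top hu hE i₀ hτ.1 hτ.2 hSτ))
        (mem_evSpan_removeSplit hu hτ.1.1 htop ρ hS hb)
    rw [Finset.sum_eq_single S]
    · rw [if_pos (show C (τ, S) from ⟨hτ, hS, h0, hothers⟩)]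
      have key : ∀ v', ((IsTop τ ∧ IsRigid u τ) ∧ ∀ S ∈ rooted τ ρ, 0 < edgeLen u τ ρ P S ∨
          (edgeLen u τ ρ P S = 0 ∧ 0 < edgeLen u τ ρ v' S)) ↔ 0 < edgeLen u τ ρ v' S := by
        intro v'
        constructor
        · rintro ⟨-, h⟩
          rcases h S hS with h | h
          · linarith
          · exact h.2
        · intro h
          refine ⟨hτ, fun S' hS' => ?_⟩
          by_cases hne : S' = S
          · subst hne; exact Or.inr ⟨h0, h⟩
          · exact Or.inl (hothers S' hS' hne)
      rw [if_congr (key v) rfl rfl, if_congr (key (-v)) rfl rfl,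
        edgeLen_neg hu hτ.1.1 hτ.2 htop ρ v hS]
      rcases hb.lt_or_gt with hb | hb
      · rw [if_neg hb.not_gt, if_pos (neg_pos.2 hb), sgn_neg hb]; ring
      · rw [if_pos hb, if_neg (by linarith), sgn_pos hb]; ring
    · rintro T - hT
      refine if_neg ?_
      rintro ⟨-, hT1, hT0, -⟩
      have := hothers T hT1 hT
      simp only at hT0
      linarith
    · intro h; exact absurd (Finset.mem_univ _) h
  rw [Finset.sum_congr rfl fun τ _ => h1 τ]
  have h2 : ∑ τ, ∑ S, (if C (τ, S) then sgn (edgeLen u τ ρ v S) * typeMult u τ else 0) =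
      ∑ p ∈ Finset.univ.filter C, sgn (edgeLen u p.1 ρ v p.2) * typeMult u p.1 := by
    rw [Finset.sum_filter, Fintype.sum_prod_type]
    refine Finset.sum_congr rfl fun _ _ => Finset.sum_congr rfl fun _ _ => ?_
    congr
  -- Contraction of the marked edge and insertion of the new edge are inverse to each other.
  have h3 : ∑ p ∈ Finset.univ.filter C, sgn (edgeLen u p.1 ρ v p.2) * typeMult u p.1 =
      ∑ p ∈ Finset.univ.filter C', sgn (edgeLen u (addSplit p.1 p.2) ρ v p.2) *
        typeMult u (addSplit p.1 p.2) := by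
    refine Finset.sum_bij' (fun p _ => ((p.1.erase p.2).erase p.2ᶜ, p.2))
      (fun p _ => (addSplit p.1 p.2, p.2)) ?_ ?_ ?_ ?_ ?_
    · rintro ⟨τ, S⟩ hp
      simp only [Finset.mem_filter, Finset.mem_univ, true_and, C, C'] at hp ⊢
      obtain ⟨hτ, hS, h0, hpos⟩ := hp
      obtain ⟨hSτ, hρ⟩ := mem_rooted.1 hS
      rw [hτ.1.1.addSplit_removeSplit hSτ]
      obtain ⟨w, hw⟩ := config_edgeLen hu hτ.1.1 ρ (P := P)
        ((hτ.1.evSpan_eq_top hτ.2 hE i₀) ▸ Submodule.mem_top)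
      refine ⟨⟨hτ.1.1.removeSplit, w, _, ?_, hw.trans (config_removeSplit hS h0).symm⟩,
        by simp, hρ, hτ⟩
      intro T hT
      rw [rooted_removeSplit hS, Finset.mem_erase] at hT
      exact hpos T hT.2 hT.1
    · rintro ⟨σ, S⟩ hp
      simp only [Finset.mem_filter, Finset.mem_univ, true_and, C, C'] at hp ⊢
      obtain ⟨⟨hσ, w, x, hx, hP⟩, hSσ, hρ, hτ⟩ := hp
      have hroot := rooted_addSplit hσ hρ
      have hPeq : P = config u (addSplit σ S) ρ w (fun T => if T = S then 0 else x T) := by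
        rw [hP, config, config, hroot, Finset.sum_insert (fun h => hSσ (mem_rooted.1 h).1),
          if_pos rfl, zero_smul, zero_add]
        congr 1
        refine Finset.sum_congr rfl fun T hT => ?_
        rw [if_neg]
        rintro rfl
        exact hSσ (mem_rooted.1 hT).1
      refine ⟨hτ, by rw [hroot]; exact Finset.mem_insert_self _ _, ?_, ?_⟩
      · rw [hPeq, edgeLen_eq hu hτ.1.1 hτ.2 ρ (by rw [hroot]; exact Finset.mem_insert_self _ _),
          if_pos rfl]
      · intro T hT hne
        rw [hPeq, edgeLen_eq hu hτ.1.1 hτ.2 ρ hT, if_neg hne]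
        rw [hroot, Finset.mem_insert] at hT
        exact hx T (hT.resolve_left hne)
    · rintro ⟨τ, S⟩ hp
      simp only [Finset.mem_filter, Finset.mem_univ, true_and, C] at hp
      simp only [hp.1.1.1.addSplit_removeSplit (mem_rooted.1 hp.2.1).1]
    · rintro ⟨σ, S⟩ hp
      simp only [Finset.mem_filter, Finset.mem_univ, true_and, C'] at hp
      simp only [Prod.mk.injEq, and_true]
      obtain ⟨⟨hσ, -⟩, hS, -⟩ := hp
      have hS' : Sᶜ ∉ σ := fun h => hS (by simpa using hσ.compl_mem _ h)
      ext T
      simp only [Finset.mem_erase, mem_addSplit]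
      constructor
      · tauto
      · intro h
        exact ⟨fun h' => hS' (h' ▸ h), fun h' => hS (h' ▸ h), Or.inr (Or.inr h)⟩
    · rintro ⟨τ, S⟩ hp
      simp only [Finset.mem_filter, Finset.mem_univ, true_and, C] at hp
      simp only [hp.1.1.1.addSplit_removeSplit (mem_rooted.1 hp.2.1).1]
  rw [h2, h3, Finset.sum_filter, Fintype.sum_prod_type]
  refine Finset.sum_eq_zero fun σ _ => ?_
  by_cases hσ : IsSplitSystem σ ∧ ∃ w x, (∀ S ∈ rooted σ ρ, 0 < x S) ∧ P = config u σ ρ w x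
  · obtain ⟨w, x, -, hw⟩ := hσ.2
    refine (Finset.sum_congr rfl fun S _ => if_congr ?_ rfl rfl).trans
      (hc.sum_wall hu hE i₀ ρ hσ.1 ((mem_evSpan_iff hu hσ.1 ρ).2 ⟨w, x, hw⟩))
    simp only [C']
    exact and_iff_right hσ
  · exact Finset.sum_eq_zero fun S _ => if_neg fun h => hσ h.1

theorem Crosses.eventually_topCount (hu : ∑ e, u e = 0) (hE : Fintype.card E = r + 1 + 2 * s)
    (i₀ : Fin r ⊕ Fin s) {P v : Fin r ⊕ Fin s → ℝ × ℝ} (hc : Crosses u P v) :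
    ∃ c, ∀ᶠ t in 𝓝[≠] (0 : ℝ), topCount u (P + t • v) = c := by
  refine ⟨sideCount u (Sum.inl i₀) P v, ?_⟩
  rw [← nhdsLT_sup_nhdsGT, eventually_sup]
  refine ⟨?_, MetricTree.eventually_topCount hu hE i₀ _ P v⟩
  have h := MetricTree.eventually_topCount hu hE i₀ (Sum.inl i₀) P (-v)
  rw [hc.sideCount_neg hu hE i₀] at h
  have ht : Tendsto (fun t : ℝ => -t) (𝓝[<] 0) (𝓝[>] 0) := by
    have := tendsto_neg_nhdsLT (a := (0 : ℝ))
    rwa [neg_zero] at this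
  filter_upwards [ht.eventually h] with t ht
  simpa using ht

end Invariance

/-! ### Independence of the generic configuration. -/

section Independence

open Filter Topology

variable {r s : ℕ} {E : Type} [Fintype E] [DecidableEq E] {u : E → ℤ × ℤ}
  {σ τ : Finset (Finset (Leaf r s E))}

/-- Nonzero lengths keep their sign under small motions. A type with a negative length is not
realized in any case, so zero lengths have to be excluded only when no length is negative. -/
theorem eventually_topCount_of_ne_zero (hu : ∑ e, u e = 0) (hE : Fintype.card E = r + 1 + 2 * s)
    (i₀ : Fin r ⊕ Fin s) {P v : Fin r ⊕ Fin s → ℝ × ℝ} {ρ : Leaf r s E}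
    (h : ∀ τ, IsTop τ → IsRigid u τ → (∀ S ∈ rooted τ ρ, 0 ≤ edgeLen u τ ρ P S) →
      ∀ S ∈ rooted τ ρ, edgeLen u τ ρ P S ≠ 0) :
    ∀ᶠ t in 𝓝 (0 : ℝ), topCount u (P + t • v) = topCount u P := by
  classical
  have h1 : ∀ᶠ t in 𝓝 (0 : ℝ), ∀ τ : Finset (Finset (Leaf r s E)), ∀ S : Finset (Leaf r s E),
      edgeLen u τ ρ P S ≠ 0 →
      (0 < edgeLen u τ ρ P S + t * edgeLen u τ ρ v S ↔ 0 < edgeLen u τ ρ P S) := by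
    rw [eventually_all]; intro τ
    rw [eventually_all]; intro S
    have hc : Tendsto (fun t : ℝ => edgeLen u τ ρ P S + t * edgeLen u τ ρ v S) (𝓝 0)
        (𝓝 (edgeLen u τ ρ P S)) := by
      have : Continuous fun t : ℝ => edgeLen u τ ρ P S + t * edgeLen u τ ρ v S := by fun_prop
      have h := this.tendsto 0
      rwa [zero_mul, add_zero] at h
    rcases lt_trichotomy (edgeLen u τ ρ P S) 0 with h | h | h
    · filter_upwards [hc.eventually (gt_mem_nhds h)] with t ht _
      exact ⟨fun h' => absurd h' ht.not_gt, fun h' => absurd h' h.not_gt⟩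
    · filter_upwards with t ht
      exact absurd h ht
    · filter_upwards [hc.eventually (lt_mem_nhds h)] with t ht _
      exact ⟨fun _ => h, fun _ => ht⟩
  filter_upwards [h1] with t ht
  rw [topCount, topCount]
  refine Finset.sum_congr rfl fun τ hτ => if_congr ?_ rfl rfl
  rw [Finset.mem_filter] at hτ
  obtain ⟨-, hτ, hr⟩ := hτ
  have htop := hτ.evSpan_eq_top hr hE i₀
  rw [realizes_iff_edgeLen hu hτ hr htop i₀ ρ, realizes_iff_edgeLen hu hτ hr htop i₀ ρ]
  have hadd := fun S (hS : S ∈ rooted τ ρ) => edgeLen_add hu hτ.1 hr htop ρ P v t hS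
  by_cases hn : ∃ S ∈ rooted τ ρ, edgeLen u τ ρ P S < 0
  · obtain ⟨S, hS, hlt⟩ := hn
    refine iff_of_false (fun h => ?_) (fun h => ?_)
    · have := h S hS
      rw [hadd S hS, ht τ S hlt.ne] at this
      linarith
    · have := h S hS
      linarith
  · push Not at hn
    refine forall₂_congr fun S hS => ?_
    rw [hadd S hS]
    exact ht τ S (h τ hτ hr hn S hS)

/-- If the value on a punctured neighbourhood of every point is constant, then it is the same
for all points. -/
theorem punctured_const {α : Type*} {g : ℝ → α} (h : ∀ t₀, ∃ c, ∀ᶠ t in 𝓝[≠] t₀, g t = c) :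
    ∃ c, ∀ t₀, ∀ᶠ t in 𝓝[≠] t₀, g t = c := by
  choose c hc using h
  -- A point near `t₀` has a whole neighbourhood on which `g` takes the value `c t₀`, so `c` takes
  -- this value there as well.
  have hloc : IsLocallyConstant c := by
    rw [IsLocallyConstant.iff_eventually_eq]
    intro t₀
    have h1 := eventually_nhdsWithin_iff.1 (eventually_eventually_nhdsWithin.2 (hc t₀))
    filter_upwards [h1] with t ht
    by_cases hne : t = t₀
    · rw [hne]
    · have h2 := ht hne
      rw [IsOpen.nhdsWithin_eq (isOpen_compl_singleton) (by simpa using hne)] at h2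
      have h3 := h2.filter_mono (nhdsWithin_le_nhds (s := {t}ᶜ))
      obtain ⟨x, hx1, hx2⟩ := ((hc t).and h3).exists
      rw [← hx1, hx2]
  refine ⟨c 0, fun t₀ => ?_⟩
  rw [hloc.apply_eq_of_isPreconnected isPreconnected_univ (Set.mem_univ 0) (Set.mem_univ t₀)]
  exact hc t₀

/-- The second end of a path that crosses all the walls transversally. -/
structure IsTarget (u : E → ℤ × ℤ) (P Q : Fin r ⊕ Fin s → ℝ × ℝ) : Prop where
  notMem : ∀ σ : Finset (Finset (Leaf r s E)), IsSplitSystem σ → evSpan u σ ≠ ⊤ → Q ∉ evSpan u σ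
  notMem_sup : ∀ σ : Finset (Finset (Leaf r s E)),
    2 * Module.finrank ℝ (evSpan u σ) + 4 ≤ 4 * (r + s) →
      Q ∉ evSpan u σ ⊔ Submodule.span ℝ {P}
  notMem_diag : ∀ i j : Fin r ⊕ Fin s, i ≠ j → ∀ R : Fin r ⊕ Fin s → ℝ × ℝ, R i = R j →
    ∀ t : ℝ, Q ≠ R + t • P

/-- The configurations in which two points coincide. -/
def diagonal (i j : Fin r ⊕ Fin s) : Submodule ℝ (Fin r ⊕ Fin s → ℝ × ℝ) where
  carrier := {R | R i = R j}
  add_mem' h h' := by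
    simp only [Set.mem_ofPred_eq, Pi.add_apply] at *
    rw [h, h']
  zero_mem' := rfl
  smul_mem' c R h := by
    simp only [Set.mem_ofPred_eq, Pi.smul_apply] at *
    rw [h]

/-- The diagonal has codimension two, so one more vector does not suffice to span the space. -/
theorem diagonal_sup_ne_top {i j : Fin r ⊕ Fin s} (hij : i ≠ j) (P : Fin r ⊕ Fin s → ℝ × ℝ) :
    diagonal i j ⊔ Submodule.span ℝ {P} ≠ ⊤ := by
  intro h
  have key : ∀ w : ℝ × ℝ, ∃ t : ℝ, w = t • (P i - P j) := by
    intro w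
    have hw : (fun k => if k = i then w else 0 : Fin r ⊕ Fin s → ℝ × ℝ) ∈
        diagonal i j ⊔ Submodule.span ℝ {P} := h ▸ Submodule.mem_top
    obtain ⟨R, hR, Q, hQ, he⟩ := Submodule.mem_sup.1 hw
    obtain ⟨t, rfl⟩ := Submodule.mem_span_singleton.1 hQ
    refine ⟨t, ?_⟩
    have h1 := congrFun he i
    have h2 := congrFun he j
    have hR' : R i = R j := hR
    simp only [Pi.add_apply, Pi.smul_apply, if_true, if_neg hij.symm, hR'] at h1 h2
    rw [← h1, smul_sub, ← sub_zero (R j + t • P i), ← h2]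
    abel
  obtain ⟨a, ha⟩ := key (1, 0)
  obtain ⟨b, hb⟩ := key (0, 1)
  rw [Prod.ext_iff] at ha hb
  simp only [Prod.smul_fst, Prod.smul_snd, smul_eq_mul] at ha hb
  obtain ⟨a1, a2⟩ := ha
  obtain ⟨b1, b2⟩ := hb
  have : a * b * ((P i - P j).1 * (P i - P j).2) = 1 := by
    calc _ = (a * (P i - P j).1) * (b * (P i - P j).2) := by ring
      _ = 1 := by rw [← a1, ← b2]; norm_num
  have h0 : a * b * ((P i - P j).1 * (P i - P j).2) = 0 := by
    calc _ = (a * (P i - P j).2) * (b * (P i - P j).1) := by ring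
      _ = 0 := by rw [← a2]; ring
  linarith

/-- Every condition excludes a proper subspace, and finitely many proper subspaces do not cover a
real vector space. The same `Q` serves two starting points, which are thus compared through it. -/
theorem exists_target (u : E → ℤ × ℤ) (P P' : Fin r ⊕ Fin s → ℝ × ℝ) :
    ∃ Q, IsTarget u P Q ∧ IsTarget u P' Q := by
  classical
  let good : Finset (Submodule ℝ (Fin r ⊕ Fin s → ℝ × ℝ)) :=
    (Finset.univ.image (fun σ : Finset (Finset (Leaf r s E)) => evSpan u σ) ∪
      (Finset.univ.image (fun σ : Finset (Finset (Leaf r s E)) =>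
        evSpan u σ ⊔ Submodule.span ℝ {P}) ∪
      Finset.univ.image (fun σ : Finset (Finset (Leaf r s E)) =>
        evSpan u σ ⊔ Submodule.span ℝ {P'})) ∪
      (Finset.univ.image (fun p : (Fin r ⊕ Fin s) × (Fin r ⊕ Fin s) =>
        diagonal p.1 p.2 ⊔ Submodule.span ℝ {P}) ∪
      Finset.univ.image (fun p : (Fin r ⊕ Fin s) × (Fin r ⊕ Fin s) =>
        diagonal p.1 p.2 ⊔ Submodule.span ℝ {P'}))).filter (· ≠ ⊤)
  have hne := Subspace.biUnion_ne_univ_of_top_notMem (s := good) (by simp [good])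
  obtain ⟨Q, hQ⟩ := (Set.ne_univ_iff_exists_notMem _).1 hne
  simp only [Set.mem_iUnion, SetLike.mem_coe, exists_prop, not_exists, not_and] at hQ
  have hspan : ∀ R : Fin r ⊕ Fin s → ℝ × ℝ, ∀ σ : Finset (Finset (Leaf r s E)),
      2 * Module.finrank ℝ (evSpan u σ) + 4 ≤ 4 * (r + s) →
      evSpan u σ ⊔ Submodule.span ℝ {R} ≠ ⊤ := by
    intro R σ h
    refine ne_top_of_finrank ?_
    have h1 := Submodule.finrank_add_le_finrank_add_finrank (evSpan u σ) (Submodule.span ℝ {R})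
    have h2 := finrank_span_le_card (R := ℝ) ({R} : Set (Fin r ⊕ Fin s → ℝ × ℝ))
    simp only [Set.toFinset_singleton, Finset.card_singleton] at h2
    omega
  refine ⟨Q, ⟨?_, ?_, ?_⟩, ⟨?_, ?_, ?_⟩⟩
  · exact fun σ _ ht => hQ _ (Finset.mem_filter.2 ⟨by simp, ht⟩)
  · exact fun σ h => hQ _ (Finset.mem_filter.2 ⟨by simp, hspan P σ h⟩)
  · rintro i j hij R hR t rfl
    refine hQ (diagonal i j ⊔ Submodule.span ℝ {P})
      (Finset.mem_filter.2 ⟨?_, diagonal_sup_ne_top hij P⟩) ?_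
    · simp only [Finset.mem_union, Finset.mem_image, Finset.mem_univ, true_and, Prod.exists]
      exact Or.inr (Or.inl ⟨i, j, rfl⟩)
    · exact Submodule.add_mem_sup hR (Submodule.smul_mem _ t (Submodule.mem_span_singleton_self P))
  · exact fun σ _ ht => hQ _ (Finset.mem_filter.2 ⟨by simp, ht⟩)
  · exact fun σ h => hQ _ (Finset.mem_filter.2 ⟨by simp, hspan P' σ h⟩)
  · rintro i j hij R hR t rfl
    refine hQ (diagonal i j ⊔ Submodule.span ℝ {P'})
      (Finset.mem_filter.2 ⟨?_, diagonal_sup_ne_top hij P'⟩) ?_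
    · simp only [Finset.mem_union, Finset.mem_image, Finset.mem_univ, true_and, Prod.exists]
      exact Or.inr (Or.inr ⟨i, j, rfl⟩)
    · exact Submodule.add_mem_sup hR (Submodule.smul_mem _ t (Submodule.mem_span_singleton_self P'))

/-- For `t ≠ 0` the target is a linear combination of the point on the line and of `P`. So
coinciding points or a span of codimension two at this point would contradict the choice of `Q`. -/
theorem IsTarget.crosses {P Q : Fin r ⊕ Fin s → ℝ × ℝ} (h : IsTarget u P Q)
    {t : ℝ} (ht : t ≠ 0) : Crosses u (P + t • (Q - P)) (Q - P) := by
  refine ⟨?_, ?_, ?_⟩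
  · intro i j hij
    by_contra hne
    refine h.notMem_diag i j hne (t⁻¹ • (P + t • (Q - P))) ?_ (1 - t⁻¹) ?_
    · rw [Pi.smul_apply, Pi.smul_apply, hij]
    · rw [smul_add, smul_smul, inv_mul_cancel₀ ht, one_smul, sub_smul, one_smul]
      abel
  · intro σ hσ hmem
    by_contra hlt
    refine h.notMem_sup σ (by omega) ?_
    have : Q = t⁻¹ • (P + t • (Q - P)) + (1 - t⁻¹) • P := by
      rw [smul_add, smul_smul, inv_mul_cancel₀ ht, one_smul, sub_smul, one_smul]
      abel
    rw [this]
    exact Submodule.add_mem_sup (Submodule.smul_mem _ _ hmem)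
      (Submodule.smul_mem _ _ (Submodule.mem_span_singleton_self P))
  · intro σ hσ hmem htop hv
    refine h.notMem σ hσ htop ?_
    have h1 := Submodule.sub_mem _ hmem (Submodule.smul_mem _ t hv)
    rw [add_sub_cancel_right] at h1
    simpa using Submodule.add_mem _ h1 hv

/-- Along the line the count is constant near every parameter except possibly at it, hence up to
isolated parameters everywhere. At both ends it is also continuous: `P` is generic, and `Q` avoids
all proper spans. -/
theorem IsGeneric.topCount_eq_of_target (hu : ∑ e, u e = 0) (hE : Fintype.card E = r + 1 + 2 * s)
    (i₀ : Fin r ⊕ Fin s) {P Q : Fin r ⊕ Fin s → ℝ × ℝ} (hP : IsGeneric u P) (h : IsTarget u P Q) :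
    topCount u P = topCount u Q := by
  have hshift : ∀ t₀ t : ℝ, P + t • (Q - P) = (P + t₀ • (Q - P)) + (t - t₀) • (Q - P) := by
    intro t₀ t; rw [sub_smul]; abel
  have hP0 := eventually_topCount_of_ne_zero hu hE i₀ (P := P) (v := Q - P) (ρ := Sum.inl i₀)
    (fun τ hτ hr hpos S hS => hP.edgeLen_ne_zero hu hE i₀ _ hτ hr hpos hS)
  have hQ0 := eventually_topCount_of_ne_zero hu hE i₀ (P := Q) (v := Q - P) (ρ := Sum.inl i₀)
    (fun τ hτ hr _ S hS h0 => h.notMem _ hτ.1.removeSplit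
      (ne_top_of_finrank (evSpan_removeSplit_ne_top hu hE i₀ hτ hr (mem_rooted.1 hS).1))
      (mem_evSpan_removeSplit hu hτ.1 (hτ.evSpan_eq_top hr hE i₀) _ hS h0))
  have htend : ∀ t₀ : ℝ, Tendsto (fun t => t - t₀) (𝓝[≠] t₀) (𝓝[≠] 0) := by
    intro t₀
    rw [tendsto_nhdsWithin_iff]
    constructor
    · have : Continuous fun t : ℝ => t - t₀ := by fun_prop
      have h := this.tendsto t₀
      rw [sub_self] at h
      exact h.mono_left nhdsWithin_le_nhds
    · filter_upwards [self_mem_nhdsWithin] with t ht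
      exact sub_ne_zero.2 ht
  obtain ⟨c, hc⟩ := punctured_const (g := fun t : ℝ => topCount u (P + t • (Q - P))) (by
    intro t₀
    by_cases ht : t₀ = 0
    · subst ht
      exact ⟨_, hP0.filter_mono nhdsWithin_le_nhds⟩
    · obtain ⟨c, hc⟩ := (h.crosses ht).eventually_topCount hu hE i₀
      refine ⟨c, ?_⟩
      filter_upwards [(htend t₀).eventually hc] with t ht
      rw [hshift t₀ t, ht])
  obtain ⟨t, ht1, ht2⟩ := ((hc 0).and (hP0.filter_mono nhdsWithin_le_nhds)).exists
  obtain ⟨t', ht1', ht2'⟩ := ((hc 1).and ((htend 1).eventually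
    (hQ0.filter_mono nhdsWithin_le_nhds))).exists
  rw [← ht2, ht1, ← ht1', ← ht2', hshift 1 t']
  simp

/-- The refined count does not depend on the configuration. -/
theorem IsGeneric.labelledCount_eq_labelledCount (hu : ∑ e, u e = 0)
    (hE : Fintype.card E = r + 1 + 2 * s) (i₀ : Fin r ⊕ Fin s) {P P' : Fin r ⊕ Fin s → ℝ × ℝ}
    (hP : IsGeneric u P) (hP' : IsGeneric u P') : labelledCount u P = labelledCount u P' := by
  obtain ⟨Q, h, h'⟩ := exists_target u P P'
  rw [hP.labelledCount_eq_topCount hu i₀, hP'.labelledCount_eq_topCount hu i₀,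
    hP.topCount_eq_of_target hu hE i₀ h, hP'.topCount_eq_of_target hu hE i₀ h']

end Independence

/-! ### Conditions against edges in the branches of a rigid curve. -/

section Excess

variable {r s : ℕ} {E : Type} [Fintype E] [DecidableEq E] {u : E → ℤ × ℤ}
  {τ : Finset (Finset (Leaf r s E))} {V : Finset (Finset (Leaf r s E))} {ρ : Leaf r s E}

/-- The number of bounded edges of a branch. -/
def edgesIn (τ : Finset (Finset (Leaf r s E))) (B : Finset (Leaf r s E)) : ℕ :=
  (τ.filter (· ⊆ B)).card

/-- The number of markings of a branch. -/
def markingsIn (B : Finset (Leaf r s E)) : ℕ :=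
  (Finset.univ.filter fun m : Fin r ⊕ Fin s => Sum.inl m ∈ B).card

/-- The difference of the number of conditions on a branch and the number of its edges. -/
def excess (τ : Finset (Finset (Leaf r s E))) (B : Finset (Leaf r s E)) : ℤ :=
  2 * (markingsIn B : ℤ) - edgesIn τ B

theorem filter_subset_compl (hτ : IsSplitSystem τ) (hV : V ∈ treeStars τ)
    {B₀ : Finset (Leaf r s E)} (hB₀ : B₀ ∈ V) :
    (τ.filter (· ⊆ B₀ᶜ)).erase B₀ᶜ = (V.erase B₀).biUnion fun B => τ.filter (· ⊆ B) := by
  ext T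
  simp only [Finset.mem_erase, Finset.mem_filter, Finset.mem_biUnion]
  constructor
  · rintro ⟨hne, hT, hsub⟩
    obtain ⟨C, hC, h | h⟩ := hτ.exists_block hV hT
    · refine ⟨C, ⟨?_, hC⟩, hT, h⟩
      rintro rfl
      obtain ⟨x, hx⟩ := hτ.block_nonempty (Or.inl hT)
      exact Finset.mem_compl.1 (hsub hx) (h hx)
    · exfalso
      obtain ⟨x, hx⟩ := hτ.star_nonempty hV hB₀
      have hB₀T : B₀ ⊆ Tᶜ := by
        intro y hy
        rw [Finset.mem_compl]
        exact fun h' => Finset.mem_compl.1 (hsub h') hy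
      have := star_eq_of_mem hV hB₀ hC hx (h (hB₀T hx))
      subst this
      exact hne (compl_injective (by rw [compl_compl]; exact Finset.Subset.antisymm h hB₀T))
  · rintro ⟨B, ⟨hne, hB⟩, hT, hTB⟩
    have h1 := star_subset_compl hV hB hB₀ hne
    refine ⟨?_, hT, hTB.trans h1⟩
    rintro rfl
    exact hτ.not_compl_subset hV hB hB₀ hTB

theorem edgesIn_compl (hτ : IsSplitSystem τ) (hV : V ∈ treeStars τ)
    {B₀ : Finset (Leaf r s E)} (hB₀ : B₀ ∈ V) :
    edgesIn τ B₀ᶜ = (if B₀ᶜ ∈ τ then 1 else 0) + ∑ B ∈ V.erase B₀, edgesIn τ B := by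
  have h1 : ∑ B ∈ V.erase B₀, edgesIn τ B = ((τ.filter (· ⊆ B₀ᶜ)).erase B₀ᶜ).card := by
    rw [filter_subset_compl hτ hV hB₀, Finset.card_biUnion]
    · rfl
    · intro A hA B hB hAB
      refine Finset.disjoint_left.2 ?_
      intro T hTA hTB
      rw [Finset.mem_filter] at hTA hTB
      obtain ⟨x, hx⟩ := hτ.block_nonempty (Or.inl hTA.1)
      exact hAB (star_eq_of_mem hV (Finset.mem_of_mem_erase hA) (Finset.mem_of_mem_erase hB)
        (hTA.2 hx) (hTB.2 hx))
  rw [h1, edgesIn]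
  by_cases h : B₀ᶜ ∈ τ
  · have hmem : B₀ᶜ ∈ τ.filter (· ⊆ B₀ᶜ) := Finset.mem_filter.2 ⟨h, subset_rfl⟩
    have := Finset.card_erase_add_one hmem
    rw [if_pos h]
    omega
  · rw [if_neg h, Finset.erase_eq_of_notMem (fun h' => h (Finset.mem_filter.1 h').1), zero_add]

theorem markingsIn_compl (hV : V ∈ treeStars τ) {B₀ : Finset (Leaf r s E)} (hB₀ : B₀ ∈ V) :
    markingsIn B₀ᶜ = ∑ B ∈ V.erase B₀, markingsIn B := by
  unfold markingsIn
  rw [← Finset.card_biUnion]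
  · congr 1
    ext m
    simp only [Finset.mem_filter, Finset.mem_univ, true_and, Finset.mem_compl, Finset.mem_biUnion,
      Finset.mem_erase]
    constructor
    · intro h
      obtain ⟨B, hB, hm⟩ := (mem_treeStars.1 hV).2.2.1 (Sum.inl m)
      exact ⟨B, ⟨fun h' => h (h' ▸ hm), hB⟩, hm⟩
    · rintro ⟨B, ⟨hne, hB⟩, hm⟩ h
      exact hne (star_eq_of_mem hV hB hB₀ hm h)
  · intro A hA B hB hAB
    refine Finset.disjoint_left.2 ?_
    intro m hmA hmB
    rw [Finset.mem_filter] at hmA hmB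
    exact hAB (star_eq_of_mem hV (Finset.mem_of_mem_erase hA) (Finset.mem_of_mem_erase hB)
      hmA.2 hmB.2)

/-- The markings and the edges of a branch are distributed over the branches at its first vertex,
except for the edge with which the branch begins, if that edge is bounded. -/
theorem excess_compl (hτ : IsSplitSystem τ) (hV : V ∈ treeStars τ)
    {B₀ : Finset (Leaf r s E)} (hB₀ : B₀ ∈ V) :
    excess τ B₀ᶜ + (if B₀ᶜ ∈ τ then 1 else 0) = ∑ B ∈ V.erase B₀, excess τ B := by
  unfold excess
  rw [edgesIn_compl hτ hV hB₀, markingsIn_compl hV hB₀, Finset.sum_sub_distrib, ← Finset.mul_sum]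
  push_cast
  ring

/-- The curve has 2(r+s) - 2 bounded edges, exactly the number of conditions from the markings other
than `m`. -/
theorem excess_root (hτ : IsSplitSystem τ) (hcard : τ.card + 4 = 4 * (r + s)) {m : Fin r ⊕ Fin s}
    (hV : V ∈ treeStars τ) (hm : {Sum.inl m} ∈ V) :
    ∑ B ∈ V.erase {Sum.inl m}, excess τ B = 0 := by
  have hn : ({Sum.inl m} : Finset (Leaf r s E))ᶜ ∉ τ := by
    intro h
    have := hτ.two_le_card _ (hτ.compl_mem _ h)
    rw [compl_compl, Finset.card_singleton] at this
    omega
  rw [← excess_compl hτ hV hm, if_neg hn, add_zero, excess]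
  have h1 : 2 * edgesIn τ ({Sum.inl m} : Finset (Leaf r s E))ᶜ = τ.card := by
    rw [← card_rooted hτ (Sum.inl m), edgesIn, rooted]
    congr 2
    ext T
    simp only [Finset.mem_filter]
    refine and_congr_right fun _ => ?_
    rw [Finset.subset_compl_comm, Finset.singleton_subset_iff, Finset.mem_compl]
  have h2 : markingsIn ({Sum.inl m} : Finset (Leaf r s E))ᶜ + 1 = r + s := by
    have : (Finset.univ.filter fun m' : Fin r ⊕ Fin s =>
        (Sum.inl m' : Leaf r s E) ∈ ({Sum.inl m} : Finset (Leaf r s E))ᶜ) = Finset.univ.erase m := by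
      ext m'; simp
    rw [markingsIn, this, Finset.card_erase_of_mem (Finset.mem_univ _)]
    have := one_le_of_marking m
    simp only [Finset.card_univ, Fintype.card_sum, Fintype.card_fin]
    omega
  omega

theorem excess_marking (hτ : IsSplitSystem τ) (m : Fin r ⊕ Fin s) :
    excess τ ({Sum.inl m} : Finset (Leaf r s E)) = 2 := by
  have h1 : edgesIn τ ({Sum.inl m} : Finset (Leaf r s E)) = 0 := by
    rw [edgesIn, Finset.card_eq_zero, Finset.filter_eq_empty_iff]
    intro T hT h
    have := Finset.card_le_card h
    have := hτ.two_le_card T hT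
    rw [Finset.card_singleton] at *
    omega
  have h2 : markingsIn ({Sum.inl m} : Finset (Leaf r s E)) = 1 := by
    rw [markingsIn, Finset.card_eq_one]
    exact ⟨m, by ext; simp⟩
  rw [excess, h1, h2]; rfl

theorem excess_end (hτ : IsSplitSystem τ) (e : E) :
    excess τ ({Sum.inr e} : Finset (Leaf r s E)) = 0 := by
  have h1 : edgesIn τ ({Sum.inr e} : Finset (Leaf r s E)) = 0 := by
    rw [edgesIn, Finset.card_eq_zero, Finset.filter_eq_empty_iff]
    intro T hT h
    have := Finset.card_le_card h
    have := hτ.two_le_card T hT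
    rw [Finset.card_singleton] at *
    omega
  have h2 : markingsIn ({Sum.inr e} : Finset (Leaf r s E)) = 0 := by
    rw [markingsIn, Finset.card_eq_zero, Finset.filter_eq_empty_iff]
    intro m _; simp
  rw [excess, h1, h2]; rfl

/-- With a root outside `B`, the lengths of the edges inside `B` move only markings in `B`. By
rigidity the resulting map is injective, so the edges are at most twice as many as the markings. -/
theorem excess_nonneg (hu : ∑ e, u e = 0) (hτ : IsSplitSystem τ) (hr : IsRigid u τ)
    {B : Finset (Leaf r s E)} (hB : B ≠ Finset.univ) : 0 ≤ excess τ B := by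
  obtain ⟨ρ, hρ⟩ : ∃ ρ, ρ ∉ B := by
    by_contra h; push Not at h; exact hB (Finset.eq_univ_iff_forall.2 h)
  set F := τ.filter (· ⊆ B) with hF
  have hFr : F ⊆ rooted τ ρ := by
    intro S hS
    rw [hF, Finset.mem_filter] at hS
    exact mem_rooted.2 ⟨hS.1, fun h => hρ (hS.2 h)⟩
  let g : (F → ℝ) →ₗ[ℝ] ({m : Fin r ⊕ Fin s // (Sum.inl m : Leaf r s E) ∈ B} → ℝ × ℝ) :=
    { toFun := fun x m => ∑ S : F, x S • edgeVec u S.1 m.1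
      map_add' := fun x y => by
        funext m; simp [add_smul, Finset.sum_add_distrib]
      map_smul' := fun c x => by
        funext m; simp [mul_smul, Finset.smul_sum] }
  have hg : Function.Injective g := by
    rw [← LinearMap.ker_eq_bot, LinearMap.ker_eq_bot']
    intro x hx
    set x' : Finset (Leaf r s E) → ℝ := fun S => if h : S ∈ F then x ⟨S, h⟩ else 0 with hx'
    have h0 : config u τ ρ 0 x' = config u τ ρ 0 0 := by
      have e1 : ∑ S ∈ rooted τ ρ, x' S • edgeVec u S = ∑ S : F, x S • edgeVec u S.1 := by
        rw [← Finset.sum_subset hFr, ← Finset.sum_attach, Finset.univ_eq_attach]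
        · refine Finset.sum_congr rfl fun S _ => ?_
          simp [hx']
        · intro S _ hS
          simp [hx', hS]
      rw [config, config, e1]
      simp only [Pi.zero_apply, zero_smul, Finset.sum_const_zero]
      congr 1
      funext j
      by_cases hj : (Sum.inl j : Leaf r s E) ∈ B
      · have := congrFun hx ⟨j, hj⟩
        simpa [g] using this
      · rw [Finset.sum_apply]
        refine Finset.sum_eq_zero fun S _ => ?_
        have hS := S.2
        have : edgeVec u S.1 j = 0 := if_neg fun h => hj ((Finset.mem_filter.1 hS).2 h)
        rw [Pi.smul_apply, this, smul_zero]
    have h1 := (config_injective hu hτ hr ρ h0).2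
    funext S
    have h2 := h1 S.1 (hFr S.2)
    simpa [hx'] using h2
  have h := LinearMap.finrank_le_finrank_of_injective hg
  have hc : Fintype.card F = F.card := Fintype.card_coe F
  rw [Module.finrank_pi_fintype, Module.finrank_pi_fintype] at h
  simp only [Module.finrank_self, Finset.sum_const, Finset.card_univ, Module.finrank_prod,
    hc, smul_eq_mul, mul_one, Fintype.card_subtype] at h
  rw [hF] at h
  rw [excess, markingsIn, edgesIn]
  omega

/-- The excesses of the two sides of a bounded edge add up to at most 1, because the edge itself is
counted on both sides, and neither of them is negative. -/
theorem excess_le_one (hu : ∑ e, u e = 0) (hτ : IsSplitSystem τ) (hr : IsRigid u τ)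
    (hcard : τ.card + 4 = 4 * (r + s)) {S : Finset (Leaf r s E)} (hS : S ∈ τ) :
    excess τ S ≤ 1 := by
  have hSc := hτ.compl_mem S hS
  have h1 := excess_nonneg hu hτ hr (hτ.ne_univ hSc)
  have hm : markingsIn S + markingsIn Sᶜ = r + s := by
    rw [markingsIn, markingsIn]
    simp only [Finset.mem_compl]
    rw [Finset.card_filter_add_card_filter_not]
    simp
  -- Complementation identifies the sides inside `Aᶜ` with those that contain `A`. Only `A` itself
  -- occurs in both families.
  have key : ∀ A ∈ τ, (τ.filter fun T => T ⊆ A ∨ A ⊆ T).card + 1 = edgesIn τ A + edgesIn τ Aᶜ := by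
    intro A hA
    have e1 : edgesIn τ Aᶜ = (τ.filter fun T => A ⊆ T).card := by
      refine Finset.card_bij' (fun T _ => Tᶜ) (fun T _ => Tᶜ) ?_ ?_ ?_ ?_
      · intro T hT
        rw [Finset.mem_filter] at hT ⊢
        exact ⟨hτ.compl_mem T hT.1, Finset.subset_compl_comm.1 hT.2⟩
      · intro T hT
        rw [Finset.mem_filter] at hT ⊢
        exact ⟨hτ.compl_mem T hT.1, Finset.compl_subset_compl.2 hT.2⟩
      · intro T _; simp
      · intro T _; simp
    rw [Finset.filter_or, e1, edgesIn, ← Finset.card_union_add_card_inter]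
    congr 1
    rw [← Finset.filter_and, eq_comm, Finset.card_eq_one]
    refine ⟨A, ?_⟩
    ext T
    rw [Finset.mem_filter, Finset.mem_singleton]
    constructor
    · rintro ⟨-, h, h'⟩; exact Finset.Subset.antisymm h h'
    · rintro rfl; exact ⟨hA, subset_rfl, subset_rfl⟩
  have hle : τ.card ≤ (τ.filter fun T => T ⊆ S ∨ S ⊆ T).card +
      (τ.filter fun T => T ⊆ Sᶜ ∨ Sᶜ ⊆ T).card := by
    refine le_trans (Finset.card_le_card ?_) (Finset.card_union_le _ _)
    intro T hT
    rw [Finset.mem_union, Finset.mem_filter, Finset.mem_filter]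
    rcases hτ.compatible T hT S hS with h | h | h | h
    · exact Or.inl ⟨hT, Or.inl h⟩
    · exact Or.inr ⟨hT, Or.inl h⟩
    · exact Or.inr ⟨hT, Or.inr (compl_subset_comm'.1 h)⟩
    · exact Or.inl ⟨hT, Or.inr (Finset.compl_subset_compl.1 h)⟩
  have k1 := key S hS
  have k2 := key Sᶜ hSc
  rw [compl_compl] at k2
  rw [excess] at h1 ⊢
  omega

end Excess

/-! ### Positions of vertices, and the bounded part of a curve. -/

section Positions

variable {r s : ℕ} {E : Type} [Fintype E] [DecidableEq E] {u : E → ℤ × ℤ}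
  {τ : Finset (Finset (Leaf r s E))} {V : Finset (Finset (Leaf r s E))} {ρ : Leaf r s E}

/-- The position of the vertex in which the branch `S` begins, seen from the root `ρ`. -/
def pt (u : E → ℤ × ℤ) (τ : Finset (Finset (Leaf r s E))) (ρ : Leaf r s E) (w : ℝ × ℝ)
    (x : Finset (Leaf r s E) → ℝ) (S : Finset (Leaf r s E)) : ℝ × ℝ :=
  w + ∑ T ∈ (rooted τ ρ).filter (S ⊆ ·), x T • dirR u T

theorem config_eq_pt (w : ℝ × ℝ) (x : Finset (Leaf r s E) → ℝ) (j : Fin r ⊕ Fin s) :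
    config u τ ρ w x j = pt u τ ρ w x {Sum.inl j} := by
  rw [config, pt, Pi.add_apply, Finset.sum_apply, Finset.sum_filter]
  congr 1
  refine Finset.sum_congr rfl fun S _ => ?_
  rw [Pi.smul_apply, edgeVec]
  by_cases h : Sum.inl j ∈ S <;> simp [h]

theorem pt_root (hτ : IsSplitSystem τ) (w : ℝ × ℝ) (x : Finset (Leaf r s E) → ℝ) :
    pt u τ ρ w x {ρ}ᶜ = w := by
  rw [pt, Finset.sum_eq_zero, add_zero]
  intro T hT
  exfalso
  rw [Finset.mem_filter, mem_rooted] at hT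
  obtain ⟨⟨h1, h2⟩, h3⟩ := hT
  have h4 := hτ.two_le_card _ (hτ.compl_mem _ h1)
  have h5 : Tᶜ ⊆ {ρ} := compl_subset_comm'.1 h3
  have := Finset.card_le_card h5
  rw [Finset.card_singleton] at this
  omega

/-- The edges between the root and the branch `B` are those between the root and its first vertex
together with `B` itself, if `B` is a bounded edge. -/
theorem pt_child (hτ : IsSplitSystem τ) (hV : V ∈ treeStars τ) {B₀ B : Finset (Leaf r s E)}
    (hB₀ : B₀ ∈ V) (hρ : ρ ∈ B₀) (hB : B ∈ V) (hne : B ≠ B₀) (w : ℝ × ℝ)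
    (x : Finset (Leaf r s E) → ℝ) :
    pt u τ ρ w x B = pt u τ ρ w x B₀ᶜ + if B ∈ τ then x B • dirR u B else 0 := by
  have hρB : ρ ∉ B := fun h => hne (star_eq_of_mem hV hB hB₀ h hρ)
  have hBsub := star_subset_compl hV hB hB₀ hne
  have hset : (rooted τ ρ).filter (B ⊆ ·) =
      if B ∈ τ then insert B ((rooted τ ρ).filter (B₀ᶜ ⊆ ·)) else (rooted τ ρ).filter (B₀ᶜ ⊆ ·) := by
    have key : ∀ T ∈ rooted τ ρ, B ⊆ T → T = B ∨ B₀ᶜ ⊆ T := by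
      intro T hT hBT
      obtain ⟨hT, hρT⟩ := mem_rooted.1 hT
      obtain ⟨x, hx⟩ := hτ.star_nonempty hV hB
      obtain ⟨C, hC, h | h⟩ := hτ.exists_block hV hT
      · left
        have := star_eq_of_mem hV hB hC hx (h (hBT hx))
        subst this
        exact Finset.Subset.antisymm h hBT
      · right
        have := star_eq_of_mem hV hB₀ hC hρ (h (Finset.mem_compl.2 hρT))
        subst this
        exact compl_subset_comm'.1 h
    split_ifs with h
    · ext T
      simp only [Finset.mem_filter, Finset.mem_insert]
      constructor
      · rintro ⟨h1, h2⟩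
        exact (key T h1 h2).imp id fun h => ⟨h1, h⟩
      · rintro (rfl | ⟨h1, h2⟩)
        · exact ⟨mem_rooted.2 ⟨h, hρB⟩, subset_rfl⟩
        · exact ⟨h1, hBsub.trans h2⟩
    · ext T
      simp only [Finset.mem_filter]
      constructor
      · rintro ⟨h1, h2⟩
        refine ⟨h1, (key T h1 h2).resolve_left ?_⟩
        rintro rfl
        exact h (mem_rooted.1 h1).1
      · rintro ⟨h1, h2⟩
        exact ⟨h1, hBsub.trans h2⟩
  rw [pt, pt, hset]
  split_ifs with h
  · rw [Finset.sum_insert]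
    · abel
    · intro h'
      exact hτ.not_compl_subset hV hB hB₀ (Finset.mem_filter.1 h').2
  · rw [add_zero]

/-- Three edges that meet in a vertex cannot be parallel. -/
theorem det_ne_zero_of_rigid (hu : ∑ e, u e = 0) (hτ : IsSplitSystem τ) (hr : IsRigid u τ)
    {T B₁ B₂ : Finset (Leaf r s E)} (hT : T ∈ rooted τ ρ) (hB₁ : B₁ ∈ rooted τ ρ)
    (hB₂ : B₂ ∈ rooted τ ρ) (hun : T = B₁ ∪ B₂) (hdis : Disjoint B₁ B₂) :
    det₂ (dirTo u B₁) (dirTo u B₂) ≠ 0 := by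
  intro hdet
  have hne1 : B₁.Nonempty := hτ.block_nonempty (Or.inl (mem_rooted.1 hB₁).1)
  have hne2 : B₂.Nonempty := hτ.block_nonempty (Or.inl (mem_rooted.1 hB₂).1)
  have h12 : B₁ ≠ B₂ := by
    rintro rfl
    exact hne1.ne_empty (Finset.disjoint_self_iff_empty _ |>.1 hdis)
  have hT1 : T ≠ B₁ := by
    rintro h
    obtain ⟨y, hy⟩ := hne2
    exact Finset.disjoint_left.1 hdis (h ▸ hun ▸ Finset.mem_union_right _ hy) hy
  have hT2 : T ≠ B₂ := by
    rintro h
    obtain ⟨y, hy⟩ := hne1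
    exact Finset.disjoint_left.1 hdis hy (h ▸ hun ▸ Finset.mem_union_left _ hy)
  have hdir : dirTo u T = dirTo u B₁ + dirTo u B₂ := by
    rw [hun, dirTo, Finset.sum_union hdis]; rfl
  have key : ∀ α β γ : ℝ,
      (∀ v : ℝ × ℝ, v = dirR u B₁ → α • dirR u T + β • v = 0) →
      (∀ v : ℝ × ℝ, v = dirR u B₂ → α • dirR u T + γ • v = 0) → α = 0 ∧ β = 0 ∧ γ = 0 := by
    intro α β γ h1 h2
    set x : Finset (Leaf r s E) → ℝ := fun S =>
      (if S = T then α else 0) + (if S = B₁ then β else 0) + (if S = B₂ then γ else 0) with hx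
    have h0 : config u τ ρ 0 x = config u τ ρ 0 0 := by
      simp only [config, hx, add_smul, ite_smul, zero_smul, Finset.sum_add_distrib,
        Finset.sum_ite_eq', hT, hB₁, hB₂, if_true, Pi.zero_apply, Finset.sum_const_zero]
      congr 1
      funext j
      simp only [Pi.add_apply, Pi.smul_apply, Pi.zero_apply, edgeVec]
      have hj : Sum.inl j ∈ T ↔ Sum.inl j ∈ B₁ ∨ Sum.inl j ∈ B₂ := by rw [hun, Finset.mem_union]
      by_cases j1 : Sum.inl j ∈ B₁
      · have j2 : Sum.inl j ∉ B₂ := Finset.disjoint_left.1 hdis j1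
        rw [if_pos (hj.2 (Or.inl j1)), if_pos j1, if_neg j2, smul_zero, add_zero]
        exact h1 _ rfl
      · by_cases j2 : Sum.inl j ∈ B₂
        · rw [if_pos (hj.2 (Or.inr j2)), if_neg j1, if_pos j2, smul_zero, add_zero]
          exact h2 _ rfl
        · rw [if_neg (by rw [hj]; tauto), if_neg j1, if_neg j2]
          simp
    have h3 := (config_injective hu hτ hr ρ h0).2
    have e0 := h3 T hT
    have e1 := h3 B₁ hB₁
    have e2 := h3 B₂ hB₂
    simp only [hx, hT1, hT2, hT1.symm, hT2.symm, h12, h12.symm, if_false, if_true, zero_add,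
      add_zero, Pi.zero_apply] at e0 e1 e2
    exact ⟨e0, e1, e2⟩
  have hd : ((dirTo u B₁).1 : ℝ) * (dirTo u B₂).2 - (dirTo u B₁).2 * (dirTo u B₂).1 = 0 := by
    exact_mod_cast hdet
  have hTR : dirR u T = dirR u B₁ + dirR u B₂ := by
    unfold dirR; rw [hdir]; ext <;> simp
  have comp : ∀ p q : ℝ, p * (dirTo u B₂).1 = q * (dirTo u B₁).1 →
      p * (dirTo u B₂).2 = q * (dirTo u B₁).2 → p = 0 := by
    intro p q hp1 hp2
    by_contra hp
    -- If p d₂ = q d₁, these changes of the three lengths leave both outer ends of the vertex fixed: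
    -- the vertex slides along the common line. Rigidity forces them to vanish, hence p² = 0.
    obtain ⟨ha, -, hc⟩ := key (p * q) (-(p * q + q * q)) (-(p * q + p * p))
      (by
        rintro v rfl
        rw [hTR]
        ext
        · simp only [dirR, Prod.fst_add, Prod.smul_fst, smul_eq_mul, Prod.fst_zero]
          linear_combination q * hp1
        · simp only [dirR, Prod.snd_add, Prod.smul_snd, smul_eq_mul, Prod.snd_zero]
          linear_combination q * hp2)
      (by
        rintro v rfl
        rw [hTR]
        ext
        · simp only [dirR, Prod.fst_add, Prod.smul_fst, smul_eq_mul, Prod.fst_zero]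
          linear_combination (-p) * hp1
        · simp only [dirR, Prod.snd_add, Prod.smul_snd, smul_eq_mul, Prod.snd_zero]
          linear_combination (-p) * hp2)
    rw [ha, zero_add, neg_eq_zero] at hc
    exact hp (mul_self_eq_zero.1 hc)
  have d1 := comp (dirTo u B₁).1 (dirTo u B₂).1 (by ring) (by linarith)
  have d2 := comp (dirTo u B₁).2 (dirTo u B₂).2 (by linarith) (by ring)
  have h0 : dirR u B₁ = 0 := by
    ext
    · exact d1
    · exact d2
  obtain ⟨-, h1, -⟩ := key 0 1 0 (by rintro v rfl; simp [h0]) (by rintro v rfl; simp)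
  exact one_ne_zero h1

/-- A rigid curve of maximal dimension through `P`, seen from the marking `m`. -/
structure IsCurve (u : E → ℤ × ℤ) (P : Fin r ⊕ Fin s → ℝ × ℝ) (m : Fin r ⊕ Fin s)
    (τ : Finset (Finset (Leaf r s E))) (x : Finset (Leaf r s E) → ℝ) : Prop where
  sum_zero : ∑ e, u e = 0
  top : IsTop τ
  rigid : IsRigid u τ
  card : τ.card + 4 = 4 * (r + s)
  pos : ∀ S ∈ rooted τ (Sum.inl m), 0 < x S
  eq : P = config u τ (Sum.inl m) (P m) x
  inj : Function.Injective P

theorem IsGeneric.isCurve (hu : ∑ e, u e = 0) (hE : Fintype.card E = r + 1 + 2 * s)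
    {P : Fin r ⊕ Fin s → ℝ × ℝ} (hP : IsGeneric u P) (h : Realizes u P τ) (m : Fin r ⊕ Fin s) :
    ∃ x, IsCurve u P m τ x := by
  have ht := hP.isTop h
  have hr := hP.isRigid hu m h
  have htop := ht.evSpan_eq_top hr hE m
  obtain ⟨w, hw⟩ := config_edgeLen hu ht.1 (Sum.inl m) (P := P) (htop ▸ Submodule.mem_top)
  refine ⟨edgeLen u τ (Sum.inl m) P, hu, ht, hr, ht.card_eq hr hE m,
    (realizes_iff_edgeLen hu ht hr htop m _ P).1 h, ?_, hP.1⟩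
  have : P m = w := by
    conv_lhs => rw [hw]
    rw [config, Pi.add_apply, Finset.sum_apply, Finset.sum_eq_zero, add_zero]
    intro S hS
    rw [Pi.smul_apply, edgeVec, if_neg (mem_rooted.1 hS).2, smul_zero]
  rw [this]
  exact hw

namespace IsCurve

variable {P : Fin r ⊕ Fin s → ℝ × ℝ} {m : Fin r ⊕ Fin s} {x : Finset (Leaf r s E) → ℝ}

/-- The position of the vertex in which a branch begins. -/
abbrev ptOf (P : Fin r ⊕ Fin s → ℝ × ℝ) (u : E → ℤ × ℤ) (m : Fin r ⊕ Fin s)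
    (τ : Finset (Finset (Leaf r s E))) (x : Finset (Leaf r s E) → ℝ) (S : Finset (Leaf r s E)) :
    ℝ × ℝ := pt u τ (Sum.inl m) (P m) x S

theorem three_le (c : IsCurve u P m τ x) (hL : 3 ≤ Fintype.card (Leaf r s E)) {A : Finset (Leaf r s E)}
    (hA : A ∈ rooted τ (Sum.inl m)) : ∃ V ∈ treeStars τ, Aᶜ ∈ V :=
  c.top.1.exists_star hL (Or.inl (c.top.1.compl_mem _ (mem_rooted.1 hA).1))

theorem sum_excess (c : IsCurve u P m τ x) {A : Finset (Leaf r s E)} (hA : A ∈ τ)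
    (hV : V ∈ treeStars τ) (hAV : Aᶜ ∈ V) :
    ∑ B ∈ V.erase Aᶜ, excess τ B = excess τ A + 1 := by
  rw [← excess_compl c.top.1 hV hAV, compl_compl, if_pos hA]

theorem excess_nonneg (c : IsCurve u P m τ x) (hV : V ∈ treeStars τ) {B : Finset (Leaf r s E)}
    (hB : B ∈ V) : 0 ≤ excess τ B :=
  MetricTree.excess_nonneg c.sum_zero c.top.1 c.rigid (c.top.1.star_ne_univ hV hB)

theorem erase_pair (c : IsCurve u P m τ x) {A : Finset (Leaf r s E)} (hV : V ∈ treeStars τ)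
    (hAV : A ∈ V) (hno : NoMarking V) :
    ∃ B T, B ≠ T ∧ V.erase A = {B, T} ∧ V = {A, B, T} := by
  have h3 := (c.top.2 V hV).2 hno.not_thick
  obtain ⟨B, T, hBT, h⟩ := Finset.card_eq_two.1
    (show (V.erase A).card = 2 by rw [Finset.card_erase_of_mem hAV, h3])
  exact ⟨B, T, hBT, h, by rw [← h, Finset.insert_erase hAV]⟩

theorem mem_of_excess_one (c : IsCurve u P m τ x) (hV : V ∈ treeStars τ) {T : Finset (Leaf r s E)}
    (hT : T ∈ V) (h1 : excess τ T = 1) : T ∈ τ := by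
  rcases (mem_treeStars.1 hV).1 T hT with h | h
  · exact h
  · exfalso
    obtain ⟨y, rfl⟩ := Finset.card_eq_one.1 h
    rcases y with j | e
    · rw [excess_marking c.top.1] at h1; omega
    · rw [excess_end c.top.1] at h1; omega

theorem root_notMem (hV : V ∈ treeStars τ) {A B : Finset (Leaf r s E)} {ρ : Leaf r s E}
    (hA : A ∈ V) (hρ : ρ ∈ A) (hB : B ∈ V) (hne : B ≠ A) : ρ ∉ B :=
  fun h => hne (star_eq_of_mem hV hB hA h hρ)

/-- The branches that follow a branch of excess `0`. -/
theorem branch_zero (c : IsCurve u P m τ x) {A : Finset (Leaf r s E)}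
    (hA : A ∈ rooted τ (Sum.inl m)) (h0 : excess τ A = 0) (hV : V ∈ treeStars τ) (hAV : Aᶜ ∈ V) :
    ∃ B T, V = {Aᶜ, B, T} ∧ B ≠ Aᶜ ∧ T ≠ Aᶜ ∧ B ≠ T ∧ excess τ B = 0 ∧ excess τ T = 1 ∧
      T ∈ rooted τ (Sum.inl m) := by
  obtain ⟨hAτ, hAm⟩ := mem_rooted.1 hA
  have hsum := c.sum_excess hAτ hV hAV
  rw [h0] at hsum
  have hmA : Sum.inl m ∈ Aᶜ := Finset.mem_compl.2 hAm
  have hno : NoMarking V := by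
    intro j hj
    by_cases hjA : ({Sum.inl j} : Finset (Leaf r s E)) = Aᶜ
    · have := c.top.1.two_le_card _ (c.top.1.compl_mem _ hAτ)
      rw [← hjA, Finset.card_singleton] at this
      omega
    -- A marking at this vertex would have excess 2, but all branches together have excess 1.
    · have h1 := Finset.single_le_sum (f := fun B => excess τ B)
        (fun B hB => c.excess_nonneg hV (Finset.mem_of_mem_erase hB))
        (Finset.mem_erase.2 ⟨hjA, hj⟩)
      simp only [excess_marking c.top.1] at h1
      omega
  obtain ⟨B, T, hBT, he, hVe⟩ := c.erase_pair hV hAV hno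
  have hB : B ∈ V.erase Aᶜ := by rw [he]; simp
  have hT : T ∈ V.erase Aᶜ := by rw [he]; simp
  rw [he, Finset.sum_pair hBT] at hsum
  have n1 := c.excess_nonneg hV (Finset.mem_of_mem_erase hB)
  have n2 := c.excess_nonneg hV (Finset.mem_of_mem_erase hT)
  rcases (show (excess τ B = 0 ∧ excess τ T = 1) ∨ (excess τ T = 0 ∧ excess τ B = 1) by omega) with
    ⟨h1, h2⟩ | ⟨h1, h2⟩
  · exact ⟨B, T, hVe, Finset.ne_of_mem_erase hB, Finset.ne_of_mem_erase hT, hBT, h1, h2,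
      mem_rooted.2 ⟨c.mem_of_excess_one hV (Finset.mem_of_mem_erase hT) h2,
        root_notMem hV hAV hmA (Finset.mem_of_mem_erase hT) (Finset.ne_of_mem_erase hT)⟩⟩
  · exact ⟨T, B, by rw [hVe, Finset.pair_comm], Finset.ne_of_mem_erase hT, Finset.ne_of_mem_erase hB,
      hBT.symm, h1, h2, mem_rooted.2 ⟨c.mem_of_excess_one hV (Finset.mem_of_mem_erase hB) h2,
        root_notMem hV hAV hmA (Finset.mem_of_mem_erase hB) (Finset.ne_of_mem_erase hB)⟩⟩

theorem star_three (hV : V ∈ treeStars τ) {A B T : Finset (Leaf r s E)} (hVe : V = {Aᶜ, B, T})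
    (hBA : B ≠ Aᶜ) (hTA : T ≠ Aᶜ) (hBT : B ≠ T) : A = B ∪ T ∧ Disjoint B T := by
  have hA : Aᶜ ∈ V := by simp [hVe]
  have hB : B ∈ V := by simp [hVe]
  have hT : T ∈ V := by simp [hVe]
  refine ⟨?_, (mem_treeStars.1 hV).2.1 B hB T hT hBT⟩
  have hB1 := star_subset_compl hV hB hA hBA
  have hT1 := star_subset_compl hV hT hA hTA
  rw [compl_compl] at hB1 hT1
  refine Finset.Subset.antisymm ?_ (Finset.union_subset hB1 hT1)
  intro y hy
  obtain ⟨C, hC, hyC⟩ := (mem_treeStars.1 hV).2.2.1 y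
  rw [hVe, Finset.mem_insert, Finset.mem_insert, Finset.mem_singleton] at hC
  rcases hC with rfl | rfl | rfl
  · exact absurd hy (Finset.mem_compl.1 hyC)
  · exact Finset.mem_union_left _ hyC
  · exact Finset.mem_union_right _ hyC

theorem dirTo_union {B T : Finset (Leaf r s E)} (h : Disjoint B T) :
    dirTo u (B ∪ T) = dirTo u B + dirTo u T := by
  rw [dirTo, Finset.sum_union h]; rfl

/-- A branch of excess `1` begins in another marking, or with two branches of excess `1`. -/
theorem branch_one (c : IsCurve u P m τ x) (hL : 3 ≤ Fintype.card (Leaf r s E))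
    {T : Finset (Leaf r s E)} (hT : T ∈ rooted τ (Sum.inl m)) (h1 : excess τ T = 1) :
    (∃ j, j ≠ m ∧ ptOf P u m τ x T = P j) ∨
    ∃ B₁ B₂, B₁ ∈ rooted τ (Sum.inl m) ∧ B₂ ∈ rooted τ (Sum.inl m) ∧ T = B₁ ∪ B₂ ∧
      Disjoint B₁ B₂ ∧ excess τ B₁ = 1 ∧ excess τ B₂ = 1 ∧
      det₂ (dirTo u B₁) (dirTo u B₂) ≠ 0 ∧
      ptOf P u m τ x B₁ = ptOf P u m τ x T + x B₁ • dirR u B₁ ∧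
      ptOf P u m τ x B₂ = ptOf P u m τ x T + x B₂ • dirR u B₂ := by
  obtain ⟨hTτ, hTm⟩ := mem_rooted.1 hT
  obtain ⟨V, hV, hTV⟩ := c.three_le hL hT
  have hsum := c.sum_excess hTτ hV hTV
  rw [h1] at hsum
  have hmT : Sum.inl m ∈ Tᶜ := Finset.mem_compl.2 hTm
  have hchild := fun B (hB : B ∈ V) (hne : B ≠ Tᶜ) =>
    pt_child (u := u) c.top.1 hV hTV hmT hB hne (P m) x
  simp only [compl_compl] at hchild
  by_cases hno : NoMarking V
  · right
    obtain ⟨B₁, B₂, h12, he, hVe⟩ := c.erase_pair hV hTV hno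
    have hB1 : B₁ ∈ V.erase Tᶜ := by rw [he]; simp
    have hB2 : B₂ ∈ V.erase Tᶜ := by rw [he]; simp
    rw [he, Finset.sum_pair h12] at hsum
    -- The total is 2 and neither of the two branches exceeds 1, so both have excess 1; in
    -- particular they are bounded edges.
    have hle : ∀ B ∈ V.erase Tᶜ, excess τ B ≤ 1 := by
      intro B hB
      rcases (mem_treeStars.1 hV).1 B (Finset.mem_of_mem_erase hB) with h | h
      · exact excess_le_one c.sum_zero c.top.1 c.rigid c.card h
      · obtain ⟨y, rfl⟩ := Finset.card_eq_one.1 h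
        rcases y with j | e
        · exact absurd (Finset.mem_of_mem_erase hB) (hno j)
        · rw [excess_end c.top.1]; omega
    have l1 := hle B₁ hB1
    have l2 := hle B₂ hB2
    have x1 : excess τ B₁ = 1 := by omega
    have x2 : excess τ B₂ = 1 := by omega
    have r1 : B₁ ∈ rooted τ (Sum.inl m) :=
      mem_rooted.2 ⟨c.mem_of_excess_one hV (Finset.mem_of_mem_erase hB1) x1,
        root_notMem hV hTV hmT (Finset.mem_of_mem_erase hB1) (Finset.ne_of_mem_erase hB1)⟩
    have r2 : B₂ ∈ rooted τ (Sum.inl m) :=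
      mem_rooted.2 ⟨c.mem_of_excess_one hV (Finset.mem_of_mem_erase hB2) x2,
        root_notMem hV hTV hmT (Finset.mem_of_mem_erase hB2) (Finset.ne_of_mem_erase hB2)⟩
    obtain ⟨hun, hdis⟩ := star_three hV hVe (Finset.ne_of_mem_erase hB1)
      (Finset.ne_of_mem_erase hB2) h12
    refine ⟨B₁, B₂, r1, r2, hun, hdis, x1, x2,
      det_ne_zero_of_rigid c.sum_zero c.top.1 c.rigid hT r1 r2 hun hdis, ?_, ?_⟩
    · have := hchild B₁ (Finset.mem_of_mem_erase hB1) (Finset.ne_of_mem_erase hB1)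
      rwa [if_pos (mem_rooted.1 r1).1] at this
    · have := hchild B₂ (Finset.mem_of_mem_erase hB2) (Finset.ne_of_mem_erase hB2)
      rwa [if_pos (mem_rooted.1 r2).1] at this
  · left
    unfold NoMarking at hno
    push Not at hno
    obtain ⟨j, hj⟩ := hno
    have hjT : ({Sum.inl j} : Finset (Leaf r s E)) ≠ Tᶜ := by
      intro h
      have := c.top.1.two_le_card _ (c.top.1.compl_mem _ hTτ)
      rw [← h, Finset.card_singleton] at this
      omega
    have hjτ : ({Sum.inl j} : Finset (Leaf r s E)) ∉ τ := by
      intro h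
      have := c.top.1.two_le_card _ h
      rw [Finset.card_singleton] at this
      omega
    have h2 := hchild _ hj hjT
    rw [if_neg hjτ, add_zero] at h2
    refine ⟨j, ?_, ?_⟩
    · rintro rfl
      exact root_notMem hV hTV hmT hj hjT (Finset.mem_singleton_self _)
    · exact h2.symm.trans ((config_eq_pt _ _ j).symm.trans (congrFun c.eq.symm j))

/-- The point `y` is the intersection of two lines of directions bounded by `D` through points of
size at most `K`. The moments of these lines are at most 2DK, and the determinant in Cramer's rule
is a nonzero integer, so it has absolute value at least 1. -/
theorem cramer {D K : ℝ} (hD : 1 ≤ D) (hK : 0 ≤ K) {d₁ d₂ : ℤ × ℤ} (hdet : det₂ d₁ d₂ ≠ 0)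
    (h1 : |(d₁.1 : ℝ)| ≤ D ∧ |(d₁.2 : ℝ)| ≤ D) (h2 : |(d₂.1 : ℝ)| ≤ D ∧ |(d₂.2 : ℝ)| ≤ D)
    {y p₁ p₂ : ℝ × ℝ} {t₁ t₂ : ℝ} (e1 : p₁ = y + t₁ • ((d₁.1 : ℝ), (d₁.2 : ℝ)))
    (e2 : p₂ = y + t₂ • ((d₂.1 : ℝ), (d₂.2 : ℝ))) (b1 : |p₁.1| ≤ K ∧ |p₁.2| ≤ K)
    (b2 : |p₂.1| ≤ K ∧ |p₂.2| ≤ K) : |y.1| ≤ 4 * D ^ 2 * K ∧ |y.2| ≤ 4 * D ^ 2 * K := by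
  have hdet1 : 1 ≤ |((det₂ d₁ d₂ : ℤ) : ℝ)| := by
    rw [← Int.cast_abs]
    exact_mod_cast Int.one_le_abs hdet
  have hb : ∀ (d : ℤ × ℤ) (p : ℝ × ℝ), (|(d.1 : ℝ)| ≤ D ∧ |(d.2 : ℝ)| ≤ D) →
      (|p.1| ≤ K ∧ |p.2| ≤ K) → |(d.1 : ℝ) * p.2 - d.2 * p.1| ≤ 2 * D * K := by
    intro d p hd hp
    calc _ ≤ |(d.1 : ℝ) * p.2| + |(d.2 : ℝ) * p.1| := abs_sub _ _
      _ ≤ D * K + D * K := by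
        rw [abs_mul, abs_mul]
        gcongr
        · exact hd.1
        · exact hp.2
        · exact hd.2
        · exact hp.1
      _ = 2 * D * K := by ring
  have c1 := hb d₁ p₁ h1 b1
  have c2 := hb d₂ p₂ h2 b2
  have k1 : (d₁.1 : ℝ) * p₁.2 - d₁.2 * p₁.1 = d₁.1 * y.2 - d₁.2 * y.1 := by
    rw [e1]; simp; ring
  have k2 : (d₂.1 : ℝ) * p₂.2 - d₂.2 * p₂.1 = d₂.1 * y.2 - d₂.2 * y.1 := by
    rw [e2]; simp; ring
  rw [k1] at c1; rw [k2] at c2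
  have hc : ((det₂ d₁ d₂ : ℤ) : ℝ) = d₁.1 * d₂.2 - d₁.2 * d₂.1 := by
    simp [det₂]
  have fin : ∀ z a b : ℝ, |a| ≤ D → |b| ≤ D →
      ((det₂ d₁ d₂ : ℤ) : ℝ) * z = (d₁.1 * y.2 - d₁.2 * y.1) * a - (d₂.1 * y.2 - d₂.2 * y.1) * b →
      |z| ≤ 4 * D ^ 2 * K := by
    intro z a b ha hb hz
    calc |z| ≤ |((det₂ d₁ d₂ : ℤ) : ℝ)| * |z| := le_mul_of_one_le_left (abs_nonneg _) hdet1
      _ = |(d₁.1 * y.2 - d₁.2 * y.1) * a - (d₂.1 * y.2 - d₂.2 * y.1) * b| := by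
        rw [← abs_mul, hz]
      _ ≤ |(d₁.1 * y.2 - d₁.2 * y.1) * a| + |(d₂.1 * y.2 - d₂.2 * y.1) * b| := abs_sub _ _
      _ ≤ 2 * D * K * D + 2 * D * K * D := by
        rw [abs_mul, abs_mul]
        gcongr
      _ = 4 * D ^ 2 * K := by ring
  refine ⟨fin y.1 d₂.1 d₁.1 h2.1 h1.1 ?_, fin y.2 d₂.2 d₁.2 h2.2 h1.2 ?_⟩
  · rw [hc]; ring
  · rw [hc]; ring

/-- The branches of excess `1` begin in a bounded region. -/
theorem pt_bounded (c : IsCurve u P m τ x) (hL : 3 ≤ Fintype.card (Leaf r s E)) {D K : ℝ}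
    (hD : 1 ≤ D) (hK : 0 ≤ K)
    (hdir : ∀ S : Finset (Leaf r s E), |((dirTo u S).1 : ℝ)| ≤ D ∧ |((dirTo u S).2 : ℝ)| ≤ D)
    (hP : ∀ j, j ≠ m → |(P j).1| ≤ K ∧ |(P j).2| ≤ K) :
    ∀ n, ∀ T : Finset (Leaf r s E), T.card ≤ n → T ∈ rooted τ (Sum.inl m) → excess τ T = 1 →
      |(ptOf P u m τ x T).1| ≤ (4 * D ^ 2) ^ n * K ∧ |(ptOf P u m τ x T).2| ≤ (4 * D ^ 2) ^ n * K := by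
  have h4 : 1 ≤ 4 * D ^ 2 := by nlinarith
  intro n
  induction n with
  | zero =>
    intro T hT hTr _
    have := c.top.1.two_le_card _ (mem_rooted.1 hTr).1
    omega
  | succ n ih =>
    intro T hT hTr h1
    rcases c.branch_one hL hTr h1 with ⟨j, hj, he⟩ | ⟨B₁, B₂, r1, r2, hun, hdis, x1, x2, hdet, e1, e2⟩
    · rw [he]
      have h := one_le_pow₀ (n := n + 1) h4
      have h2 : K ≤ (4 * D ^ 2) ^ (n + 1) * K := le_mul_of_one_le_left hK h
      exact ⟨(hP j hj).1.trans h2, (hP j hj).2.trans h2⟩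
    · have hc : T.card = B₁.card + B₂.card := by rw [hun, Finset.card_union_of_disjoint hdis]
      have hc1 := c.top.1.two_le_card _ (mem_rooted.1 r1).1
      have hc2 := c.top.1.two_le_card _ (mem_rooted.1 r2).1
      have := cramer hD (by positivity) hdet (hdir B₁) (hdir B₂) e1 e2 (ih B₁ (by omega) r1 x1)
        (ih B₂ (by omega) r2 x2)
      rw [pow_succ']
      simpa only [mul_assoc] using this

end IsCurve

end Positions

/-! ### Paths that start at a marking far away. -/

namespace IsCurve

variable {r s : ℕ} {E : Type} [Fintype E] [DecidableEq E] {u : E → ℤ × ℤ}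
  {τ : Finset (Finset (Leaf r s E))} {V : Finset (Finset (Leaf r s E))}
  {P : Fin r ⊕ Fin s → ℝ × ℝ} {m : Fin r ⊕ Fin s} {x : Finset (Leaf r s E) → ℝ}

/-- The length of a contracted bounded edge could be changed without moving any marking. -/
theorem dirTo_ne_zero (c : IsCurve u P m τ x) {S : Finset (Leaf r s E)}
    (hS : S ∈ rooted τ (Sum.inl m)) : dirTo u S ≠ 0 := by
  intro h
  have h0 : config u τ (Sum.inl m) 0 (Pi.single S 1) = config u τ (Sum.inl m) 0 0 := by
    simp only [config, Pi.single_apply, ite_smul, zero_smul, Finset.sum_ite_eq', hS, if_true,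
      one_smul, Pi.zero_apply, Finset.sum_const_zero]
    congr 1
    funext j
    simp [edgeVec, dirR, h]
  have := (config_injective c.sum_zero c.top.1 c.rigid _ h0).2 S hS
  simp at this

/-- The first step on a path of branches of excess `0`. -/
theorem path_step (c : IsCurve u P m τ x) (hL : 3 ≤ Fintype.card (Leaf r s E))
    {A : Finset (Leaf r s E)} (hA : A ∈ rooted τ (Sum.inl m)) (h0 : excess τ A = 0) :
    ∃ B T, {Aᶜ, B, T} ∈ treeStars τ ∧ IsBlock τ B ∧ Sum.inl m ∉ B ∧ excess τ B = 0 ∧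
      T ∈ rooted τ (Sum.inl m) ∧ excess τ T = 1 ∧ dirTo u A = dirTo u B + dirTo u T ∧
      ptOf P u m τ x T = ptOf P u m τ x A + x T • dirR u T ∧ 0 < x T ∧
      (B ∈ τ → ptOf P u m τ x B = ptOf P u m τ x A + x B • dirR u B ∧ 0 < x B) ∧
      B.card < A.card := by
  obtain ⟨V, hV, hAV⟩ := c.three_le hL hA
  obtain ⟨B, T, hVe, hBA, hTA, hBT, b0, t1, hT⟩ := c.branch_zero hA h0 hV hAV
  obtain ⟨hun, hdis⟩ := star_three hV hVe hBA hTA hBT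
  have hB : B ∈ V := by simp [hVe]
  have hTV : T ∈ V := by simp [hVe]
  have hmA : Sum.inl m ∈ Aᶜ := Finset.mem_compl.2 (mem_rooted.1 hA).2
  have hBm := root_notMem hV hAV hmA hB hBA
  have hchild := fun B (hB : B ∈ V) (hne : B ≠ Aᶜ) =>
    pt_child (u := u) c.top.1 hV hAV hmA hB hne (P m) x
  simp only [compl_compl] at hchild
  refine ⟨B, T, hVe ▸ hV, (mem_treeStars.1 hV).1 B hB, hBm, b0, hT, t1, ?_, ?_, c.pos T hT, ?_, ?_⟩
  · rw [hun, dirTo_union hdis]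
  · have := hchild T hTV hTA
    rwa [if_pos (mem_rooted.1 hT).1] at this
  · intro hBτ
    have := hchild B hB hBA
    rw [if_pos hBτ] at this
    exact ⟨this, c.pos B (mem_rooted.2 ⟨hBτ, hBm⟩)⟩
  · rw [hun, Finset.card_union_of_disjoint hdis]
    have := Finset.card_pos.2 (c.top.1.star_nonempty hV hTV)
    omega

theorem end_or_mem (c : IsCurve u P m τ x) {A : Finset (Leaf r s E)} (hA : IsBlock τ A)
    (h0 : excess τ A = 0) : (∃ e, A = {Sum.inr e}) ∨ A ∈ τ := by
  rcases hA with h | h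
  · exact Or.inr h
  · obtain ⟨y, rfl⟩ := Finset.card_eq_one.1 h
    rcases y with j | e
    · rw [excess_marking c.top.1] at h0; omega
    · exact Or.inl ⟨e, rfl⟩

theorem dirTo_end (e : E) : dirTo (r := r) (s := s) u {Sum.inr e} = u e := by
  simp [dirTo]

/-- The marking `m` lies far away in the direction of the first basis vector, but also far away from
the line through the origin in this direction. -/
structure IsFar (u : E → ℤ × ℤ) (P : Fin r ⊕ Fin s → ℝ × ℝ) (m : Fin r ⊕ Fin s)
    (τ : Finset (Finset (Leaf r s E))) (x : Finset (Leaf r s E) → ℝ) (D K : ℝ) : Prop where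
  one_le : 1 ≤ D
  nonneg : 0 ≤ K
  dir_le : ∀ S : Finset (Leaf r s E), |((dirTo u S).1 : ℝ)| ≤ D ∧ |((dirTo u S).2 : ℝ)| ≤ D
  bounded : ∀ T ∈ rooted τ (Sum.inl m), excess τ T = 1 →
    |(ptOf P u m τ x T).1| ≤ K ∧ |(ptOf P u m τ x T).2| ≤ K
  lt_snd : K < (P m).2
  lt_fst : D * (P m).2 + 2 * D ^ 2 * ((P m).2 + K) + 2 * D * K * (Fintype.card (Leaf r s E) + 1)
    + K + 1 < (P m).1

/-- Suppose the branch is bounded. Its next vertex is still higher than `K`, so the branch of excess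
1 there must descend. Then the continuing branch rises with slope component at least 2; by induction
it is an end, but ends rise by at most 1. -/
theorem path_up (c : IsCurve u P m τ x) (hL : 3 ≤ Fintype.card (Leaf r s E)) {D K : ℝ}
    (hf : IsFar u P m τ x D K) (hu1 : ∀ e, (u e).2 ≤ 1) :
    ∀ n, ∀ A : Finset (Leaf r s E), A.card ≤ n → IsBlock τ A → Sum.inl m ∉ A → excess τ A = 0 →
      ∀ y₀ : ℝ × ℝ, (A ∈ τ → ptOf P u m τ x A = y₀ + x A • dirR u A) → (P m).2 ≤ y₀.2 →
      1 ≤ (dirTo u A).2 → ∃ e, A = {Sum.inr e} := by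
  intro n
  induction n with
  | zero =>
    intro A hA hAb _ _ _ _ _ _
    have := Finset.card_pos.2 (c.top.1.block_nonempty hAb)
    omega
  | succ n ih =>
    intro A hAn hAb hAm h0 y₀ hy hy0 hdir
    rcases c.end_or_mem hAb h0 with h | hAτ
    · exact h
    exfalso
    have hA := mem_rooted.2 ⟨hAτ, hAm⟩
    obtain ⟨B, T, -, hBb, hBm, b0, hT, t1, hd, hpt, hx, hB, hcard⟩ := c.path_step hL hA h0
    have hyA : (P m).2 ≤ (ptOf P u m τ x A).2 := by
      rw [hy hAτ]
      simp only [Prod.snd_add, Prod.smul_snd, smul_eq_mul, dirR]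
      have h1 : (1 : ℝ) ≤ ((dirTo u A).2 : ℝ) := by exact_mod_cast hdir
      have := c.pos A hA
      nlinarith
    have hT2 : (dirTo u T).2 < 0 := by
      by_contra hcon
      push Not at hcon
      have h1 : (0 : ℝ) ≤ ((dirTo u T).2 : ℝ) := by exact_mod_cast hcon
      have h2 := (abs_le.1 (hf.bounded T hT t1).2).2
      rw [hpt] at h2
      simp only [Prod.snd_add, Prod.smul_snd, smul_eq_mul, dirR] at h2
      have := hf.lt_snd
      nlinarith [mul_nonneg hx.le h1]
    have hB2 : 2 ≤ (dirTo u B).2 := by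
      have := congrArg Prod.snd hd
      simp only [Prod.snd_add] at this
      omega
    obtain ⟨e, rfl⟩ := ih B (by omega) hBb hBm b0 _ (fun h => (hB h).1) hyA (by omega)
    have := hu1 e
    rw [dirTo_end] at hB2
    omega

/-- A bounded horizontal branch leads to a vertex at the height of the marking, from which a branch
of excess 1 descends to the bounded region. The path continues upwards, hence with an end. A branch
to the right is impossible, because the descent from there would be too short to come back. -/
theorem path_zero (c : IsCurve u P m τ x) (hL : 3 ≤ Fintype.card (Leaf r s E)) {D K : ℝ}
    (hf : IsFar u P m τ x D K) (hu1 : ∀ e, (u e).2 ≤ 1) {A : Finset (Leaf r s E)}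
    (hAb : IsBlock τ A) (hAm : Sum.inl m ∉ A) (h0 : excess τ A = 0)
    (hy : A ∈ τ → ptOf P u m τ x A = P m + x A • dirR u A) (hdir : (dirTo u A).2 = 0) :
    (∃ e, A = {Sum.inr e}) ∨ ((dirTo u A).1 < 0 ∧ ∃ e T, {Aᶜ, {Sum.inr e}, T} ∈ treeStars τ ∧
      T ∈ rooted τ (Sum.inl m) ∧ (u e).2 = 1) := by
  rcases c.end_or_mem hAb h0 with h | hAτ
  · exact Or.inl h
  right
  have hA := mem_rooted.2 ⟨hAτ, hAm⟩
  obtain ⟨B, T, hV, hBb, hBm, b0, hT, t1, hd, hpt, hx, hB, hcard⟩ := c.path_step hL hA h0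
  have hyA : (ptOf P u m τ x A).2 = (P m).2 := by
    rw [hy hAτ]
    simp [dirR, hdir]
  obtain ⟨hb1, hb2⟩ := hf.bounded T hT t1
  have hT2 : (dirTo u T).2 < 0 := by
    by_contra hcon
    push Not at hcon
    have h1 : (0 : ℝ) ≤ ((dirTo u T).2 : ℝ) := by exact_mod_cast hcon
    have h2 := (abs_le.1 hb2).2
    rw [hpt] at h2
    simp only [Prod.snd_add, Prod.smul_snd, smul_eq_mul, dirR, hyA] at h2
    have := hf.lt_snd
    nlinarith [mul_nonneg hx.le h1]
  have hB2 : 1 ≤ (dirTo u B).2 := by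
    have := congrArg Prod.snd hd
    simp only [Prod.snd_add] at this
    omega
  obtain ⟨e, rfl⟩ := c.path_up hL hf hu1 _ B le_rfl hBb hBm b0 _ (fun h => (hB h).1) hyA.ge hB2
  rw [dirTo_end] at hB2 hd
  refine ⟨?_, e, T, hV, hT, le_antisymm (hu1 e) hB2⟩
  by_contra hcon
  push Not at hcon
  have h1 : (0 : ℝ) ≤ ((dirTo u A).1 : ℝ) := by exact_mod_cast hcon
  have h2 : ((dirTo u T).2 : ℝ) ≤ -1 := by exact_mod_cast (by omega : (dirTo u T).2 ≤ -1)
  have e2 := (abs_le.1 hb2).1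
  have e1 := (abs_le.1 hb1).2
  rw [hpt] at e1 e2
  simp only [Prod.snd_add, Prod.fst_add, Prod.smul_fst, Prod.smul_snd, smul_eq_mul, dirR, hyA]
    at e1 e2
  have hA1 : (P m).1 ≤ (ptOf P u m τ x A).1 := by
    rw [hy hAτ]
    simp only [Prod.fst_add, Prod.smul_fst, smul_eq_mul, dirR]
    have := mul_nonneg (c.pos A hA).le h1
    linarith
  -- `T` loses at least one unit of height per unit of length and stays above -K. So its horizontal
  -- drift is at most D times this bound, too small to reach abscissae of size at most `K`.
  have hxT : x T ≤ (P m).2 + K := by nlinarith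
  have hDT := (abs_le.1 (hf.dir_le T).1).1
  have hxD : x T * ((dirTo u T).1 : ℝ) ≥ -(((P m).2 + K) * D) := by
    have : x T * ((dirTo u T).1 : ℝ) ≥ x T * (-D) := mul_le_mul_of_nonneg_left hDT hx.le
    have h4 : x T * D ≤ ((P m).2 + K) * D :=
      mul_le_mul_of_nonneg_right hxT (zero_le_one.trans hf.one_le)
    linarith
  have hlt := hf.lt_fst
  have hD := hf.one_le
  have hK := hf.nonneg
  have hM : 0 ≤ (P m).2 := hK.trans hf.lt_snd.le
  have g1 : 0 ≤ D * (P m).2 := by positivity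
  have g2 : 0 ≤ 2 * D * K * (Fintype.card (Leaf r s E) + 1 : ℝ) := by positivity
  have g3 : ((P m).2 + K) * D ≤ 2 * D ^ 2 * ((P m).2 + K) := by
    have h5 : D ≤ 2 * D ^ 2 := by nlinarith
    have h6 : 0 ≤ (P m).2 + K := by linarith
    linarith [mul_le_mul_of_nonneg_left h5 h6]
  linarith

/-- Here (a₁, a₂) is the direction of a path at the point y, and (t₁, t₂) is the direction of a
branch from y to a point z of the bounded region. The moment of this branch about the origin is at
most 2DK. Thus the continuing path keeps a large moment, the branch must turn to a definite side,
and it must be long. -/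
theorem far_arith {D K M N x a₁ a₂ t₁ t₂ y₁ y₂ z₁ z₂ : ℝ} (hD : 1 ≤ D) (hK : 0 ≤ K) (hM : 0 ≤ M)
    (hN : 0 ≤ N) (hx : 0 < x) (hA1 : |a₁| ≤ D) (hA2 : |a₂| ≤ D) (hT1 : |t₁| ≤ D) (hT2 : |t₂| ≤ D)
    (hb1 : |z₁| ≤ K) (hb2 : |z₂| ≤ K) (hz1 : z₁ = y₁ + x * t₁) (hz2 : z₂ = y₂ + x * t₂)
    (hdet : 2 * D ^ 2 * (M + K) + 2 * D * K * (N + 1) + 1 ≤ a₁ * y₂ - a₂ * y₁) :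
    0 < a₂ * t₁ - a₁ * t₂ ∧ M + K < x ∧
      2 * D ^ 2 * (M + K) + 2 * D * K * N + 1 ≤ (a₁ - t₁) * y₂ - (a₂ - t₂) * y₁ := by
  have hD0 : 0 ≤ D := by linarith
  have hprod : ∀ p q C : ℝ, |p| ≤ D → |q| ≤ C → |p * q| ≤ D * C := by
    intro p q C hp hq
    rw [abs_mul]
    exact mul_le_mul hp hq (abs_nonneg _) hD0
  have k1 := (abs_le.1 (hprod _ _ _ hA1 hb2)).2
  have k2 := (abs_le.1 (hprod _ _ _ hA2 hb1)).1
  have k3 := (abs_le.1 (hprod _ _ _ hT1 hb2)).2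
  have k4 := (abs_le.1 (hprod _ _ _ hT2 hb1)).1
  have k5 := (abs_le.1 (hprod _ _ _ hA2 hT1)).2
  have k6 := (abs_le.1 (hprod _ _ _ hA1 hT2)).1
  have hDK : 0 ≤ D * K := by positivity
  have hDKN : 0 ≤ D * K * N := by positivity
  have hMK : 0 ≤ D ^ 2 * (M + K) := by positivity
  have e1 : x * (a₂ * t₁ - a₁ * t₂) = (a₁ * y₂ - a₂ * y₁) - (a₁ * z₂ - a₂ * z₁) := by
    rw [hz1, hz2]; ring
  have e2 : t₁ * y₂ - t₂ * y₁ = t₁ * z₂ - t₂ * z₁ := by rw [hz1, hz2]; ring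
  have hbig : 2 * D ^ 2 * (M + K) + 1 ≤ x * (a₂ * t₁ - a₁ * t₂) := by rw [e1]; linarith
  have hcross : 0 < a₂ * t₁ - a₁ * t₂ := (mul_pos_iff_of_pos_left hx).1 (by linarith)
  refine ⟨hcross, ?_, by linarith⟩
  by_contra hcon
  push Not at hcon
  have : x * (a₂ * t₁ - a₁ * t₂) ≤ (M + K) * (2 * D ^ 2) :=
    mul_le_mul hcon (by linarith) hcross.le (by linarith)
  linarith

/-- The induction keeps the moment of the path about the origin large: it is constant along an edge,
and each attached branch takes away at most 2DK, which is the reason for the factor `n + 1`. The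
attached branches turn out to be horizontal and to point to the left, so the vertical component
stays the one of the final end. -/
theorem path_down (c : IsCurve u P m τ x) (hL : 3 ≤ Fintype.card (Leaf r s E)) {D K : ℝ}
    (hf : IsFar u P m τ x D K) (hu2 : ∀ e, (u e).2 ≤ -1 → (u e).2 = -1 ∧ (u e).1 ≤ 0) :
    ∀ n, ∀ A : Finset (Leaf r s E), A.card ≤ n → IsBlock τ A → Sum.inl m ∉ A → excess τ A = 0 →
      ∀ y₀ : ℝ × ℝ, (A ∈ τ → ptOf P u m τ x A = y₀ + x A • dirR u A) → y₀.2 ≤ (P m).2 →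
      (dirTo u A).2 ≤ -1 →
      2 * D ^ 2 * ((P m).2 + K) + 2 * D * K * (n + 1) + 1 ≤
        ((dirTo u A).1 : ℝ) * y₀.2 - (dirTo u A).2 * y₀.1 →
      (dirTo u A).2 = -1 ∧ ((∃ e, A = {Sum.inr e}) ∨ ((dirTo u A).1 ≤ -1 ∧
        ((dirTo u A).1 = -1 → ∃ e T, {Aᶜ, {Sum.inr e}, T} ∈ treeStars τ ∧
          T ∈ rooted τ (Sum.inl m) ∧ u e = (0, -1)))) := by
  have hD := hf.one_le
  have hK := hf.nonneg
  have hM : 0 ≤ (P m).2 := hK.trans hf.lt_snd.le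
  intro n
  induction n with
  | zero =>
    intro A hA hAb _ _ _ _ _ _ _
    have := Finset.card_pos.2 (c.top.1.block_nonempty hAb)
    omega
  | succ n ih =>
    intro A hAn hAb hAm h0 y₀ hy hy0 hdir hdet
    rcases c.end_or_mem hAb h0 with ⟨e, rfl⟩ | hAτ
    · rw [dirTo_end] at hdir ⊢
      exact ⟨(hu2 e hdir).1, Or.inl ⟨e, rfl⟩⟩
    have hA := mem_rooted.2 ⟨hAτ, hAm⟩
    obtain ⟨B, T, hV, hBb, hBm, b0, hT, t1, hd, hpt, hx, hB, hcard⟩ := c.path_step hL hA h0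
    obtain ⟨hb1, hb2⟩ := hf.bounded T hT t1
    obtain ⟨hA1, hA2⟩ := hf.dir_le A
    obtain ⟨hT1, hT2⟩ := hf.dir_le T
    set y := ptOf P u m τ x A with hydef
    set z := ptOf P u m τ x T with hzdef
    set a₁ : ℝ := ((dirTo u A).1 : ℝ) with ha1
    set a₂ : ℝ := ((dirTo u A).2 : ℝ) with ha2
    set t₁ : ℝ := ((dirTo u T).1 : ℝ) with ht1
    set t₂ : ℝ := ((dirTo u T).2 : ℝ) with ht2
    have hyA := hy hAτ
    have hy1 : y.1 = y₀.1 + x A * a₁ := by rw [hyA]; rfl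
    have hy2 : y.2 = y₀.2 + x A * a₂ := by rw [hyA]; rfl
    have hz1 : z.1 = y.1 + x T * t₁ := by rw [hpt]; rfl
    have hz2 : z.2 = y.2 + x T * t₂ := by rw [hpt]; rfl
    have hxA := c.pos A hA
    have hyM : y.2 ≤ (P m).2 := by
      have h1 : a₂ ≤ -1 := by rw [ha2]; exact_mod_cast hdir
      have h2 : x A * a₂ ≤ x A * (-1) := mul_le_mul_of_nonneg_left h1 hxA.le
      linarith
    push_cast at hdet
    obtain ⟨hcross, hxT, hnext⟩ := far_arith (x := x T) (N := n + 1) hD hK hM (by positivity) hx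
      hA1 hA2 hT1 hT2 hb1 hb2 hz1 hz2 (by
        have e : a₁ * y.2 - a₂ * y.1 = a₁ * y₀.2 - a₂ * y₀.1 := by rw [hy1, hy2]; ring
        rw [e]; exact hdet)
    have hTy : 0 ≤ (dirTo u T).2 := by
      by_contra hcon
      push Not at hcon
      have h1 : t₂ ≤ -1 := by rw [ht2]; exact_mod_cast (by omega : (dirTo u T).2 ≤ -1)
      have h2 := (abs_le.1 hb2).1
      have h3 : x T * t₂ ≤ x T * (-1) := mul_le_mul_of_nonneg_left h1 hx.le
      linarith
    have hd2 : (dirTo u A).2 = (dirTo u B).2 + (dirTo u T).2 := by rw [hd]; rfl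
    have hd1 : (dirTo u A).1 = (dirTo u B).1 + (dirTo u T).1 := by rw [hd]; rfl
    have hcastB1 : ((dirTo u B).1 : ℝ) = a₁ - t₁ := by rw [ha1, ht1, hd1]; push_cast; ring
    have hcastB2 : ((dirTo u B).2 : ℝ) = a₂ - t₂ := by rw [ha2, ht2, hd2]; push_cast; ring
    obtain ⟨i1, i2⟩ := ih B (by omega) hBb hBm b0 y (fun h => (hB h).1) hyM (by omega) (by
      rw [hcastB1, hcastB2]
      exact hnext)
    -- The continuing branch descends by exactly 1 and `A` by at least 1, while `T` does not
    -- descend; so `T` is horizontal.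
    have hT0 : (dirTo u T).2 = 0 := by omega
    have hA0 : (dirTo u A).2 = -1 := by omega
    have hT1' : (dirTo u T).1 ≤ -1 := by
      have h1 : a₂ = -1 := by rw [ha2, hA0]; norm_num
      have h2 : t₂ = 0 := by rw [ht2, hT0]; norm_num
      rw [h1, h2] at hcross
      have : t₁ < 0 := by linarith
      rw [ht1] at this
      have : (dirTo u T).1 < 0 := by exact_mod_cast this
      omega
    refine ⟨hA0, Or.inr ?_⟩
    rcases i2 with ⟨e, rfl⟩ | ⟨i3, -⟩
    · rw [dirTo_end] at hd1 i1
      have := (hu2 e (by omega)).2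
      refine ⟨by omega, fun hA1 => ⟨e, T, hV, hT, ?_⟩⟩
      ext
      · simp only; omega
      · exact i1
    · exact ⟨by omega, fun h => by omega⟩

end IsCurve

/-! ### The corners at a far marking. -/

variable {r s : ℕ} {E : Type} [Fintype E] [DecidableEq E] {u : E → ℤ × ℤ}
  {τ : Finset (Finset (Leaf r s E))} {V : Finset (Finset (Leaf r s E))}
  {P : Fin r ⊕ Fin s → ℝ × ℝ} {m : Fin r ⊕ Fin s} {x : Finset (Leaf r s E) → ℝ}

/-- The leaves adjacent to the vertex at the marking `m` if the ends in `J` are adjacent to it. -/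
def core (m : Fin r ⊕ Fin s) (J : Finset E) : Finset (Leaf r s E) :=
  insert (Sum.inl m) (J.image Sum.inr)

theorem insert_core_singleton (m : Fin r ⊕ Fin s) (e : E) (B : Finset (Leaf r s E)) :
    insert B ((core m {e}).image singleton) = {{Sum.inl m}, {Sum.inr e}, B} := by
  ext X
  simp only [core, Finset.image_singleton, Finset.image_insert, Finset.mem_insert,
    Finset.mem_singleton]
  tauto

theorem insert_core_pair (m : Fin r ⊕ Fin s) (e f : E) (B : Finset (Leaf r s E)) :
    insert B ((core m {e, f}).image singleton) =
      {{Sum.inl m}, {Sum.inr e}, {Sum.inr f}, B} := by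
  ext X
  simp only [core, Finset.image_singleton, Finset.image_insert, Finset.mem_insert,
    Finset.mem_singleton]
  tauto

/-- A curve of type `τ` has the ends in `J` and one more edge at the marking `m`, and the other
vertex of this edge is trivalent and adjacent to the end `f`. -/
structure IsCorner (τ : Finset (Finset (Leaf r s E))) (m : Fin r ⊕ Fin s) (J : Finset E) (f : E) :
    Prop where
  notMem : f ∉ J
  star : insert (core m J)ᶜ ((core m J).image singleton) ∈ treeStars τ
  next : {core m J, {Sum.inr f}, (insert (Sum.inr f) (core m J))ᶜ} ∈ treeStars τ
  mem : (insert (Sum.inr f) (core m J))ᶜ ∈ τ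

/-- The primitive directions that occur for the ends. -/
def IsStdDir (v : ℤ × ℤ) : Prop :=
  v = (1, 0) ∨ v = (0, 1) ∨ v = (1, 1) ∨ v = (-1, 0) ∨ v = (0, -1) ∨ v = (-1, -1)

theorem IsStdDir.ne_zero {v : ℤ × ℤ} (h : IsStdDir v) : v ≠ 0 := by
  rintro rfl
  simp [IsStdDir, Prod.ext_iff] at h

theorem IsStdDir.snd_le {v : ℤ × ℤ} (h : IsStdDir v) : v.2 ≤ 1 := by
  rcases h with rfl | rfl | rfl | rfl | rfl | rfl <;> simp

theorem IsStdDir.of_snd_neg {v : ℤ × ℤ} (h : IsStdDir v) (h1 : v.2 ≤ -1) :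
    v.2 = -1 ∧ v.1 ≤ 0 := by
  rcases h with rfl | rfl | rfl | rfl | rfl | rfl <;> simp_all

theorem IsStdDir.of_snd_one {v : ℤ × ℤ} (h : IsStdDir v) (h1 : v.2 = 1) :
    v = (0, 1) ∨ v = (1, 1) := by
  rcases h with rfl | rfl | rfl | rfl | rfl | rfl <;> simp_all

theorem IsStdDir.of_snd_zero {v : ℤ × ℤ} (h : IsStdDir v) (h1 : v.2 = 0) (h2 : 0 < v.1) :
    v = (1, 0) := by
  rcases h with rfl | rfl | rfl | rfl | rfl | rfl <;> simp_all

theorem star_block_eq (hV : V ∈ treeStars τ) {B C : Finset (Leaf r s E)} (hB : B ∈ V)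
    (h1 : ∀ y, y ∈ C → y ∉ B) (h2 : ∀ A ∈ V, A ≠ B → A ⊆ C) : B = Cᶜ := by
  ext y
  rw [Finset.mem_compl]
  constructor
  · exact fun hy hyC => h1 y hyC hy
  · intro hy
    obtain ⟨A, hA, hyA⟩ := (mem_treeStars.1 hV).2.2.1 y
    by_cases h : A = B
    · exact h ▸ hyA
    · exact absurd (h2 A hA h hyA) hy

theorem star_disjoint (hV : V ∈ treeStars τ) {A B : Finset (Leaf r s E)} (hA : A ∈ V) (hB : B ∈ V)
    (h : A ≠ B) : ∀ y, y ∈ A → y ∉ B :=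
  fun _ hy hy' => h (star_eq_of_mem hV hA hB hy hy')

/-- Recognition of a corner from its two vertices. -/
theorem IsCorner.of_stars (hτ : IsSplitSystem τ) {J : Finset E} {f : E} {B T : Finset (Leaf r s E)}
    (h1 : insert B ((core m J).image singleton) ∈ treeStars τ)
    (h2 : {Bᶜ, {Sum.inr f}, T} ∈ treeStars τ) (hB : B ∈ τ) (hT : T ∈ τ) : IsCorner τ m J f := by
  have hBs : ∀ y, B ≠ {y} := by
    rintro y rfl
    have := hτ.two_le_card _ hB
    simp at this
  have hTs : ∀ y, T ≠ {y} := by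
    rintro y rfl
    have := hτ.two_le_card _ hT
    simp at this
  have hBcs : ∀ y, Bᶜ ≠ {y} := by
    intro y h
    have := hτ.two_le_card _ (hτ.compl_mem _ hB)
    rw [h] at this
    simp at this
  have hBe : B = (core m J)ᶜ := by
    refine star_block_eq h1 (Finset.mem_insert_self _ _) ?_ ?_
    · intro y hy hyB
      refine hBs y (star_eq_of_mem h1 (Finset.mem_insert_self _ _)
        (Finset.mem_insert_of_mem (Finset.mem_image_of_mem _ hy)) hyB (Finset.mem_singleton_self y))
    · intro A hA hAB
      obtain ⟨y, hy, rfl⟩ := Finset.mem_image.1 ((Finset.mem_insert.1 hA).resolve_left hAB)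
      exact Finset.singleton_subset_iff.2 hy
  have hBce : Bᶜ = core m J := by rw [hBe, compl_compl]
  have hTB : T ≠ Bᶜ := by
    rintro rfl
    have := (mem_treeStars.1 h2).2.2.2.1
    have h3 : ({Bᶜ, {Sum.inr f}, Bᶜ} : Finset (Finset (Leaf r s E))).card ≤ 2 := by
      rw [Finset.pair_comm, Finset.insert_idem]
      exact Finset.card_le_two
    omega
  have hTe : T = (insert (Sum.inr f) (core m J))ᶜ := by
    refine star_block_eq h2 (by simp) ?_ ?_
    · intro y hy
      rcases Finset.mem_insert.1 hy with rfl | hy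
      · exact star_disjoint h2 (by simp) (by simp) (hTs _).symm _ (Finset.mem_singleton_self _)
      · exact star_disjoint h2 (by simp) (by simp) hTB.symm _ (hBce ▸ hy)
    · intro A hA hAT
      simp only [Finset.mem_insert, Finset.mem_singleton] at hA
      rcases hA with rfl | rfl | rfl
      · rw [hBce]; exact Finset.subset_insert _ _
      · simp
      · exact absurd rfl hAT
  refine ⟨?_, hBe ▸ h1, ?_, hTe ▸ hT⟩
  · intro hf
    have : (Sum.inr f : Leaf r s E) ∈ Bᶜ := by
      rw [hBce]
      exact Finset.mem_insert_of_mem (Finset.mem_image_of_mem _ hf)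
    exact star_disjoint h2 (by simp) (by simp) (hBcs _) _ this (Finset.mem_singleton_self _)
  · rw [← hTe, ← hBce]; exact h2

namespace IsCurve

/-- The branches at the marking `m`. -/
theorem root_star (c : IsCurve u P m τ x) (hL : 3 ≤ Fintype.card (Leaf r s E)) :
    ∃ V ∈ treeStars τ, {Sum.inl m} ∈ V ∧ ∀ A ∈ V, A ≠ {Sum.inl m} → IsBlock τ A ∧
      Sum.inl m ∉ A ∧ excess τ A = 0 ∧ (A ∈ τ → ptOf P u m τ x A = P m + x A • dirR u A) := by
  obtain ⟨V, hV, hm⟩ := c.top.1.exists_star hL (Or.inr (Finset.card_singleton (Sum.inl m)))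
  refine ⟨V, hV, hm, fun A hA hne => ?_⟩
  have hAm := root_notMem hV hm (Finset.mem_singleton_self _) hA hne
  refine ⟨(mem_treeStars.1 hV).1 A hA, hAm, ?_, ?_⟩
  · have hs := excess_root c.top.1 c.card hV hm
    exact (Finset.sum_eq_zero_iff_of_nonneg fun B hB =>
      c.excess_nonneg hV (Finset.mem_of_mem_erase hB)).1 hs A (Finset.mem_erase.2 ⟨hne, hA⟩)
  · intro hAτ
    have := pt_child (u := u) c.top.1 hV hm (Finset.mem_singleton_self _) hA hne (P m) x
    rwa [if_pos hAτ, pt_root c.top.1] at this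

theorem block_dir_ne_zero (c : IsCurve u P m τ x) (hu : ∀ e, IsStdDir (u e))
    {A : Finset (Leaf r s E)} (hA : IsBlock τ A) (hAm : Sum.inl m ∉ A) (h0 : excess τ A = 0) :
    dirTo u A ≠ 0 := by
  rcases c.end_or_mem hA h0 with ⟨e, rfl⟩ | h
  · rw [dirTo_end]; exact (hu e).ne_zero
  · exact c.dirTo_ne_zero (mem_rooted.2 ⟨h, hAm⟩)

theorem sum_star_dir (c : IsCurve u P m τ x) (hV : V ∈ treeStars τ) :
    ∑ B ∈ V, dirTo u B = 0 := by
  have h1 : V.biUnion id = Finset.univ := by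
    ext y
    obtain ⟨B, hB, hy⟩ := (mem_treeStars.1 hV).2.2.1 y
    simp only [Finset.mem_biUnion, Finset.mem_univ, iff_true]
    exact ⟨B, hB, hy⟩
  have h2 : dirTo u (Finset.univ : Finset (Leaf r s E)) = 0 := by
    rw [dirTo, Fintype.sum_sum_type]
    simp [c.sum_zero]
  rw [← h2, ← h1]
  unfold dirTo
  rw [Finset.sum_biUnion]
  · rfl
  · intro A hA B hB h
    exact (mem_treeStars.1 hV).2.1 A hA B hB h

theorem not_all_ends (hV : V ∈ treeStars τ) {j : Fin r ⊕ Fin s} (hj : j ≠ m)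
    (h : ∀ A ∈ V, A = {Sum.inl m} ∨ ∃ e, A = {Sum.inr e}) : False := by
  obtain ⟨A, hA, hjA⟩ := (mem_treeStars.1 hV).2.2.1 (Sum.inl j)
  rcases h A hA with rfl | ⟨e, rfl⟩
  · exact hj (by simpa using hjA)
  · simp at hjA

/-- The downward branches at a marking that is far away. -/
theorem root_down (c : IsCurve u P m τ x) (hL : 3 ≤ Fintype.card (Leaf r s E)) {D K : ℝ}
    (hf : IsFar u P m τ x D K) (hu : ∀ e, IsStdDir (u e)) {A : Finset (Leaf r s E)}
    (hAb : IsBlock τ A) (hAm : Sum.inl m ∉ A) (h0 : excess τ A = 0)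
    (hy : A ∈ τ → ptOf P u m τ x A = P m + x A • dirR u A) (hdir : (dirTo u A).2 ≤ -1) :
    (dirTo u A).2 = -1 ∧ ((∃ e, A = {Sum.inr e}) ∨ ((dirTo u A).1 ≤ -1 ∧
      ((dirTo u A).1 = -1 → ∃ e T, {Aᶜ, {Sum.inr e}, T} ∈ treeStars τ ∧
        T ∈ rooted τ (Sum.inl m) ∧ u e = (0, -1)))) := by
  -- At the marking the moment of a descending direction is at least (P m).1 - D (P m).2. This
  -- exceeds what a path with at most as many steps as there are leaves can lose.
  refine c.path_down hL hf (fun e => (hu e).of_snd_neg) (Fintype.card (Leaf r s E)) A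
    (Finset.card_le_univ _) hAb hAm h0 _ hy le_rfl hdir ?_
  have hK := hf.nonneg
  have hM : 0 ≤ (P m).2 := hK.trans hf.lt_snd.le
  have hD := hf.one_le
  have hlt := hf.lt_fst
  have h1 : 0 ≤ D * (P m).2 := by positivity
  have h2 : 0 ≤ D ^ 2 * ((P m).2 + K) := by positivity
  have h3 : 0 ≤ D * K * (Fintype.card (Leaf r s E) + 1) := by positivity
  have h4 : -(D * (P m).2) ≤ ((dirTo u A).1 : ℝ) * (P m).2 := by
    rw [← neg_mul]
    exact mul_le_mul_of_nonneg_right (abs_le.1 (hf.dir_le A).1).1 hM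
  have h5 : (P m).1 ≤ -((dirTo u A).2 : ℝ) * (P m).1 := by
    have : (1 : ℝ) ≤ -((dirTo u A).2 : ℝ) := by exact_mod_cast (by omega : 1 ≤ -(dirTo u A).2)
    exact le_mul_of_one_le_left (by linarith) this
  linarith

/-- The vertices near a simple marking that is far away. -/
theorem corner_simple {k : Fin r} (c : IsCurve u P (Sum.inl k) τ x)
    (hL : 3 ≤ Fintype.card (Leaf r s E)) {D K : ℝ} (hf : IsFar u P (Sum.inl k) τ x D K)
    (hu : ∀ e, IsStdDir (u e)) {j : Fin r ⊕ Fin s} (hj : j ≠ Sum.inl k) :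
    ∃ e f, IsCorner τ (Sum.inl k) {e} f ∧ (u e = (1, 0) ∧ u f = (0, 1) ∨
      u e = (1, 0) ∧ u f = (1, 1) ∨ u e = (1, 1) ∧ u f = (0, -1)) := by
  obtain ⟨V, hV, hm, hb⟩ := c.root_star hL
  have hnt : ¬ HasThick V := by
    rintro ⟨k', hk'⟩
    have := (hb _ hk' (by simp)).2.2.1
    rw [excess_marking c.top.1] at this
    omega
  obtain ⟨A, B, hAB, he⟩ := Finset.card_eq_two.1
    (show (V.erase {Sum.inl (Sum.inl k)}).card = 2 by
      rw [Finset.card_erase_of_mem hm, (c.top.2 V hV).2 hnt])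
  have hVe : V = {{Sum.inl (Sum.inl k)}, A, B} := by rw [← he, Finset.insert_erase hm]
  have hsum : dirTo u A + dirTo u B = 0 := by
    have := c.sum_star_dir hV
    rw [← Finset.insert_erase hm, Finset.sum_insert (Finset.notMem_erase _ _), he,
      Finset.sum_pair hAB] at this
    rwa [show dirTo u {Sum.inl (Sum.inl k)} = 0 by simp [dirTo], zero_add] at this
  -- the two branches play symmetric roles
  have key : ∀ A B : Finset (Leaf r s E), V = {{Sum.inl (Sum.inl k)}, A, B} →
      A ∈ V.erase {Sum.inl (Sum.inl k)} → B ∈ V.erase {Sum.inl (Sum.inl k)} →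
      dirTo u A + dirTo u B = 0 → (1 ≤ (dirTo u A).2 ∨ (dirTo u A).2 = 0 ∧ 0 < (dirTo u A).1) →
      ∃ e f, IsCorner τ (Sum.inl k) {e} f ∧ (u e = (1, 0) ∧ u f = (0, 1) ∨
        u e = (1, 0) ∧ u f = (1, 1) ∨ u e = (1, 1) ∧ u f = (0, -1)) := by
    intro A B hVe hA hB hsum hdir
    obtain ⟨hAb, hAm, hA0, hAp⟩ := hb A (Finset.mem_of_mem_erase hA) (Finset.ne_of_mem_erase hA)
    obtain ⟨hBb, hBm, hB0, hBp⟩ := hb B (Finset.mem_of_mem_erase hB) (Finset.ne_of_mem_erase hB)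
    have hs1 := congrArg Prod.fst hsum
    have hs2 := congrArg Prod.snd hsum
    simp only [Prod.fst_add, Prod.snd_add, Prod.fst_zero, Prod.snd_zero] at hs1 hs2
    have hend : ∀ e, A = {Sum.inr e} → ∀ f T, {Bᶜ, {Sum.inr f}, T} ∈ treeStars τ →
        T ∈ rooted τ (Sum.inl (Sum.inl k)) → IsCorner τ (Sum.inl k) {e} f := by
      rintro e rfl f T h2 hT
      refine IsCorner.of_stars c.top.1 (B := B) (T := T) ?_ h2 ?_ (mem_rooted.1 hT).1
      · rw [insert_core_singleton, ← hVe]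
        exact hV
      · refine (c.end_or_mem hBb hB0).resolve_left ?_
        rintro ⟨e', rfl⟩
        refine not_all_ends hV hj fun C hC => ?_
        rw [hVe] at hC
        simp only [Finset.mem_insert, Finset.mem_singleton] at hC
        rcases hC with rfl | rfl | rfl
        · exact Or.inl rfl
        · exact Or.inr ⟨e, rfl⟩
        · exact Or.inr ⟨e', rfl⟩
    have hno : ∀ e e', A = {Sum.inr e} → B ≠ {Sum.inr e'} := by
      rintro e e' rfl rfl
      refine not_all_ends hV hj fun C hC => ?_
      rw [hVe] at hC
      simp only [Finset.mem_insert, Finset.mem_singleton] at hC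
      rcases hC with rfl | rfl | rfl
      · exact Or.inl rfl
      · exact Or.inr ⟨e, rfl⟩
      · exact Or.inr ⟨e', rfl⟩
    -- An ascending branch is an end, and the opposite one descends. The latter is no end, since
    -- there is another marking; its first component is at most -1, which leaves only (1,1) for the
    -- ascending end. A branch to the right is an end (1,0), and the opposite one leads to a vertex
    -- with an ascending end.
    rcases hdir with hdir | ⟨hd2, hd1⟩
    · obtain ⟨e, hAe⟩ := c.path_up hL hf (fun e => (hu e).snd_le) _ A le_rfl hAb hAm hA0 _ hAp
        le_rfl hdir
      have hdA : dirTo u A = u e := by rw [hAe, dirTo_end]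
      obtain ⟨h1, h2⟩ := c.root_down hL hf hu hBb hBm hB0 hBp (by omega)
      have hsd := hu e
      rw [← hdA] at hsd
      have h3 : (dirTo u A).2 = 1 := by omega
      rcases h2 with ⟨e', hBe⟩ | ⟨h2, h4⟩
      · exact absurd hBe (hno e e' hAe)
      · have h5 : dirTo u A = (1, 1) := by
          refine (hsd.of_snd_one h3).resolve_left fun h => ?_
          rw [h] at hs1
          simp only at hs1
          omega
        obtain ⟨f, T, h6, h7, h8⟩ := h4 (by rw [h5] at hs1; simp at hs1; omega)
        exact ⟨e, f, hend e hAe f T h6 h7, Or.inr (Or.inr ⟨hdA ▸ h5, h8⟩)⟩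
    · obtain ⟨e, hAe⟩ := (c.path_zero hL hf (fun e => (hu e).snd_le) hAb hAm hA0 hAp hd2).resolve_right
        (by rintro ⟨h, -⟩; omega)
      have hdA : dirTo u A = u e := by rw [hAe, dirTo_end]
      have hue : u e = (1, 0) := (hu e).of_snd_zero (hdA ▸ hd2) (hdA ▸ hd1)
      rcases c.path_zero hL hf (fun e => (hu e).snd_le) hBb hBm hB0 hBp (by omega) with
        ⟨e', hBe⟩ | ⟨-, f, T, h6, h7, h8⟩
      · exact absurd hBe (hno e e' hAe)
      · refine ⟨e, f, hend e hAe f T h6 h7, ?_⟩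
        rcases (hu f).of_snd_one h8 with h | h
        · exact Or.inl ⟨hue, h⟩
        · exact Or.inr (Or.inl ⟨hue, h⟩)
  have hA : A ∈ V.erase {Sum.inl (Sum.inl k)} := by rw [he]; simp
  have hB : B ∈ V.erase {Sum.inl (Sum.inl k)} := by rw [he]; simp
  obtain ⟨hAb, hAm, hA0, hAp⟩ := hb A (Finset.mem_of_mem_erase hA) (Finset.ne_of_mem_erase hA)
  have hne := c.block_dir_ne_zero hu hAb hAm hA0
  by_cases h : 1 ≤ (dirTo u A).2 ∨ (dirTo u A).2 = 0 ∧ 0 < (dirTo u A).1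
  · exact key A B hVe hA hB hsum h
  · refine key B A (by rw [hVe, Finset.pair_comm A B]) hB hA (by rw [add_comm]; exact hsum) ?_
    have hs1 := congrArg Prod.fst hsum
    have hs2 := congrArg Prod.snd hsum
    simp only [Prod.fst_add, Prod.snd_add, Prod.fst_zero, Prod.snd_zero] at hs1 hs2
    have : (dirTo u A).1 ≠ 0 ∨ (dirTo u A).2 ≠ 0 := by
      by_contra hcon
      push Not at hcon
      exact hne (Prod.ext hcon.1 hcon.2)
    omega

/-- Collects what the three path lemmas say when no end is (1,1). The alternative with first
component -1 in the horizontal case covers the ends (-1,0); in `corner_thick` the horizontal branch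
has first component -2. -/
theorem thick_type (c : IsCurve u P m τ x) (hL : 3 ≤ Fintype.card (Leaf r s E)) {D K : ℝ}
    (hf : IsFar u P m τ x D K) (hu : ∀ e, IsStdDir (u e)) (hu' : ∀ e, u e ≠ (1, 1))
    {A : Finset (Leaf r s E)} (hAb : IsBlock τ A) (hAm : Sum.inl m ∉ A) (h0 : excess τ A = 0)
    (hy : A ∈ τ → ptOf P u m τ x A = P m + x A • dirR u A) :
    (∃ e, A = {Sum.inr e} ∧ u e = (1, 0)) ∨ (∃ e, A = {Sum.inr e} ∧ u e = (0, 1)) ∨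
    ((dirTo u A).2 = 0 ∧ (dirTo u A).1 ≤ -1 ∧ ((dirTo u A).1 = -1 ∨
      ∃ f T, {Aᶜ, {Sum.inr f}, T} ∈ treeStars τ ∧ T ∈ rooted τ (Sum.inl m) ∧ u f = (0, 1))) ∨
    ((dirTo u A).2 = -1 ∧ (dirTo u A).1 ≤ 0 ∧ ((∃ e, A = {Sum.inr e}) ∨ ((dirTo u A).1 = -1 →
      ∃ f T, {Aᶜ, {Sum.inr f}, T} ∈ treeStars τ ∧ T ∈ rooted τ (Sum.inl m) ∧ u f = (0, -1)))) := by
  have hne := c.block_dir_ne_zero hu hAb hAm h0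
  rcases lt_trichotomy (dirTo u A).2 0 with h | h | h
  · right; right; right
    obtain ⟨h1, ⟨e, he⟩ | ⟨h2, h3⟩⟩ := c.root_down hL hf hu hAb hAm h0 hy (by omega)
    · refine ⟨h1, ?_, Or.inl ⟨e, he⟩⟩
      rw [he, dirTo_end] at h1 ⊢
      exact ((hu e).of_snd_neg (by omega)).2
    · exact ⟨h1, by omega, Or.inr h3⟩
  · rcases c.path_zero hL hf (fun e => (hu e).snd_le) hAb hAm h0 hy h with
      ⟨e, he⟩ | ⟨h1, f, T, h2, h3, h4⟩
    · have hd : dirTo u A = u e := by rw [he, dirTo_end]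
      rcases lt_trichotomy (dirTo u A).1 0 with h1 | h1 | h1
      · right; right; left
        refine ⟨h, by omega, Or.inl ?_⟩
        rw [hd] at h h1 ⊢
        rcases hu e with h' | h' | h' | h' | h' | h' <;> rw [h'] at h h1 ⊢ <;> simp at h h1 ⊢
      · exact absurd (Prod.ext h1 h) hne
      · exact Or.inl ⟨e, he, (hu e).of_snd_zero (hd ▸ h) (hd ▸ h1)⟩
    · right; right; left
      exact ⟨h, by omega, Or.inr ⟨f, T, h2, h3, ((hu f).of_snd_one h4).resolve_right (hu' f)⟩⟩
  · obtain ⟨e, he⟩ := c.path_up hL hf (fun e => (hu e).snd_le) _ A le_rfl hAb hAm h0 _ hy le_rfl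
      (by omega)
    have hd : dirTo u A = u e := by rw [he, dirTo_end]
    rw [hd] at h
    have := (hu e).snd_le
    exact Or.inr (Or.inl ⟨e, he, ((hu e).of_snd_one (by omega)).resolve_right (hu' e)⟩)

/-- The vertices near a thick marking that is far away. -/
theorem corner_thick {k : Fin s} (c : IsCurve u P (Sum.inr k) τ x)
    (hL : 3 ≤ Fintype.card (Leaf r s E)) {D K : ℝ} (hf : IsFar u P (Sum.inr k) τ x D K)
    (hu : ∀ e, IsStdDir (u e)) (hu' : ∀ e, u e ≠ (1, 1)) {j : Fin r ⊕ Fin s}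
    (hj : j ≠ Sum.inr k) :
    ∃ e e' f, e ≠ e' ∧ IsCorner τ (Sum.inr k) {e, e'} f ∧
      (u e = (1, 0) ∧ u e' = (1, 0) ∧ u f = (0, 1) ∨
        u e = (1, 0) ∧ u e' = (0, 1) ∧ u f = (0, -1)) := by
  obtain ⟨V, hV, hm, hb⟩ := c.root_star hL
  obtain ⟨A, B, C, hAB, hAC, hBC, he⟩ := Finset.card_eq_three.1
    (show (V.erase {Sum.inl (Sum.inr k)}).card = 3 by
      rw [Finset.card_erase_of_mem hm, (c.top.2 V hV).1 ⟨k, hm⟩])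
  have hVe : V = {{Sum.inl (Sum.inr k)}, A, B, C} := by rw [← he, Finset.insert_erase hm]
  have hsum : dirTo u A + dirTo u B + dirTo u C = 0 := by
    have := c.sum_star_dir hV
    rw [← Finset.insert_erase hm, Finset.sum_insert (Finset.notMem_erase _ _), he,
      Finset.sum_insert (by simp [hAB, hAC]), Finset.sum_pair hBC] at this
    rwa [show dirTo u {Sum.inl (Sum.inr k)} = 0 by simp [dirTo], zero_add, ← add_assoc] at this
  have hmem : ∀ S, S ∈ V.erase {Sum.inl (Sum.inr k)} ↔ S = A ∨ S = B ∨ S = C := by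
    intro S; rw [he]; simp
  have htype := fun S (hS : S ∈ V.erase {Sum.inl (Sum.inr k)}) =>
    let h := hb S (Finset.mem_of_mem_erase hS) (Finset.ne_of_mem_erase hS)
    c.thick_type hL hf hu hu' h.1 h.2.1 h.2.2.1 h.2.2.2
  -- the last branch
  have last : ∀ e e' S, e ≠ e' → V = {{Sum.inl (Sum.inr k)}, {Sum.inr e}, {Sum.inr e'}, S} →
      S ∈ V.erase {Sum.inl (Sum.inr k)} →
      (∀ e'', S ≠ {Sum.inr e''}) ∧ ∀ f T, {Sᶜ, {Sum.inr f}, T} ∈ treeStars τ →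
        T ∈ rooted τ (Sum.inl (Sum.inr k)) → IsCorner τ (Sum.inr k) {e, e'} f := by
    intro e e' S _ hVe hS
    have hno : ∀ e'', S ≠ {Sum.inr e''} := by
      rintro e'' rfl
      refine not_all_ends hV hj fun X hX => ?_
      rw [hVe] at hX
      simp only [Finset.mem_insert, Finset.mem_singleton] at hX
      rcases hX with h | h | h | h
      · exact Or.inl h
      · exact Or.inr ⟨_, h⟩
      · exact Or.inr ⟨_, h⟩
      · exact Or.inr ⟨_, h⟩
    refine ⟨hno, fun f T h2 hT => IsCorner.of_stars c.top.1 (B := S) (T := T) ?_ h2 ?_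
      (mem_rooted.1 hT).1⟩
    · rw [insert_core_pair, ← hVe]
      exact hV
    · obtain ⟨h1, -, h3, -⟩ := hb S (Finset.mem_of_mem_erase hS) (Finset.ne_of_mem_erase hS)
      exact (c.end_or_mem h1 h3).resolve_left fun ⟨e'', h⟩ => hno e'' h
  have key : ∀ A B C, V = {{Sum.inl (Sum.inr k)}, A, B, C} → A ≠ B →
      C ∈ V.erase {Sum.inl (Sum.inr k)} → dirTo u A + dirTo u B + dirTo u C = 0 →
      (∃ e, A = {Sum.inr e} ∧ u e = (1, 0)) →
      ((∃ e, B = {Sum.inr e} ∧ u e = (1, 0)) ∨ ∃ e, B = {Sum.inr e} ∧ u e = (0, 1)) →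
      ∃ e e' f, e ≠ e' ∧ IsCorner τ (Sum.inr k) {e, e'} f ∧
        (u e = (1, 0) ∧ u e' = (1, 0) ∧ u f = (0, 1) ∨
          u e = (1, 0) ∧ u e' = (0, 1) ∧ u f = (0, -1)) := by
    rintro A B C hVe hAB hC hsum ⟨e, rfl, hue⟩ hB
    have hs1 := congrArg Prod.fst hsum
    have hs2 := congrArg Prod.snd hsum
    simp only [Prod.fst_add, Prod.snd_add, Prod.fst_zero, Prod.snd_zero, dirTo_end, hue]
      at hs1 hs2
    rcases hB with ⟨e', rfl, hue'⟩ | ⟨e', rfl, hue'⟩ <;>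
    · have hee : e ≠ e' := fun h => hAB (by rw [h])
      obtain ⟨hno, hcor⟩ := last e e' C hee hVe hC
      simp only [dirTo_end, hue'] at hs1 hs2
      rcases htype C hC with ⟨e'', h, -⟩ | ⟨e'', h, -⟩ | ⟨h1, h2, h3⟩ | ⟨h1, h2, h3⟩
      · exact absurd h (hno _)
      · exact absurd h (hno _)
      · first
        | omega
        | obtain ⟨f, T, h4, h5, h6⟩ := h3.resolve_left (by omega)
          exact ⟨e, e', f, hee, hcor f T h4 h5, Or.inl ⟨hue, hue', h6⟩⟩
      · first
        | omega
        | obtain ⟨f, T, h4, h5, h6⟩ := h3.resolve_left (fun ⟨e'', h⟩ => hno _ h) (by omega)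
          exact ⟨e, e', f, hee, hcor f T h4 h5, Or.inr ⟨hue, hue', h6⟩⟩
  have hs1 := congrArg Prod.fst hsum
  have hs2 := congrArg Prod.snd hsum
  simp only [Prod.fst_add, Prod.snd_add, Prod.fst_zero, Prod.snd_zero] at hs1 hs2
  have hA := (hmem A).2 (Or.inl rfl)
  have hB := (hmem B).2 (Or.inr (Or.inl rfl))
  have hC := (hmem C).2 (Or.inr (Or.inr rfl))
  have d1 : ∀ S : Finset (Leaf r s E), (∃ e, S = {Sum.inr e} ∧ u e = (1, 0)) → (dirTo u S).1 = 1 ∧ (dirTo u S).2 = 0 := by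
    rintro S ⟨e, rfl, h⟩; rw [dirTo_end, h]; simp
  have d2 : ∀ S : Finset (Leaf r s E), (∃ e, S = {Sum.inr e} ∧ u e = (0, 1)) → (dirTo u S).1 = 0 ∧ (dirTo u S).2 = 1 := by
    rintro S ⟨e, rfl, h⟩; rw [dirTo_end, h]; simp
  have hVbac : V = {{Sum.inl (Sum.inr k)}, B, A, C} := by rw [hVe, Finset.insert_comm A B]
  have hVacb : V = {{Sum.inl (Sum.inr k)}, A, C, B} := by rw [hVe, Finset.pair_comm B C]
  have hVbca : V = {{Sum.inl (Sum.inr k)}, B, C, A} := by rw [hVbac, Finset.pair_comm A C]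
  have hVcab : V = {{Sum.inl (Sum.inr k)}, C, A, B} := by rw [hVacb, Finset.insert_comm A C]
  have hVcba : V = {{Sum.inl (Sum.inr k)}, C, B, A} := by rw [hVcab, Finset.pair_comm A B]
  have kAB := key A B C hVe hAB hC hsum
  have kBA := key B A C hVbac hAB.symm hC (by rw [← hsum]; abel)
  have kAC := key A C B hVacb hAC hB (by rw [← hsum]; abel)
  have kCA := key C A B hVcab hAC.symm hB (by rw [← hsum]; abel)
  have kBC := key B C A hVbca hBC hA (by rw [← hsum]; abel)
  have kCB := key C B A hVcba hBC.symm hA (by rw [← hsum]; abel)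
  -- The three directions sum to zero. As the descending branches do not point to the right, this
  -- forces an end (1,0) together with a second end (1,0) or an end (0,1).
  rcases htype A hA with a | a | ⟨a1, a2, -⟩ | ⟨a1, a2, -⟩ <;>
  rcases htype B hB with b | b | ⟨b1, b2, -⟩ | ⟨b1, b2, -⟩ <;>
  first
  | exact kAB a (Or.inl b)
  | exact kAB a (Or.inr b)
  | exact kBA b (Or.inr a)
  | rcases htype C hC with t | t | ⟨t1, t2, -⟩ | ⟨t1, t2, -⟩ <;>
    first
    | exact kAC a (Or.inl t)
    | exact kAC a (Or.inr t)
    | exact kBC b (Or.inl t)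
    | exact kBC b (Or.inr t)
    | exact kCA t (Or.inr a)
    | exact kCB t (Or.inr b)
    | exfalso
      try have := d1 _ a
      try have := d2 _ a
      try have := d1 _ b
      try have := d2 _ b
      try have := d1 _ t
      try have := d2 _ t
      omega

end IsCurve

end MetricTree

/-! ### Replacing two vertices of a tree by a leaf, and the inverse operation. -/

section Contraction

variable {L L' : Type} [Fintype L] [DecidableEq L] [Fintype L'] [DecidableEq L'] {π : L → L'}

/-- The preimage of a set of leaves. -/
def pullSet (π : L → L') (T : Finset L') : Finset L := Finset.univ.filter fun x => π x ∈ T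

theorem mem_pullSet {T : Finset L'} {x : L} : x ∈ pullSet π T ↔ π x ∈ T := by simp [pullSet]

theorem pullSet_compl (T : Finset L') : pullSet π Tᶜ = (pullSet π T)ᶜ := by
  ext x; simp [mem_pullSet]

theorem pullSet_mono {T T' : Finset L'} (h : T ⊆ T') : pullSet π T ⊆ pullSet π T' :=
  fun _ hx => mem_pullSet.2 (h (mem_pullSet.1 hx))

theorem pullSet_subset_iff (hπ : Function.Surjective π) {T T' : Finset L'} :
    pullSet π T ⊆ pullSet π T' ↔ T ⊆ T' := by
  refine ⟨fun h y hy => ?_, pullSet_mono⟩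
  obtain ⟨x, rfl⟩ := hπ y
  exact mem_pullSet.1 (h (mem_pullSet.2 hy))

theorem pullSet_injective (hπ : Function.Surjective π) : Function.Injective (pullSet π) :=
  fun _ _ h => Finset.Subset.antisymm ((pullSet_subset_iff hπ).1 h.subset)
    ((pullSet_subset_iff hπ).1 h.superset)

theorem card_le_card_pullSet (hπ : Function.Surjective π) (T : Finset L') :
    T.card ≤ (pullSet π T).card := by
  have : T ⊆ (pullSet π T).image π := by
    intro y hy
    obtain ⟨x, rfl⟩ := hπ y
    exact Finset.mem_image_of_mem _ (mem_pullSet.2 hy)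
  exact (Finset.card_le_card this).trans Finset.card_image_le

/-- The map `π` contracts the leaves in `S` and the leaf `z` to the leaf `o`. -/
structure IsContraction (π : L → L') (S : Finset L) (z : L) (o : L') : Prop where
  surj : Function.Surjective π
  fiber : ∀ x, π x = o ↔ x ∈ insert z S
  inj : ∀ x y, π x = π y → π x ≠ o → x = y
  notMem : z ∉ S
  two_le : 2 ≤ S.card
  three_le : 3 ≤ Fintype.card L'

/-- The tree in which the leaf `o` is replaced by a vertex adjacent to the leaf `z` and to
a vertex with the leaves in `S`. -/
def glue (π : L → L') (S : Finset L) (z : L) (τ : Finset (Finset L')) : Finset (Finset L) :=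
  τ.image (pullSet π) ∪ {S, Sᶜ, insert z S, (insert z S)ᶜ}

/-- The vertex adjacent to the leaves in `S` and one more edge. -/
def outerStar (S : Finset L) : Finset (Finset L) := insert Sᶜ (S.image singleton)

/-- The vertex adjacent to the leaf `z` and to the edge towards the leaves in `S`. -/
def innerStar (S : Finset L) (z : L) : Finset (Finset L) := {S, {z}, (insert z S)ᶜ}

theorem mem_glue {S : Finset L} {z : L} {τ : Finset (Finset L')} {T : Finset L} :
    T ∈ glue π S z τ ↔ (∃ T' ∈ τ, pullSet π T' = T) ∨ T = S ∨ T = Sᶜ ∨ T = insert z S ∨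
      T = (insert z S)ᶜ := by
  simp only [glue, Finset.mem_union, Finset.mem_image, Finset.mem_insert, Finset.mem_singleton]

namespace IsContraction

variable {S : Finset L} {z : L} {o : L'} (c : IsContraction π S z o)
include c

theorem pullSet_singleton : pullSet π {o} = insert z S := by
  ext x; rw [mem_pullSet, Finset.mem_singleton, c.fiber]

theorem subset_pullSet {T : Finset L'} (h : o ∈ T) : insert z S ⊆ pullSet π T := by
  rw [← c.pullSet_singleton]
  exact pullSet_mono (Finset.singleton_subset_iff.2 h)

theorem pullSet_subset {T : Finset L'} (h : o ∉ T) : pullSet π T ⊆ (insert z S)ᶜ := by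
  rw [← c.pullSet_singleton, ← pullSet_compl]
  exact pullSet_mono fun y hy => Finset.mem_compl.2 fun h' => h (Finset.mem_singleton.1 h' ▸ hy)

theorem card_pullSet_singleton {y : L'} (hy : y ≠ o) : (pullSet π {y}).card = 1 := by
  obtain ⟨x, rfl⟩ := c.surj y
  rw [Finset.card_eq_one]
  refine ⟨x, ?_⟩
  ext w
  rw [mem_pullSet, Finset.mem_singleton, Finset.mem_singleton]
  exact ⟨fun h => (c.inj x w h.symm hy).symm, fun h => h ▸ rfl⟩

theorem two_le_compl : 2 ≤ (insert z S)ᶜ.card := by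
  rw [← c.pullSet_singleton, ← pullSet_compl]
  refine le_trans ?_ (card_le_card_pullSet c.surj _)
  rw [Finset.card_compl, Finset.card_singleton]
  have := c.three_le
  omega

theorem nonempty : S.Nonempty := Finset.card_pos.1 (by have := c.two_le; omega)

theorem compl_subset : (insert z S)ᶜ ⊆ Sᶜ :=
  Finset.compl_subset_compl.2 (Finset.subset_insert _ _)

theorem pullSet_ne {T : Finset L'} : pullSet π T ≠ S := by
  intro h
  by_cases ho : o ∈ T
  · exact c.notMem (h ▸ c.subset_pullSet ho (Finset.mem_insert_self _ _))
  · obtain ⟨y, hy⟩ := c.nonempty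
    have := c.pullSet_subset ho (h.symm ▸ hy)
    exact Finset.mem_compl.1 this (Finset.mem_insert_of_mem hy)

theorem pullSet_ne_compl {T : Finset L'} : pullSet π T ≠ Sᶜ := by
  intro h
  apply c.pullSet_ne (T := Tᶜ)
  rw [pullSet_compl, h, compl_compl]

variable {τ : Finset (Finset L')}

theorem isSplitSystem_glue (hτ : IsSplitSystem τ) : IsSplitSystem (glue π S z τ) := by
  have hcompl : ∀ T ∈ glue π S z τ, Tᶜ ∈ glue π S z τ := by
    intro T hT
    rw [mem_glue] at hT ⊢
    rcases hT with ⟨T', h, rfl⟩ | rfl | rfl | rfl | rfl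
    · exact Or.inl ⟨T'ᶜ, hτ.compl_mem _ h, pullSet_compl _⟩
    · simp
    · simp
    · simp
    · simp
  have key : ∀ A B : Finset L, A ⊆ B ∨ A ⊆ Bᶜ ∨ Aᶜ ⊆ B ∨ Aᶜ ⊆ Bᶜ →
      (Aᶜ ⊆ B ∨ Aᶜ ⊆ Bᶜ ∨ Aᶜᶜ ⊆ B ∨ Aᶜᶜ ⊆ Bᶜ) ∧ (A ⊆ Bᶜ ∨ A ⊆ Bᶜᶜ ∨ Aᶜ ⊆ Bᶜ ∨ Aᶜ ⊆ Bᶜᶜ) ∧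
      (B ⊆ A ∨ B ⊆ Aᶜ ∨ Bᶜ ⊆ A ∨ Bᶜ ⊆ Aᶜ) := by
    intro A B h
    have e1 : Aᶜ ⊆ B ↔ Bᶜ ⊆ A := compl_subset_comm'
    have e2 : A ⊆ Bᶜ ↔ B ⊆ Aᶜ := by rw [← compl_compl A, compl_subset_comm', compl_compl, compl_compl]
    have e3 : A ⊆ B ↔ Bᶜ ⊆ Aᶜ := Finset.compl_subset_compl.symm
    have e4 : B ⊆ A ↔ Aᶜ ⊆ Bᶜ := Finset.compl_subset_compl.symm
    rw [compl_compl, compl_compl]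
    tauto
  refine ⟨hcompl, ?_, ?_⟩
  · intro T hT
    rcases mem_glue.1 hT with ⟨T', h, rfl⟩ | rfl | rfl | rfl | rfl
    · exact (hτ.two_le_card _ h).trans (card_le_card_pullSet c.surj _)
    · exact c.two_le
    · exact c.two_le_compl.trans (Finset.card_le_card c.compl_subset)
    · exact c.two_le.trans (Finset.card_le_card (Finset.subset_insert _ _))
    · exact c.two_le_compl
  · have hp : ∀ T', pullSet π T' ⊆ (insert z S)ᶜ ∨ (pullSet π T')ᶜ ⊆ (insert z S)ᶜ := by
      intro T'
      by_cases h : o ∈ T'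
      · exact Or.inr (Finset.compl_subset_compl.2 (c.subset_pullSet h))
      · exact Or.inl (c.pullSet_subset h)
    have hpK : ∀ T', pullSet π T' ⊆ insert z S ∨ pullSet π T' ⊆ (insert z S)ᶜ ∨
        (pullSet π T')ᶜ ⊆ insert z S ∨ (pullSet π T')ᶜ ⊆ (insert z S)ᶜ := by
      intro T'; rcases hp T' with h | h <;> tauto
    have hpS : ∀ T', pullSet π T' ⊆ S ∨ pullSet π T' ⊆ Sᶜ ∨
        (pullSet π T')ᶜ ⊆ S ∨ (pullSet π T')ᶜ ⊆ Sᶜ := by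
      intro T'
      rcases hp T' with h | h
      · exact Or.inr (Or.inl (h.trans c.compl_subset))
      · exact Or.inr (Or.inr (Or.inr (h.trans c.compl_subset)))
    have hSK : S ⊆ insert z S ∨ S ⊆ (insert z S)ᶜ ∨ Sᶜ ⊆ insert z S ∨ Sᶜ ⊆ (insert z S)ᶜ :=
      Or.inl (Finset.subset_insert _ _)
    have hrefl : ∀ A : Finset L, A ⊆ A ∨ A ⊆ Aᶜ ∨ Aᶜ ⊆ A ∨ Aᶜ ⊆ Aᶜ := fun A => Or.inl subset_rfl
    intro T hT T₁ hT₁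
    rcases mem_glue.1 hT with ⟨T', h, rfl⟩ | rfl | rfl | rfl | rfl <;>
    rcases mem_glue.1 hT₁ with ⟨T₁', h₁, rfl⟩ | rfl | rfl | rfl | rfl
    · simp only [← pullSet_compl, pullSet_subset_iff c.surj]
      exact hτ.compatible _ h _ h₁
    · exact hpS _
    · exact (key _ _ (hpS _)).2.1
    · exact hpK _
    · exact (key _ _ (hpK _)).2.1
    · exact (key _ _ (hpS _)).2.2
    · exact hrefl _
    · exact (key _ _ (hrefl _)).2.1
    · exact hSK
    · exact (key _ _ hSK).2.1
    · exact (key _ _ (key _ _ (hpS _)).2.2).1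
    · exact (key _ _ (hrefl _)).1
    · exact (key _ _ (key _ _ (hrefl _)).1).2.1
    · exact (key _ _ hSK).1
    · exact (key _ _ (key _ _ hSK).1).2.1
    · exact (key _ _ (hpK _)).2.2
    · exact (key _ _ hSK).2.2
    · exact (key _ _ (key _ _ hSK).2.2).2.1
    · exact hrefl _
    · exact (key _ _ (hrefl _)).2.1
    · exact (key _ _ (key _ _ (hpK _)).2.2).1
    · exact (key _ _ (key _ _ hSK).2.2).1
    · exact (key _ _ (key _ _ (key _ _ hSK).2.2).1).2.1
    · exact (key _ _ (hrefl _)).1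
    · exact (key _ _ (key _ _ (hrefl _)).1).2.1

theorem star_pullSet {V : Finset (Finset L')} (hV : V ∈ treeStars τ) :
    V.image (pullSet π) ∈ treeStars (glue π S z τ) := by
  obtain ⟨h1, h2, h3, h4, h5⟩ := mem_treeStars.1 hV
  obtain ⟨B₀, hB₀, ho⟩ := h3 o
  refine mem_treeStars.2 ⟨?_, ?_, ?_, ?_, ?_⟩
  · intro B hB
    obtain ⟨B', hB', rfl⟩ := Finset.mem_image.1 hB
    rcases h1 B' hB' with h | h
    · exact Or.inl (mem_glue.2 (Or.inl ⟨B', h, rfl⟩))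
    · obtain ⟨y, rfl⟩ := Finset.card_eq_one.1 h
      by_cases hy : y = o
      · subst hy
        rw [c.pullSet_singleton]
        exact Or.inl (mem_glue.2 (by simp))
      · exact Or.inr (c.card_pullSet_singleton hy)
  · intro A hA B hB hne
    obtain ⟨A', hA', rfl⟩ := Finset.mem_image.1 hA
    obtain ⟨B', hB', rfl⟩ := Finset.mem_image.1 hB
    rw [Finset.disjoint_left]
    intro x hx hx'
    exact Finset.disjoint_left.1 (h2 A' hA' B' hB' fun h => hne (by rw [h])) (mem_pullSet.1 hx)
      (mem_pullSet.1 hx')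
  · intro x
    obtain ⟨B, hB, hx⟩ := h3 (π x)
    exact ⟨_, Finset.mem_image_of_mem _ hB, mem_pullSet.2 hx⟩
  · rwa [Finset.card_image_of_injective _ (pullSet_injective c.surj)]
  · intro T hT
    have hK := c.subset_pullSet ho
    rcases mem_glue.1 hT with ⟨T', h, rfl⟩ | rfl | rfl | rfl | rfl
    · obtain ⟨B, hB, h⟩ := h5 T' h
      refine ⟨_, Finset.mem_image_of_mem _ hB, ?_⟩
      rwa [← pullSet_compl, pullSet_subset_iff c.surj, pullSet_subset_iff c.surj]
    · exact ⟨_, Finset.mem_image_of_mem _ hB₀, Or.inl ((Finset.subset_insert _ _).trans hK)⟩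
    · refine ⟨_, Finset.mem_image_of_mem _ hB₀, Or.inr ?_⟩
      rw [compl_compl]
      exact (Finset.subset_insert _ _).trans hK
    · exact ⟨_, Finset.mem_image_of_mem _ hB₀, Or.inl hK⟩
    · refine ⟨_, Finset.mem_image_of_mem _ hB₀, Or.inr ?_⟩
      rwa [compl_compl]

theorem pullSet_trichotomy (T : Finset L') :
    pullSet π T ⊆ (insert z S)ᶜ ∨ (pullSet π T)ᶜ ⊆ (insert z S)ᶜ := by
  by_cases h : o ∈ T
  · exact Or.inr (Finset.compl_subset_compl.2 (c.subset_pullSet h))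
  · exact Or.inl (c.pullSet_subset h)

theorem outerStar_mem : outerStar S ∈ treeStars (glue π S z τ) := by
  have hself : Sᶜ ∈ outerStar S := Finset.mem_insert_self _ _
  refine mem_treeStars.2 ⟨?_, ?_, ?_, ?_, ?_⟩
  · intro B hB
    rcases Finset.mem_insert.1 hB with rfl | hB
    · exact Or.inl (mem_glue.2 (by simp))
    · obtain ⟨x, -, rfl⟩ := Finset.mem_image.1 hB
      exact Or.inr (Finset.card_singleton _)
  · intro A hA B hB hne
    rcases Finset.mem_insert.1 hA with rfl | hA <;> rcases Finset.mem_insert.1 hB with rfl | hB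
    · exact absurd rfl hne
    · obtain ⟨x, hx, rfl⟩ := Finset.mem_image.1 hB
      simpa using hx
    · obtain ⟨x, hx, rfl⟩ := Finset.mem_image.1 hA
      simpa using hx
    · obtain ⟨x, hx, rfl⟩ := Finset.mem_image.1 hA
      obtain ⟨y, hy, rfl⟩ := Finset.mem_image.1 hB
      rw [Finset.disjoint_singleton]
      rintro rfl
      exact hne rfl
  · intro x
    by_cases h : x ∈ S
    · exact ⟨{x}, Finset.mem_insert_of_mem (Finset.mem_image_of_mem _ h), Finset.mem_singleton_self _⟩
    · exact ⟨Sᶜ, hself, Finset.mem_compl.2 h⟩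
  · rw [outerStar, Finset.card_insert_of_notMem, Finset.card_image_of_injective _
      Finset.singleton_injective]
    · have := c.two_le; omega
    · intro h
      obtain ⟨x, hx, h⟩ := Finset.mem_image.1 h
      have : x ∈ Sᶜ := h ▸ Finset.mem_singleton_self x
      exact Finset.mem_compl.1 this hx
  · intro T hT
    refine ⟨Sᶜ, hself, ?_⟩
    rcases mem_glue.1 hT with ⟨T', h, rfl⟩ | rfl | rfl | rfl | rfl
    · exact (c.pullSet_trichotomy T').imp (·.trans c.compl_subset) (·.trans c.compl_subset)
    · exact Or.inr subset_rfl
    · exact Or.inl subset_rfl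
    · exact Or.inr c.compl_subset
    · exact Or.inl c.compl_subset

theorem innerStar_mem : innerStar S z ∈ treeStars (glue π S z τ) := by
  have d1 : Disjoint S {z} := Finset.disjoint_singleton_right.2 c.notMem
  have d2 : Disjoint S (insert z S)ᶜ :=
    Finset.disjoint_left.2 fun y hy h => Finset.mem_compl.1 h (Finset.mem_insert_of_mem hy)
  have d3 : Disjoint {z} (insert z S)ᶜ :=
    Finset.disjoint_singleton_left.2 fun h => Finset.mem_compl.1 h (Finset.mem_insert_self _ _)
  have hS1 : S ∈ innerStar S z := by simp [innerStar]
  have hS2 : (insert z S)ᶜ ∈ innerStar S z := by simp [innerStar]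
  refine mem_treeStars.2 ⟨?_, ?_, ?_, ?_, ?_⟩
  · intro B hB
    simp only [innerStar, Finset.mem_insert, Finset.mem_singleton] at hB
    rcases hB with rfl | rfl | rfl
    · exact Or.inl (mem_glue.2 (by simp))
    · exact Or.inr (Finset.card_singleton _)
    · exact Or.inl (mem_glue.2 (by simp))
  · intro A hA B hB hne
    simp only [innerStar, Finset.mem_insert, Finset.mem_singleton] at hA hB
    rcases hA with rfl | rfl | rfl <;> rcases hB with rfl | rfl | rfl <;>
    first
    | exact absurd rfl hne
    | exact d1
    | exact d2
    | exact d3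
    | exact d1.symm
    | exact d2.symm
    | exact d3.symm
  · intro x
    by_cases h : x ∈ insert z S
    · rcases Finset.mem_insert.1 h with rfl | h
      · exact ⟨{x}, by simp [innerStar], Finset.mem_singleton_self _⟩
      · exact ⟨S, hS1, h⟩
    · exact ⟨_, hS2, Finset.mem_compl.2 h⟩
  · have hc2 := c.two_le_compl
    have n3 : ({z} : Finset L) ≠ (insert z S)ᶜ := by
      intro h
      rw [← h, Finset.card_singleton] at hc2
      omega
    have n1 : S ≠ {z} := fun h => c.notMem (h ▸ Finset.mem_singleton_self z)
    have n2 : S ≠ (insert z S)ᶜ := by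
      intro h
      obtain ⟨y, hy⟩ := c.nonempty
      exact Finset.disjoint_left.1 d2 hy (h ▸ hy)
    exact (Finset.card_eq_three.2 ⟨_, _, _, n1, n2, n3, rfl⟩).ge
  · intro T hT
    rcases mem_glue.1 hT with ⟨T', h, rfl⟩ | rfl | rfl | rfl | rfl
    · exact ⟨_, hS2, c.pullSet_trichotomy T'⟩
    · exact ⟨_, hS1, Or.inl subset_rfl⟩
    · exact ⟨_, hS1, Or.inr (by rw [compl_compl])⟩
    · exact ⟨_, hS2, Or.inr subset_rfl⟩
    · exact ⟨_, hS2, Or.inl subset_rfl⟩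

/-- A star is determined by one of its blocks. Each block of the glued tree is a preimage, or a
single leaf, or a side of one of the two new edges, and so lies in one of the listed stars. -/
theorem treeStars_glue (hτ : IsSplitSystem τ) :
    treeStars (glue π S z τ) =
      insert (outerStar S) (insert (innerStar S z) ((treeStars τ).image fun V => V.image (pullSet π))) := by
  have hσ := c.isSplitSystem_glue hτ
  ext V
  rw [Finset.mem_insert, Finset.mem_insert, Finset.mem_image]
  constructor
  · intro hV
    obtain ⟨A, hA⟩ : V.Nonempty := Finset.card_pos.1 (by
      have := (mem_treeStars.1 hV).2.2.2.1; omega)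
    have hpull : ∀ B, IsBlock τ B → pullSet π B = A →
        ∃ V', V' ∈ treeStars τ ∧ V'.image (pullSet π) = V := by
      rintro B hB rfl
      obtain ⟨V', hV', hB'⟩ := hτ.exists_star c.three_le hB
      exact ⟨V', hV', hσ.star_unique (c.star_pullSet hV') hV (Finset.mem_image_of_mem _ hB') hA⟩
    have hout : A ∈ outerStar S → V = outerStar S := fun h =>
      hσ.star_unique hV c.outerStar_mem hA h
    have hinn : A ∈ innerStar S z → V = innerStar S z := fun h =>
      hσ.star_unique hV c.innerStar_mem hA h
    have hout' : A ∉ outerStar S ∨ V = outerStar S := by tauto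
    have hinn' : A ∉ innerStar S z ∨ V = innerStar S z := by tauto
    rcases hout' with hout' | h
    swap
    · exact Or.inl h
    rcases hinn' with hinn' | h
    swap
    · exact Or.inr (Or.inl h)
    right; right
    rcases (mem_treeStars.1 hV).1 A hA with h | h
    · rcases mem_glue.1 h with ⟨T', h', rfl⟩ | rfl | rfl | rfl | rfl
      · exact hpull T' (Or.inl h') rfl
      · exact absurd (by simp [innerStar]) hinn'
      · exact absurd (by simp [outerStar]) hout'
      · exact hpull {o} (Or.inr (Finset.card_singleton _)) c.pullSet_singleton
      · exact absurd (by simp [innerStar]) hinn'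
    · obtain ⟨y, rfl⟩ := Finset.card_eq_one.1 h
      have h1 : y ≠ z := by
        rintro rfl
        exact hinn' (by simp [innerStar])
      have h2 : y ∉ S := fun h => hout' (Finset.mem_insert_of_mem (Finset.mem_image_of_mem _ h))
      have h3 : π y ≠ o := fun h => by
        rcases Finset.mem_insert.1 ((c.fiber y).1 h) with h | h
        · exact h1 h
        · exact h2 h
      refine hpull {π y} (Or.inr (Finset.card_singleton _)) ?_
      ext w
      rw [mem_pullSet, Finset.mem_singleton, Finset.mem_singleton]
      exact ⟨fun h => (c.inj y w h.symm h3).symm, fun h => h ▸ rfl⟩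
  · rintro (rfl | rfl | ⟨V', hV', rfl⟩)
    · exact c.outerStar_mem
    · exact c.innerStar_mem
    · exact c.star_pullSet hV'

theorem outerStar_ne_innerStar : outerStar S ≠ innerStar S z := by
  intro h
  have h1 : Sᶜ ∈ innerStar S z := h ▸ Finset.mem_insert_self _ _
  simp only [innerStar, Finset.mem_insert, Finset.mem_singleton] at h1
  obtain ⟨y, hy⟩ := c.nonempty
  rcases h1 with h1 | h1 | h1
  · exact Finset.mem_compl.1 (h1.symm ▸ hy) hy
  · have := c.two_le_compl.trans (Finset.card_le_card c.compl_subset)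
    rw [h1, Finset.card_singleton] at this
    omega
  · have : z ∈ (insert z S)ᶜ := h1 ▸ Finset.mem_compl.2 c.notMem
    exact Finset.mem_compl.1 this (Finset.mem_insert_self _ _)

theorem outerStar_ne_image (V : Finset (Finset L')) : V.image (pullSet π) ≠ outerStar S := by
  intro h
  have : Sᶜ ∈ V.image (pullSet π) := h ▸ Finset.mem_insert_self _ _
  obtain ⟨T, -, hT⟩ := Finset.mem_image.1 this
  exact c.pullSet_ne_compl hT

theorem innerStar_ne_image (V : Finset (Finset L')) : V.image (pullSet π) ≠ innerStar S z := by
  intro h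
  have : S ∈ V.image (pullSet π) := h ▸ Finset.mem_insert_self _ _
  obtain ⟨T, -, hT⟩ := Finset.mem_image.1 this
  exact c.pullSet_ne hT

theorem prod_treeStars_glue {M : Type} [CommMonoid M] (hτ : IsSplitSystem τ)
    (f : Finset (Finset L) → M) :
    ∏ V ∈ treeStars (glue π S z τ), f V =
      f (outerStar S) * f (innerStar S z) * ∏ V ∈ treeStars τ, f (V.image (pullSet π)) := by
  rw [c.treeStars_glue hτ, Finset.prod_insert, Finset.prod_insert, Finset.prod_image, mul_assoc]
  · intro V _ V' _ h
    exact Finset.image_injective (pullSet_injective c.surj) h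
  · intro h
    obtain ⟨V, -, h⟩ := Finset.mem_image.1 h
    exact c.innerStar_ne_image V h
  · intro h
    rcases Finset.mem_insert.1 h with h | h
    · exact c.outerStar_ne_innerStar h
    · obtain ⟨V, -, h⟩ := Finset.mem_image.1 h
      exact c.outerStar_ne_image V h

theorem subset_of_glue {τ₁ τ₂ : Finset (Finset L')} (h₁ : IsSplitSystem τ₁)
    (h : glue π S z τ₁ ⊆ glue π S z τ₂) : τ₁ ⊆ τ₂ := by
  intro T hT
  rcases mem_glue.1 (h (mem_glue.2 (Or.inl ⟨T, hT, rfl⟩))) with ⟨T', h', he⟩ | h' | h' | h' | h'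
  · exact pullSet_injective c.surj he ▸ h'
  · exact absurd h' c.pullSet_ne
  · exact absurd h' c.pullSet_ne_compl
  · rw [← c.pullSet_singleton] at h'
    have := h₁.two_le_card _ hT
    rw [pullSet_injective c.surj h', Finset.card_singleton] at this
    omega
  · rw [← c.pullSet_singleton, ← pullSet_compl] at h'
    have := h₁.two_le_card _ (h₁.compl_mem _ hT)
    rw [pullSet_injective c.surj h', compl_compl, Finset.card_singleton] at this
    omega

theorem glue_injective {τ₁ τ₂ : Finset (Finset L')} (h₁ : IsSplitSystem τ₁)
    (h₂ : IsSplitSystem τ₂) (h : glue π S z τ₁ = glue π S z τ₂) : τ₁ = τ₂ :=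
  Finset.Subset.antisymm (c.subset_of_glue h₁ h.subset) (c.subset_of_glue h₂ h.superset)

/-- A set that does not meet the contracted leaves is a preimage. -/
theorem exists_pullSet {T : Finset L} (h : T ⊆ (insert z S)ᶜ) : ∃ T', pullSet π T' = T := by
  refine ⟨T.image π, ?_⟩
  ext x
  rw [mem_pullSet, Finset.mem_image]
  constructor
  · rintro ⟨y, hy, hyx⟩
    have : π y ≠ o := fun h' => Finset.mem_compl.1 (h hy) ((c.fiber y).1 h')
    exact c.inj y x hyx this ▸ hy
  · exact fun hx => ⟨x, hx, rfl⟩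

/-- A tree with the two prescribed vertices has, apart from the edge `S`, only splits with a side
beyond the edge `(insert z S)ᶜ`. There `π` is injective, so these splits are preimages. -/
theorem exists_glue {σ : Finset (Finset L)} (hσ : IsSplitSystem σ) (h1 : outerStar S ∈ treeStars σ)
    (h2 : innerStar S z ∈ treeStars σ) (hK : (insert z S)ᶜ ∈ σ) :
    ∃ τ, IsSplitSystem τ ∧ glue π S z τ = σ := by
  have hS : S ∈ σ := by
    rcases (mem_treeStars.1 h2).1 S (by simp [innerStar]) with h | h
    · exact h
    · have := c.two_le; omega
  have hcov : ∀ T ∈ σ, T = S ∨ T = Sᶜ ∨ T ⊆ (insert z S)ᶜ ∨ Tᶜ ⊆ (insert z S)ᶜ := by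
    have half : ∀ T ∈ σ, T ⊆ Sᶜ → T = Sᶜ ∨ T ⊆ (insert z S)ᶜ := by
      intro T hT hTS
      have hTne := hσ.block_nonempty (Or.inl hT)
      obtain ⟨B, hB, h⟩ := (mem_treeStars.1 h2).2.2.2.2 T hT
      simp only [innerStar, Finset.mem_insert, Finset.mem_singleton] at hB
      rcases hB with rfl | rfl | rfl
      · rcases h with h | h
        · obtain ⟨y, hy⟩ := hTne
          exact absurd (h hy) (Finset.mem_compl.1 (hTS hy))
        · left
          exact Finset.Subset.antisymm hTS (compl_subset_comm'.1 h)
      · exfalso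
        rcases h with h | h
        · have := (hσ.two_le_card _ hT).trans (Finset.card_le_card h)
          rw [Finset.card_singleton] at this
          omega
        · have := (hσ.two_le_card _ (hσ.compl_mem _ hT)).trans (Finset.card_le_card h)
          rw [Finset.card_singleton] at this
          omega
      · rcases h with h | h
        · exact Or.inr h
        · exfalso
          obtain ⟨y, hy⟩ := c.nonempty
          exact Finset.mem_compl.1 (hTS (Finset.compl_subset_compl.1 h
            (Finset.mem_insert_of_mem hy))) hy
    intro T hT
    obtain ⟨B, hB, h⟩ := (mem_treeStars.1 h1).2.2.2.2 T hT
    rcases Finset.mem_insert.1 hB with rfl | hB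
    · rcases h with h | h
      · rcases half T hT h with h | h <;> tauto
      · rcases half Tᶜ (hσ.compl_mem _ hT) h with h | h
        · left; exact compl_injective h
        · tauto
    · exfalso
      obtain ⟨x, -, rfl⟩ := Finset.mem_image.1 hB
      rcases h with h | h
      · have := (hσ.two_le_card _ hT).trans (Finset.card_le_card h)
        rw [Finset.card_singleton] at this
        omega
      · have := (hσ.two_le_card _ (hσ.compl_mem _ hT)).trans (Finset.card_le_card h)
        rw [Finset.card_singleton] at this
        omega
  -- The edge `insert z S` is the preimage of the leaf `o`. It becomes a leaf edge, and so its two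
  -- sides have to be left out.
  refine ⟨Finset.univ.filter fun T' => pullSet π T' ∈ σ ∧ T' ≠ {o} ∧ T' ≠ {o}ᶜ, ⟨?_, ?_, ?_⟩, ?_⟩
  · intro T hT
    simp only [Finset.mem_filter, Finset.mem_univ, true_and] at hT ⊢
    refine ⟨pullSet_compl (π := π) T ▸ hσ.compl_mem _ hT.1, fun h => hT.2.2 ?_, fun h => hT.2.1 ?_⟩
    · rw [← h, compl_compl]
    · exact compl_injective h
  · intro T hT
    simp only [Finset.mem_filter, Finset.mem_univ, true_and] at hT
    by_contra hlt
    have h2 := hσ.two_le_card _ hT.1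
    have hne : T.Nonempty := by
      rw [Finset.nonempty_iff_ne_empty]
      rintro rfl
      simp [pullSet] at h2
    obtain ⟨y, rfl⟩ := Finset.card_eq_one.1 (show T.card = 1 by
      have := Finset.card_pos.2 hne; omega)
    by_cases hy : y = o
    · exact hT.2.1 (by rw [hy])
    · rw [c.card_pullSet_singleton hy] at h2
      omega
  · intro T hT T₁ hT₁
    simp only [Finset.mem_filter, Finset.mem_univ, true_and] at hT hT₁
    have := hσ.compatible _ hT.1 _ hT₁.1
    simpa only [← pullSet_compl, pullSet_subset_iff c.surj] using this
  · ext T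
    rw [mem_glue]
    simp only [Finset.mem_filter, Finset.mem_univ, true_and]
    constructor
    · rintro (⟨T', ⟨h, -⟩, rfl⟩ | rfl | rfl | rfl | rfl)
      · exact h
      · exact hS
      · exact hσ.compl_mem _ hS
      · exact compl_compl (insert z S) ▸ hσ.compl_mem _ hK
      · exact hK
    · intro hT
      by_cases n1 : T = insert z S
      · tauto
      by_cases n2 : T = (insert z S)ᶜ
      · tauto
      have hne : ∀ T', pullSet π T' = T → T' ≠ {o} ∧ T' ≠ {o}ᶜ := by
        rintro T' rfl
        refine ⟨?_, ?_⟩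
        · rintro rfl; exact n1 c.pullSet_singleton
        · rintro rfl; exact n2 (by rw [pullSet_compl, c.pullSet_singleton])
      rcases hcov T hT with h | h | h | h
      · tauto
      · tauto
      · obtain ⟨T', rfl⟩ := c.exists_pullSet h
        exact Or.inl ⟨T', ⟨hT, hne T' rfl⟩, rfl⟩
      · obtain ⟨T', hT'⟩ := c.exists_pullSet h
        have e : pullSet π T'ᶜ = T := by rw [pullSet_compl, hT', compl_compl]
        exact Or.inl ⟨T'ᶜ, ⟨e ▸ hT, hne _ e⟩, e⟩

end IsContraction

end Contraction

/-! ### Curves with a corner and curves with the corner collapsed. -/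

namespace MetricTree

theorem realizes_iff_config {r s : ℕ} {E : Type} [Fintype E] [DecidableEq E] {u : E → ℤ × ℤ}
    {σ : Finset (Finset (Leaf r s E))} (hu : ∑ e, u e = 0) (hσ : IsSplitSystem σ) (ρ : Leaf r s E)
    (i₀ : Fin r ⊕ Fin s) (P : Fin r ⊕ Fin s → ℝ × ℝ) :
    Realizes u P σ ↔ (∀ V ∈ treeStars σ, HasThick V → 4 ≤ V.card) ∧
      ∃ w x, (∀ S ∈ rooted σ ρ, 0 < x S) ∧ P = config u σ ρ w x := by
  rw [realizes_iff hu hσ ρ i₀ P]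
  refine and_congr_right fun _ => ⟨?_, ?_⟩
  · rintro ⟨w, x, hx, rfl⟩
    refine ⟨w, extendLength σ ρ x, fun S hS => extendLength_pos hx hσ (mem_rooted.1 hS).1, ?_⟩
    rw [config_eq_evMap]; congr; funext S; exact (extendLength_rooted x S).symm
  · rintro ⟨w, x, hx, rfl⟩
    exact ⟨w, fun S => x S, fun S => hx S.1 S.2, config_eq_evMap ρ w x⟩

/-- The data that relate the curves with a given corner at the marking `m` to the curves in which
the corner is replaced by an end `o`. -/
structure IsCollapse {r s r' s' : ℕ} {E E' : Type} [Fintype E] [DecidableEq E] [Fintype E']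
    [DecidableEq E'] (u : E → ℤ × ℤ) (u' : E' → ℤ × ℤ) (m : Fin r ⊕ Fin s)
    (μ : Fin r' ⊕ Fin s' → Fin r ⊕ Fin s) (J : Finset E) (f : E)
    (π : Leaf r s E → Leaf r' s' E') (o : E') : Prop where
  contraction : IsContraction π (core m J) (Sum.inr f) (Sum.inr o)
  marking : ∀ j, π (Sum.inl (μ j)) = Sum.inl j
  ne : ∀ j, μ j ≠ m
  cover : ∀ j, j ≠ m → ∃ j', μ j' = j
  isRight : ∀ j, (μ j).isRight = j.isRight
  dir : ∀ e, dirTo u (pullSet π {Sum.inr e}) = u' e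

namespace IsCollapse

variable {r s r' s' : ℕ} {E E' : Type} [Fintype E] [DecidableEq E] [Fintype E']
    [DecidableEq E'] {u : E → ℤ × ℤ} {u' : E' → ℤ × ℤ} {m : Fin r ⊕ Fin s}
    {μ : Fin r' ⊕ Fin s' → Fin r ⊕ Fin s} {J : Finset E} {f : E}
    {π : Leaf r s E → Leaf r' s' E'} {o : E'} (c : IsCollapse u u' m μ J f π o)
    {τ : Finset (Finset (Leaf r' s' E'))}
include c

theorem pullSet_marking (j : Fin r' ⊕ Fin s') :
    pullSet π {Sum.inl j} = {Sum.inl (μ j)} := by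
  obtain ⟨y, hy⟩ := Finset.card_eq_one.1
    (c.contraction.card_pullSet_singleton (y := Sum.inl j) (by simp))
  have : Sum.inl (μ j) ∈ pullSet π {Sum.inl j} :=
    mem_pullSet.2 (Finset.mem_singleton.2 (c.marking j))
  rw [hy, Finset.mem_singleton] at this
  rw [hy, this]

theorem mem_core_iff (j : Fin r ⊕ Fin s) :
    (Sum.inl j : Leaf r s E) ∈ core m J ↔ j = m := by
  simp [core]

/-- The new end has the total direction of the collapsed leaves, and all other leaves keep their
directions. Hence old vertices keep their multiplicities. -/
theorem dirTo_pullSet (T : Finset (Leaf r' s' E')) : dirTo u (pullSet π T) = dirTo u' T := by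
  rw [dirTo, dirTo, ← Finset.sum_fiberwise_of_maps_to (g := π) (t := T) fun x hx => mem_pullSet.1 hx]
  refine Finset.sum_congr rfl fun y hy => ?_
  have h : (pullSet π T).filter (fun x => π x = y) = pullSet π {y} := by
    ext x
    rw [Finset.mem_filter, mem_pullSet, mem_pullSet, Finset.mem_singleton]
    exact ⟨fun h => h.2, fun h => ⟨h ▸ hy, h⟩⟩
  rw [h]
  rcases y with j | e
  · rw [c.pullSet_marking]; simp
  · exact c.dir e

theorem sum_eq_zero (hu : ∑ e, u e = 0) : ∑ e, u' e = 0 := by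
  have h : ∀ {r s : ℕ} {E : Type} [Fintype E] [DecidableEq E] (u : E → ℤ × ℤ),
      dirTo (r := r) (s := s) u Finset.univ = ∑ e, u e := by
    intro r s E _ _ u
    rw [dirTo, Fintype.sum_sum_type]
    simp
  rw [← h (r := r') (s := s'), ← c.dirTo_pullSet, ← hu, ← h (r := r) (s := s)]
  congr 1
  ext x
  simp [mem_pullSet]

theorem marking_mem_image {V : Finset (Finset (Leaf r' s' E'))} {i : Fin r ⊕ Fin s} :
    {Sum.inl i} ∈ V.image (pullSet π) ↔ ∃ j, μ j = i ∧ {Sum.inl j} ∈ V := by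
  constructor
  · intro h
    obtain ⟨T, hT, he⟩ := Finset.mem_image.1 h
    by_cases hi : i = m
    · exfalso
      have h1 : (Sum.inl i : Leaf r s E) ∈ core m J := (c.mem_core_iff i).2 hi
      have h2 : Sum.inr o ∈ T := by
        rw [← (c.contraction.fiber (Sum.inl i)).2 (Finset.mem_insert_of_mem h1), ← mem_pullSet, he]
        exact Finset.mem_singleton_self _
      have h3 := c.contraction.subset_pullSet h2 (Finset.mem_insert_self _ _)
      rw [he] at h3
      simp at h3
    · obtain ⟨j, rfl⟩ := c.cover i hi
      refine ⟨j, rfl, ?_⟩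
      rw [← c.pullSet_marking] at he
      exact pullSet_injective c.contraction.surj he ▸ hT
  · rintro ⟨j, rfl, hj⟩
    rw [← c.pullSet_marking]
    exact Finset.mem_image_of_mem _ hj

theorem hasThick_image {V : Finset (Finset (Leaf r' s' E'))} :
    HasThick (V.image (pullSet π)) ↔ HasThick V := by
  constructor
  · rintro ⟨k, hk⟩
    obtain ⟨j, hj, hV⟩ := c.marking_mem_image.1 hk
    have := c.isRight j
    rw [hj] at this
    rcases j with j | j
    · simp at this
    · exact ⟨j, hV⟩
  · rintro ⟨k, hk⟩
    have := c.isRight (Sum.inr k)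
    obtain ⟨k', hk'⟩ : ∃ k', μ (Sum.inr k) = Sum.inr k' := Sum.isRight_iff.1 (by simpa using this)
    exact ⟨k', c.marking_mem_image.2 ⟨_, hk', hk⟩⟩

theorem hasSimple_image {V : Finset (Finset (Leaf r' s' E'))} :
    HasSimple (V.image (pullSet π)) ↔ HasSimple V := by
  constructor
  · rintro ⟨k, hk⟩
    obtain ⟨j, hj, hV⟩ := c.marking_mem_image.1 hk
    have := c.isRight j
    rw [hj] at this
    rcases j with j | j
    · exact ⟨j, hV⟩
    · simp at this
  · rintro ⟨k, hk⟩
    have := c.isRight (Sum.inl k)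
    obtain ⟨k', hk'⟩ : ∃ k', μ (Sum.inl k) = Sum.inl k' := Sum.isLeft_iff.1 (by simpa using this)
    exact ⟨k', c.marking_mem_image.2 ⟨_, hk', hk⟩⟩

theorem vertexMult_image (V : Finset (Finset (Leaf r' s' E'))) :
    vertexMult u (V.image (pullSet π)) = vertexMult u' V := by
  have h : mikhalkinMult u (V.image (pullSet π)) = mikhalkinMult u' V := by
    rw [mikhalkinMult, mikhalkinMult, ← Finset.prodMap_image_product, Finset.sup_image]
    refine Finset.sup_congr rfl fun p _ => ?_
    simp only [Function.comp, Prod.map_fst, Prod.map_snd, c.dirTo_pullSet]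
  have ht := c.hasThick_image (V := V)
  have hs := c.hasSimple_image (V := V)
  unfold vertexMult
  rw [h]
  classical
  exact if_congr ht rfl (if_congr hs rfl rfl)

theorem typeMult_glue (hτ : IsSplitSystem τ) :
    typeMult u (glue π (core m J) (Sum.inr f) τ) =
      vertexMult u (outerStar (core m J)) * vertexMult u (innerStar (core m J) (Sum.inr f)) *
        typeMult u' τ := by
  rw [typeMult, c.contraction.prod_treeStars_glue hτ]
  simp only [c.vertexMult_image, typeMult]

theorem rooted_glue (hτ : IsSplitSystem τ) :
    rooted (glue π (core m J) (Sum.inr f) τ) (Sum.inl m) =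
      insert (core m J)ᶜ (insert (insert (Sum.inr f) (core m J))ᶜ
        ((rooted τ (Sum.inr o)).image (pullSet π))) := by
  have hm : (Sum.inl m : Leaf r s E) ∈ core m J := Finset.mem_insert_self _ _
  ext T
  simp only [mem_rooted, mem_glue, Finset.mem_insert, Finset.mem_image]
  constructor
  · rintro ⟨⟨T', hT', rfl⟩ | rfl | rfl | rfl | rfl, h⟩
    · refine Or.inr (Or.inr ⟨T', ⟨hT', fun ho => h ?_⟩, rfl⟩)
      exact c.contraction.subset_pullSet ho (Finset.mem_insert_of_mem hm)
    · exact absurd hm h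
    · exact Or.inl rfl
    · exact absurd (Finset.mem_insert_of_mem hm) h
    · exact Or.inr (Or.inl rfl)
  · rintro (rfl | rfl | ⟨T', ⟨hT', ho⟩, rfl⟩)
    · exact ⟨by simp, by simpa using hm⟩
    · exact ⟨by simp, fun h => Finset.mem_compl.1 h (Finset.mem_insert_of_mem hm)⟩
    · refine ⟨Or.inl ⟨T', hT', rfl⟩, fun h => ?_⟩
      exact Finset.mem_compl.1 (c.contraction.pullSet_subset ho h) (Finset.mem_insert_of_mem hm)

/-- Seen from `m`, the two edges of the corner only translate the rest of the curve. -/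
theorem config_glue (hτ : IsSplitSystem τ) (w : ℝ × ℝ) (x : Finset (Leaf r s E) → ℝ) :
    (config u (glue π (core m J) (Sum.inr f) τ) (Sum.inl m) w x m = w) ∧
    ∀ j, config u (glue π (core m J) (Sum.inr f) τ) (Sum.inl m) w x (μ j) =
      config u' τ (Sum.inr o) (w + x (core m J)ᶜ • dirR u (core m J)ᶜ +
        x (insert (Sum.inr f) (core m J))ᶜ • dirR u (insert (Sum.inr f) (core m J))ᶜ)
        (fun T => x (pullSet π T)) j := by
  constructor
  · rw [config, Pi.add_apply, Finset.sum_apply, Finset.sum_eq_zero, add_zero]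
    intro S hS
    rw [Pi.smul_apply, edgeVec, if_neg (mem_rooted.1 hS).2, smul_zero]
  · intro j
    have hne : Sum.inl (μ j) ∉ insert (Sum.inr f) (core m J) := by
      rw [Finset.mem_insert, c.mem_core_iff]
      simp [c.ne j]
    have hne' : Sum.inl (μ j) ∉ core m J := fun h => hne (Finset.mem_insert_of_mem h)
    rw [config, config, c.rooted_glue hτ, Finset.sum_insert, Finset.sum_insert, Finset.sum_image]
    · simp only [Pi.add_apply, Finset.sum_apply, Pi.smul_apply]
      rw [← add_assoc, ← add_assoc]
      congr 1
      · simp [edgeVec, hne']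
      · refine Finset.sum_congr rfl fun T _ => ?_
        have h1 : Sum.inl (μ j) ∈ pullSet π T ↔ Sum.inl j ∈ T := by rw [mem_pullSet, c.marking]
        have h2 : dirR u (pullSet π T) = dirR u' T := by simp only [dirR, c.dirTo_pullSet]
        simp only [edgeVec, h1, h2]
    · exact fun _ _ _ _ h => pullSet_injective c.contraction.surj h
    · intro h
      obtain ⟨T, hT, he⟩ := Finset.mem_image.1 h
      rw [← c.contraction.pullSet_singleton, ← pullSet_compl] at he
      have h1 := pullSet_injective c.contraction.surj he
      have h2 := hτ.two_le_card _ (hτ.compl_mem _ (mem_rooted.1 hT).1)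
      rw [h1, compl_compl, Finset.card_singleton] at h2
      omega
    · intro h
      rcases Finset.mem_insert.1 h with h | h
      · have h1 := compl_injective h
        exact c.contraction.notMem (h1 ▸ Finset.mem_insert_self _ _)
      · obtain ⟨T, -, he⟩ := Finset.mem_image.1 h
        exact c.contraction.pullSet_ne_compl he

theorem realizes_of_glue (hu : ∑ e, u e = 0) (hτ : IsSplitSystem τ) (i₀ : Fin r' ⊕ Fin s')
    {P : Fin r ⊕ Fin s → ℝ × ℝ} (h : Realizes u P (glue π (core m J) (Sum.inr f) τ)) :
    Realizes u' (P ∘ μ) τ := by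
  obtain ⟨h1, w, x, hx, hP⟩ := (realizes_iff_config hu (c.contraction.isSplitSystem_glue hτ)
    (Sum.inl m) m P).1 h
  refine (realizes_iff_config (c.sum_eq_zero hu) hτ (Sum.inr o) i₀ _).2 ⟨fun V hV hth => ?_,
    w + x (core m J)ᶜ • dirR u (core m J)ᶜ + x (insert (Sum.inr f) (core m J))ᶜ •
      dirR u (insert (Sum.inr f) (core m J))ᶜ, fun T => x (pullSet π T), fun S hS => ?_, ?_⟩
  rotate_left 2
  · funext j
    rw [Function.comp, hP]
    exact (c.config_glue hτ w x).2 j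
  · have := h1 _ (c.contraction.star_pullSet hV) (c.hasThick_image.2 hth)
    rwa [Finset.card_image_of_injective _ (pullSet_injective c.contraction.surj)] at this
  · refine hx _ ?_
    rw [c.rooted_glue hτ]
    exact Finset.mem_insert_of_mem (Finset.mem_insert_of_mem (Finset.mem_image_of_mem _ hS))

theorem not_hasThick_innerStar : ¬ HasThick (innerStar (core m J) (Sum.inr f)) := by
  rintro ⟨k, hk⟩
  have h1 := c.contraction.two_le
  have h2 := c.contraction.two_le_compl
  simp only [innerStar, Finset.mem_insert, Finset.mem_singleton] at hk
  rcases hk with hk | hk | hk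
  · rw [← hk, Finset.card_singleton] at h1; omega
  · simp at hk
  · rw [← hk, Finset.card_singleton] at h2; omega

theorem not_hasSimple_innerStar : ¬ HasSimple (innerStar (core m J) (Sum.inr f)) := by
  rintro ⟨k, hk⟩
  have h1 := c.contraction.two_le
  have h2 := c.contraction.two_le_compl
  simp only [innerStar, Finset.mem_insert, Finset.mem_singleton] at hk
  rcases hk with hk | hk | hk
  · rw [← hk, Finset.card_singleton] at h1; omega
  · simp at hk
  · rw [← hk, Finset.card_singleton] at h2; omega

theorem marking_mem_outerStar {j : Fin r ⊕ Fin s} :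
    {Sum.inl j} ∈ outerStar (core m J) ↔ j = m := by
  have h2 := c.contraction.two_le_compl.trans (Finset.card_le_card c.contraction.compl_subset)
  rw [outerStar, Finset.mem_insert, Finset.mem_image]
  constructor
  · rintro (h | ⟨x, hx, h⟩)
    · rw [← h, Finset.card_singleton] at h2; omega
    · rw [Finset.singleton_inj] at h
      exact (c.mem_core_iff j).1 (h ▸ hx)
  · exact fun h => Or.inr ⟨_, (c.mem_core_iff j).2 h, rfl⟩

/-- The corner can be attached if the marking lies in the open cone at the vertex of the end `o`
spanned by the directions of the two new edges. The coefficients are the lengths of these edges. -/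
theorem realizes_glue (hu : ∑ e, u e = 0) (hτ : IsSplitSystem τ) {P : Fin r ⊕ Fin s → ℝ × ℝ}
    {Q : Fin r' ⊕ Fin s' → ℝ × ℝ} (hQ : ∀ j, P (μ j) = Q j)
    (hthick : HasThick (outerStar (core m J)) → 2 ≤ J.card)
    (i₀ : Fin r' ⊕ Fin s') (h : Realizes u' Q τ) {w : ℝ × ℝ} {x : Finset (Leaf r' s' E') → ℝ}
    (hx : ∀ S ∈ rooted τ (Sum.inr o), 0 < x S) (hw : Q = config u' τ (Sum.inr o) w x) {a b : ℝ}
    (ha : 0 < a) (hb : 0 < b) (hP : P m = w + a • dirR u (core m J) +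
      b • dirR u (insert (Sum.inr f) (core m J))) :
    Realizes u P (glue π (core m J) (Sum.inr f) τ) := by
  have h1 := ((realizes_iff_config (c.sum_eq_zero hu) hτ (Sum.inr o) i₀ _).1 h).1
  refine (realizes_iff_config hu (c.contraction.isSplitSystem_glue hτ) (Sum.inl m) m P).2 ⟨?_, ?_⟩
  · intro V hV hth
    rw [c.contraction.treeStars_glue hτ, Finset.mem_insert, Finset.mem_insert, Finset.mem_image] at hV
    rcases hV with rfl | rfl | ⟨V, hV, rfl⟩
    · rw [outerStar, Finset.card_insert_of_notMem, Finset.card_image_of_injective _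
        Finset.singleton_injective, core, Finset.card_insert_of_notMem (by simp),
        Finset.card_image_of_injective _ Sum.inr_injective]
      · have := hthick hth; omega
      · intro h
        obtain ⟨y, hy, h⟩ := Finset.mem_image.1 h
        have : y ∈ (core m J)ᶜ := h ▸ Finset.mem_singleton_self y
        exact Finset.mem_compl.1 this hy
    · exact absurd hth c.not_hasThick_innerStar
    · rw [Finset.card_image_of_injective _ (pullSet_injective c.contraction.surj)]
      exact h1 V hV (c.hasThick_image.1 hth)
  -- The side `(core m J)ᶜ` is not a preimage and receives the default value `a`. The other new side
  -- is the preimage of `{o}ᶜ`, which is not an edge of `τ`, so its value can be set to `b`.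
  · set y : Finset (Leaf r s E) → ℝ := Function.extend (pullSet π)
      (Function.update x {Sum.inr o}ᶜ b) fun _ => a with hy
    have hy1 : y (core m J)ᶜ = a := Function.extend_apply' _ _ _ fun ⟨T, hT⟩ =>
      c.contraction.pullSet_ne_compl hT
    have hy2 : y (insert (Sum.inr f) (core m J))ᶜ = b := by
      rw [← c.contraction.pullSet_singleton, ← pullSet_compl, hy,
        (pullSet_injective c.contraction.surj).extend_apply, Function.update_self]
    have hy3 : ∀ T ∈ rooted τ (Sum.inr o), y (pullSet π T) = x T := by
      intro T hT
      rw [hy, (pullSet_injective c.contraction.surj).extend_apply, Function.update_of_ne]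
      rintro rfl
      have := hτ.two_le_card _ (hτ.compl_mem _ (mem_rooted.1 hT).1)
      rw [compl_compl, Finset.card_singleton] at this
      omega
    refine ⟨P m, y, ?_, ?_⟩
    · intro S hS
      rw [c.rooted_glue hτ, Finset.mem_insert, Finset.mem_insert, Finset.mem_image] at hS
      rcases hS with rfl | rfl | ⟨T, hT, rfl⟩
      · rwa [hy1]
      · rwa [hy2]
      · rw [hy3 T hT]; exact hx T hT
    · obtain ⟨c1, c2⟩ := c.config_glue hτ (P m) y
      funext j
      by_cases hj : j = m
      · rw [hj, c1]
      · obtain ⟨j, rfl⟩ := c.cover j hj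
        rw [c2, hQ, hw, hy1, hy2, dirR_compl hu, dirR_compl hu, hP]
        have e : w + a • dirR u (core m J) + b • dirR u (insert (Sum.inr f) (core m J)) +
            a • -dirR u (core m J) + b • -dirR u (insert (Sum.inr f) (core m J)) = w := by
          rw [smul_neg, smul_neg]; abel
        have e' : ∑ S ∈ rooted τ (Sum.inr o), y (pullSet π S) • edgeVec u' S =
            ∑ S ∈ rooted τ (Sum.inr o), x S • edgeVec u' S :=
          Finset.sum_congr rfl fun T hT => by rw [hy3 T hT]
        simp only [e, config, e']

end IsCollapse

/-! ### Summation over the curves with a given corner. -/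

section Corners

variable {r s : ℕ} {E : Type} [Fintype E] [DecidableEq E] {u : E → ℤ × ℤ}
  {τ : Finset (Finset (Leaf r s E))} {m : Fin r ⊕ Fin s}

theorem IsCorner.mem_iff {J : Finset E} {f : E} (c : IsCorner τ m J f) (hτ : IsSplitSystem τ)
    (e : E) : e ∈ J ↔ {Sum.inr e} ∈ outerStar (core m J) := by
  rw [outerStar, Finset.mem_insert, Finset.mem_image]
  constructor
  · intro h
    exact Or.inr ⟨Sum.inr e, Finset.mem_insert_of_mem (Finset.mem_image_of_mem _ h), rfl⟩
  · rintro (h | ⟨x, hx, h⟩)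
    · have h2 := (hτ.two_le_card _ c.mem).trans (Finset.card_le_card
        (Finset.compl_subset_compl.2 (Finset.subset_insert (Sum.inr f) (core m J))))
      rw [← h, Finset.card_singleton] at h2
      omega
    · rw [Finset.singleton_inj] at h
      rw [h] at hx
      simpa [core] using hx

/-- The star of the marking determines `J`, and the star at the other end of its remaining edge
determines `f`. -/
theorem IsCorner.unique (hτ : IsSplitSystem τ) {J J' : Finset E} {f f' : E}
    (c : IsCorner τ m J f) (c' : IsCorner τ m J' f') : J = J' ∧ f = f' := by
  have hm : ∀ J : Finset E, {Sum.inl m} ∈ outerStar (core m J) := fun J =>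
    Finset.mem_insert_of_mem (Finset.mem_image_of_mem _ (Finset.mem_insert_self _ _))
  have hJ : J = J' := by
    ext e
    rw [c.mem_iff hτ, c'.mem_iff hτ]
    have : outerStar (core m J) = outerStar (core m J') :=
      hτ.star_unique c.star c'.star (hm J) (hm J')
    rw [this]
  subst hJ
  refine ⟨rfl, ?_⟩
  have h1 : innerStar (core m J) (Sum.inr f) = innerStar (core m J) (Sum.inr f') :=
    hτ.star_unique c.next c'.next (A := core m J) (Finset.mem_insert_self _ _)
      (Finset.mem_insert_self _ _)
  have h2 : {Sum.inr f} ∈ innerStar (core m J) (Sum.inr f') := by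
    rw [← h1]; simp [innerStar]
  simp only [innerStar, Finset.mem_insert, Finset.mem_singleton] at h2
  rcases h2 with h | h | h
  · have : Sum.inl m ∈ core m J := Finset.mem_insert_self _ _
    rw [← h] at this
    simp at this
  · simpa using h
  · have := hτ.two_le_card _ c'.mem
    rw [← h, Finset.card_singleton] at this
    omega

end Corners

namespace IsCollapse

variable {r s r' s' : ℕ} {E E' : Type} [Fintype E] [DecidableEq E] [Fintype E']
    [DecidableEq E'] {u : E → ℤ × ℤ} {u' : E' → ℤ × ℤ} {m : Fin r ⊕ Fin s}
    {μ : Fin r' ⊕ Fin s' → Fin r ⊕ Fin s} {J : Finset E} {f : E}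
    {π : Leaf r s E → Leaf r' s' E'} {o : E'} (c : IsCollapse u u' m μ J f π o)
    {τ : Finset (Finset (Leaf r' s' E'))}
include c

theorem isCorner : IsCorner (glue π (core m J) (Sum.inr f) τ) m J f :=
  ⟨fun h => c.contraction.notMem (Finset.mem_insert_of_mem (Finset.mem_image_of_mem _ h)),
    c.contraction.outerStar_mem, c.contraction.innerStar_mem, by simp [mem_glue]⟩

theorem dirTo_core : dirTo u (core m J) = ∑ e ∈ J, u e := by
  rw [dirTo, core, Finset.sum_insert (by simp), Finset.sum_image (by simp)]
  simp

theorem dirTo_insert_core : dirTo u (insert (Sum.inr f) (core m J)) = ∑ e ∈ J, u e + u f := by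
  rw [← c.dirTo_core, dirTo, Finset.sum_insert c.contraction.notMem, add_comm]
  rfl

theorem vertexMult_innerStar (hu : ∑ e, u e = 0) :
    vertexMult u (innerStar (core m J) (Sum.inr f)) =
      powDiff ((det₂ (∑ e ∈ J, u e) (u f)).natAbs : ℤ) / (RatFunc.X - RatFunc.X⁻¹) := by
  rw [mult_unmarked c.not_hasThick_innerStar c.not_hasSimple_innerStar,
    mikhalkinMult_eq (core m J) {Sum.inr f} (by simp [innerStar]) (by simp [innerStar]),
    c.dirTo_core, IsCurve.dirTo_end]
  intro C hC h1 h2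
  right
  simp only [innerStar, Finset.mem_insert, Finset.mem_singleton] at hC
  rw [(hC.resolve_left h1).resolve_left h2, dirTo_compl hu, c.dirTo_insert_core, c.dirTo_core,
    IsCurve.dirTo_end]

theorem vertexMult_outerStar_simple (hm : m.isLeft) : vertexMult u (outerStar (core m J)) = 1 := by
  obtain ⟨k, rfl⟩ := Sum.isLeft_iff.1 hm
  refine mult_simple ?_ ⟨k, c.marking_mem_outerStar.2 rfl⟩
  rintro ⟨k', hk'⟩
  simpa using c.marking_mem_outerStar.1 hk'

theorem vertexMult_outerStar_thick (hu : ∑ e, u e = 0) (hm : m.isRight) {e e' : E} (hee : e ≠ e')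
    (hJ : J = {e, e'}) : vertexMult u (outerStar (core m J)) =
      powSum ((det₂ (u e) (u e')).natAbs : ℤ) / (RatFunc.X + RatFunc.X⁻¹) := by
  obtain ⟨k, rfl⟩ := Sum.isRight_iff.1 hm
  have he : e ∈ J := by simp [hJ]
  have he' : e' ∈ J := by simp [hJ]
  have hin : ∀ e ∈ J, {Sum.inr e} ∈ outerStar (core (r := r) (Sum.inr k) J) := fun e he =>
    Finset.mem_insert_of_mem (Finset.mem_image_of_mem _
      (Finset.mem_insert_of_mem (Finset.mem_image_of_mem _ he)))
  rw [mult_thick ⟨k, c.marking_mem_outerStar.2 rfl⟩,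
    mikhalkinMult_eq {Sum.inr e} {Sum.inr e'} (hin e he) (hin e' he'),
    IsCurve.dirTo_end, IsCurve.dirTo_end]
  intro C hC h1 h2
  rw [outerStar, Finset.mem_insert, Finset.mem_image] at hC
  rcases hC with rfl | ⟨y, hy, rfl⟩
  · right
    rw [dirTo_compl hu, c.dirTo_core, hJ, Finset.sum_pair hee, IsCurve.dirTo_end, IsCurve.dirTo_end]
  · left
    rw [core, Finset.mem_insert, Finset.mem_image] at hy
    rcases hy with rfl | ⟨e'', he'', rfl⟩
    · exact dirTo_marking _
    · exfalso
      rw [hJ, Finset.mem_insert, Finset.mem_singleton] at he''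
      rcases he'' with rfl | rfl
      · exact h1 rfl
      · exact h2 rfl

-- Gluing is a bijection from the types through `Q` to the types through `P` with this corner.
-- Collapsing always preserves the incidences; for the converse `P m` has to be far away, which is
-- the hypothesis `hreal`.
open Classical in
theorem sum_typeMult_corner (hu : ∑ e, u e = 0) {P : Fin r ⊕ Fin s → ℝ × ℝ}
    {Q : Fin r' ⊕ Fin s' → ℝ × ℝ} (hP : IsGeneric u P) (hQ : IsGeneric u' Q)
    (hPQ : ∀ j, P (μ j) = Q j) (i₀ : Fin r' ⊕ Fin s')
    (hreal : ∀ τ, Realizes u' Q τ → Realizes u P (glue π (core m J) (Sum.inr f) τ)) :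
    ∑ σ ∈ (Finset.univ.filter (Realizes u P)).filter (fun σ => IsCorner σ m J f), typeMult u σ =
      vertexMult u (outerStar (core m J)) * vertexMult u (innerStar (core m J) (Sum.inr f)) *
        labelledCount u' Q := by
  rw [hQ.labelledCount_eq, Finset.mul_sum]
  symm
  refine Finset.sum_bij (fun τ _ => glue π (core m J) (Sum.inr f) τ) ?_ ?_ ?_ ?_
  · intro τ hτ
    simp only [Finset.mem_filter, Finset.mem_univ, true_and] at hτ ⊢
    exact ⟨hreal τ hτ, c.isCorner⟩
  · intro τ hτ τ' hτ' h
    simp only [Finset.mem_filter, Finset.mem_univ, true_and] at hτ hτ'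
    exact c.contraction.glue_injective (hQ.isTop hτ).1 (hQ.isTop hτ').1 h
  · intro σ hσ
    simp only [Finset.mem_filter, Finset.mem_univ, true_and] at hσ
    obtain ⟨τ, hτ, rfl⟩ := c.contraction.exists_glue (hP.isTop hσ.1).1 hσ.2.star hσ.2.next hσ.2.mem
    refine ⟨τ, ?_, rfl⟩
    simp only [Finset.mem_filter, Finset.mem_univ, true_and]
    have := c.realizes_of_glue hu hτ i₀ hσ.1
    rwa [show P ∘ μ = Q from funext hPQ] at this
  · intro τ hτ
    simp only [Finset.mem_filter, Finset.mem_univ, true_and] at hτ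
    rw [c.typeMult_glue (hQ.isTop hτ).1]

end IsCollapse

theorem labelledCount_eq_sum_corners {r s : ℕ} {E : Type} [Fintype E] [DecidableEq E]
    {u : E → ℤ × ℤ} {P : Fin r ⊕ Fin s → ℝ × ℝ} (hP : IsGeneric u P) {m : Fin r ⊕ Fin s}
    (Δ : Finset (Finset E × E))
    (h : ∀ σ, Realizes u P σ → ∃ δ ∈ Δ, IsCorner σ m δ.1 δ.2) [DecidablePred (Realizes u P)]
    [∀ δ : Finset E × E, DecidablePred fun σ => IsCorner σ m δ.1 δ.2] :
    labelledCount u P = ∑ δ ∈ Δ, ∑ σ ∈ (Finset.univ.filter (Realizes u P)).filter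
      (fun σ => IsCorner σ m δ.1 δ.2), typeMult u σ := by
  classical
  rw [hP.labelledCount_eq, ← Finset.sum_biUnion]
  · refine Finset.sum_congr ?_ fun _ _ => rfl
    ext σ
    simp only [Finset.mem_filter, Finset.mem_univ, true_and, Finset.mem_biUnion]
    exact ⟨fun hσ => (h σ hσ).imp fun δ hδ => ⟨hδ.1, hσ, hδ.2⟩, fun ⟨_, _, hσ, _⟩ => hσ⟩
  · intro δ _ δ' _ hne
    rw [Function.onFun, Finset.disjoint_left]
    intro σ hσ hσ'
    simp only [Finset.mem_filter, Finset.mem_univ, true_and] at hσ hσ'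
    have := hσ.2.unique (hP.isTop hσ.1).1 hσ'.2
    exact hne (Prod.ext this.1 this.2)

/-! ### Configurations with one far marking. -/

/-- The injection `μ` describes all markings except for `m`. -/
structure IsMarkingMap {r s r' s' : ℕ} (m : Fin r ⊕ Fin s) (μ : Fin r' ⊕ Fin s' → Fin r ⊕ Fin s) :
    Prop where
  inj : Function.Injective μ
  ne : ∀ j, μ j ≠ m
  cover : ∀ j, j ≠ m → ∃ j', μ j' = j
  isRight : ∀ j, (μ j).isRight = j.isRight

theorem isMarkingMap_simple (r s : ℕ) :
    IsMarkingMap (Sum.inl 0 : Fin (r + 1) ⊕ Fin s) (Sum.map Fin.succ id) := by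
  refine ⟨Function.Injective.sumMap (Fin.succ_injective r) Function.injective_id, ?_, ?_, ?_⟩
  · rintro (j | j) <;> simp
  · rintro (j | j) h
    · obtain ⟨i, rfl⟩ := Fin.exists_succ_eq.2 (fun h' : j = 0 => h (by rw [h']))
      exact ⟨Sum.inl i, rfl⟩
    · exact ⟨Sum.inr j, rfl⟩
  · rintro (j | j) <;> simp

theorem isMarkingMap_thick (r s : ℕ) :
    IsMarkingMap (Sum.inr 0 : Fin r ⊕ Fin (s + 1)) (Sum.map id Fin.succ) := by
  refine ⟨Function.Injective.sumMap Function.injective_id (Fin.succ_injective s), ?_, ?_, ?_⟩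
  · rintro (j | j) <;> simp
  · rintro (j | j) h
    · exact ⟨Sum.inl j, rfl⟩
    · obtain ⟨i, rfl⟩ := Fin.exists_succ_eq.2 (fun h' : j = 0 => h (by rw [h']))
      exact ⟨Sum.inr i, rfl⟩
  · rintro (j | j) <;> simp

/-- The filter of the pairs `(M, L)` with `L` much larger than `M` and `M` large. -/
def farFilter : Filter (ℝ × ℝ) := Filter.curry Filter.atTop Filter.atTop

theorem eventually_far {p : ℝ × ℝ → Prop} :
    (∀ᶠ z in farFilter, p z) ↔ ∀ᶠ M in Filter.atTop, ∀ᶠ L in Filter.atTop, p (M, L) :=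
  Filter.eventually_curry_iff

theorem exists_notMem_of_eventually {p : ℝ → Prop} (hp : ∀ᶠ x in Filter.atTop, p x) {C : Set ℝ}
    (hC : C.Countable) : ∃ x, x ∉ C ∧ p x := by
  obtain ⟨a, ha⟩ := Filter.eventually_atTop.1 hp
  obtain ⟨x, hx, hxC⟩ := (hC.dense_compl ℝ).inter_open_nonempty _ isOpen_Ioi
    (Set.nonempty_Ioi (a := a))
  exact ⟨x, hxC, ha x hx.le⟩

section Far

variable {r s r' s' : ℕ} {m : Fin r ⊕ Fin s} {μ : Fin r' ⊕ Fin s' → Fin r ⊕ Fin s}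

theorem IsMarkingMap.sum_eq (hμ : IsMarkingMap m μ) (F : Fin r ⊕ Fin s → ℝ) :
    ∑ j, F j = F m + ∑ j, F (μ j) := by
  have h : (Finset.univ : Finset (Fin r ⊕ Fin s)) = insert m (Finset.univ.image μ) := by
    ext j
    simp only [Finset.mem_univ, Finset.mem_insert, Finset.mem_image, true_and, true_iff]
    by_cases hj : j = m
    · exact Or.inl hj
    · exact Or.inr (hμ.cover j hj)
  rw [h, Finset.sum_insert, Finset.sum_image fun _ _ _ _ h => hμ.inj h]
  intro h
  obtain ⟨j, -, hj⟩ := Finset.mem_image.1 h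
  exact hμ.ne j hj

/-- A rational relation with a nonzero coefficient at a new coordinate determines this coordinate
from countably many data. So the heights M, and then the abscissae L, have to avoid only countable
sets. -/
theorem exists_far (hμ : IsMarkingMap m μ) {Q : Fin r' ⊕ Fin s' → ℝ × ℝ} (hQ : QIndep Q)
    {p : ℝ × ℝ → Prop} (hp : ∀ᶠ z in farFilter, p z) :
    ∃ P : Fin r ⊕ Fin s → ℝ × ℝ, QIndep P ∧ (∀ j, P (μ j) = Q j) ∧ p ((P m).2, (P m).1) := by
  set val : (Fin r' ⊕ Fin s' → ℚ) × (Fin r' ⊕ Fin s' → ℚ) → ℝ := fun t =>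
    ∑ j, ((t.1 j : ℝ) * (Q j).1 + (t.2 j : ℝ) * (Q j).2) with hval
  obtain ⟨M, hM, hpM⟩ := exists_notMem_of_eventually (eventually_far.1 hp)
    (Set.countable_range fun t : ((Fin r' ⊕ Fin s' → ℚ) × (Fin r' ⊕ Fin s' → ℚ)) × ℚ =>
      -val t.1 / t.2)
  obtain ⟨L, hL, hpL⟩ := exists_notMem_of_eventually hpM
    (Set.countable_range fun t : ((Fin r' ⊕ Fin s' → ℚ) × (Fin r' ⊕ Fin s' → ℚ)) × ℚ × ℚ =>
      -(val t.1 + t.2.1 * M) / t.2.2)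
  set P : Fin r ⊕ Fin s → ℝ × ℝ := Function.extend μ Q fun _ => (L, M) with hPdef
  have hPμ : ∀ j, P (μ j) = Q j := fun j => hμ.inj.extend_apply _ _ _
  have hPm : P m = (L, M) := Function.extend_apply' _ _ _ fun ⟨j, hj⟩ => hμ.ne j hj
  refine ⟨P, ?_, hPμ, by rw [hPm]; exact hpL⟩
  intro f g h
  rw [hμ.sum_eq] at h
  simp only [hPμ, hPm] at h
  have hv : val (f ∘ μ, g ∘ μ) = ∑ j, ((f (μ j) : ℝ) * (Q j).1 + (g (μ j) : ℝ) * (Q j).2) := rfl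
  rw [← hv] at h
  have hf : f m = 0 := by
    by_contra hne
    have hne' : (f m : ℝ) ≠ 0 := by exact_mod_cast hne
    refine hL ⟨((f ∘ μ, g ∘ μ), g m, f m), ?_⟩
    change -(val (f ∘ μ, g ∘ μ) + (g m : ℝ) * M) / (f m : ℝ) = L
    rw [div_eq_iff hne']
    linarith
  have hg : g m = 0 := by
    by_contra hne
    have hne' : (g m : ℝ) ≠ 0 := by exact_mod_cast hne
    refine hM ⟨((f ∘ μ, g ∘ μ), g m), ?_⟩
    change -val (f ∘ μ, g ∘ μ) / (g m : ℝ) = M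
    rw [div_eq_iff hne']
    rw [hf] at h
    push_cast at h
    linarith
  rw [hf, hg] at h
  obtain ⟨h1, h2⟩ := hQ (f ∘ μ) (g ∘ μ) (by
    rw [hv] at h
    simpa using h)
  constructor
  · funext j
    by_cases hj : j = m
    · rw [hj]; exact hf
    · obtain ⟨j, rfl⟩ := hμ.cover j hj
      exact congrFun h1 j
  · funext j
    by_cases hj : j = m
    · rw [hj]; exact hg
    · obtain ⟨j, rfl⟩ := hμ.cover j hj
      exact congrFun h2 j

theorem exists_qIndep : ∀ r s : ℕ, ∃ Q : Fin r ⊕ Fin s → ℝ × ℝ, QIndep Q := by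
  have hs : ∀ s : ℕ, ∃ Q : Fin 0 ⊕ Fin s → ℝ × ℝ, QIndep Q := by
    intro s
    induction s with
    | zero => exact ⟨fun _ => 0, fun f g _ => ⟨Subsingleton.elim _ _, Subsingleton.elim _ _⟩⟩
    | succ s ih =>
      obtain ⟨Q, hQ⟩ := ih
      obtain ⟨P, hP, -⟩ := exists_far (isMarkingMap_thick 0 s) hQ (p := fun _ => True) (by simp)
      exact ⟨P, hP⟩
  intro r s
  induction r with
  | zero => exact hs s
  | succ r ih =>
    obtain ⟨Q, hQ⟩ := ih
    obtain ⟨P, hP, -⟩ := exists_far (isMarkingMap_simple r s) hQ (p := fun _ => True) (by simp)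
    exact ⟨P, hP⟩

/-- One of the two directions is horizontal to the right and the other rises by 1. The difference of
heights fixes the second coefficient, and a large L makes the first one positive. -/
theorem eventually_cone (w : ℝ × ℝ) {d₁ d₂ : ℤ × ℤ}
    (h : d₁.2 = 0 ∧ 0 < d₁.1 ∧ d₂.2 = 1 ∨ d₂.2 = 0 ∧ 0 < d₂.1 ∧ d₁.2 = 1) :
    ∀ᶠ z in farFilter, ∃ a b : ℝ, 0 < a ∧ 0 < b ∧
      (z.2, z.1) = w + a • ((d₁.1 : ℝ), (d₁.2 : ℝ)) + b • ((d₂.1 : ℝ), (d₂.2 : ℝ)) := by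
  have key : ∀ d₁ d₂ : ℤ × ℤ, d₁.2 = 0 → 0 < d₁.1 → d₂.2 = 1 →
      ∀ᶠ z in farFilter, ∃ a b : ℝ, 0 < a ∧ 0 < b ∧
        (z.2, z.1) = w + a • ((d₁.1 : ℝ), (d₁.2 : ℝ)) + b • ((d₂.1 : ℝ), (d₂.2 : ℝ)) := by
    intro d₁ d₂ h1 h2 h3
    rw [eventually_far]
    filter_upwards [Filter.eventually_gt_atTop w.2] with M hM
    filter_upwards [Filter.eventually_gt_atTop (w.1 + (M - w.2) * d₂.1)] with L hL
    have h2' : (0 : ℝ) < d₁.1 := by exact_mod_cast h2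
    refine ⟨(L - (w.1 + (M - w.2) * d₂.1)) / d₁.1, M - w.2, div_pos (by linarith) h2',
      by linarith, ?_⟩
    ext
    · simp only [Prod.fst_add, Prod.smul_fst, smul_eq_mul]
      field_simp
      ring
    · simp [h1, h3]
  rcases h with ⟨h1, h2, h3⟩ | ⟨h1, h2, h3⟩
  · exact key d₁ d₂ h1 h2 h3
  · filter_upwards [key d₂ d₁ h1 h2 h3] with z hz
    obtain ⟨b, a, hb, ha, hz⟩ := hz
    exact ⟨a, b, ha, hb, by rw [hz]; abel⟩

/-- The bounds `D` and `K` depend only on the ends and on the fixed points `Q`, and thus can be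
chosen before M and L. -/
theorem eventually_isFar {E : Type} [Fintype E] [DecidableEq E] (u : E → ℤ × ℤ)
    (hμ : IsMarkingMap m μ) (Q : Fin r' ⊕ Fin s' → ℝ × ℝ)
    (hL : 3 ≤ Fintype.card (Leaf r s E)) :
    ∃ D K : ℝ, ∀ᶠ z in farFilter, ∀ P : Fin r ⊕ Fin s → ℝ × ℝ, (∀ j, P (μ j) = Q j) →
      ((P m).2, (P m).1) = z → ∀ τ x, IsCurve u P m τ x → IsCurve.IsFar u P m τ x D K := by
  set D : ℝ := 1 + ∑ S : Finset (Leaf r s E), (|((dirTo u S).1 : ℝ)| + |((dirTo u S).2 : ℝ)|) with hD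
  set K₀ : ℝ := ∑ j, (|(Q j).1| + |(Q j).2|) with hK₀
  have hD1 : 1 ≤ D := le_add_of_nonneg_right (Finset.sum_nonneg fun _ _ => by positivity)
  have hK0 : 0 ≤ K₀ := Finset.sum_nonneg fun _ _ => by positivity
  have hdir : ∀ S : Finset (Leaf r s E), |((dirTo u S).1 : ℝ)| ≤ D ∧ |((dirTo u S).2 : ℝ)| ≤ D := by
    intro S
    have := Finset.single_le_sum
      (f := fun S : Finset (Leaf r s E) => |((dirTo u S).1 : ℝ)| + |((dirTo u S).2 : ℝ)|)
      (fun _ _ => by positivity) (Finset.mem_univ S)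
    constructor <;> linarith [abs_nonneg ((dirTo u S).1 : ℝ), abs_nonneg ((dirTo u S).2 : ℝ)]
  have hQ : ∀ j, |(Q j).1| ≤ K₀ ∧ |(Q j).2| ≤ K₀ := by
    intro j
    have := Finset.single_le_sum (f := fun j => |(Q j).1| + |(Q j).2|)
      (fun _ _ => by positivity) (Finset.mem_univ j)
    constructor <;> linarith [abs_nonneg (Q j).1, abs_nonneg (Q j).2]
  set K : ℝ := (4 * D ^ 2) ^ Fintype.card (Leaf r s E) * K₀ with hK
  refine ⟨D, K, ?_⟩
  rw [eventually_far]
  filter_upwards [Filter.eventually_gt_atTop K] with M hM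
  filter_upwards [Filter.eventually_gt_atTop (D * M + 2 * D ^ 2 * (M + K) +
    2 * D * K * (Fintype.card (Leaf r s E) + 1) + K + 1)] with L hLM P hP hz τ x c
  obtain ⟨h1, h2⟩ := Prod.mk.inj hz
  refine ⟨hD1, by positivity, hdir, ?_, by rw [h1]; exact hM, by rw [h1, h2]; exact hLM⟩
  intro T hT ht1
  refine c.pt_bounded hL hD1 hK0 hdir ?_ _ T (Finset.card_le_univ T) hT ht1
  intro j hj
  obtain ⟨j, rfl⟩ := hμ.cover j hj
  rw [hP]
  exact hQ j

end Far

/-! ### Recursion for a far marking. -/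

theorem exists_equiv_of_map_eq {A B γ : Type} [Fintype A] [Fintype B] {f : A → γ} {g : B → γ}
    (h : (Finset.univ : Finset A).val.map f = (Finset.univ : Finset B).val.map g) :
    ∃ ψ : A ≃ B, ∀ a, g (ψ a) = f a := by
  classical
  have hcard : ∀ c, Fintype.card {a // f a = c} = Fintype.card {b // g b = c} := by
    intro c
    have := congrArg (Multiset.count c) h
    rw [Multiset.count_map, Multiset.count_map] at this
    rw [Fintype.card_subtype, Fintype.card_subtype]
    simp only [Finset.card_def, Finset.filter_val]
    simpa only [eq_comm] using this
  exact ⟨Equiv.ofFiberEquiv fun c => Fintype.equivOfCardEq (hcard c),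
    fun a => Equiv.ofFiberEquiv_map _ a⟩

variable {r s r' s' : ℕ} {E : Type} [Fintype E] [DecidableEq E] {u : E → ℤ × ℤ}
  {m : Fin r ⊕ Fin s} {μ : Fin r' ⊕ Fin s' → Fin r ⊕ Fin s}

/-- Only the multisets of directions have to match: they provide a direction-preserving bijection
between the ends outside the corner and the ends other than `o`. -/
theorem exists_collapse {E' : Type} [Fintype E'] [DecidableEq E'] {u' : E' → ℤ × ℤ}
    (hμ : IsMarkingMap m μ) (i₀ : Fin r' ⊕ Fin s') {J : Finset E} {f : E} (hf : f ∉ J) (hJ : J.Nonempty)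
    (hL : 3 ≤ Fintype.card (Leaf r' s' E')) {R : Multiset (ℤ × ℤ)}
    (hR : (Finset.univ : Finset E).val.map u = J.val.map u + {u f} + R)
    (hR' : (Finset.univ : Finset E').val.map u' = {∑ e ∈ J, u e + u f} + R) :
    ∃ (π : Leaf r s E → Leaf r' s' E') (o : E'), IsCollapse u u' m μ J f π o := by
  classical
  obtain ⟨o, -, ho⟩ := Multiset.mem_map.1 (show ∑ e ∈ J, u e + u f ∈
    (Finset.univ : Finset E').val.map u' by rw [hR']; simp)
  have hA : (Finset.univ : Finset {e // e ∉ J ∧ e ≠ f}).val.map (fun e => u e.1) = R := by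
    have h1 : (Finset.univ : Finset E).val = J.val + {f} +
        (Finset.univ.filter fun e => e ∉ J ∧ e ≠ f).val := by
      have hd : Disjoint J {f} := Finset.disjoint_singleton_right.2 hf
      have hd' : Disjoint (J.disjUnion {f} hd) (Finset.univ.filter fun e => e ∉ J ∧ e ≠ f) := by
        rw [Finset.disjoint_left]
        intro e he he'
        simp only [Finset.mem_disjUnion, Finset.mem_singleton] at he
        have := (Finset.mem_filter.1 he').2
        tauto
      have : (Finset.univ : Finset E) = (J.disjUnion {f} hd).disjUnion _ hd' := by
        ext e
        simp only [Finset.mem_univ, Finset.mem_disjUnion, Finset.mem_singleton, Finset.mem_filter,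
          true_and, true_iff]
        tauto
      exact congrArg Finset.val this
    rw [h1, Multiset.map_add, Multiset.map_add, Multiset.map_singleton] at hR
    have h2 := add_left_cancel hR
    rw [← h2]
    have h3 : (Finset.univ : Finset {e // e ∉ J ∧ e ≠ f}).map (Function.Embedding.subtype _) =
        Finset.univ.filter fun e => e ∉ J ∧ e ≠ f := by
      ext e; simp
    rw [← h3, Finset.map_val, Multiset.map_map]
    rfl
  have hB : (Finset.univ : Finset {e // e ≠ o}).val.map (fun e => u' e.1) = R := by
    have h1 : (Finset.univ : Finset E').val = {o} + (Finset.univ.erase o).val := by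
      rw [Finset.erase_val, Multiset.singleton_add, Multiset.cons_erase (Finset.mem_univ o)]
    rw [h1, Multiset.map_add, Multiset.map_singleton, ho] at hR'
    rw [← add_left_cancel hR']
    have h3 : (Finset.univ : Finset {e // e ≠ o}).map (Function.Embedding.subtype _) =
        Finset.univ.erase o := by
      ext e; simp
    rw [← h3, Finset.map_val, Multiset.map_map]
    rfl
  obtain ⟨ψ, hψ⟩ := exists_equiv_of_map_eq (hA.trans hB.symm)
  have : Nonempty (Fin r' ⊕ Fin s') := ⟨i₀⟩
  choose! ν hν using hμ.cover
  have hνμ : ∀ j, ν (μ j) = j := fun j => hμ.inj (hν _ (hμ.ne j))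
  set π : Leaf r s E → Leaf r' s' E' := Sum.elim
    (fun j => if j = m then Sum.inr o else Sum.inl (ν j))
    (fun e => if h : e ∉ J ∧ e ≠ f then Sum.inr (ψ ⟨e, h⟩).1 else Sum.inr o) with hπ
  have hπm : π (Sum.inl m) = Sum.inr o := by simp [hπ]
  have hπj : ∀ j, j ≠ m → π (Sum.inl j) = Sum.inl (ν j) := fun j hj => by simp [hπ, hj]
  have hπe : ∀ e (h : e ∉ J ∧ e ≠ f), π (Sum.inr e) = Sum.inr (ψ ⟨e, h⟩).1 := fun e h => by
    simp [hπ, h]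
  have hπo : ∀ e, ¬ (e ∉ J ∧ e ≠ f) → π (Sum.inr e) = Sum.inr o := fun e h => by
    simp only [hπ, Sum.elim_inr, dif_neg h]
  have hcon : IsContraction π (core m J) (Sum.inr f) (Sum.inr o) := by
    refine ⟨?_, ?_, ?_, ?_, ?_, hL⟩
    · rintro (j | e)
      · exact ⟨Sum.inl (μ j), by rw [hπj _ (hμ.ne j), hνμ]⟩
      · by_cases he : e = o
        · exact ⟨Sum.inl m, by rw [hπm, he]⟩
        · refine ⟨Sum.inr (ψ.symm ⟨e, he⟩).1, ?_⟩
          rw [hπe _ (ψ.symm ⟨e, he⟩).2]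
          simp
    · rintro (j | e)
      · by_cases hj : j = m
        · rw [hj, hπm]; simp [core]
        · rw [hπj j hj]; simp [core, hj]
      · by_cases he : e ∉ J ∧ e ≠ f
        · rw [hπe e he]
          have := (ψ ⟨e, he⟩).2
          simp [core, this, he.1, he.2]
        · rw [hπo e he]
          simp only [core, Finset.mem_insert, Finset.mem_image, Sum.inr.injEq, exists_eq_right,
            reduceCtorEq, false_or, true_iff]
          tauto
    · rintro (i | e) (j | e') h hne
      · by_cases hi : i = m
        · rw [hi] at hne; exact absurd hπm hne
        by_cases hj : j = m
        · rw [hj, hπm] at h; exact absurd h hne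
        rw [hπj i hi, hπj j hj, Sum.inl.injEq] at h
        rw [← hν i hi, ← hν j hj, h]
      · exfalso
        by_cases hi : i = m
        · rw [hi] at hne; exact absurd hπm hne
        rw [hπj i hi] at h
        by_cases he : e' ∉ J ∧ e' ≠ f
        · rw [hπe e' he] at h; simp at h
        · rw [hπo e' he] at h; simp at h
      · exfalso
        by_cases he : e ∉ J ∧ e ≠ f
        · rw [hπe e he] at h
          by_cases hj : j = m
          · rw [hj, hπm] at h
            exact (ψ ⟨e, he⟩).2 (Sum.inr_injective h)
          · rw [hπj j hj] at h; simp at h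
        · exact hne (hπo e he)
      · by_cases he : e ∉ J ∧ e ≠ f
        · by_cases he' : e' ∉ J ∧ e' ≠ f
          · rw [hπe e he, hπe e' he', Sum.inr.injEq] at h
            have := congrArg Subtype.val (ψ.injective (Subtype.ext h))
            simp only at this
            rw [this]
          · rw [hπo e' he'] at h; exact absurd h hne
        · exact absurd (hπo e he) hne
    · simp [core, hf]
    · rw [core, Finset.card_insert_of_notMem (by simp),
        Finset.card_image_of_injective _ Sum.inr_injective]
      have := hJ.card_pos
      omega
  refine ⟨π, o, hcon, fun j => by rw [hπj _ (hμ.ne j), hνμ], hμ.ne, hμ.cover, hμ.isRight, ?_⟩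
  intro e
  by_cases he : e = o
  · rw [he, hcon.pullSet_singleton, ho, dirTo, Finset.sum_insert hcon.notMem, core,
      Finset.sum_insert (by simp), Finset.sum_image (by simp)]
    simp [add_comm]
  · have h1 : pullSet π {Sum.inr e} = {Sum.inr (ψ.symm ⟨e, he⟩).1} := by
      obtain ⟨y, hy⟩ := Finset.card_eq_one.1
        (hcon.card_pullSet_singleton (y := Sum.inr e) (by simpa using he))
      have : Sum.inr (ψ.symm ⟨e, he⟩).1 ∈ pullSet π {Sum.inr e} := by
        rw [mem_pullSet, hπe _ (ψ.symm ⟨e, he⟩).2]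
        simp
      rw [hy, Finset.mem_singleton] at this
      rw [hy, this]
    rw [h1, IsCurve.dirTo_end]
    have := hψ (ψ.symm ⟨e, he⟩)
    rw [Equiv.apply_symm_apply] at this
    exact this.symm

/-- The curves through a configuration with a marking that is far away are determined by
their corner and by the remaining curve. -/
theorem labelledCount_eq_sum_far (hu : ∑ e, u e = 0) (hE : Fintype.card E = r + 1 + 2 * s)
    (hμ : IsMarkingMap m μ) (i₀ : Fin r' ⊕ Fin s') {Q : Fin r' ⊕ Fin s' → ℝ × ℝ} (hQ : QIndep Q)
    {Δ : Finset (Finset E × E)} {F : Finset E × E → RatFunc ℚ}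
    (hcorner : ∀ P τ x D K, IsCurve u P m τ x → IsCurve.IsFar u P m τ x D K →
      ∃ δ ∈ Δ, IsCorner τ m δ.1 δ.2)
    (hδ : ∀ δ ∈ Δ, ∃ (E' : Type) (_ : Fintype E') (_ : DecidableEq E') (u' : E' → ℤ × ℤ)
      (π : Leaf r s E → Leaf r' s' E') (o : E'), IsCollapse u u' m μ δ.1 δ.2 π o ∧
      Fintype.card E' = r' + 1 + 2 * s' ∧ (m.isRight → 2 ≤ δ.1.card) ∧
      ((∑ e ∈ δ.1, u e).2 = 0 ∧ 0 < (∑ e ∈ δ.1, u e).1 ∧ (∑ e ∈ δ.1, u e + u δ.2).2 = 1 ∨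
        (∑ e ∈ δ.1, u e + u δ.2).2 = 0 ∧ 0 < (∑ e ∈ δ.1, u e + u δ.2).1 ∧
          (∑ e ∈ δ.1, u e).2 = 1) ∧
      F δ = vertexMult u (outerStar (core m δ.1)) *
        vertexMult u (innerStar (core m δ.1) (Sum.inr δ.2)) * labelledCount u' Q)
    {P : Fin r ⊕ Fin s → ℝ × ℝ} (hP : IsGeneric u P) : labelledCount u P = ∑ δ ∈ Δ, F δ := by
  classical
  have hL : 3 ≤ Fintype.card (Leaf r s E) := by
    simp only [Fintype.card_sum, Fintype.card_fin, hE]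
    rcases m with k | k
    · have := k.pos; omega
    · have := k.pos; omega
  obtain ⟨D, K, hfar⟩ := eventually_isFar u hμ Q hL
  have hsum : ∀ δ ∈ Δ, ∀ᶠ z in farFilter, ∀ P : Fin r ⊕ Fin s → ℝ × ℝ, IsGeneric u P →
      (∀ j, P (μ j) = Q j) → ((P m).2, (P m).1) = z →
      ∑ σ ∈ (Finset.univ.filter (Realizes u P)).filter (fun σ => IsCorner σ m δ.1 δ.2),
        typeMult u σ = F δ := by
    intro δ hδΔ
    obtain ⟨E', i1, i2, u', π, o, c, hE', hthick, hcone, hF⟩ := hδ δ hδΔ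
    have hu' := c.sum_eq_zero hu
    have hgen := hQ.isGeneric hu' hE' i₀
    have hev : ∀ᶠ z in farFilter, ∀ τ : Finset (Finset (Leaf r' s' E')), Realizes u' Q τ →
        ∃ w x, (∀ S ∈ rooted τ (Sum.inr o), 0 < x S) ∧ Q = config u' τ (Sum.inr o) w x ∧
          ∃ a b : ℝ, 0 < a ∧ 0 < b ∧ (z.2, z.1) = w + a • dirR u (core m δ.1) +
            b • dirR u (insert (Sum.inr δ.2) (core m δ.1)) := by
      rw [Filter.eventually_all]
      intro τ
      by_cases h : Realizes u' Q τ
      · obtain ⟨-, w, x, hx, hw⟩ :=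
          (realizes_iff_config hu' (hgen.isTop h).1 (Sum.inr o) i₀ _).1 h
        filter_upwards [eventually_cone w hcone] with z hz _
        refine ⟨w, x, hx, hw, ?_⟩
        simpa only [dirR, c.dirTo_core, c.dirTo_insert_core] using hz
      · exact Filter.Eventually.of_forall fun _ h' => absurd h' h
    filter_upwards [hev] with z hz P hP hPQ hPz
    rw [hF]
    refine c.sum_typeMult_corner hu hP hgen hPQ i₀ fun τ hτ => ?_
    obtain ⟨w, x, hx, hw, a, b, ha, hb, hab⟩ := hz τ hτ
    refine c.realizes_glue hu (hgen.isTop hτ).1 hPQ ?_ i₀ hτ hx hw ha hb ?_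
    · rintro ⟨k, hk⟩
      refine hthick ?_
      rw [← c.marking_mem_outerStar.1 hk]
      rfl
    · rw [← hab, ← hPz]
  -- By invariance, `P` may be replaced by an extension of `Q` in which `m` is so far away that the
  -- list of corners is complete and every curve through `Q` can be extended by each corner.
  obtain ⟨P', hP', hPQ, h1, h2⟩ := exists_far hμ hQ
    (hfar.and ((Filter.eventually_all_finset Δ).2 hsum))
  have hgen := hP'.isGeneric hu hE m
  rw [IsGeneric.labelledCount_eq_labelledCount hu hE m hP hgen,
    labelledCount_eq_sum_corners hgen Δ]
  · exact Finset.sum_congr rfl fun δ hδ => h2 δ hδ P' hgen hPQ rfl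
  · intro σ hσ
    obtain ⟨x, c⟩ := hgen.isCurve hu hE hσ m
    exact hcorner P' σ x D K c (h1 P' hPQ rfl σ x c)

/-! ### Multiplicities at the corners. -/

theorem ratX_sub_inv_ne_zero : (RatFunc.X - RatFunc.X⁻¹ : RatFunc ℚ) ≠ 0 := by
  intro h
  have hX : (RatFunc.X : RatFunc ℚ) ≠ 0 := RatFunc.X_ne_zero
  have h1 : (RatFunc.X : RatFunc ℚ) * RatFunc.X = 1 := by
    have := sub_eq_zero.1 h
    nth_rewrite 2 [this]
    exact mul_inv_cancel₀ hX
  have h2 : algebraMap (Polynomial ℚ) (RatFunc ℚ) (Polynomial.X * Polynomial.X) =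
      algebraMap (Polynomial ℚ) (RatFunc ℚ) 1 := by
    rw [map_mul, RatFunc.algebraMap_X, map_one, h1]
  have h3 := congrArg (Polynomial.eval 0) (RatFunc.algebraMap_injective ℚ h2)
  simp at h3

theorem ratX_add_inv_ne_zero : (RatFunc.X + RatFunc.X⁻¹ : RatFunc ℚ) ≠ 0 := by
  intro h
  have hX : (RatFunc.X : RatFunc ℚ) ≠ 0 := RatFunc.X_ne_zero
  have h1 : (RatFunc.X : RatFunc ℚ) * RatFunc.X = -1 := by
    have := eq_neg_of_add_eq_zero_left h
    nth_rewrite 2 [this]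
    rw [mul_neg, mul_inv_cancel₀ hX]
  have h2 : algebraMap (Polynomial ℚ) (RatFunc ℚ) (Polynomial.X * Polynomial.X) =
      algebraMap (Polynomial ℚ) (RatFunc ℚ) (-1) := by
    rw [map_mul, RatFunc.algebraMap_X, map_neg, map_one, h1]
  have h3 := congrArg (Polynomial.eval 0) (RatFunc.algebraMap_injective ℚ h2)
  simp at h3

theorem powDiff_one_div : powDiff 1 / (RatFunc.X - RatFunc.X⁻¹) = 1 := by
  rw [powDiff, zpow_one, zpow_neg_one, div_self ratX_sub_inv_ne_zero]

theorem powSum_one_div : powSum 1 / (RatFunc.X + RatFunc.X⁻¹) = 1 := by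
  rw [powSum, zpow_one, zpow_neg_one, div_self ratX_add_inv_ne_zero]

/-- The factor of the corner of a thick marking with two parallel ends (1,0), followed by an end
(0,1): the denominator of the thick vertex cancels against the refined multiplicity of the vertex of
multiplicity 2. -/
theorem powSum_zero_mul_powDiff_two :
    powSum 0 / (RatFunc.X + RatFunc.X⁻¹) * (powDiff 2 / (RatFunc.X - RatFunc.X⁻¹)) = 2 := by
  have h : powDiff 2 = (RatFunc.X + RatFunc.X⁻¹) * (RatFunc.X - RatFunc.X⁻¹) := by
    rw [powDiff, zpow_neg]
    norm_cast
    rw [← inv_pow]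
    ring
  rw [h, powSum, neg_zero, zpow_zero]
  have := ratX_sub_inv_ne_zero
  have := ratX_add_inv_ne_zero
  rw [mul_div_assoc, div_self ratX_sub_inv_ne_zero, mul_one, div_mul_cancel₀ _ ratX_add_inv_ne_zero]
  norm_num

/-! ### The recursion for simple markings, in terms of multisets of directions. -/

section Recursion

variable {r s r' s' : ℕ} {E : Type} [Fintype E] [DecidableEq E] {u : E → ℤ × ℤ}

/-- The directions of the ends, with multiplicities. -/
def dirs (u : E → ℤ × ℤ) : Multiset (ℤ × ℤ) := (Finset.univ : Finset E).val.map u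

theorem mem_dirs (e : E) : u e ∈ dirs u := Multiset.mem_map_of_mem u (Finset.mem_univ e)

theorem sum_dirs (u : E → ℤ × ℤ) : (dirs u).sum = ∑ e, u e := rfl

theorem card_dirs (u : E → ℤ × ℤ) : Multiset.card (dirs u) = Fintype.card E := by
  simp [dirs]

theorem count_dirs (u : E → ℤ × ℤ) (v : ℤ × ℤ) :
    (dirs u).count v = (Finset.univ.filter fun e => u e = v).card := by
  rw [dirs, Multiset.count_map, Finset.card_def, Finset.filter_val]
  simp only [eq_comm]

theorem exists_dirs_eq (M : Multiset (ℤ × ℤ)) : ∃ (n : ℕ) (u : Fin n → ℤ × ℤ), dirs u = M := by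
  obtain ⟨l, rfl⟩ := Quot.exists_rep M
  refine ⟨l.length, l.get, ?_⟩
  rw [dirs, Fin.univ_val_map, List.ofFn_get]
  rfl

/-- The number `A` counts the curves for which the ends of directions `B` are
replaced by one end of direction `b`. -/
def IsReplacedCount (u : E → ℤ × ℤ) (Q : Fin r' ⊕ Fin s' → ℝ × ℝ) (B : Multiset (ℤ × ℤ)) (b : ℤ × ℤ)
    (A : RatFunc ℚ) : Prop :=
  B ≤ dirs u → ∃ (E' : Type) (_ : Fintype E') (_ : DecidableEq E') (u' : E' → ℤ × ℤ),
    dirs u' + B = dirs u + {b} ∧ A = labelledCount u' Q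

/-- If the directions `B` do not all occur, any number is admissible. There are no corners of this
kind then, so it enters with coefficient zero. -/
theorem exists_isReplacedCount (u : E → ℤ × ℤ) (Q : Fin r' ⊕ Fin s' → ℝ × ℝ)
    (B : Multiset (ℤ × ℤ)) (b : ℤ × ℤ) : ∃ A, IsReplacedCount u Q B b A := by
  obtain ⟨n, u', hu'⟩ := exists_dirs_eq (dirs u - B + {b})
  refine ⟨labelledCount u' Q, fun h => ⟨_, _, _, u', ?_, rfl⟩⟩
  rw [hu', add_right_comm, tsub_add_cancel_of_le h]

variable {m : Fin r ⊕ Fin s} {μ : Fin r' ⊕ Fin s' → Fin r ⊕ Fin s}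

theorem map_add_le_dirs {J : Finset E} {f : E} (hf : f ∉ J) : J.val.map u + {u f} ≤ dirs u := by
  have : J.val.map u + {u f} = (J.cons f hf).val.map u := by
    rw [Finset.cons_val, Multiset.map_cons, add_comm, Multiset.singleton_add]
  rw [this]
  exact Multiset.map_le_map (Finset.val_le_iff.2 (Finset.subset_univ _))

theorem IsReplacedCount.exists_collapse (hμ : IsMarkingMap m μ) (i₀ : Fin r' ⊕ Fin s')
    {Q : Fin r' ⊕ Fin s' → ℝ × ℝ} {J : Finset E} {f : E} (hf : f ∉ J) (hJ : J.Nonempty)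
    (hcard : Fintype.card E = J.card + (r' + 2 * s') + 1) {B : Multiset (ℤ × ℤ)} {b : ℤ × ℤ}
    {A : RatFunc ℚ} (h : IsReplacedCount u Q B b A) (hB : J.val.map u + {u f} = B)
    (hb : ∑ e ∈ J, u e + u f = b) :
    ∃ (E' : Type) (_ : Fintype E') (_ : DecidableEq E') (u' : E' → ℤ × ℤ)
      (π : Leaf r s E → Leaf r' s' E') (o : E'), IsCollapse u u' m μ J f π o ∧
      Fintype.card E' = r' + 1 + 2 * s' ∧ A = labelledCount u' Q := by
  have hle := map_add_le_dirs (u := u) hf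
  obtain ⟨E', i1, i2, u', hu', hA⟩ := h (hB ▸ hle)
  obtain ⟨R, hR⟩ := Multiset.le_iff_exists_add.1 hle
  have hR' : dirs u' = {∑ e ∈ J, u e + u f} + R := by
    have h1 : dirs u' + B = ({∑ e ∈ J, u e + u f} + R) + B := by
      rw [hu', hR, hB, hb]
      abel
    exact add_right_cancel h1
  have hc : Fintype.card E' = r' + 1 + 2 * s' := by
    have h1 := congrArg Multiset.card hu'
    rw [Multiset.card_add, Multiset.card_add, card_dirs, card_dirs, ← hB, Multiset.card_add,
      Multiset.card_map, Multiset.card_singleton, Multiset.card_singleton] at h1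
    have : Multiset.card J.val = J.card := rfl
    omega
  have hL : 3 ≤ Fintype.card (Leaf r' s' E') := by
    simp only [Fintype.card_sum, Fintype.card_fin, hc]
    rcases i₀ with k | k
    · have := k.pos; omega
    · have := k.pos; omega
  obtain ⟨π, o, c⟩ := MetricTree.exists_collapse hμ i₀ hf hJ hL hR hR'
  exact ⟨E', i1, i2, u', π, o, c, hc, hA⟩

/-- The corners with one end of direction `a` at the marking. -/
def pairCorners (u : E → ℤ × ℤ) (a b : ℤ × ℤ) : Finset (Finset E × E) :=
  ((Finset.univ.filter fun e => u e = a) ×ˢ Finset.univ.filter fun e => u e = b).image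
    fun p => ({p.1}, p.2)

theorem mem_pairCorners {a b : ℤ × ℤ} {δ : Finset E × E} :
    δ ∈ pairCorners u a b ↔ ∃ e, δ.1 = {e} ∧ u e = a ∧ u δ.2 = b := by
  simp only [pairCorners, Finset.mem_image, Finset.mem_product, Finset.mem_filter, Finset.mem_univ,
    true_and, Prod.exists]
  constructor
  · rintro ⟨e, f, ⟨h1, h2⟩, rfl⟩
    exact ⟨e, rfl, h1, h2⟩
  · rintro ⟨e, h1, h2, h3⟩
    exact ⟨e, δ.2, ⟨h2, h3⟩, by rw [← h1]⟩

theorem card_pairCorners (a b : ℤ × ℤ) :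
    (pairCorners u a b).card = (dirs u).count a * (dirs u).count b := by
  rw [pairCorners, Finset.card_image_of_injective, Finset.card_product, count_dirs, count_dirs]
  rintro ⟨e, f⟩ ⟨e', f'⟩ h
  simpa using h

/-- The recursion that moves a simple marking far away. -/
theorem labelledCount_simple (hu : ∑ e, u e = 0) (hE : Fintype.card E = r + 1 + 1 + 2 * s)
    (hdir : ∀ e, IsStdDir (u e)) (i₀ : Fin r ⊕ Fin s) {Q : Fin r ⊕ Fin s → ℝ × ℝ} (hQ : QIndep Q)
    {A₁ A₂ A₃ : RatFunc ℚ} (h₁ : IsReplacedCount u Q ({(1, 0)} + {(0, 1)}) (1, 1) A₁)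
    (h₂ : IsReplacedCount u Q ({(1, 0)} + {(1, 1)}) (2, 1) A₂)
    (h₃ : IsReplacedCount u Q ({(1, 1)} + {(0, -1)}) (1, 0) A₃)
    {P : Fin (r + 1) ⊕ Fin s → ℝ × ℝ} (hP : IsGeneric u P) :
    labelledCount u P =
      (dirs u).count (1, 0) * (dirs u).count (0, 1) * A₁ +
      (dirs u).count (1, 0) * (dirs u).count (1, 1) * A₂ +
      (dirs u).count (1, 1) * (dirs u).count (0, -1) * A₃ := by
  have hμ := isMarkingMap_simple r s
  -- The three kinds of corners are distinguished by the direction of the second end alone.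
  set F : Finset E × E → RatFunc ℚ := fun δ =>
    if u δ.2 = (0, 1) then A₁ else if u δ.2 = (1, 1) then A₂ else A₃ with hF
  have hsum : ∀ a b A, (∀ δ, u δ.2 = b → F δ = A) →
      ∑ δ ∈ pairCorners u a b, F δ = (dirs u).count a * (dirs u).count b * A := by
    intro a b A h
    rw [Finset.sum_congr rfl (fun δ hδ => h δ (mem_pairCorners.1 hδ).choose_spec.2.2),
      Finset.sum_const, card_pairCorners, nsmul_eq_mul, Nat.cast_mul]
  have hdis : ∀ a b a' b', b ≠ b' → Disjoint (pairCorners u a b) (pairCorners u a' b') := by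
    intro a b a' b' h
    rw [Finset.disjoint_left]
    intro δ hδ hδ'
    obtain ⟨-, -, -, h1⟩ := mem_pairCorners.1 hδ
    obtain ⟨-, -, -, h2⟩ := mem_pairCorners.1 hδ'
    exact h (h1.symm.trans h2)
  have hF1 : ∀ δ : Finset E × E, u δ.2 = (0, 1) → F δ = A₁ := fun δ h => by simp [hF, h]
  have hF2 : ∀ δ : Finset E × E, u δ.2 = (1, 1) → F δ = A₂ := fun δ h => by simp [hF, h]
  have hF3 : ∀ δ : Finset E × E, u δ.2 = (0, -1) → F δ = A₃ := fun δ h => by simp [hF, h]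
  have hmain : ∀ (a b : ℤ × ℤ) (A : RatFunc ℚ), IsReplacedCount u Q ({a} + {b}) (a + b) A →
      a ≠ b → det₂ a b = 1 ∨ det₂ a b = -1 →
      (a.2 = 0 ∧ 0 < a.1 ∧ (a + b).2 = 1 ∨ (a + b).2 = 0 ∧ 0 < (a + b).1 ∧ a.2 = 1) →
      ∀ e f, u e = a → u f = b →
      ∃ (E' : Type) (_ : Fintype E') (_ : DecidableEq E') (u' : E' → ℤ × ℤ)
        (π : Leaf (r + 1) s E → Leaf r s E') (o : E'),
        IsCollapse u u' (Sum.inl 0) (Sum.map Fin.succ id) {e} f π o ∧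
        Fintype.card E' = r + 1 + 2 * s ∧
        ((Sum.inl 0 : Fin (r + 1) ⊕ Fin s).isRight → 2 ≤ ({e} : Finset E).card) ∧
        ((∑ e ∈ {e}, u e).2 = 0 ∧ 0 < (∑ e ∈ {e}, u e).1 ∧ (∑ e ∈ {e}, u e + u f).2 = 1 ∨
          (∑ e ∈ {e}, u e + u f).2 = 0 ∧ 0 < (∑ e ∈ {e}, u e + u f).1 ∧ (∑ e ∈ {e}, u e).2 = 1) ∧
        A = vertexMult u (outerStar (core (Sum.inl 0 : Fin (r + 1) ⊕ Fin s) {e})) *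
          vertexMult u (innerStar (core (Sum.inl 0 : Fin (r + 1) ⊕ Fin s) {e}) (Sum.inr f)) *
            labelledCount u' Q := by
    intro a b A hA hab hdet hcone e f he hf
    have hef : f ∉ ({e} : Finset E) := by
      rw [Finset.mem_singleton]
      rintro rfl
      exact hab (he.symm.trans hf)
    obtain ⟨E', i1, i2, u', π, o, c, hc, hA'⟩ := hA.exists_collapse (u := u) hμ i₀ hef
      (Finset.singleton_nonempty e) (by rw [Finset.card_singleton]; omega)
      (by rw [Finset.singleton_val, Multiset.map_singleton, he, hf])
      (by rw [Finset.sum_singleton, he, hf])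
    refine ⟨E', i1, i2, u', π, o, c, hc, by simp, ?_, ?_⟩
    · rw [Finset.sum_singleton, he, hf]
      exact hcone
    · rw [c.vertexMult_outerStar_simple rfl, c.vertexMult_innerStar hu, Finset.sum_singleton, he, hf,
        hA']
      have : ((det₂ a b).natAbs : ℤ) = 1 := by rcases hdet with h | h <;> rw [h] <;> rfl
      rw [this, powDiff_one_div, one_mul, one_mul]
  have := labelledCount_eq_sum_far hu (by omega) hμ i₀ hQ
    (Δ := pairCorners u (1, 0) (0, 1) ∪ (pairCorners u (1, 0) (1, 1) ∪ pairCorners u (1, 1) (0, -1)))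
    (F := F) ?_ ?_ hP
  · rw [this, Finset.sum_union, Finset.sum_union (hdis _ _ _ _ (by simp)), hsum _ _ _ hF1,
      hsum _ _ _ hF2, hsum _ _ _ hF3, add_assoc]
    exact Finset.disjoint_union_right.2 ⟨hdis _ _ _ _ (by simp), hdis _ _ _ _ (by simp)⟩
  · intro P τ x D K c hfar
    obtain ⟨e, f, hcor, h⟩ := c.corner_simple (by
      simp only [Fintype.card_sum, Fintype.card_fin, hE]; omega) hfar hdir (hμ.ne i₀)
    refine ⟨({e}, f), ?_, hcor⟩
    simp only [Finset.mem_union, mem_pairCorners]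
    rcases h with h | h | h
    · exact Or.inl ⟨e, rfl, h⟩
    · exact Or.inr (Or.inl ⟨e, rfl, h⟩)
    · exact Or.inr (Or.inr ⟨e, rfl, h⟩)
  · rintro ⟨J, f⟩ hδ
    simp only [Finset.mem_union, mem_pairCorners] at hδ
    rcases hδ with ⟨e, rfl, he, hf⟩ | ⟨e, rfl, he, hf⟩ | ⟨e, rfl, he, hf⟩
    · rw [hF1 _ hf]
      exact hmain _ _ A₁ h₁ (by simp) (by simp [det₂]) (by simp) e f he hf
    · rw [hF2 _ hf]
      exact hmain _ _ A₂ h₂ (by simp) (by simp [det₂]) (by simp) e f he hf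
    · rw [hF3 _ hf]
      exact hmain _ _ A₃ h₃ (by simp) (by simp [det₂]) (by simp) e f he hf

end Recursion

/-! ### The recursion for thick markings and the comparison. -/

section Recursion

variable {r s r' s' : ℕ} {E : Type} [Fintype E] [DecidableEq E] {u : E → ℤ × ℤ}
  {m : Fin r ⊕ Fin s} {μ : Fin r' ⊕ Fin s' → Fin r ⊕ Fin s}

/-- The corners with two ends of direction `a` at the marking. -/
def doubleCorners (u : E → ℤ × ℤ) (a b : ℤ × ℤ) : Finset (Finset E × E) :=
  (Finset.univ.filter fun e => u e = a).powersetCard 2 ×ˢ Finset.univ.filter fun e => u e = b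

theorem card_doubleCorners (a b : ℤ × ℤ) :
    (doubleCorners u a b).card = ((dirs u).count a).choose 2 * (dirs u).count b := by
  rw [doubleCorners, Finset.card_product, Finset.card_powersetCard, count_dirs, count_dirs]

theorem mem_doubleCorners {a b : ℤ × ℤ} {δ : Finset E × E} :
    δ ∈ doubleCorners u a b ↔
      ∃ e e', e ≠ e' ∧ δ.1 = {e, e'} ∧ u e = a ∧ u e' = a ∧ u δ.2 = b := by
  simp only [doubleCorners, Finset.mem_product, Finset.mem_powersetCard, Finset.mem_filter,
    Finset.mem_univ, true_and, Finset.card_eq_two]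
  constructor
  · rintro ⟨⟨h1, e, e', hne, h⟩, h2⟩
    rw [h] at h1
    exact ⟨e, e', hne, h, (Finset.mem_filter.1 (h1 (by simp))).2,
      (Finset.mem_filter.1 (h1 (by simp))).2, h2⟩
  · rintro ⟨e, e', hne, h, he, he', h2⟩
    refine ⟨⟨?_, e, e', hne, h⟩, h2⟩
    rw [h]
    intro x hx
    rw [Finset.mem_insert, Finset.mem_singleton] at hx
    rcases hx with rfl | rfl <;> simp [he, he']

/-- The corners with ends of directions `a` and `a'` at the marking. -/
def mixedCorners (u : E → ℤ × ℤ) (a a' b : ℤ × ℤ) : Finset (Finset E × E) :=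
  ((Finset.univ.filter fun e => u e = a) ×ˢ (Finset.univ.filter fun e => u e = a') ×ˢ
    Finset.univ.filter fun e => u e = b).image fun p => ({p.1, p.2.1}, p.2.2)

theorem mem_mixedCorners {a a' b : ℤ × ℤ} {δ : Finset E × E} :
    δ ∈ mixedCorners u a a' b ↔ ∃ e e', δ.1 = {e, e'} ∧ u e = a ∧ u e' = a' ∧ u δ.2 = b := by
  simp only [mixedCorners, Finset.mem_image, Finset.mem_product, Finset.mem_filter, Finset.mem_univ,
    true_and, Prod.exists]
  constructor
  · rintro ⟨e, e', f, ⟨h1, h2, h3⟩, rfl⟩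
    exact ⟨e, e', rfl, h1, h2, h3⟩
  · rintro ⟨e, e', h1, h2, h3, h4⟩
    exact ⟨e, e', δ.2, ⟨h2, h3, h4⟩, by rw [← h1]⟩

theorem card_mixedCorners {a a' : ℤ × ℤ} (h : a ≠ a') (b : ℤ × ℤ) :
    (mixedCorners u a a' b).card =
      (dirs u).count a * (dirs u).count a' * (dirs u).count b := by
  rw [mixedCorners, Finset.card_image_of_injOn, Finset.card_product, Finset.card_product,
    count_dirs, count_dirs, count_dirs, mul_assoc]
  rintro ⟨e, e', f⟩ he ⟨g, g', f'⟩ hg heq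
  simp only [Finset.coe_product, Finset.coe_filter, Finset.mem_univ, true_and, Set.mem_prod,
    Set.mem_ofPred_eq] at he hg
  simp only [Prod.mk.injEq] at heq ⊢
  obtain ⟨h1, h2⟩ := heq
  have e1 : e ∈ ({g, g'} : Finset E) := h1 ▸ by simp
  have e2 : e' ∈ ({g, g'} : Finset E) := h1 ▸ by simp
  rw [Finset.mem_insert, Finset.mem_singleton] at e1 e2
  refine ⟨e1.resolve_right ?_, e2.resolve_left ?_, h2⟩
  · rintro rfl
    exact h (he.1.symm.trans hg.2.1)
  · rintro rfl
    exact h (hg.1.symm.trans he.2.1)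

theorem collapse_thick (hu : ∑ e, u e = 0) (hE : Fintype.card E = r + 1 + 2 * (s + 1))
    (i₀ : Fin r ⊕ Fin s) {Q : Fin r ⊕ Fin s → ℝ × ℝ} {a a' b : ℤ × ℤ} {A : RatFunc ℚ}
    (hA : IsReplacedCount u Q ({a} + {a'} + {b}) (a + a' + b) A) {e e' f : E} (he : u e = a)
    (he' : u e' = a') (hf : u f = b) (hee : e ≠ e') (hab : a ≠ b) (hab' : a' ≠ b)
    (hcone : (a + a').2 = 0 ∧ 0 < (a + a').1 ∧ (a + a' + b).2 = 1 ∨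
      (a + a' + b).2 = 0 ∧ 0 < (a + a' + b).1 ∧ (a + a').2 = 1) :
    ∃ (E' : Type) (_ : Fintype E') (_ : DecidableEq E') (u' : E' → ℤ × ℤ)
      (π : Leaf r (s + 1) E → Leaf r s E') (o : E'),
      IsCollapse u u' (Sum.inr 0) (Sum.map id Fin.succ) {e, e'} f π o ∧
      Fintype.card E' = r + 1 + 2 * s ∧
      ((Sum.inr 0 : Fin r ⊕ Fin (s + 1)).isRight → 2 ≤ ({e, e'} : Finset E).card) ∧
      ((∑ e ∈ {e, e'}, u e).2 = 0 ∧ 0 < (∑ e ∈ {e, e'}, u e).1 ∧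
          (∑ e ∈ {e, e'}, u e + u f).2 = 1 ∨
        (∑ e ∈ {e, e'}, u e + u f).2 = 0 ∧ 0 < (∑ e ∈ {e, e'}, u e + u f).1 ∧
          (∑ e ∈ {e, e'}, u e).2 = 1) ∧
      powSum (det₂ a a').natAbs / (RatFunc.X + RatFunc.X⁻¹) *
          (powDiff (det₂ (a + a') b).natAbs / (RatFunc.X - RatFunc.X⁻¹)) * A =
        vertexMult u (outerStar (core (Sum.inr 0 : Fin r ⊕ Fin (s + 1)) {e, e'})) *
        vertexMult u (innerStar (core (Sum.inr 0 : Fin r ⊕ Fin (s + 1)) {e, e'}) (Sum.inr f)) *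
          labelledCount u' Q := by
  have hef : f ∉ ({e, e'} : Finset E) := by
    rw [Finset.mem_insert, Finset.mem_singleton]
    rintro (rfl | rfl)
    · exact hab (he.symm.trans hf)
    · exact hab' (he'.symm.trans hf)
  have hsum : ∑ e ∈ {e, e'}, u e = a + a' := by rw [Finset.sum_pair hee, he, he']
  obtain ⟨E', i1, i2, u', π, o, c, hc, hA'⟩ := hA.exists_collapse (u := u) (isMarkingMap_thick r s)
    i₀ hef ⟨e, by simp⟩ (by rw [Finset.card_pair hee]; omega)
    (by rw [Finset.insert_val_of_notMem (by simpa using hee), Multiset.map_cons,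
      Finset.singleton_val, Multiset.map_singleton, he, he', hf]; rfl)
    (by rw [hsum, hf])
  refine ⟨E', i1, i2, u', π, o, c, hc, fun _ => (Finset.card_pair hee).ge, ?_, ?_⟩
  · rw [hsum, hf]
    exact hcone
  · rw [c.vertexMult_outerStar_thick hu rfl hee rfl, c.vertexMult_innerStar hu, hsum, he, he', hf,
      hA']

/-- The recursion that moves a thick marking far away. -/
theorem labelledCount_thick (hu : ∑ e, u e = 0) (hE : Fintype.card E = r + 1 + 2 * (s + 1))
    (hdir : ∀ e, IsStdDir (u e)) (hdir' : ∀ e, u e ≠ (1, 1)) (i₀ : Fin r ⊕ Fin s)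
    {Q : Fin r ⊕ Fin s → ℝ × ℝ} (hQ : QIndep Q)
    {A₁ A₂ : RatFunc ℚ} (h₁ : IsReplacedCount u Q ({(1, 0)} + {(1, 0)} + {(0, 1)}) (2, 1) A₁)
    (h₂ : IsReplacedCount u Q ({(1, 0)} + {(0, 1)} + {(0, -1)}) (1, 0) A₂)
    {P : Fin r ⊕ Fin (s + 1) → ℝ × ℝ} (hP : IsGeneric u P) :
    labelledCount u P =
      (dirs u).count (1, 0) * ((dirs u).count (1, 0) - 1) * (dirs u).count (0, 1) * A₁ +
      (dirs u).count (1, 0) * (dirs u).count (0, 1) * (dirs u).count (0, -1) * A₂ := by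
  have hμ := isMarkingMap_thick r s
  -- The 2 is the multiplicity of the corner with two ends (1,0). It cancels the denominator of the
  -- binomial coefficient that counts unordered pairs of such ends.
  set F : Finset E × E → RatFunc ℚ := fun δ => if u δ.2 = (0, 1) then 2 * A₁ else A₂ with hF
  have hF1 : ∀ δ : Finset E × E, u δ.2 = (0, 1) → F δ = 2 * A₁ := fun δ h => by simp [hF, h]
  have hF2 : ∀ δ : Finset E × E, u δ.2 = (0, -1) → F δ = A₂ := fun δ h => by simp [hF, h]
  have := labelledCount_eq_sum_far hu (by omega) hμ i₀ hQ
    (Δ := doubleCorners u (1, 0) (0, 1) ∪ mixedCorners u (1, 0) (0, 1) (0, -1))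
    (F := F) ?_ ?_ hP
  · rw [this, Finset.sum_union, Finset.sum_congr rfl (fun δ hδ => hF1 δ
      (mem_doubleCorners.1 hδ).choose_spec.choose_spec.2.2.2.2), Finset.sum_congr rfl (fun δ hδ =>
      hF2 δ (mem_mixedCorners.1 hδ).choose_spec.choose_spec.2.2.2), Finset.sum_const,
      Finset.sum_const, card_doubleCorners, card_mixedCorners (by simp), nsmul_eq_mul, nsmul_eq_mul]
    · push_cast [Nat.cast_choose_two]
      ring
    · rw [Finset.disjoint_left]
      intro δ hδ hδ'
      obtain ⟨-, -, -, -, -, -, h1⟩ := mem_doubleCorners.1 hδ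
      obtain ⟨-, -, -, -, -, h2⟩ := mem_mixedCorners.1 hδ'
      rw [h1] at h2
      simp at h2
  · intro P τ x D K c hfar
    obtain ⟨e, e', f, hee, hcor, h⟩ := c.corner_thick (by
      simp only [Fintype.card_sum, Fintype.card_fin, hE]; omega) hfar hdir hdir' (hμ.ne i₀)
    refine ⟨({e, e'}, f), ?_, hcor⟩
    simp only [Finset.mem_union, mem_doubleCorners, mem_mixedCorners]
    rcases h with h | h
    · exact Or.inl ⟨e, e', hee, rfl, h⟩
    · exact Or.inr ⟨e, e', rfl, h⟩
  · rintro ⟨J, f⟩ hδ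
    simp only [Finset.mem_union, mem_doubleCorners, mem_mixedCorners] at hδ
    rcases hδ with ⟨e, e', hee, rfl, he, he', hf⟩ | ⟨e, e', rfl, he, he', hf⟩
    · have h := collapse_thick hu hE i₀ (A := A₁) h₁ he he' hf hee (by simp) (by simp) (by simp)
      have hd : powSum (det₂ (1, 0) (1, 0)).natAbs / (RatFunc.X + RatFunc.X⁻¹) *
          (powDiff (det₂ ((1, 0) + (1, 0)) (0, 1)).natAbs / (RatFunc.X - RatFunc.X⁻¹)) = 2 := by
        have e1 : ((det₂ (1, 0) (1, 0)).natAbs : ℤ) = 0 := by simp [det₂]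
        have e2 : ((det₂ ((1, 0) + (1, 0)) (0, 1)).natAbs : ℤ) = 2 := by simp [det₂]
        rw [e1, e2, powSum_zero_mul_powDiff_two]
      rw [hd] at h
      rw [hF1 _ hf]
      exact h
    · have hee : e ≠ e' := by
        rintro rfl
        rw [he] at he'
        simp at he'
      have h := collapse_thick hu hE i₀ (A := A₂) h₂ he he' hf hee (by simp) (by simp) (by simp)
      have hd : powSum (det₂ (1, 0) (0, 1)).natAbs / (RatFunc.X + RatFunc.X⁻¹) *
          (powDiff (det₂ ((1, 0) + (0, 1)) (0, -1)).natAbs / (RatFunc.X - RatFunc.X⁻¹)) = 1 := by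
        have e1 : ((det₂ (1, 0) (0, 1)).natAbs : ℤ) = 1 := by simp [det₂]
        have e2 : ((det₂ ((1, 0) + (0, 1)) (0, -1)).natAbs : ℤ) = 1 := by simp [det₂]
        rw [e1, e2, powSum_one_div, powDiff_one_div, one_mul]
      rw [hd, one_mul] at h
      rw [hF2 _ hf]
      exact h

/-- Replacing two simple points by a thick point. -/
theorem labelledCount_sub_labelledCount (hu : ∑ e, u e = 0)
    (hE : Fintype.card E = r + 1 + 1 + 1 + 2 * s) (hdir : ∀ e, IsStdDir (u e))
    (hdir' : ∀ e, u e ≠ (1, 1)) (i₀ : Fin r ⊕ Fin s) {B : RatFunc ℚ}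
    (hB : 2 ≤ (dirs u).count (1, 0) → 2 ≤ (dirs u).count (0, 1) →
      ∃ (E'' : Type) (_ : Fintype E'') (_ : DecidableEq E'') (v : E'' → ℤ × ℤ)
        (Q : Fin r ⊕ Fin s → ℝ × ℝ), IsGeneric v Q ∧ B = labelledCount v Q ∧
        dirs v + ({(1, 0)} + {(0, 1)} + ({(1, 0)} + {(0, 1)})) = dirs u + ({(1, 1)} + {(1, 1)}))
    {P : Fin (r + 1 + 1) ⊕ Fin s → ℝ × ℝ} (hP : IsGeneric u P) {P' : Fin r ⊕ Fin (s + 1) → ℝ × ℝ}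
    (hP' : IsGeneric u P') :
    labelledCount u P = labelledCount u P' +
      (dirs u).count (1, 0) * ((dirs u).count (1, 0) - 1) *
        ((dirs u).count (0, 1) * ((dirs u).count (0, 1) - 1)) * B := by
  obtain ⟨Q₀, hQ₀⟩ := exists_qIndep r s
  obtain ⟨Q₁, hQ₁⟩ := exists_qIndep (r + 1) s
  have h11 : (dirs u).count (1, 1) = 0 := by
    rw [Multiset.count_eq_zero]
    intro h
    obtain ⟨e, -, he⟩ := Multiset.mem_map.1 h
    exact hdir' e he
  obtain ⟨B₁, hB₁⟩ := exists_isReplacedCount u Q₀ ({(1, 0)} + {(1, 0)} + {(0, 1)}) (2, 1)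
  obtain ⟨B₂, hB₂⟩ := exists_isReplacedCount u Q₀ ({(1, 0)} + {(0, 1)} + {(0, -1)}) (1, 0)
  rw [labelledCount_thick hu (by omega) hdir hdir' i₀ hQ₀ hB₁ hB₂ hP']
  obtain ⟨A₂, hA₂⟩ := exists_isReplacedCount u Q₁ ({(1, 0)} + {(1, 1)}) (2, 1)
  obtain ⟨A₃, hA₃⟩ := exists_isReplacedCount u Q₁ ({(1, 1)} + {(0, -1)}) (1, 0)
  obtain ⟨A₁, hA₁⟩ := exists_isReplacedCount u Q₁ ({(1, 0)} + {(0, 1)}) (1, 1)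
  rw [labelledCount_simple hu (by omega) hdir (Sum.inl 0) hQ₁ hA₁ hA₂ hA₃ hP, h11]
  -- If one of the two directions does not occur, all terms vanish; otherwise the first replacement
  -- exists.
  by_cases hpos : 1 ≤ (dirs u).count (1, 0) ∧ 1 ≤ (dirs u).count (0, 1)
  swap
  · have : (dirs u).count (1, 0) = 0 ∨ (dirs u).count (0, 1) = 0 := by omega
    rcases this with h | h <;> rw [h] <;> simp
  obtain ⟨ha, hb⟩ := hpos
  -- As (1,1) does not occur in `u`, only the first kind of corner contributes. The ends `u₁` have
  -- one (1,1) in place of one (1,0) and one (0,1), and so the second step sees all three kinds.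
  obtain ⟨E₁, i1, i2, u₁, hu₁, rfl⟩ := hA₁ (by
    rw [Multiset.le_iff_count]
    intro z
    rw [Multiset.count_add, Multiset.count_singleton, Multiset.count_singleton]
    split_ifs with h1 h2 h2
    · rw [h1] at h2; simp at h2
    · subst h1; omega
    · subst h2; omega
    · omega)
  have hsum₁ : ∑ e, u₁ e = 0 := by
    have := congrArg Multiset.sum hu₁
    rw [Multiset.sum_add, Multiset.sum_add, Multiset.sum_add, sum_dirs, sum_dirs, hu,
      Multiset.sum_singleton, Multiset.sum_singleton, Multiset.sum_singleton] at this
    have h2 : ((1, 0) + (0, 1) : ℤ × ℤ) = (1, 1) := rfl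
    rw [h2, zero_add] at this
    simpa using this
  have hcard₁ : Fintype.card E₁ = r + 1 + 1 + 2 * s := by
    have := congrArg Multiset.card hu₁
    simp only [Multiset.card_add, Multiset.card_singleton, card_dirs] at this
    omega
  have hdir₁ : ∀ e, IsStdDir (u₁ e) := by
    intro e
    have h1 : u₁ e ∈ dirs u + {(1, 1)} := by
      rw [← hu₁]
      exact Multiset.mem_add.2 (Or.inl (mem_dirs e))
    rcases Multiset.mem_add.1 h1 with h | h
    · obtain ⟨e', -, he'⟩ := Multiset.mem_map.1 h
      rw [← he']; exact hdir e'
    · rw [Multiset.mem_singleton.1 h]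
      exact Or.inr (Or.inr (Or.inl rfl))
  have hcount : ∀ z, (dirs u₁).count z + ((if z = (1, 0) then 1 else 0) +
      if z = (0, 1) then 1 else 0) = (dirs u).count z + if z = (1, 1) then 1 else 0 := by
    intro z
    have := congrArg (Multiset.count z) hu₁
    simpa only [Multiset.count_add, Multiset.count_singleton] using this
  have ca := hcount (1, 0)
  have cb := hcount (0, 1)
  have cg := hcount (1, 1)
  have cc := hcount (0, -1)
  simp only [Prod.mk.injEq, if_true, and_true, and_false, one_ne_zero, zero_ne_one, if_false,
    add_zero, zero_add, and_self, h11,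
    show ((-1 : ℤ) = 0) = False by simp, show ((-1 : ℤ) = 1) = False by simp] at ca cb cg cc
  have hpair : ({(1, 0)} + {(0, 1)} : Multiset (ℤ × ℤ)) ≤ dirs u₁ →
      2 ≤ (dirs u).count (1, 0) ∧ 2 ≤ (dirs u).count (0, 1) := by
    intro h
    have h1 := Multiset.count_le_of_le (1, 0) h
    have h2 := Multiset.count_le_of_le (0, 1) h
    simp at h1 h2
    omega
  have g₁ : IsReplacedCount u₁ Q₀ ({(1, 0)} + {(0, 1)}) (1, 1) B := by
    intro h
    obtain ⟨h1, h2⟩ := hpair h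
    obtain ⟨E'', i1, i2, v, Q, hQ, hBv, hd⟩ := hB h1 h2
    refine ⟨E'', i1, i2, v, ?_, ?_⟩
    · refine add_right_cancel (b := {(1, 0)} + {(0, 1)}) ?_
      rw [add_assoc, hd, add_right_comm, hu₁]
      abel
    · have hs : ∑ e, v e = 0 := by
        have := congrArg Multiset.sum hd
        simp only [Multiset.sum_add, Multiset.sum_singleton, sum_dirs, hu] at this
        exact add_right_cancel (b := ((2, 2) : ℤ × ℤ)) this
      have hc : Fintype.card E'' = r + 1 + 2 * s := by
        have := congrArg Multiset.card hd
        simp only [Multiset.card_add, Multiset.card_singleton, card_dirs] at this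
        omega
      rw [hBv]
      exact IsGeneric.labelledCount_eq_labelledCount hs hc i₀ hQ (hQ₀.isGeneric hs hc i₀)
  -- Removing (1,0) and the new (1,1) from `u₁` is the same as removing (1,0), (1,0), (0,1) from
  -- `u`. Thus this number is the one in the thick recursion; the analogue holds for `B₂` below.
  have g₂ : IsReplacedCount u₁ Q₀ ({(1, 0)} + {(1, 1)}) (2, 1) B₁ := by
    intro h
    have h1 := Multiset.count_le_of_le (1, 0) h
    simp at h1
    obtain ⟨E', i1, i2, u', hu', h'⟩ := hB₁ (by
      rw [Multiset.le_iff_count]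
      intro z
      simp only [Multiset.count_add, Multiset.count_singleton]
      split_ifs with h1 h2 h2
      · rw [h1] at h2; simp at h2
      · subst h1; omega
      · subst h2; omega
      · omega)
    refine ⟨E', i1, i2, u', ?_, h'⟩
    refine add_right_cancel (b := {(1, 0)} + {(0, 1)}) ?_
    rw [add_right_comm (dirs u₁), hu₁, add_right_comm (dirs u), ← hu']
    abel
  have g₃ : IsReplacedCount u₁ Q₀ ({(1, 1)} + {(0, -1)}) (1, 0) B₂ := by
    intro h
    have h1 := Multiset.count_le_of_le (0, -1) h
    simp at h1
    obtain ⟨E', i1, i2, u', hu', h'⟩ := hB₂ (by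
      rw [Multiset.le_iff_count]
      intro z
      simp only [Multiset.count_add, Multiset.count_singleton]
      split_ifs with h1 h2 h3 h3 h2 h3 h3
      all_goals first
        | omega
        | (subst_vars; omega)
        | (exact absurd (h1.symm.trans h2) (by simp))
        | (exact absurd (h1.symm.trans h3) (by simp))
        | (exact absurd (h2.symm.trans h3) (by simp)))
    refine ⟨E', i1, i2, u', ?_, h'⟩
    refine add_right_cancel (b := {(1, 0)} + {(0, 1)}) ?_
    rw [add_right_comm (dirs u₁), hu₁, add_right_comm (dirs u), ← hu']
    abel
  rw [labelledCount_simple hsum₁ hcard₁ hdir₁ i₀ hQ₀ g₁ g₂ g₃ (hQ₁.isGeneric hsum₁ (by omega)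
    (Sum.inl 0)), cg, cc]
  have ca' : ((dirs u).count (1, 0) : RatFunc ℚ) = (dirs u₁).count (1, 0) + 1 := by
    rw [← ca]; push_cast; rfl
  have cb' : ((dirs u).count (0, 1) : RatFunc ℚ) = (dirs u₁).count (0, 1) + 1 := by
    rw [← cb]; push_cast; rfl
  rw [ca', cb']
  push_cast
  ring

end Recursion

/-! ### Configurations of one point, and three ends. -/

section SmallCases

variable {r s : ℕ} {E : Type} [Fintype E] [DecidableEq E] {u : E → ℤ × ℤ}

/-- For a single point there is one curve, with one vertex. -/
theorem labelledCount_of_single (hu : ∑ e, u e = 0) (hE : Fintype.card E = r + 1 + 2 * s)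
    (h1 : r + s = 1) (i₀ : Fin r ⊕ Fin s) {P : Fin r ⊕ Fin s → ℝ × ℝ} (hP : IsGeneric u P) :
    labelledCount u P =
      vertexMult u ((Finset.univ : Finset (Leaf r s E)).image singleton) := by
  classical
  have hL : 3 ≤ Fintype.card (Leaf r s E) := by
    simp only [Fintype.card_sum, Fintype.card_fin, hE]; omega
  have hempty : IsSplitSystem (∅ : Finset (Finset (Leaf r s E))) := by
    constructor <;> simp
  have hstars := IsSplitSystem.treeStars_empty hL
  have hset : (Finset.univ.filter (Realizes u P)) = {∅} := by
    ext σ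
    simp only [Finset.mem_filter, Finset.mem_univ, true_and, Finset.mem_singleton]
    constructor
    · intro h
      have := (hP.isTop h).card_eq (hP.isRigid hu i₀ h) hE i₀
      exact Finset.card_eq_zero.1 (by omega)
    · rintro rfl
      refine (realizes_iff_config hu hempty (Sum.inl i₀) i₀ P).2 ⟨?_, P i₀, fun _ => 1, by simp, ?_⟩
      · rw [hstars]
        intro V hV ⟨k, _⟩
        rw [Finset.mem_singleton.1 hV, Finset.card_image_of_injective _ Finset.singleton_injective,
          Finset.card_univ]
        simp only [Fintype.card_sum, Fintype.card_fin, hE]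
        have := k.pos
        omega
      · funext j
        have : Subsingleton (Fin r ⊕ Fin s) :=
          Fintype.card_le_one_iff_subsingleton.1 (by simp [h1])
        rw [Subsingleton.elim j i₀]
        simp [config, rooted]
  rw [hP.labelledCount_eq]
  convert Finset.sum_singleton (typeMult u) ∅ using 1
  · exact Finset.sum_congr (by convert hset) fun _ _ => rfl
  · rw [typeMult, hstars, Finset.prod_singleton]

/-- If no end is (1,0), no first component is positive, so all of them vanish and the second
components are ±1. But three odd numbers do not sum to zero. -/
theorem exists_dir_of_card_three (hu : ∑ e, u e = 0) (hE : Fintype.card E = 3)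
    (hdir : ∀ e, IsStdDir (u e)) (hdir' : ∀ e, u e ≠ (1, 1)) :
    (∃ e, u e = (1, 0)) ∧ ∃ e, u e = (0, 1) := by
  have h1 : ∑ e, (u e).1 = 0 := by rw [← Prod.fst_sum, hu]; rfl
  have h2 : ∑ e, (u e).2 = 0 := by rw [← Prod.snd_sum, hu]; rfl
  have key : ∀ a b : E → ℤ, ∑ e, a e = 0 → ∑ e, b e = 0 → (∀ e, a e ≤ 0) →
      (∀ e, a e = 0 → b e = 1 ∨ b e = -1) → False := by
    intro a b ha hb hle h
    have h0 := (Finset.sum_eq_zero_iff_of_nonpos fun e _ => hle e).1 ha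
    have hodd : ∀ e, ∃ c, b e = 1 + 2 * c := by
      intro e
      rcases h e (h0 e (Finset.mem_univ e)) with h | h
      · exact ⟨0, by omega⟩
      · exact ⟨-1, by omega⟩
    choose c hc using hodd
    rw [Finset.sum_congr rfl fun e _ => hc e, Finset.sum_add_distrib, ← Finset.mul_sum] at hb
    simp only [Finset.sum_const, Finset.card_univ, hE] at hb
    norm_num at hb
    omega
  constructor
  · by_contra hcon
    push Not at hcon
    refine key (fun e => (u e).1) (fun e => (u e).2) h1 h2 (fun e => ?_) fun e => ?_ <;>
    · have := hdir' e
      have := hcon e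
      rcases hdir e with h | h | h | h | h | h <;> simp_all
  · by_contra hcon
    push Not at hcon
    refine key (fun e => (u e).2) (fun e => (u e).1) h2 h1 (fun e => ?_) fun e => ?_ <;>
    · have := hdir' e
      have := hcon e
      rcases hdir e with h | h | h | h | h | h <;> simp_all

/-- The case of three ends. -/
theorem labelledCount_eq_of_card_three (hu : ∑ e, u e = 0) (hE : Fintype.card E = 3)
    (hdir : ∀ e, IsStdDir (u e)) (hdir' : ∀ e, u e ≠ (1, 1)) {P : Fin 2 ⊕ Fin 0 → ℝ × ℝ}
    (hP : IsGeneric u P) {P' : Fin 0 ⊕ Fin 1 → ℝ × ℝ} (hP' : IsGeneric u P') :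
    labelledCount u P = labelledCount u P' ∧ (dirs u).count (1, 0) = 1 := by
  obtain ⟨⟨e, he⟩, ⟨e', he'⟩⟩ := exists_dir_of_card_three hu hE hdir hdir'
  have hee : e ≠ e' := by
    rintro rfl
    rw [he] at he'
    simp at he'
  obtain ⟨f, hf⟩ := Finset.card_eq_one.1 (show ({e, e'}ᶜ : Finset E).card = 1 by
    rw [Finset.card_compl, hE, Finset.card_pair hee])
  have huniv : (Finset.univ : Finset E) = insert e (insert e' {f}) := by
    rw [← hf]
    ext y
    simp only [Finset.mem_univ, Finset.mem_insert, Finset.mem_compl, Finset.mem_singleton, true_iff]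
    tauto
  have hfmem : f ∈ ({e, e'}ᶜ : Finset E) := by rw [hf]; simp
  simp only [Finset.mem_compl, Finset.mem_insert, Finset.mem_singleton, not_or] at hfmem
  have huf : u f = (-1, -1) := by
    have h := hu
    rw [huniv, Finset.sum_insert (by simp [hee, Ne.symm hfmem.1]),
      Finset.sum_insert (by simp [Ne.symm hfmem.2]), Finset.sum_singleton, he, he'] at h
    have h1 := congrArg Prod.fst h
    have h2 := congrArg Prod.snd h
    simp only [Prod.fst_add, Prod.snd_add, Prod.fst_zero, Prod.snd_zero] at h1 h2
    exact Prod.ext (by simp only; omega) (by simp only; omega)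
  have hdirs : dirs u = {(1, 0)} + {(0, 1)} + {(-1, -1)} := by
    rw [dirs, huniv, Finset.insert_val_of_notMem (by simp [hee, Ne.symm hfmem.1]),
      Finset.insert_val_of_notMem (by simp [Ne.symm hfmem.2]), Finset.singleton_val,
      Multiset.map_cons, Multiset.map_cons, Multiset.map_singleton, he, he', huf]
    rfl
  have hc1 : (dirs u).count (1, 0) = 1 := by
    rw [hdirs]; simp
  have hc2 : (dirs u).count (0, 1) = 1 := by
    rw [hdirs]; simp
  have hc3 : (dirs u).count (1, 1) = 0 := by
    rw [hdirs]; simp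
  refine ⟨?_, hc1⟩
  have hright : labelledCount u P' = 1 := by
    rw [labelledCount_of_single hu hE rfl (Sum.inr 0) hP', mult_thick ⟨0, by simp⟩,
      mikhalkinMult_eq {Sum.inr e} {Sum.inr e'} (by simp) (by simp), IsCurve.dirTo_end,
      IsCurve.dirTo_end, he, he']
    · have : ((det₂ (1, 0) (0, 1)).natAbs : ℤ) = 1 := by simp [det₂]
      rw [this, powSum_one_div]
    · intro C hC h1 h2
      obtain ⟨y, -, rfl⟩ := Finset.mem_image.1 hC
      rcases y with j | g
      · exact Or.inl (dirTo_marking j)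
      · right
        have hg : g ∈ (Finset.univ : Finset E) := Finset.mem_univ g
        rw [huniv] at hg
        simp only [Finset.mem_insert, Finset.mem_singleton] at hg
        rcases hg with rfl | rfl | rfl
        · exact absurd rfl h1
        · exact absurd rfl h2
        · rw [IsCurve.dirTo_end, IsCurve.dirTo_end, IsCurve.dirTo_end, he, he', huf]
          rfl
  obtain ⟨Q, hQ⟩ := exists_qIndep 1 0
  obtain ⟨A₂, hA₂⟩ := exists_isReplacedCount u Q ({(1, 0)} + {(1, 1)}) (2, 1)
  obtain ⟨A₃, hA₃⟩ := exists_isReplacedCount u Q ({(1, 1)} + {(0, -1)}) (1, 0)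
  have hA₁ : IsReplacedCount u Q ({(1, 0)} + {(0, 1)}) (1, 1) 1 := by
    intro _
    obtain ⟨n, u', hu'⟩ := exists_dirs_eq ({(-1, -1)} + {(1, 1)} : Multiset (ℤ × ℤ))
    refine ⟨_, inferInstance, inferInstance, u', by rw [hu', hdirs]; abel, ?_⟩
    have hs : ∑ e, u' e = 0 := by
      rw [← sum_dirs, hu']
      rfl
    have hc : Fintype.card (Fin n) = 1 + 1 + 2 * 0 := by
      rw [← card_dirs u', hu']
      rfl
    rw [labelledCount_of_single hs hc rfl (Sum.inl 0) (hQ.isGeneric hs hc (Sum.inl 0)),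
      mult_simple (fun ⟨k, _⟩ => k.elim0) ⟨0, by simp⟩]
  rw [hright, labelledCount_simple hu hE hdir (Sum.inl 0) hQ hA₁ hA₂ hA₃ hP, hc1, hc2, hc3]
  simp

/-- Replacing two simple points by a thick point, for any number of points. -/
theorem labelledCount_replace {n n' : ℕ} (hu : ∑ e, u e = 0)
    (hE : Fintype.card E = n + 1 + 2 * s) (hn : n = n' + 2) (hdir : ∀ e, IsStdDir (u e))
    (hdir' : ∀ e, u e ≠ (1, 1)) {B : RatFunc ℚ}
    (hB : 2 ≤ (dirs u).count (1, 0) → 2 ≤ (dirs u).count (0, 1) →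
      ∃ (E'' : Type) (_ : Fintype E'') (_ : DecidableEq E'') (v : E'' → ℤ × ℤ)
        (Q : Fin n' ⊕ Fin s → ℝ × ℝ), IsGeneric v Q ∧ B = labelledCount v Q ∧
        dirs v + ({(1, 0)} + {(0, 1)} + ({(1, 0)} + {(0, 1)})) = dirs u + ({(1, 1)} + {(1, 1)}))
    {P : Fin n ⊕ Fin s → ℝ × ℝ} (hP : IsGeneric u P) {P' : Fin n' ⊕ Fin (s + 1) → ℝ × ℝ}
    (hP' : IsGeneric u P') :
    labelledCount u P = labelledCount u P' +
      (dirs u).count (1, 0) * ((dirs u).count (1, 0) - 1) *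
        ((dirs u).count (0, 1) * ((dirs u).count (0, 1) - 1)) * B := by
  subst hn
  -- Without a remaining marking the second step of the recursion is not available. In this case
  -- there are three ends, only one of them is (1,0), and the correction term vanishes.
  by_cases h : n' = 0 ∧ s = 0
  · obtain ⟨rfl, rfl⟩ := h
    obtain ⟨h1, h2⟩ := labelledCount_eq_of_card_three hu hE hdir hdir' hP hP'
    rw [h1, h2]
    simp
  · have i₀ : Nonempty (Fin n' ⊕ Fin s) := by
      rw [← Fintype.card_pos_iff]
      simp only [Fintype.card_sum, Fintype.card_fin]
      omega
    exact labelledCount_sub_labelledCount hu hE hdir hdir' i₀.some hB hP hP'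

end SmallCases

/-! ### Change of the lattice basis. -/

section Coordinates

/-- The linear map with the matrix `![![a, b], ![c, d]]`. -/
def linMap {R : Type} [CommRing R] (A : (ℤ × ℤ) × (ℤ × ℤ)) (v : R × R) : R × R :=
  (A.1.1 * v.1 + A.1.2 * v.2, A.2.1 * v.1 + A.2.2 * v.2)

variable {r s : ℕ} {E : Type} [Fintype E] [DecidableEq E] {u : E → ℤ × ℤ}
  {A : (ℤ × ℤ) × (ℤ × ℤ)}

theorem linMap_injective (hA : det₂ A.1 A.2 = 1 ∨ det₂ A.1 A.2 = -1) :
    Function.Injective (linMap (R := ℝ) A) := by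
  have hA' : (A.1.1 * A.2.2 - A.1.2 * A.2.1 : ℝ) ≠ 0 := by
    rcases hA with h | h <;> unfold det₂ at h
    · have : (A.1.1 * A.2.2 - A.1.2 * A.2.1 : ℝ) = 1 := by exact_mod_cast h
      rw [this]; norm_num
    · have : (A.1.1 * A.2.2 - A.1.2 * A.2.1 : ℝ) = -1 := by exact_mod_cast h
      rw [this]; norm_num
  intro v w h
  obtain ⟨h1, h2⟩ := Prod.mk.inj h
  refine Prod.ext (mul_left_cancel₀ hA' ?_) (mul_left_cancel₀ hA' ?_)
  · linear_combination (A.2.2 : ℝ) * h1 - (A.1.2 : ℝ) * h2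
  · linear_combination (A.1.1 : ℝ) * h2 - (A.2.1 : ℝ) * h1

theorem linMap_add {R : Type} [CommRing R] (v w : R × R) :
    linMap A (v + w) = linMap A v + linMap A w := by
  ext <;> simp [linMap] <;> ring

theorem linMap_sum {R ι : Type} [CommRing R] (F : Finset ι) (v : ι → R × R) :
    linMap A (∑ j ∈ F, v j) = ∑ j ∈ F, linMap A (v j) :=
  map_sum (AddMonoidHom.mk' (linMap (R := R) A) linMap_add) v F

theorem dirTo_linMap (S : Finset (Leaf r s E)) :
    dirTo (fun e => linMap A (u e)) S = linMap A (dirTo u S) := by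
  rw [dirTo, dirTo, linMap_sum]
  refine Finset.sum_congr rfl fun y _ => ?_
  rcases y with j | e
  · simp [linMap]
  · rfl

theorem passesThrough_linMap (hA : det₂ A.1 A.2 = 1 ∨ det₂ A.1 A.2 = -1)
    (P : Fin r ⊕ Fin s → ℝ × ℝ) (C : MetricTree (Leaf r s E)) :
    C.PassesThrough (fun e => linMap A (u e)) (fun j => linMap A (P j)) ↔ C.PassesThrough u P := by
  refine and_congr_left fun _ => forall_congr' fun i => forall_congr' fun j => ?_
  rw [← (linMap_injective hA).eq_iff (a := P j - P i), linMap_sum]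
  have h1 : linMap A (P j) - linMap A (P i) = linMap A (P j - P i) := by
    ext <;> simp [linMap] <;> ring
  rw [h1]
  refine Eq.congr_right (Finset.sum_congr rfl fun S _ => ?_)
  rw [dirTo_linMap]
  ext <;> simp [linMap] <;> ring

theorem isGeneric_linMap (hA : det₂ A.1 A.2 = 1 ∨ det₂ A.1 A.2 = -1)
    {P : Fin r ⊕ Fin s → ℝ × ℝ} (hP : IsGeneric u P) :
    IsGeneric (fun e => linMap A (u e)) fun j => linMap A (P j) := by
  refine ⟨(linMap_injective hA).comp hP.1, fun C hC => ?_⟩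
  obtain ⟨h1, h2⟩ := hP.2 C ((passesThrough_linMap hA P C).1 hC)
  exact ⟨h1, fun C' hC' => h2 C' ((passesThrough_linMap hA P C').1 hC')⟩

/-- A unimodular map preserves incidences and the absolute values of determinants, hence all
multiplicities. -/
theorem labelledCount_linMap (hA : det₂ A.1 A.2 = 1 ∨ det₂ A.1 A.2 = -1)
    (P : Fin r ⊕ Fin s → ℝ × ℝ) :
    labelledCount (fun e => linMap A (u e)) (fun j => linMap A (P j)) = labelledCount u P := by
  have h : ∀ V : Finset (Finset (Leaf r s E)),
      vertexMult (fun e => linMap A (u e)) V = vertexMult u V := by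
    intro V
    have : mikhalkinMult (fun e => linMap A (u e)) V = mikhalkinMult u V := by
      unfold mikhalkinMult
      refine Finset.sup_congr rfl fun p _ => ?_
      rw [dirTo_linMap, dirTo_linMap]
      have : ∀ a b : ℤ × ℤ, (linMap A a).1 * (linMap A b).2 - (linMap A a).2 * (linMap A b).1 =
          det₂ A.1 A.2 * (a.1 * b.2 - a.2 * b.1) := by
        intro a b
        simp only [linMap, det₂, Int.cast_id]
        ring
      rw [this, Int.natAbs_mul]
      rcases hA with h | h <;> rw [h] <;> simp
    simp only [vertexMult, this]
  simp only [labelledCount, refinedMult, h, passesThrough_linMap hA]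

end Coordinates

theorem dirs_sigma {κ : Type} [Fintype κ] [DecidableEq κ] (m : κ → ℕ) (w : κ → ℤ × ℤ) :
    dirs (fun e : Σ k, Fin (m k) => w e.1) = ∑ k, Multiset.replicate (m k) (w k) := by
  have h : dirs (fun e : Σ k, Fin (m k) => w e.1) =
      ∑ e : Σ k, Fin (m k), ({w e.1} : Multiset (ℤ × ℤ)) := by
    conv_lhs => rw [← Multiset.sum_map_singleton (dirs _), dirs, Multiset.map_map]
    rfl
  rw [h, Fintype.sum_sigma]
  refine Finset.sum_congr rfl fun k _ => ?_
  change ∑ _y : Fin (m k), ({w k} : Multiset (ℤ × ℤ)) = _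
  rw [Finset.sum_const, Finset.card_univ, Fintype.card_fin, Multiset.nsmul_singleton]

end MetricTree

theorem Fintype.prod_ite_or {κ M : Type} [Fintype κ] [DecidableEq κ] [CommMonoid M] {i j : κ}
    (hij : i ≠ j) (f : κ → M) : ∏ k, (if k = i ∨ k = j then f k else 1) = f i * f j := by
  rw [← Finset.prod_filter, ← Finset.prod_pair hij]
  congr 1
  ext k
  simp

theorem Fintype.sum_ite_or {κ M : Type} [Fintype κ] [DecidableEq κ] [AddCommMonoid M] {i j : κ}
    (hij : i ≠ j) (f : κ → M) : ∑ k, (if k = i ∨ k = j then f k else 0) = f i + f j :=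
  Fintype.prod_ite_or (M := Multiplicative M) hij f

/-! ### Intersection numbers and corners of the toric surfaces. -/

namespace ToricSurface

open MetricTree

/-- The intersection numbers with the boundary divisors satisfy the balancing condition. -/
def IsBalanced (X : ToricSurface) : Prop :=
  ∀ d, ∑ k, X.pair d (X.cls k) • X.ray k = 0

theorem pair_blowUp (X : ToricSurface) (i j : X.Div) (D c : (X.blowUp i j).H2) :
    (X.blowUp i j).pair D c =
      X.pair (fun a => D (some a)) (fun a => c (some a)) - D none * c none := by
  change ∑ a : Option X.Basis, ∑ b : Option X.Basis, D a * (X.blowUp i j).inter a b * c b = _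
  simp only [Fintype.sum_option, pair]
  simp [blowUp]
  ring

theorem pair_cls_none (X : ToricSurface) (i j : X.Div) (D : (X.blowUp i j).H2) :
    (X.blowUp i j).pair D ((X.blowUp i j).cls none) = -D none := by
  rw [pair_blowUp]
  simp [blowUp, pair]

theorem pair_cls_some (X : ToricSurface) (i j : X.Div) (D : (X.blowUp i j).H2) (k : X.Div) :
    (X.blowUp i j).pair D ((X.blowUp i j).cls (some k)) =
      X.pair (fun a => D (some a)) (X.cls k) + if k = i ∨ k = j then D none else 0 := by
  rw [pair_blowUp]
  by_cases h : k = i ∨ k = j <;> simp [blowUp, pair, pullback, h]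

theorem IsBalanced.blowUp {X : ToricSurface} (hX : X.IsBalanced) {i j : X.Div} (hij : i ≠ j) :
    (X.blowUp i j).IsBalanced := by
  intro D
  change ∑ k : Option X.Div, (X.blowUp i j).pair D ((X.blowUp i j).cls k) •
    (X.blowUp i j).ray k = 0
  rw [Fintype.sum_option, pair_cls_none]
  simp only [pair_cls_some, add_smul, Finset.sum_add_distrib, ite_smul, zero_smul]
  have h := hX fun a => D (some a)
  rw [show ∑ k, X.pair (fun a => D (some a)) (X.cls k) • (X.blowUp i j).ray (some k) = 0 from h,
    Fintype.sum_ite_or hij]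
  change -D none • (X.ray i + X.ray j) + (0 + (D none • X.ray i + D none • X.ray j)) = 0
  rw [neg_smul, smul_add, zero_add, neg_add_cancel]

theorem isBalanced_QH : QH.IsBalanced := by
  intro d
  change ∑ k : Fin 4, (∑ a : Fin 2, ∑ b : Fin 2, _) • _ = _
  ext <;> simp [Fin.sum_univ_four, Fin.sum_univ_two, QH]

theorem isBalanced_P2 : P2.IsBalanced := by
  intro d
  change ∑ k : Fin 3, (∑ a : Fin 1, ∑ b : Fin 1, _) • _ = _
  ext <;> simp [Fin.sum_univ_three, P2]

/-- The linear map that sends the rays of `i` and `j` to the coordinate directions. -/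
def cornerMap (X : ToricSurface) (i j : X.Div) : (ℤ × ℤ) × (ℤ × ℤ) :=
  ((det₂ (X.ray i) (X.ray j) * (X.ray j).2, -det₂ (X.ray i) (X.ray j) * (X.ray j).1),
    (-det₂ (X.ray i) (X.ray j) * (X.ray i).2, det₂ (X.ray i) (X.ray j) * (X.ray i).1))

/-- In coordinates at the corner `i`, `j`, the rays are coordinate directions, and
all but two are opposite to the corner. -/
def IsStdCorner (X : ToricSurface) (i j : X.Div) : Prop :=
  (det₂ (X.cornerMap i j).1 (X.cornerMap i j).2 = 1 ∨
    det₂ (X.cornerMap i j).1 (X.cornerMap i j).2 = -1) ∧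
  linMap (X.cornerMap i j) (X.ray i) = (1, 0) ∧ linMap (X.cornerMap i j) (X.ray j) = (0, 1) ∧
  ∀ k, k ≠ i → k ≠ j →
    linMap (X.cornerMap i j) (X.ray k) = (-1, 0) ∨ linMap (X.cornerMap i j) (X.ray k) = (0, -1) ∨
      linMap (X.cornerMap i j) (X.ray k) = (-1, -1)

/-- A finite check over the pairs of boundary divisors, as for the other three surfaces. The
coordinate change is the inverse of the matrix with the two rays as columns, whose determinant is ±1
at a corner. -/
theorem isStdCorner_QH : ∀ i j, QH.IsBlowUpPoint i j → QH.IsStdCorner i j := by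
  unfold IsBlowUpPoint IsStdCorner
  decide +kernel

theorem isStdCorner_P2 : ∀ i j, P2.IsBlowUpPoint i j → P2.IsStdCorner i j := by
  unfold IsBlowUpPoint IsStdCorner
  decide +kernel

theorem isStdCorner_P2Blow1 : ∀ i j, P2Blow1.IsBlowUpPoint i j → P2Blow1.IsStdCorner i j := by
  unfold IsBlowUpPoint IsStdCorner
  decide +kernel

theorem isStdCorner_P2Blow2 : ∀ i j, P2Blow2.IsBlowUpPoint i j → P2Blow2.IsStdCorner i j := by
  unfold IsBlowUpPoint IsStdCorner
  decide +kernel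

/-! ### Existence of the invariants. -/

section Invariant

variable {X : ToricSurface} {d : X.H2} {s : ℕ}

theorem sum_endDir (hX : X.IsBalanced) (hd : ∀ k, 0 ≤ X.pair d (X.cls k)) :
    ∑ e, X.endDir d e = 0 := by
  rw [← hX d, Fintype.sum_sigma]
  refine Finset.sum_congr rfl fun k _ => ?_
  simp only [endDir, Finset.sum_const, Finset.card_univ, Fintype.card_fin]
  rw [← natCast_zsmul, Int.toNat_of_nonneg (hd k)]

theorem card_ends (hd : ∀ k, 0 ≤ X.pair d (X.cls k)) : (Fintype.card (X.Ends d) : ℤ) = X.c1 d := by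
  rw [Fintype.card_sigma, c1, Nat.cast_sum]
  refine Finset.sum_congr rfl fun k _ => ?_
  rw [Fintype.card_fin, Int.toNat_of_nonneg (hd k)]

/-- The value exists by invariance of the labelled count, so the choice in `G` satisfies its
specification. The free variable `r` avoids transport along the equality with `numSimple`. -/
theorem isRefinedInvariant_G (hX : X.IsBalanced) (hd : ∀ k, 0 ≤ X.pair d (X.cls k)) {r : ℕ}
    (hr : X.c1 d = r + 1 + 2 * s) (hrs : 0 < r + s) :
    X.IsRefinedInvariant d s (X.G d s) ∧ ∀ P : Fin r ⊕ Fin s → ℝ × ℝ, IsGeneric (X.endDir d) P →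
      X.G d s = labelledCount (X.endDir d) P /
        ∏ k, (((X.pair d (X.cls k)).toNat ! : ℕ) : RatFunc ℚ) := by
  obtain rfl : r = X.numSimple d s := by unfold numSimple; omega
  have hu := sum_endDir hX hd
  have hE : Fintype.card (X.Ends d) = X.numSimple d s + 1 + 2 * s := by
    have := card_ends hd
    omega
  have : Nonempty (Fin (X.numSimple d s) ⊕ Fin s) := Fintype.card_pos_iff.1 (by simpa using hrs)
  obtain ⟨i₀⟩ := this
  obtain ⟨Q, hQ⟩ := exists_qIndep (X.numSimple d s) s
  have hG := hQ.isGeneric hu hE i₀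
  have hc : (∀ k, 0 ≤ X.pair d (X.cls k)) ∧ 0 ≤ X.c1 d - 1 - 2 * s := ⟨hd, by omega⟩
  have h : X.IsRefinedInvariant d s (X.G d s) := by
    refine Classical.epsilon_spec (p := X.IsRefinedInvariant d s) ⟨X.refinedCount d s Q, ?_⟩
    unfold IsRefinedInvariant
    rw [if_pos hc]
    refine ⟨⟨Q, hG⟩, fun P hP => ?_⟩
    rw [refinedCount, refinedCount, hP.labelledCount_eq_labelledCount hu hE i₀ hG]
  refine ⟨h, fun P hP => ?_⟩
  unfold IsRefinedInvariant at h
  rw [if_pos hc] at h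
  exact (h.2 P hP).symm

theorem isRefinedInvariant_zero
    (h : ¬ ((∀ k, 0 ≤ X.pair d (X.cls k)) ∧ 0 ≤ X.c1 d - 1 - 2 * (s : ℤ))) :
    X.IsRefinedInvariant d s (X.G d s) ∧ X.G d s = 0 := by
  have h0 : ∀ g, X.IsRefinedInvariant d s g ↔ g = 0 := by
    intro g
    unfold IsRefinedInvariant
    rw [if_neg h]
  have h1 : X.IsRefinedInvariant d s (X.G d s) :=
    Classical.epsilon_spec (p := X.IsRefinedInvariant d s) ⟨0, (h0 0).2 rfl⟩
  exact ⟨h1, (h0 _).1 h1⟩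

end Invariant

/-! ### The class d - 2E on the blow-up and the final formula. -/

section BlowUpFormula

variable {X : ToricSurface} {i j : X.Div} (d : X.H2)

theorem pair_pull_sub_none :
    (X.blowUp i j).pair (X.pull i j d - 2 • X.exc i j) ((X.blowUp i j).cls none) = 2 := by
  rw [pair_cls_none]
  change -((0 : ℤ) - 2 • (if (none : Option X.Basis) = none then (1 : ℤ) else 0)) = 2
  simp

theorem pair_pull_sub_some (k : X.Div) :
    (X.blowUp i j).pair (X.pull i j d - 2 • X.exc i j) ((X.blowUp i j).cls (some k)) =
      X.pair d (X.cls k) - if k = i ∨ k = j then 2 else 0 := by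
  have h1 : (fun a => (X.pull i j d - 2 • X.exc i j) (some a)) = d := by
    funext a
    change d a - 2 • (if (some a : Option X.Basis) = none then (1 : ℤ) else 0) = d a
    simp
  have h2 : (X.pull i j d - 2 • X.exc i j) none = -2 := by
    have := pair_pull_sub_none (i := i) (j := j) d
    rw [pair_cls_none] at this
    omega
  rw [pair_cls_some, h1, h2]
  split_ifs <;> ring

theorem c1_pull_sub (hij : i ≠ j) :
    (X.blowUp i j).c1 (X.pull i j d - 2 • X.exc i j) = X.c1 d - 2 := by
  change ∑ k : Option X.Div, (X.blowUp i j).pair _ ((X.blowUp i j).cls k) = _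
  rw [Fintype.sum_option, pair_pull_sub_none]
  simp only [pair_pull_sub_some, Finset.sum_sub_distrib]
  rw [Fintype.sum_ite_or hij fun _ => (2 : ℤ), c1]
  ring

/-- Use n! = n(n-1)(n-2)! for the two divisors through the point. The factor 2 in the first product
is the factorial of (d - 2E)·E = 2, and it becomes the coefficient in the formula. -/
theorem prod_factorial_blowUp (hij : i ≠ j) (hi : 2 ≤ X.pair d (X.cls i))
    (hj : 2 ≤ X.pair d (X.cls j)) :
    ∃ q : RatFunc ℚ, q ≠ 0 ∧
      ∏ k, ((((X.blowUp i j).pair (X.pull i j d - 2 • X.exc i j)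
        ((X.blowUp i j).cls k)).toNat ! : ℕ) : RatFunc ℚ) = 2 * q ∧
      ∏ k, (((X.pair d (X.cls k)).toNat ! : ℕ) : RatFunc ℚ) =
        ((X.pair d (X.cls i)).toNat * ((X.pair d (X.cls i)).toNat - 1)) *
          ((X.pair d (X.cls j)).toNat * ((X.pair d (X.cls j)).toNat - 1)) * q := by
  refine ⟨∏ k, (((X.pair d (X.cls k) - if k = i ∨ k = j then 2 else 0).toNat ! : ℕ) : RatFunc ℚ),
    Finset.prod_ne_zero_iff.2 fun k _ => Nat.cast_ne_zero.2 (Nat.factorial_ne_zero _), ?_, ?_⟩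
  · change ∏ k : Option X.Div, ((((X.blowUp i j).pair _
      ((X.blowUp i j).cls k)).toNat ! : ℕ) : RatFunc ℚ) = _
    rw [Fintype.prod_option, pair_pull_sub_none]
    simp only [pair_pull_sub_some]
    rfl
  · rw [← Fintype.prod_ite_or hij fun k =>
      ((X.pair d (X.cls k)).toNat * ((X.pair d (X.cls k)).toNat - 1) : RatFunc ℚ),
      ← Finset.prod_mul_distrib]
    refine Finset.prod_congr rfl fun k _ => ?_
    split_ifs with h
    · have hk : 2 ≤ X.pair d (X.cls k) := by rcases h with rfl | rfl <;> assumption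
      obtain ⟨m, hm⟩ : ∃ m : ℕ, X.pair d (X.cls k) = m + 2 :=
        ⟨(X.pair d (X.cls k) - 2).toNat, by omega⟩
      rw [hm, show ((m : ℤ) + 2 - 2).toNat = m by omega, show ((m : ℤ) + 2).toNat = m + 2 by omega,
        Nat.factorial_succ, Nat.factorial_succ]
      push_cast
      ring
    · simp

/-- The two proper transforms lose two ends each, and the new ray, the sum of the two rays, obtains
two. A map `f` is included so that the change of basis can be applied. -/
theorem dirs_blowUp (hij : i ≠ j) (hi : 2 ≤ X.pair d (X.cls i)) (hj : 2 ≤ X.pair d (X.cls j))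
    (f : ℤ × ℤ → ℤ × ℤ) :
    dirs (fun e => f ((X.blowUp i j).endDir (X.pull i j d - 2 • X.exc i j) e)) +
        ({f (X.ray i)} + {f (X.ray j)} + ({f (X.ray i)} + {f (X.ray j)})) =
      dirs (fun e => f (X.endDir d e)) +
        ({f (X.ray i + X.ray j)} + {f (X.ray i + X.ray j)}) := by
  have h1 := dirs_sigma (fun k => (X.pair d (X.cls k)).toNat) fun k => f (X.ray k)
  have h2 := dirs_sigma (fun k => ((X.blowUp i j).pair (X.pull i j d - 2 • X.exc i j)
    ((X.blowUp i j).cls k)).toNat) fun k => f ((X.blowUp i j).ray k)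
  have h3 : ∑ k, Multiset.replicate (((X.blowUp i j).pair (X.pull i j d - 2 • X.exc i j)
      ((X.blowUp i j).cls k)).toNat) (f ((X.blowUp i j).ray k)) =
      Multiset.replicate 2 (f (X.ray i + X.ray j)) + ∑ k, Multiset.replicate
        (X.pair d (X.cls k) - if k = i ∨ k = j then 2 else 0).toNat (f (X.ray k)) := by
    change ∑ k : Option X.Div, Multiset.replicate (((X.blowUp i j).pair _
      ((X.blowUp i j).cls k)).toNat) (f ((X.blowUp i j).ray k)) = _
    rw [Fintype.sum_option, pair_pull_sub_none]
    simp only [pair_pull_sub_some]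
    rfl
  have h4 : ∑ k, Multiset.replicate (X.pair d (X.cls k)).toNat (f (X.ray k)) =
      ∑ k, Multiset.replicate
        (X.pair d (X.cls k) - if k = i ∨ k = j then 2 else 0).toNat (f (X.ray k)) +
      (Multiset.replicate 2 (f (X.ray i)) + Multiset.replicate 2 (f (X.ray j))) := by
    rw [← Fintype.sum_ite_or hij fun k => Multiset.replicate 2 (f (X.ray k)),
      ← Finset.sum_add_distrib]
    refine Finset.sum_congr rfl fun k _ => ?_
    split_ifs with h
    · have hk : 2 ≤ X.pair d (X.cls k) := by rcases h with rfl | rfl <;> assumption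
      rw [← Multiset.replicate_add]
      congr 1
      omega
    · simp
  have h5 : ∀ v : ℤ × ℤ, Multiset.replicate 2 v = {v} + {v} := fun v => rfl
  rw [show dirs (fun e => f ((X.blowUp i j).endDir (X.pull i j d - 2 • X.exc i j) e)) = _ from h2,
    show dirs (fun e => f (X.endDir d e)) = _ from h1, h3, h4, h5, h5, h5]
  abel

theorem count_dirs_endDir {f : ℤ × ℤ → ℤ × ℤ} {v : ℤ × ℤ} {l : X.Div}
    (hf : ∀ k, f (X.ray k) = v ↔ k = l) :
    (dirs fun e => f (X.endDir d e)).count v = (X.pair d (X.cls l)).toNat := by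
  rw [show dirs (fun e => f (X.endDir d e)) = _ from
    dirs_sigma (fun k => (X.pair d (X.cls k)).toNat) fun k => f (X.ray k), Multiset.count_sum']
  simp only [Multiset.count_replicate, hf]
  simp

/-- In the basis of the corner, `labelledCount_replace` applies with B the labelled count of the
blow-up. Its coefficient is exactly the quotient of the two products of factorials, up to the factor
2. -/
theorem refined_blowUp_formula (hX : X.IsBalanced) (hij : i ≠ j) (hc : X.IsStdCorner i j)
    {s : ℕ} (hs : 3 ≤ X.c1 d - 2 * (s : ℤ)) :
    X.IsRefinedInvariant d (s + 1) (X.G d (s + 1)) ∧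
    X.IsRefinedInvariant d s (X.G d s) ∧
    (X.blowUp i j).IsRefinedInvariant (X.pull i j d - 2 • X.exc i j) s
      ((X.blowUp i j).G (X.pull i j d - 2 • X.exc i j) s) ∧
    X.G d (s + 1) =
      X.G d s - 2 * (X.blowUp i j).G (X.pull i j d - 2 • X.exc i j) s := by
  -- A negative intersection number stays negative for the proper transform, so otherwise all three
  -- invariants are zero.
  by_cases hd : ∀ k, 0 ≤ X.pair d (X.cls k)
  swap
  · obtain ⟨h1, h1'⟩ := isRefinedInvariant_zero (s := s + 1) (fun h => hd h.1)
    obtain ⟨h2, h2'⟩ := isRefinedInvariant_zero (s := s) (fun h => hd h.1)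
    obtain ⟨h3, h3'⟩ := isRefinedInvariant_zero (X := X.blowUp i j)
      (d := X.pull i j d - 2 • X.exc i j) (s := s) (fun h => hd fun k => by
        have := h.1 (some k)
        rw [pair_pull_sub_some] at this
        split_ifs at this <;> omega)
    exact ⟨h1, h2, h3, by rw [h1', h2', h3']; ring⟩
  obtain ⟨n, hn⟩ : ∃ n : ℕ, X.c1 d = n + 3 + 2 * s := ⟨(X.c1 d - 3 - 2 * s).toNat, by omega⟩
  obtain ⟨h1, h1'⟩ := isRefinedInvariant_G hX hd (r := n) (s := s + 1) (by push_cast; omega)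
    (by omega)
  obtain ⟨h2, h2'⟩ := isRefinedInvariant_G hX hd (r := n + 2) (s := s) (by push_cast; omega)
    (by omega)
  refine ⟨h1, h2, ?_⟩
  have hu := sum_endDir hX hd
  have hE := card_ends hd
  obtain ⟨P, hP⟩ := exists_qIndep (n + 2) s
  obtain ⟨P', hP'⟩ := exists_qIndep n (s + 1)
  replace hP := hP.isGeneric hu (by omega) (Sum.inl 0)
  replace hP' := hP'.isGeneric hu (by omega) (Sum.inr 0)
  rw [h1' P' hP', h2' P hP]
  obtain ⟨hA, hci, hcj, hck⟩ := hc
  set A := X.cornerMap i j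
  have hcase : ∀ k, k = i ∨ k = j ∨ linMap A (X.ray k) = (-1, 0) ∨
      linMap A (X.ray k) = (0, -1) ∨ linMap A (X.ray k) = (-1, -1) := by
    intro k
    by_cases hki : k = i
    · exact Or.inl hki
    by_cases hkj : k = j
    · exact Or.inr (Or.inl hkj)
    exact Or.inr (Or.inr (hck k hki hkj))
  have hdir : ∀ k, IsStdDir (linMap A (X.ray k)) ∧ linMap A (X.ray k) ≠ (1, 1) := by
    intro k
    rcases hcase k with rfl | rfl | h | h | h <;> simp [IsStdDir, *]
  have hai := count_dirs_endDir d (f := linMap A) (v := (1, 0)) (l := i) (fun k => by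
    refine ⟨fun h => ?_, fun h => h ▸ hci⟩
    rcases hcase k with h' | rfl | h' | h' | h'
    · exact h'
    all_goals simp_all)
  have haj := count_dirs_endDir d (f := linMap A) (v := (0, 1)) (l := j) (fun k => by
    refine ⟨fun h => ?_, fun h => h ▸ hcj⟩
    rcases hcase k with rfl | h' | h' | h' | h'
    · simp_all
    · exact h'
    all_goals simp_all)
  have key := fun B hB => labelledCount_replace (n := n + 2) (n' := n) (s := s) (B := B)
    (u := fun e => linMap A (X.endDir d e))
    (by rw [← linMap_sum, hu]; simp [linMap]) (by omega) rfl (fun e => (hdir e.1).1)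
    (fun e => (hdir e.1).2) hB (isGeneric_linMap hA hP) (isGeneric_linMap hA hP')
  simp only [labelledCount_linMap hA, hai, haj] at key
  -- If one of the two numbers is smaller than 2, the class d - 2E meets a boundary divisor
  -- negatively and its invariant is zero. Then the comparison is used with B = 0.
  by_cases h : 2 ≤ X.pair d (X.cls i) ∧ 2 ≤ X.pair d (X.cls j)
  · have hd' : ∀ k, 0 ≤ (X.blowUp i j).pair (X.pull i j d - 2 • X.exc i j)
        ((X.blowUp i j).cls k) := by
      rintro (_ | k)
      · rw [pair_pull_sub_none]; norm_num
      · rw [pair_pull_sub_some]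
        split_ifs with hk
        · rcases hk with rfl | rfl <;> omega
        · have := hd k; omega
    have hc1 := c1_pull_sub (X := X) d hij
    -- The two intersection numbers already give c₁(X)·d ≥ 4, so at least one marking is left for
    -- the blow-up.
    have hpos : 0 < n + s := by
      have : X.pair d (X.cls i) + X.pair d (X.cls j) ≤ X.c1 d := by
        rw [← Finset.sum_pair hij (f := fun k => X.pair d (X.cls k))]
        exact Finset.sum_le_sum_of_subset_of_nonneg (Finset.subset_univ _) fun k _ _ => hd k
      omega
    obtain ⟨h3, h3'⟩ := isRefinedInvariant_G (hX.blowUp hij) hd' (r := n) (s := s)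
      (by rw [hc1]; omega) hpos
    refine ⟨h3, ?_⟩
    obtain ⟨i₀⟩ : Nonempty (Fin n ⊕ Fin s) := Fintype.card_pos_iff.1 (by simpa using hpos)
    obtain ⟨Q, hQ⟩ := exists_qIndep n s
    have hE' := card_ends hd'
    replace hQ := hQ.isGeneric (sum_endDir (hX.blowUp hij) hd') (by omega) i₀
    rw [h3' Q hQ]
    have hdirs := dirs_blowUp d hij h.1 h.2 (linMap A)
    rw [linMap_add, hci, hcj, show ((1, 0) + (0, 1) : ℤ × ℤ) = (1, 1) from rfl] at hdirs
    have := key _ fun _ _ => ⟨_, _, _, _, _, isGeneric_linMap hA hQ, rfl, hdirs⟩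
    rw [labelledCount_linMap hA] at this
    obtain ⟨q, hq, hq1, hq2⟩ := prod_factorial_blowUp d hij h.1 h.2
    have hne : ∏ k, (((X.pair d (X.cls k)).toNat ! : ℕ) : RatFunc ℚ) ≠ 0 :=
      Finset.prod_ne_zero_iff.2 fun k _ => Nat.cast_ne_zero.2 (Nat.factorial_ne_zero _)
    rw [this, hq1]
    rw [hq2] at hne ⊢
    have hne' := left_ne_zero_of_mul hne
    generalize ((X.pair d (X.cls i)).toNat * ((X.pair d (X.cls i)).toNat - 1) : RatFunc ℚ) *
      ((X.pair d (X.cls j)).toNat * ((X.pair d (X.cls j)).toNat - 1)) = c at *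
    field_simp
    ring
  · obtain ⟨h3, h3'⟩ := isRefinedInvariant_zero (X := X.blowUp i j)
      (d := X.pull i j d - 2 • X.exc i j) (s := s) (fun h' => h ⟨by
        have := h'.1 (some i)
        rw [pair_pull_sub_some, if_pos (Or.inl rfl)] at this
        omega, by
        have := h'.1 (some j)
        rw [pair_pull_sub_some, if_pos (Or.inr rfl)] at this
        omega⟩)
    refine ⟨h3, ?_⟩
    have := key 0 fun h1 h2 => absurd ⟨by omega, by omega⟩ h
    rw [h3', this]
    ring

end BlowUpFormula

end ToricSurface

theorem proposition4p3 (X : ToricSurface)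
    (hX : X = ToricSurface.QH ∨ X = ToricSurface.P2 ∨ X = ToricSurface.P2Blow1 ∨
      X = ToricSurface.P2Blow2)
    (i j : X.Div) (hij : X.IsBlowUpPoint i j)
    (d : X.H2) (s : ℕ) (hs : 3 ≤ X.c1 d - 2 * (s : ℤ)) :
    X.IsRefinedInvariant d (s + 1) (X.G d (s + 1)) ∧
    X.IsRefinedInvariant d s (X.G d s) ∧
    (X.blowUp i j).IsRefinedInvariant (X.pull i j d - 2 • X.exc i j) s
      ((X.blowUp i j).G (X.pull i j d - 2 • X.exc i j) s) ∧
    X.G d (s + 1) =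
      X.G d s - 2 * (X.blowUp i j).G (X.pull i j d - 2 • X.exc i j) s := by

  have hB1 : ToricSurface.P2Blow1.IsBalanced := ToricSurface.isBalanced_P2.blowUp (show (0 : Fin 3) ≠ 1 by decide)
  refine ToricSurface.refined_blowUp_formula d ?_ hij.1 ?_ hs
  · rcases hX with rfl | rfl | rfl | rfl
    · exact ToricSurface.isBalanced_QH
    · exact ToricSurface.isBalanced_P2
    · exact hB1
    · exact hB1.blowUp (show (some 1 : Option (Fin 3)) ≠ some 2 by decide)
  · rcases hX with rfl | rfl | rfl | rfl
    · exact ToricSurface.isStdCorner_QH i j hij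
    · exact ToricSurface.isStdCorner_P2 i j hij
    · exact ToricSurface.isStdCorner_P2Blow1 i j hij
    · exact ToricSurface.isStdCorner_P2Blow2 i j hij
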